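/- Let $S\subset\mathbb P^3_{\mathbb R}$ be the sphere $w^2=x^2+y^2+z^2$ and let $\pi\colon S\dashrightarrow\mathbb P^1_{\mathbb R}$ be the conic fibration $(w:x:y:z)\mapsto(w:z)$. Let $\mathrm{Aut}(S(\mathbb R))$ be the group of birational transformations $g$ of $S$ (over $\mathbb R$) such that $g$ and $g^{-1}$ are defined at every real point of $S$, let $\mathrm{Aut}(S(\mathbb R)/\pi)$ be its subgroup of elements $g$ with $\pi g=\pi$, and let $\mathrm{Aut}^+(S(\mathbb R)/\pi)$ be the subgroup of those elements of $\mathrm{Aut}(S(\mathbb R)/\pi)$ which preserve the orientation of the sphere $S(\mathbb R)$. An involution is an element of order $2$. If $g\in\mathrm{Aut}(S(\mathbb R)/\pi)$ is an involution, then $g$ has exactly two fixed points on the geometric generic fibre of $\pi$, and they form a single closed point of the generic fibre, a conic over $\mathbb R(z)$. The residue field of this closed point is a quadratic extension of $\mathbb R(z)$. Let $\mathrm{Fix}(g)\to\mathbb P^1$ be the smooth projective model of the curve of fixed points of $g$, that is, the smooth projective real curve with this function field, with its induced morphism of degree $2$ to $\mathbb P^1$. A double cover is a smooth projective curve $\Gamma$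 over $\mathbb R$, irreducible over $\mathbb R$ (but not necessarily over $\mathbb C$), with a finite morphism $\pi\colon\Gamma\to\mathbb P^1_{\mathbb R}$ of degree $2$. A $\pi$-isomorphism between $(\Gamma,\pi)$ and $(\Gamma',\pi')$ is an isomorphism $\gamma\colon\Gamma\to\Gamma'$ over $\mathbb R$ with $\pi'\gamma=\pi$. The ovals of $\Gamma$ are the connected components of $\Gamma(\mathbb R)$. Then $g\mapsto(\mathrm{Fix}(g)\to\mathbb P^1)$ induces bijective correspondences (1) between the conjugacy classes of involutions in the group $\mathrm{Aut}^+(S(\mathbb R)/\pi)$ and the double covers $\pi\colon\Gamma\to\mathbb P^1$ such that $\Gamma$ has no real point, up to $\pi$-isomorphism; (2) between the involutions in $\mathrm{Aut}(S(\mathbb R)/\pi)\setminus\mathrm{Aut}^+(S(\mathbb R)/\pi)$, up to conjugacy in $\mathrm{Aut}(S(\mathbb R)/\pi)$, and the double covers $\pi\colon\Gamma\to\mathbb P^1$ such that $\Gamma$ has exactly one oval and $\pi(\Gamma(\mathbb R))=[-1,1]=\{(1:a)\mid a\in\mathbb R,\ -1\le a\le 1\}$, up to $\pi$-isomorphism.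 -/

import Mathlib

open AlgebraicGeometry CategoryTheory
open scoped IntermediateField

namespace RealSphere

noncomputable section

/-! ### The sphere and its group of birational transformations -/

/-- The affine equation `x² + y² + z² - 1` of the sphere. -/
def sphereEq : MvPolynomial (Fin 3) ℝ :=
  MvPolynomial.X 0 ^ 2 + MvPolynomial.X 1 ^ 2 + MvPolynomial.X 2 ^ 2 - 1

theorem sphereEq_prime : Prime sphereEq := by
  let e := MvPolynomial.finSuccEquiv ℝ 2
  let c : MvPolynomial (Fin 2) ℝ := MvPolynomial.X 0 ^ 2 + MvPolynomial.X 1 ^ 2 - 1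
  have he : e sphereEq = Polynomial.X ^ 2 + Polynomial.C c := by
    have h1 : e (MvPolynomial.X 1) = Polynomial.C (MvPolynomial.X 0) :=
      MvPolynomial.finSuccEquiv_X_succ (j := 0)
    have h2 : e (MvPolynomial.X 2) = Polynomial.C (MvPolynomial.X 1) :=
      MvPolynomial.finSuccEquiv_X_succ (j := 1)
    have h0 : e (MvPolynomial.X 0) = Polynomial.X := MvPolynomial.finSuccEquiv_X_zero
    simp only [sphereEq, map_add, map_sub, map_pow, map_one, h0, h1, h2, c]
    ring
  have hm : (Polynomial.X ^ 2 + Polynomial.C c).Monic :=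
    Polynomial.monic_X_pow_add_C c two_ne_zero
  have hd : (Polynomial.X ^ 2 + Polynomial.C c).natDegree = 2 :=
    Polynomial.natDegree_X_pow_add_C
  have hirr : Irreducible (Polynomial.X ^ 2 + Polynomial.C c) := by
    rw [hm.irreducible_iff_roots_eq_zero_of_degree_le_three (by rw [hd]) (by rw [hd]; norm_num)]
    refine Multiset.eq_zero_of_forall_notMem fun s hs => ?_
    have hs' := Polynomial.isRoot_of_mem_roots hs
    simp only [Polynomial.IsRoot, Polynomial.eval_add, Polynomial.eval_pow, Polynomial.eval_X,
      Polynomial.eval_C] at hs'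
    have := congrArg (MvPolynomial.eval ![(2 : ℝ), 0]) hs'
    simp [c] at this
    nlinarith [sq_nonneg (MvPolynomial.eval ![(2 : ℝ), 0] s)]
  rw [← he] at hirr
  exact ((MulEquiv.irreducible_iff e).1 hirr).prime

instance : (Ideal.span {sphereEq}).IsPrime :=
  (Ideal.span_singleton_prime sphereEq_prime.ne_zero).2 sphereEq_prime

/-- The function field `ℝ(S)` of the sphere `S`, i.e. the fraction field of
`ℝ[x, y, z] / (x² + y² + z² - 1)`. -/
abbrev FunField : Type :=
  FractionRing (MvPolynomial (Fin 3) ℝ ⧸ Ideal.span {sphereEq})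

/-- A polynomial in `x, y, z` as a rational function on `S`. -/
def toFun : MvPolynomial (Fin 3) ℝ →ₐ[ℝ] FunField :=
  (IsScalarTower.toAlgHom ℝ (MvPolynomial (Fin 3) ℝ ⧸ Ideal.span {sphereEq}) FunField).comp
    (Ideal.Quotient.mkₐ ℝ _)

/-- The affine coordinates `x, y, z` (for `i = 0, 1, 2`) as rational functions on `S`. -/
def coord (i : Fin 3) : FunField := toFun (MvPolynomial.X i)

/-- The group of birational transformations of `S`. A birational transformation `g` of `S` is
represented by the automorphism `g* : f ↦ f ∘ g` of the field `ℝ(S)`, so that in the affine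
coordinates `g = (g* x, g* y, g* z)`. The identification `g ↦ g*` reverses the order of composition,
which affects neither subgroups, nor conjugacy, nor orders of elements. -/
abbrev Bir : Type := FunField ≃ₐ[ℝ] FunField

/-- Euclidean `3`-space. The real locus `S(ℝ)` lies in the affine chart `w = 1` and is the unit
sphere `Metric.sphere 0 1` of this space. -/
abbrev E3 : Type := EuclideanSpace ℝ (Fin 3)

/-- The rational function `f` on `S` is regular at the real point `p`, with value `c` there. -/
def HasValueAt (f : FunField) (p : E3) (c : ℝ) : Prop :=
  ∃ a b : MvPolynomial (Fin 3) ℝ, MvPolynomial.eval (fun i => p i) b ≠ 0 ∧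
    f * toFun b = toFun a ∧
    c * MvPolynomial.eval (fun i => p i) b = MvPolynomial.eval (fun i => p i) a

/-- The rational map `g : S ⇢ S ⊆ ℙ³` is defined at the real point `p`: it can be written
`g = (F₀ : F₁ : F₂ : F₃)` with rational functions `Fᵢ` that are all regular at `p` and do not all
vanish there. -/
def IsDefinedAt (g : Bir) (p : E3) : Prop :=
  ∃ (F : Fin 4 → FunField) (c : Fin 4 → ℝ), (∀ i, HasValueAt (F i) p (c i)) ∧ c ≠ 0 ∧
    ∀ i : Fin 3, g (coord i) * F 0 = F i.succ

theorem sum_sq_eq_one {p : E3} (hp : p ∈ Metric.sphere (0 : E3) 1) :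
    p 0 ^ 2 + p 1 ^ 2 + p 2 ^ 2 = 1 := by
  have h : ‖p‖ = 1 := by simpa using hp
  have := EuclideanSpace.norm_sq_eq p
  rw [h, Fin.sum_univ_three] at this
  simpa using this.symm

theorem mem_sphere_of_sum_sq {p : E3} (h : p 0 ^ 2 + p 1 ^ 2 + p 2 ^ 2 = 1) :
    p ∈ Metric.sphere (0 : E3) 1 := by
  have := EuclideanSpace.norm_sq_eq p
  rw [Fin.sum_univ_three] at this
  simp only [Real.norm_eq_abs, sq_abs, h] at this
  have h1 : ‖p‖ = 1 := by
    nlinarith [norm_nonneg p]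
  simpa using h1

theorem toFun_eq_zero_iff {P : MvPolynomial (Fin 3) ℝ} :
    toFun P = 0 ↔ P ∈ Ideal.span {sphereEq} := by
  have : toFun P = algebraMap (MvPolynomial (Fin 3) ℝ ⧸ Ideal.span {sphereEq}) FunField
    (Ideal.Quotient.mk _ P) := rfl
  rw [this, IsFractionRing.to_map_eq_zero_iff, Ideal.Quotient.eq_zero_iff_mem]

theorem coord_sum_sq : coord 0 ^ 2 + coord 1 ^ 2 + coord 2 ^ 2 = 1 := by
  have h : toFun sphereEq = 0 := toFun_eq_zero_iff.2 (Ideal.mem_span_singleton_self _)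
  simp only [sphereEq, map_sub, map_add, map_pow, map_one] at h
  exact sub_eq_zero.1 h

theorem eval_eq_zero {P : MvPolynomial (Fin 3) ℝ} (h : toFun P = 0) {p : E3}
    (hp : p ∈ Metric.sphere (0 : E3) 1) : MvPolynomial.eval (fun i => p i) P = 0 := by
  obtain ⟨Q, rfl⟩ := Ideal.mem_span_singleton'.1 (toFun_eq_zero_iff.1 h)
  have := sum_sq_eq_one hp
  simp [sphereEq, this]

namespace HasValueAt

variable {f f' : FunField} {p : E3} {c c' : ℝ}

theorem toFun_ne_zero {b : MvPolynomial (Fin 3) ℝ} (hp : p ∈ Metric.sphere (0 : E3) 1)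
    (hb : MvPolynomial.eval (fun i => p i) b ≠ 0) : toFun b ≠ 0 :=
  fun h => hb (eval_eq_zero h hp)

theorem unique (hp : p ∈ Metric.sphere (0 : E3) 1) (h : HasValueAt f p c)
    (h' : HasValueAt f p c') : c = c' := by
  obtain ⟨a, b, hb, e, v⟩ := h
  obtain ⟨a', b', hb', e', v'⟩ := h'
  have h0 : toFun (a * b' - a' * b) = 0 := by
    rw [map_sub, map_mul, map_mul, ← e, ← e']; ring
  have h1 := eval_eq_zero h0 hp
  rw [map_sub, map_mul, map_mul, ← v, ← v'] at h1
  have : (c - c') * (MvPolynomial.eval (fun i => p i) b * MvPolynomial.eval (fun i => p i) b')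
      = 0 := by linear_combination h1
  rcases mul_eq_zero.1 this with h | h
  · exact sub_eq_zero.1 h
  · exact absurd h (mul_ne_zero hb hb')

theorem of_poly (P : MvPolynomial (Fin 3) ℝ) :
    HasValueAt (toFun P) p (MvPolynomial.eval (fun i => p i) P) :=
  ⟨P, 1, by simp, by simp, by simp⟩

theorem add (h : HasValueAt f p c) (h' : HasValueAt f' p c') :
    HasValueAt (f + f') p (c + c') := by
  obtain ⟨a, b, hb, e, v⟩ := h
  obtain ⟨a', b', hb', e', v'⟩ := h'
  refine ⟨a * b' + a' * b, b * b', ?_, ?_, ?_⟩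
  · rw [map_mul]; exact mul_ne_zero hb hb'
  · simp only [map_mul, map_add, ← e, ← e']; ring
  · simp only [map_mul, map_add, ← v, ← v']; ring

theorem mul (h : HasValueAt f p c) (h' : HasValueAt f' p c') :
    HasValueAt (f * f') p (c * c') := by
  obtain ⟨a, b, hb, e, v⟩ := h
  obtain ⟨a', b', hb', e', v'⟩ := h'
  refine ⟨a * a', b * b', ?_, ?_, ?_⟩
  · rw [map_mul]; exact mul_ne_zero hb hb'
  · simp only [map_mul, ← e, ← e']; ring
  · simp only [map_mul, ← v, ← v']; ring

theorem inv (hp : p ∈ Metric.sphere (0 : E3) 1) (h : HasValueAt f p c) (hc : c ≠ 0) :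
    HasValueAt f⁻¹ p c⁻¹ := by
  obtain ⟨a, b, hb, e, v⟩ := h
  have ha : MvPolynomial.eval (fun i => p i) a ≠ 0 := v ▸ mul_ne_zero hc hb
  have hf : f ≠ 0 := by
    rintro rfl
    exact toFun_ne_zero hp ha (by rw [← e, zero_mul])
  exact ⟨b, a, ha, by rw [← e]; field_simp, by rw [← v]; field_simp⟩

end HasValueAt

/-- If `g` is defined at `p` with image `q`, and `f` is regular at `q`, then `g* f` is regular at
`p`, with the expected value. -/
theorem HasValueAt.comp {g : Bir} {p q : E3} (hp : p ∈ Metric.sphere (0 : E3) 1)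
    (hg : ∀ i, HasValueAt (g (coord i)) p (q i)) {f : FunField} {c : ℝ} (hf : HasValueAt f q c) :
    HasValueAt (g f) p c := by
  have key : ∀ P : MvPolynomial (Fin 3) ℝ,
      HasValueAt (g (toFun P)) p (MvPolynomial.eval (fun i => q i) P) := by
    intro P
    induction P using MvPolynomial.induction_on with
    | C r =>
      have h := HasValueAt.of_poly (p := p) (MvPolynomial.C r)
      have h1 : toFun (MvPolynomial.C r) = algebraMap ℝ FunField r := toFun.commutes r
      rw [h1] at h ⊢
      simpa using h
    | add P Q hP hQ => simpa only [map_add] using hP.add hQ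
    | mul_X P i hP =>
      rw [map_mul, map_mul, map_mul, MvPolynomial.eval_X]
      exact hP.mul (hg i)
  obtain ⟨a, b, hb, e, v⟩ := hf
  have hb' : g (toFun b) ≠ 0 := by
    intro h
    have h0 : HasValueAt (0 : FunField) p (MvPolynomial.eval (fun i => q i) b) := h ▸ key b
    have h1 : HasValueAt (0 : FunField) p 0 := by
      simpa using HasValueAt.of_poly (p := p) 0
    exact hb (h0.unique hp h1)
  have h := (key a).mul ((key b).inv hp hb)
  have e1 : g f = g (toFun a) * (g (toFun b))⁻¹ := by
    rw [← e, map_mul]; field_simp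
  have e2 : c = MvPolynomial.eval (fun i => q i) a * (MvPolynomial.eval (fun i => q i) b)⁻¹ := by
    rw [← v]; field_simp
  rwa [e1, e2]

/-- A rational map that is defined at a real point maps it to a real point, given by the values of
the three affine coordinates. -/
theorem IsDefinedAt.exists_image {g : Bir} {p : E3} (hp : p ∈ Metric.sphere (0 : E3) 1)
    (h : IsDefinedAt g p) :
    ∃ q ∈ Metric.sphere (0 : E3) 1, ∀ i, HasValueAt (g (coord i)) p (q i) := by
  obtain ⟨F, c, hF, hc, e⟩ := h
  have hsum : F 1 * F 1 + F 2 * F 2 + F 3 * F 3 = F 0 * F 0 := by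
    have := congrArg g coord_sum_sq
    simp only [map_add, map_pow, map_one] at this
    rw [← show _ = F 1 from e 0, ← show _ = F 2 from e 1, ← show _ = F 3 from e 2]
    linear_combination (F 0) ^ 2 * this
  have hval : c 1 * c 1 + c 2 * c 2 + c 3 * c 3 = c 0 * c 0 := by
    refine HasValueAt.unique hp ?_ ((hF 0).mul (hF 0))
    rw [← hsum]
    exact (((hF 1).mul (hF 1)).add ((hF 2).mul (hF 2))).add ((hF 3).mul (hF 3))
  have hc0 : c 0 ≠ 0 := by
    intro h0
    rw [h0] at hval
    apply hc
    funext i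
    fin_cases i
    · exact h0
    · change c 1 = 0
      nlinarith [mul_self_nonneg (c 1), mul_self_nonneg (c 2), mul_self_nonneg (c 3)]
    · change c 2 = 0
      nlinarith [mul_self_nonneg (c 1), mul_self_nonneg (c 2), mul_self_nonneg (c 3)]
    · change c 3 = 0
      nlinarith [mul_self_nonneg (c 1), mul_self_nonneg (c 2), mul_self_nonneg (c 3)]
  have hF0 : F 0 ≠ 0 := by
    intro h0
    have h1 := hF 0
    rw [h0] at h1
    exact hc0 (h1.unique hp (by simpa using HasValueAt.of_poly (p := p) 0))
  refine ⟨WithLp.toLp 2 fun i => c i.succ * (c 0)⁻¹, mem_sphere_of_sum_sq ?_, fun i => ?_⟩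
  · change (c 1 * (c 0)⁻¹) ^ 2 + (c 2 * (c 0)⁻¹) ^ 2 + (c 3 * (c 0)⁻¹) ^ 2 = 1
    field_simp
    linear_combination hval
  · have : g (coord i) = F i.succ * (F 0)⁻¹ := by rw [← e i]; field_simp
    rw [this]
    exact (hF i.succ).mul ((hF 0).inv hp hc0)

theorem isDefinedAt_of_hasValueAt {g : Bir} {p : E3} {q : Fin 3 → ℝ}
    (h : ∀ i, HasValueAt (g (coord i)) p (q i)) : IsDefinedAt g p := by
  refine ⟨Fin.cons 1 fun i => g (coord i), Fin.cons 1 q, fun i => ?_, fun h0 => ?_, fun i => ?_⟩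
  · refine Fin.cases ?_ (fun j => ?_) i
    · simpa using HasValueAt.of_poly (p := p) 1
    · simpa using h j
  · simpa using congrFun h0 0
  · simp

theorem isDefinedAt_mul {g h : Bir} (hg : ∀ p ∈ Metric.sphere (0 : E3) 1, IsDefinedAt g p)
    (hh : ∀ p ∈ Metric.sphere (0 : E3) 1, IsDefinedAt h p) :
    ∀ p ∈ Metric.sphere (0 : E3) 1, IsDefinedAt (g * h) p := by
  intro p hp
  obtain ⟨q, hq, hgq⟩ := (hg p hp).exists_image hp
  obtain ⟨r, -, hhr⟩ := (hh q hq).exists_image hq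
  exact isDefinedAt_of_hasValueAt fun i => HasValueAt.comp hp hgq (hhr i)

/-- The group `Aut(S(ℝ))` of birational diffeomorphisms: the birational transformations `g` of `S`
such that `g` and `g⁻¹` are defined at every real point. -/
def autReal : Subgroup Bir where
  carrier := {g | (∀ p ∈ Metric.sphere (0 : E3) 1, IsDefinedAt g p) ∧
    ∀ p ∈ Metric.sphere (0 : E3) 1, IsDefinedAt g⁻¹ p}
  mul_mem' {g h} hg hh := ⟨isDefinedAt_mul hg.1 hh.1, by
    rw [mul_inv_rev]; exact isDefinedAt_mul hh.2 hg.2⟩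
  one_mem' := by
    have : ∀ p ∈ Metric.sphere (0 : E3) 1, IsDefinedAt 1 p := fun p _ =>
      isDefinedAt_of_hasValueAt fun i => HasValueAt.of_poly (MvPolynomial.X i)
    exact ⟨this, by simpa using this⟩
  inv_mem' {g} hg := ⟨hg.2, by simpa using hg.1⟩

/-- The group `Aut(S(ℝ)/π)` of birational diffeomorphisms `g` with `π ∘ g = π`, where
`π : S ⇢ ℙ¹` is `(w : x : y : z) ↦ (w : z)`; in the affine coordinate `z` this says `g* z = z`. -/
def autRealOverPi : Subgroup Bir :=
  autReal ⊓ MulAction.stabilizer Bir (coord 2)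

open Classical in
/-- The value of a rational function at a real point (`0` if it is not regular there). -/
def valueAt (f : FunField) (p : E3) : ℝ :=
  if h : ∃ c, HasValueAt f p c then h.choose else 0

/-- The self-map of `S(ℝ)` induced by `g`. -/
def realMap (g : Bir) (p : E3) : E3 :=
  WithLp.toLp 2 fun i => valueAt (g (coord i)) p

/-- The extension `v ↦ ‖v‖ g(v / ‖v‖)` to `ℝ³ ∖ {0}` of the self-map of the unit sphere induced
by `g`. -/
def radialExt (g : Bir) (v : E3) : E3 :=
  ‖v‖ • realMap g (‖v‖⁻¹ • v)

/-- The self-map of the sphere `S(ℝ)` induced by `g` preserves the orientation. The differential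
at `p ∈ S(ℝ)` of the radial extension of `g` maps the outer normal at `p` to the outer normal at
`g(p)` and restricts to the differential of `g` on the tangent plane at `p`, so its determinant is
positive exactly when the latter preserves the orientation. -/
def IsOrientationPreserving (g : Bir) : Prop :=
  ∀ p ∈ Metric.sphere (0 : E3) 1, 0 < (fderiv ℝ (radialExt g) p).det

theorem HasValueAt.valueAt_eq {f : FunField} {p : E3} {c : ℝ}
    (hp : p ∈ Metric.sphere (0 : E3) 1) (h : HasValueAt f p c) : valueAt f p = c := by
  have h' : ∃ c, HasValueAt f p c := ⟨c, h⟩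
  rw [valueAt, dif_pos h']
  exact h'.choose_spec.unique hp h

theorem realMap_spec {g : Bir} {p : E3} (hp : p ∈ Metric.sphere (0 : E3) 1)
    (h : IsDefinedAt g p) : realMap g p ∈ Metric.sphere (0 : E3) 1 ∧
      ∀ i, HasValueAt (g (coord i)) p (realMap g p i) := by
  obtain ⟨q, hq, hv⟩ := h.exists_image hp
  have : realMap g p = q := by
    ext i
    exact (hv i).valueAt_eq hp
  rw [this]
  exact ⟨hq, hv⟩

theorem realMap_mul {g h : Bir} {p : E3} (hp : p ∈ Metric.sphere (0 : E3) 1)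
    (hg : IsDefinedAt g p) (hh : IsDefinedAt h (realMap g p)) :
    realMap (g * h) p = realMap h (realMap g p) := by
  obtain ⟨hq, hv⟩ := realMap_spec hp hg
  obtain ⟨-, hw⟩ := realMap_spec hq hh
  ext i
  exact (HasValueAt.comp hp hv (hw i)).valueAt_eq hp

theorem realMap_one {p : E3} (hp : p ∈ Metric.sphere (0 : E3) 1) : realMap 1 p = p := by
  ext i
  exact HasValueAt.valueAt_eq hp (by
    simpa [coord] using HasValueAt.of_poly (p := p) (MvPolynomial.X i))

theorem normalize_mem {v : E3} (hv : v ≠ 0) : ‖v‖⁻¹ • v ∈ Metric.sphere (0 : E3) 1 := by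
  simp [norm_smul, hv]

theorem radialExt_mul {g h : Bir} (hg : g ∈ autReal) (hh : h ∈ autReal) {v : E3} (hv : v ≠ 0) :
    radialExt (g * h) v = radialExt h (radialExt g v) := by
  have hu := normalize_mem hv
  obtain ⟨hq, -⟩ := realMap_spec hu (hg.1 _ hu)
  have hq1 : ‖realMap g (‖v‖⁻¹ • v)‖ = 1 := by simpa using hq
  have hn : ‖v‖ ≠ 0 := norm_ne_zero_iff.2 hv
  have h1 : ‖radialExt g v‖ = ‖v‖ := by rw [radialExt, norm_smul, hq1]; simp
  rw [radialExt, realMap_mul hu (hg.1 _ hu) (hh.1 _ hq), radialExt, h1]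
  congr 2
  rw [radialExt, smul_smul, inv_mul_cancel₀ hn, one_smul]

theorem radialExt_one {v : E3} (hv : v ≠ 0) : radialExt 1 v = v := by
  have hn : ‖v‖ ≠ 0 := norm_ne_zero_iff.2 hv
  rw [radialExt, realMap_one (normalize_mem hv), smul_smul, mul_inv_cancel₀ hn, one_smul]

theorem ne_zero_of_mem {p : E3} (hp : p ∈ Metric.sphere (0 : E3) 1) : p ≠ 0 :=
  ne_zero_of_mem_unit_sphere ⟨p, hp⟩

theorem radialExt_eq {g : Bir} {p : E3} (hp : p ∈ Metric.sphere (0 : E3) 1) :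
    radialExt g p = realMap g p := by
  have h : ‖p‖ = 1 := by simpa using hp
  simp [radialExt, h]

theorem differentiable_eval (P : MvPolynomial (Fin 3) ℝ) :
    Differentiable ℝ fun v : E3 => MvPolynomial.eval (fun i => v i) P := by
  induction P using MvPolynomial.induction_on with
  | C r => simp
  | add P Q hP hQ =>
    simp only [map_add]
    exact hP.add hQ
  | mul_X P i hP =>
    have : Differentiable ℝ fun v : E3 => v i := (EuclideanSpace.proj (𝕜 := ℝ) i).differentiable
    simp only [map_mul, MvPolynomial.eval_X]
    exact hP.mul this

theorem differentiableAt_radialExt {g : Bir} {p : E3} (hp : p ∈ Metric.sphere (0 : E3) 1)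
    (h : IsDefinedAt g p) : DifferentiableAt ℝ (radialExt g) p := by
  have hp0 : p ≠ 0 := ne_zero_of_mem hp
  have hp1 : ‖p‖ = 1 := by simpa using hp
  have hnorm : DifferentiableAt ℝ (fun v : E3 => ‖v‖) p := differentiableAt_id.norm ℝ hp0
  have hnz : ‖p‖ ≠ 0 := norm_ne_zero_iff.2 hp0
  have hu : DifferentiableAt ℝ (fun v : E3 => ‖v‖⁻¹ • v) p :=
    (hnorm.inv hnz).smul differentiableAt_id
  have hup : ‖p‖⁻¹ • p = p := by simp [hp1]
  rw [differentiableAt_euclidean]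
  intro i
  obtain ⟨a, b, hb, e, v⟩ := (realMap_spec hp h).2 i
  have hA (P : MvPolynomial (Fin 3) ℝ) : DifferentiableAt ℝ
      (fun v : E3 => MvPolynomial.eval (fun i => (‖v‖⁻¹ • v) i) P) p :=
    DifferentiableAt.comp (g := fun v : E3 => MvPolynomial.eval (fun i => v i) P) p
      (differentiable_eval P _) hu
  have hb' : MvPolynomial.eval (fun i => (‖p‖⁻¹ • p) i) b ≠ 0 := by rw [hup]; exact hb
  have hD := hnorm.mul ((hA a).mul ((hA b).inv hb'))
  refine hD.congr_of_eventuallyEq ?_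
  filter_upwards [(hA b).continuousAt.eventually_ne hb',
    continuousAt_id.eventually_ne hp0] with w hw hw0
  have hws : ‖w‖⁻¹ • w ∈ Metric.sphere (0 : E3) 1 := normalize_mem hw0
  have hval : HasValueAt (g (coord i)) (‖w‖⁻¹ • w)
      (MvPolynomial.eval (fun i => (‖w‖⁻¹ • w) i) a *
        (MvPolynomial.eval (fun i => (‖w‖⁻¹ • w) i) b)⁻¹) :=
    ⟨a, b, hw, e, by rw [mul_assoc, inv_mul_cancel₀ hw, mul_one]⟩
  change ‖w‖ * valueAt (g (coord i)) (‖w‖⁻¹ • w) = _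
  rw [hval.valueAt_eq hws]
  rfl

theorem det_fderiv_mul {g h : Bir} (hg : g ∈ autReal) (hh : h ∈ autReal) {p : E3}
    (hp : p ∈ Metric.sphere (0 : E3) 1) :
    (fderiv ℝ (radialExt (g * h)) p).det =
      (fderiv ℝ (radialExt h) (realMap g p)).det * (fderiv ℝ (radialExt g) p).det := by
  have hq := (realMap_spec hp (hg.1 p hp)).1
  have h1 : radialExt (g * h) =ᶠ[nhds p] radialExt h ∘ radialExt g := by
    filter_upwards [continuousAt_id.eventually_ne (ne_zero_of_mem hp)] with v hv
    exact radialExt_mul hg hh hv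
  have hd : DifferentiableAt ℝ (radialExt h) (radialExt g p) := by
    rw [radialExt_eq hp]
    exact differentiableAt_radialExt hq (hh.1 _ hq)
  rw [h1.fderiv_eq, fderiv_comp p hd (differentiableAt_radialExt hp (hg.1 p hp)), radialExt_eq hp]
  exact LinearMap.det_comp _ _

theorem det_fderiv_one {p : E3} (hp : p ∈ Metric.sphere (0 : E3) 1) :
    (fderiv ℝ (radialExt 1) p).det = 1 := by
  have h1 : radialExt 1 =ᶠ[nhds p] id := by
    filter_upwards [continuousAt_id.eventually_ne (ne_zero_of_mem hp)] with v hv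
    exact radialExt_one hv
  rw [h1.fderiv_eq, fderiv_id]
  exact LinearMap.det_id

/-- The group `Aut⁺(S(ℝ)/π)` of those elements of `Aut(S(ℝ)/π)` that preserve the orientation of
the sphere `S(ℝ)`. -/
def autRealOverPiPlus : Subgroup Bir where
  carrier := {g | g ∈ autRealOverPi ∧ IsOrientationPreserving g}
  mul_mem' {g h} hg hh := ⟨mul_mem hg.1 hh.1, fun p hp => by
    rw [det_fderiv_mul hg.1.1 hh.1.1 hp]
    exact mul_pos (hh.2 _ (realMap_spec hp (hg.1.1.1 p hp)).1) (hg.2 p hp)⟩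
  one_mem' := ⟨one_mem _, fun p hp => by rw [det_fderiv_one hp]; exact one_pos⟩
  inv_mem' {g} hg := ⟨inv_mem hg.1, fun p hp => by
    have hi : g⁻¹ ∈ autReal := inv_mem hg.1.1
    have h := det_fderiv_mul hi hg.1.1 hp
    rw [inv_mul_cancel, det_fderiv_one hp] at h
    have hpos := hg.2 _ (realMap_spec hp (hi.1 p hp)).1
    by_contra hcon
    exact absurd h (by nlinarith [mul_nonneg hpos.le (sub_nonneg.2 (not_lt.1 hcon))])⟩

/-! ### Double covers of the real projective line -/

/-- The grading of `ℝ[w, z]` by the degree. -/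
abbrev gradingP1 : ℕ → Submodule ℝ (MvPolynomial (Fin 2) ℝ) :=
  MvPolynomial.homogeneousSubmodule (Fin 2) ℝ

instance : GradedAlgebra gradingP1 := MvPolynomial.gradedAlgebra

/-- The real projective line `ℙ¹ = Proj ℝ[w, z]`; its homogeneous coordinates `w, z` are the
variables with index `0, 1`. -/
abbrev P1 : Scheme.{0} := Proj gradingP1

/-- The structure morphism of the real projective line. -/
def P1.toSpec : P1 ⟶ Spec (.of ℝ) :=
  Proj.toSpecZero gradingP1 ≫ Spec.map (CommRingCat.ofHom (algebraMap ℝ (gradingP1 0)))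

/-- The ring homomorphism from the coordinate ring `ℝ[w, z]_(w)` of the affine chart `w ≠ 0` of
`ℙ¹` to `L` that is `ρ` on `ℝ` and maps the affine coordinate `z / w` to `ζ`. -/
def P1.chartHom {L : Type} [CommRing L] (ρ : ℝ →+* L) (ζ : L) :
    HomogeneousLocalization.Away gradingP1 (MvPolynomial.X 0) →+* L :=
  (Localization.awayLift (MvPolynomial.eval₂Hom ρ ![1, ζ]) (MvPolynomial.X 0) (by simp)).comp
    (algebraMap (HomogeneousLocalization.Away gradingP1 (MvPolynomial.X 0))
      (Localization.Away (MvPolynomial.X 0 : MvPolynomial (Fin 2) ℝ)))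

/-- The `L`-valued point `(1 : ζ)` of `ℙ¹`, where `L` is an `ℝ`-algebra through `ρ`. -/
def P1.point {L : Type} [CommRing L] (ρ : ℝ →+* L) (ζ : L) : Spec (.of L) ⟶ P1 :=
  Spec.map (CommRingCat.ofHom (P1.chartHom ρ ζ)) ≫
    Proj.awayι gradingP1 (MvPolynomial.X 0) (MvPolynomial.isHomogeneous_X ℝ 0) one_pos

/-- A smooth real projective curve `Γ` (smooth, proper and irreducible over `ℝ`) with a
`2 : 1`-covering `π : Γ ⟶ ℙ¹`, i.e. a finite flat morphism of degree `2` over `ℝ`. As `Γ` is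
finite over `ℙ¹`, it is purely of dimension `1`. -/
structure DoubleCover where
  /-- The curve. -/
  Γ : Scheme.{0}
  /-- The covering of the projective line. -/
  π : Γ ⟶ P1
  isIntegral : IsIntegral Γ
  smooth : Smooth (π ≫ P1.toSpec)
  isProper : IsProper (π ≫ P1.toSpec)
  isFinite : IsFinite π
  flat : Flat π
  degree_eq_two : ∀ y : P1, π.finrank y = 2

namespace DoubleCover

instance (C : DoubleCover) : IsIntegral C.Γ := C.isIntegral

/-- `π`-isomorphism of double covers: an isomorphism of curves that commutes with the coverings. -/
instance piIso : Setoid DoubleCover where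
  r C C' := ∃ e : C.Γ ≅ C'.Γ, e.hom ≫ C'.π = C.π
  iseqv := ⟨fun _ => ⟨Iso.refl _, by simp⟩, fun ⟨e, h⟩ => ⟨e.symm, by simp [← h]⟩,
    fun ⟨e, h⟩ ⟨e', h'⟩ => ⟨e ≪≫ e', by simp [h, h']⟩⟩

/-- The set `Γ(ℝ)` of real points. -/
def RealPoints (C : DoubleCover) : Type :=
  {s : Spec (.of ℝ) ⟶ C.Γ // s ≫ C.π ≫ P1.toSpec = 𝟙 _}

/-- The Euclidean topology on `Γ(ℝ)`: the coarsest one for which `U(ℝ)` is open and `f` is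
continuous on `U(ℝ)`, for all Zariski open sets `U` and all regular functions `f` on `U`. -/
instance (C : DoubleCover) : TopologicalSpace C.RealPoints :=
  TopologicalSpace.generateFrom
    {T | ∃ (U : C.Γ.Opens) (f : Γ(C.Γ, U)) (W : Set ℝ), IsOpen W ∧
      T = {s | ∃ h : ⊤ ≤ s.1 ⁻¹ᵁ U,
        (Scheme.ΓSpecIso (.of ℝ)).hom (s.1.appLE U ⊤ h f) ∈ W}}

/-- `Γ` has no real point. -/
def HasNoRealPoint (C : DoubleCover) : Prop := IsEmpty C.RealPoints

/-- `Γ` has exactly one oval: the ovals of a smooth real projective curve are the connected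
components of `Γ(ℝ)`, so this means that `Γ(ℝ)` is connected and not empty. -/
def HasOneOval (C : DoubleCover) : Prop := ConnectedSpace C.RealPoints

/-- `π(Γ(ℝ)) = [-1, 1]`, as a set of real points `(1 : a)` of `ℙ¹`. -/
def ImageIsInterval (C : DoubleCover) : Prop :=
  Set.range (fun s : C.RealPoints => s.1 ≫ C.π) =
    P1.point (RingHom.id ℝ) '' Set.Icc (-1 : ℝ) 1

end DoubleCover

/-! ### The curve of fixed points -/

/-- The curve of fixed points of `g`, as a place of `ℝ(S)`. The generic fibre of `π : S ⇢ ℙ¹` is a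
smooth conic over `ℝ(z)`, on which `g` acts as an automorphism if it commutes with `π`; the closed
points of this conic are the valuation rings `ℝ(z) ⊆ V ⊊ ℝ(S)`. Such a point is fixed by `g` (as
a subscheme) if and only if `g` maps `V` to itself and acts trivially on the residue field of `V`.
It spreads out to a curve, dominating `ℙ¹`, of fixed points of `g` on a conic bundle birational to
`S`, and the residue field of `V` is the field of rational functions on this curve. -/
structure FixedCurve (g : Bir) where
  /-- The valuation ring. -/
  V : ValuationSubring FunField
  ne_top : V ≠ ⊤
  base_le : ∀ f ∈ ℝ⟮coord 2⟯, f ∈ V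
  fixed : ∀ f ∈ V, V.valuation (g f - f) < 1

namespace FixedCurve

variable {g : Bir} (F : FixedCurve g)

/-- The field of rational functions on the curve of fixed points. -/
abbrev field : Type := IsLocalRing.ResidueField F.V

/-- The constants, as rational functions on the curve of fixed points. -/
def const : ℝ →+* F.field :=
  (IsLocalRing.residue F.V).comp ((algebraMap ℝ FunField).codRestrict F.V.toSubring fun c =>
    F.base_le _ (ℝ⟮coord 2⟯.algebraMap_mem c))

/-- The restriction of `z` to the curve of fixed points. -/
def z : F.field :=
  IsLocalRing.residue F.V ⟨coord 2, F.base_le _ (IntermediateField.mem_adjoin_simple_self ℝ _)⟩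

/-- The restriction of `π` to the generic point of the curve of fixed points. -/
def genericMap : Spec (.of F.field) ⟶ P1 := P1.point F.const F.z

end FixedCurve

/-- `π : Γ ⟶ ℙ¹` is the smooth projective model `Fix(g) → ℙ¹` of the curve of fixed points of `g`:
the generic point of `Γ` is identified with that of the curve of fixed points, compatibly with the
maps to `ℙ¹`. -/
def IsFixedCurveOf (C : DoubleCover) (g : Bir) : Prop :=
  ∃ (F : FixedCurve g) (e : F.field ≃+* C.Γ.functionField),
    C.Γ.fromSpecStalk (genericPoint C.Γ) ≫ C.π =
      Spec.map (CommRingCat.ofHom e.toRingHom) ≫ F.genericMap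

/-! ### The two sides of the correspondences -/

/-- The involutions in `Aut⁺(S(ℝ)/π)`, up to conjugacy in this group. -/
instance invPlus : Setoid {g : autRealOverPiPlus // orderOf g = 2} where
  r g g' := IsConj g.1 g'.1
  iseqv := ⟨fun _ => IsConj.refl _, IsConj.symm, IsConj.trans⟩

/-- The involutions in `Aut(S(ℝ)/π) ∖ Aut⁺(S(ℝ)/π)`, up to conjugacy in `Aut(S(ℝ)/π)`. -/
instance invMinus :
    Setoid {g : autRealOverPi // orderOf g = 2 ∧ (g : Bir) ∉ autRealOverPiPlus} where
  r g g' := IsConj g.1 g'.1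
  iseqv := ⟨fun _ => IsConj.refl _, IsConj.symm, IsConj.trans⟩

/-- Double covers without real point, up to `π`-isomorphism. -/
instance coverPlus : Setoid {C : DoubleCover // C.HasNoRealPoint} :=
  DoubleCover.piIso.comap Subtype.val

/-- Double covers with one oval lying over `[-1, 1]`, up to `π`-isomorphism. -/
instance coverMinus : Setoid {C : DoubleCover // C.HasOneOval ∧ C.ImageIsInterval} :=
  DoubleCover.piIso.comap Subtype.val

end

end RealSphere

/-! ### Rational functions on the sphere and their values at real points -/

namespace RealSphere

/-! Put δ = 1 - z² and t = x + iy. Over ℂ(z) the generic fibre x² + y² = δ is a rational curve with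
coordinate t, and the conjugate of t is δ/t. An involution over ℙ¹ is therefore a Möbius
transformation of trace zero in t. As it commutes with complex conjugation, a scaling argument in
the style of Hilbert 90 brings it to the form t ↦ (iαt + δb)/(b̄t - iα) with b = β + iγ, where α, β,
γ are real polynomials in z without common real zero (`exists_isRefl`). So g is the reflection
attached to a pure quaternion q, determined up to scalars, with norm N = α² - δ(β² + γ²). If b ≠ 0,
its fixed points lie on the line βy - γx = α, and on this line u = βx + γy satisfies u² = -N; if b =
0, they lie at infinity. In both cases the curve of fixed points has the function field ℝ(z)(√-N)
(`FixedCurve.isQuadExt_of_isRefl`, `nonempty_fixedCurve`).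

If g is a birational diffeomorphism, then N has no zero with -1 < z < 1, because the circle over
such a zero would be contracted (`IsRefl.eval_nrd_ne_zero`). Hence there are two kinds. Either N > 0
on [-1, 1] (timelike); then g acts on the tangent plane at the north pole as a half turn and
preserves the orientation. Or N < 0 between the poles; then δ divides α, -N = δk with k > 0 on [-1,
1] (spacelike), and g acts at the north pole as a reflection and reverses the orientation. Outside
[-1, 1] the sign of δ gives N ≥ 0 in the first case and k ≥ 0 in the second. So u² = -N has no real
points in the first case, and one oval over [-1, 1] in the second.

A double cover is likewise governed by a square class in ℝ(z): its affine charts are u² = f with f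
squarefree, and it is the normalization of ℙ¹ in its function field
(`DoubleCover.HasDiscr.equiv_iff`, `exists_doubleCover`). It remains to see that the square class of
-N is a complete invariant and takes all admissible values.

Completeness: if q and q' have the same norm, then the reflection in q + q' conjugates one into the
other (`conj_eq_of_nrd_eq`), and one needs q + q' to be of one of the two good kinds. For timelike
quaternions this is the reversed Cauchy–Schwarz inequality once the signs are adjusted
(`IsTimelike.add`). For spacelike ones, q' is taken with α' = 0, and q is first rotated by b ↦ (c +
id)²b̄, where c + id approximates a square root of bb' on [-1, 1] (`exists_sq_approx`).

Existence: a positive f is, up to a square, the norm of a timelike quaternion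
(`exists_isTimelike_nrd_eq`). A class δk with k > 0 is realized with α = 0, since k is a sum of two
squares (`exists_eq_sq_add_sq`). -/

noncomputable instance : Field FunField := inferInstance
noncomputable instance : CommRing FunField := inferInstance
noncomputable instance : Ring FunField := inferInstance
noncomputable instance : Semiring FunField := inferInstance
noncomputable instance : CommSemiring FunField := inferInstance
noncomputable instance : Mul FunField := inferInstance
noncomputable instance : Add FunField := inferInstance
noncomputable instance : Sub FunField := inferInstance
noncomputable instance : Neg FunField := inferInstance
noncomputable instance : Zero FunField := inferInstance
noncomputable instance : One FunField := inferInstance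
noncomputable instance : Monoid FunField := inferInstance
noncomputable instance : Algebra ℝ FunField := inferInstance
noncomputable instance : NonAssocSemiring FunField := inferInstance
noncomputable instance : MulZeroClass FunField := inferInstance

theorem eval_finSuccEquiv_symm_linear (r₀ r₁ : MvPolynomial (Fin 2) ℝ) (p : Fin 3 → ℝ) :
    MvPolynomial.eval p ((MvPolynomial.finSuccEquiv ℝ 2).symm
      (Polynomial.C r₁ * Polynomial.X + Polynomial.C r₀)) =
      MvPolynomial.eval (fun i => p i.succ) r₁ * p 0 + MvPolynomial.eval (fun i => p i.succ) r₀ := by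
  have := MvPolynomial.eval_eq_eval_mv_eval' (fun i : Fin 2 => p i.succ) (p 0)
    ((MvPolynomial.finSuccEquiv ℝ 2).symm (Polynomial.C r₁ * Polynomial.X + Polynomial.C r₀))
  rw [AlgEquiv.apply_symm_apply] at this
  have hp : p = Fin.cons (p 0) fun i : Fin 2 => p i.succ := (Fin.cons_self_tail p).symm
  rw [hp, this]
  simp

/-- A polynomial that vanishes on the real sphere is a multiple of the equation of the sphere. -/
theorem toFun_eq_zero_of_eval {P : MvPolynomial (Fin 3) ℝ}
    (h : ∀ p ∈ Metric.sphere (0 : E3) 1, MvPolynomial.eval (fun i => p i) P = 0) :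
    toFun P = 0 := by
  let e := MvPolynomial.finSuccEquiv ℝ 2
  have hm : (Polynomial.X ^ 2 + Polynomial.C
      (MvPolynomial.X 0 ^ 2 + MvPolynomial.X 1 ^ 2 - 1 : MvPolynomial (Fin 2) ℝ)).Monic :=
    Polynomial.monic_X_pow_add_C _ two_ne_zero
  have he : e sphereEq = Polynomial.X ^ 2 + Polynomial.C
      (MvPolynomial.X 0 ^ 2 + MvPolynomial.X 1 ^ 2 - 1 : MvPolynomial (Fin 2) ℝ) := by
    have h1 : e (MvPolynomial.X 1) = Polynomial.C (MvPolynomial.X 0) :=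
      MvPolynomial.finSuccEquiv_X_succ (j := 0)
    have h2 : e (MvPolynomial.X 2) = Polynomial.C (MvPolynomial.X 1) :=
      MvPolynomial.finSuccEquiv_X_succ (j := 1)
    have h0 : e (MvPolynomial.X 0) = Polynomial.X := MvPolynomial.finSuccEquiv_X_zero
    simp only [sphereEq, map_add, map_sub, map_pow, map_one, h0, h1, h2]
    ring
  set r := e P %ₘ e sphereEq with hr
  have hdeg : r.degree ≤ 1 := by
    have := Polynomial.degree_modByMonic_lt (e P) (he ▸ hm)
    rw [← hr, he, Polynomial.degree_X_pow_add_C (by norm_num)] at this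
    exact Order.le_of_lt_succ this
  have hrl := Polynomial.eq_X_add_C_of_degree_le_one hdeg
  have hP : P = e.symm r + sphereEq * e.symm (e P /ₘ e sphereEq) := by
    apply e.injective
    simp only [map_add, map_mul, AlgEquiv.apply_symm_apply]
    exact (Polynomial.modByMonic_add_div (e P) (e sphereEq)).symm
  -- Division by the monic quadratic in x leaves r₁x + r₀ with coefficients in y, z. Over this box
  -- y² + z² < 1, so both points x = ±√(1 - y² - z²) are real points of the sphere, and two
  -- different zeros kill r₀ and r₁.
  have key : ∀ v ∈ Set.pi Set.univ fun _ : Fin 2 => Set.Ioo (0 : ℝ) (1 / 2),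
      MvPolynomial.eval v (r.coeff 0) = 0 ∧ MvPolynomial.eval v (r.coeff 1) = 0 := by
    intro v hv
    have h0 := hv 0 trivial
    have h1 := hv 1 trivial
    have hpos : 0 < 1 - v 0 ^ 2 - v 1 ^ 2 := by
      nlinarith [h0.1, h0.2, h1.1, h1.2]
    have hs := Real.sq_sqrt hpos.le
    have hs0 := Real.sqrt_pos.2 hpos
    set s := Real.sqrt (1 - v 0 ^ 2 - v 1 ^ 2)
    have main : ∀ a : ℝ, a ^ 2 = s ^ 2 →
        MvPolynomial.eval v (r.coeff 1) * a + MvPolynomial.eval v (r.coeff 0) = 0 := by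
      intro a ha
      have hq : (WithLp.toLp 2 ![a, v 0, v 1] : E3) ∈ Metric.sphere (0 : E3) 1 := by
        apply mem_sphere_of_sum_sq
        simp
        linarith
      have h2 := h _ hq
      have h3 : MvPolynomial.eval (fun i => (WithLp.toLp 2 ![a, v 0, v 1] : E3) i) sphereEq = 0 := by
        simp [sphereEq]
        linarith
      rw [hP, map_add, map_mul, h3, zero_mul, add_zero, hrl,
        eval_finSuccEquiv_symm_linear] at h2
      have hv' : (fun i : Fin 2 => (WithLp.toLp 2 ![a, v 0, v 1] : E3) i.succ) = v := by
        funext i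
        fin_cases i <;> rfl
      rw [hv'] at h2
      simpa using h2
    have e1 := main s rfl
    have e2 := main (-s) (by ring)
    have h3 : MvPolynomial.eval v (r.coeff 1) * s = 0 := by linarith
    refine ⟨by linarith, (mul_eq_zero.1 h3).resolve_right hs0.ne'⟩
  have hz : ∀ Q : MvPolynomial (Fin 2) ℝ,
      (∀ v ∈ Set.pi Set.univ fun _ : Fin 2 => Set.Ioo (0 : ℝ) (1 / 2),
        MvPolynomial.eval v Q = 0) → Q = 0 := by
    intro Q hQ
    refine MvPolynomial.funext_set (fun _ => Set.Ioo (0 : ℝ) (1 / 2))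
      (fun _ => Set.Ioo_infinite (by norm_num)) fun v hv => ?_
    rw [hQ v hv, map_zero]
  have hr0 : r = 0 := by
    rw [hrl, hz _ fun v hv => (key v hv).1, hz _ fun v hv => (key v hv).2]
    simp
  rw [hr0, map_zero, zero_add] at hP
  rw [hP]
  exact toFun_eq_zero_iff.2 (Ideal.mul_mem_right _ _ (Ideal.mem_span_singleton_self _))

theorem toFun_surjective_frac (f : FunField) :
    ∃ a b : MvPolynomial (Fin 3) ℝ, toFun b ≠ 0 ∧ f = toFun a / toFun b := by
  obtain ⟨a, b, hb, rfl⟩ :=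
    IsFractionRing.div_surjective (A := MvPolynomial (Fin 3) ℝ ⧸ Ideal.span {sphereEq}) f
  obtain ⟨a, rfl⟩ := Ideal.Quotient.mk_surjective a
  obtain ⟨b, rfl⟩ := Ideal.Quotient.mk_surjective b
  exact ⟨a, b, fun h => nonZeroDivisors.ne_zero hb
    (Ideal.Quotient.eq_zero_iff_mem.2 (toFun_eq_zero_iff.1 h)), rfl⟩

/-- The function field of the sphere is formally real. -/
theorem eq_zero_of_sq_add_sq {f g : FunField} (h : f ^ 2 + g ^ 2 = 0) : f = 0 ∧ g = 0 := by
  suffices ∀ {f g : FunField}, f ^ 2 + g ^ 2 = 0 → f = 0 from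
    ⟨this h, this (by rw [add_comm]; exact h)⟩
  clear h f g
  intro f g h
  obtain ⟨a, b, hb, rfl⟩ := toFun_surjective_frac f
  obtain ⟨c, d, hd, rfl⟩ := toFun_surjective_frac g
  have h0 : toFun ((a * d) ^ 2 + (c * b) ^ 2) = 0 := by
    simp only [map_add, map_pow, map_mul]
    field_simp at h
    linear_combination h
  have h1 : toFun (a * d) = 0 := by
    refine toFun_eq_zero_of_eval fun p hp => ?_
    have := eval_eq_zero h0 hp
    simp only [map_add, map_pow] at this
    nlinarith [sq_nonneg (MvPolynomial.eval (fun i => p i) (a * d)),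
      sq_nonneg (MvPolynomial.eval (fun i => p i) (c * b))]
  rw [map_mul] at h1
  rw [(mul_eq_zero.1 h1).resolve_right hd, zero_div]

/-- A subfield that contains the constants and the coordinates is the whole function field. -/
theorem subfield_eq_top (E : Subfield FunField) (hc : ∀ c : ℝ, algebraMap ℝ FunField c ∈ E)
    (h : ∀ i, coord i ∈ E) (f : FunField) : f ∈ E := by
  have key : ∀ P : MvPolynomial (Fin 3) ℝ, toFun P ∈ E := by
    intro P
    induction P using MvPolynomial.induction_on with
    | C r =>
      have h1 : toFun (MvPolynomial.C r) = algebraMap ℝ FunField r := toFun.commutes r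
      rw [h1]; exact hc r
    | add P Q hP hQ => rw [map_add]; exact add_mem hP hQ
    | mul_X P i hP => rw [map_mul]; exact mul_mem hP (h i)
  obtain ⟨a, b, -, rfl⟩ := toFun_surjective_frac f
  exact div_mem (key a) (key b)

theorem bir_ext {g h : Bir} (H : ∀ i, g (coord i) = h (coord i)) : g = h := by
  apply AlgEquiv.ext
  exact subfield_eq_top (RingHom.eqLocusField (g : FunField →+* FunField) (h : FunField →+* FunField))
    (fun c => by
      change g _ = h _
      rw [g.commutes, h.commutes]) H

open Polynomial in
/-- `p(z)`. -/
noncomputable abbrev pz : ℝ[X] →ₐ[ℝ] FunField := Polynomial.aeval (coord 2)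

open Polynomial in
theorem pz_eq_toFun (p : ℝ[X]) : pz p = toFun (aeval (MvPolynomial.X 2) p) := by
  rw [← Polynomial.aeval_algHom_apply]
  rfl

open Polynomial in
theorem eval_aeval_X (p : ℝ[X]) (v : Fin 3 → ℝ) (i : Fin 3) :
    MvPolynomial.eval v (aeval (MvPolynomial.X i) p) = p.eval (v i) := by
  change (MvPolynomial.aeval v) _ = _
  rw [← Polynomial.aeval_algHom_apply]
  simp [Polynomial.aeval_def, Polynomial.eval₂_eq_eval_map]

theorem HasValueAt.of_pz (p : Polynomial ℝ) (v : E3) : HasValueAt (pz p) v (p.eval (v 2)) := by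
  rw [pz_eq_toFun, ← eval_aeval_X p (fun i => v i)]
  exact HasValueAt.of_poly _

theorem HasValueAt.of_coord (i : Fin 3) (v : E3) : HasValueAt (coord i) v (v i) := by
  simpa [coord] using HasValueAt.of_poly (p := v) (MvPolynomial.X i)

/-- The points `(s, 0, a)` of the sphere, for `-1 ≤ a ≤ 1`. -/
theorem exists_sphere_point {a : ℝ} (ha : a ∈ Set.Icc (-1 : ℝ) 1) (θ : ℝ) :
    (WithLp.toLp 2 ![Real.sqrt (1 - a ^ 2) * Real.cos θ, Real.sqrt (1 - a ^ 2) * Real.sin θ, a]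
      : E3) ∈ Metric.sphere (0 : E3) 1 := by
  apply mem_sphere_of_sum_sq
  have : 0 ≤ 1 - a ^ 2 := by nlinarith [ha.1, ha.2]
  simp [mul_pow, Real.sq_sqrt this]
  linear_combination (1 - a ^ 2) * Real.sin_sq_add_cos_sq θ

theorem pz_injective : Function.Injective pz := by
  rw [injective_iff_map_eq_zero]
  intro p hp
  refine Polynomial.eq_zero_of_infinite_isRoot p
    (Set.Infinite.mono ?_ (Set.Icc_infinite (show (-1 : ℝ) < 1 by norm_num)))
  intro a ha
  rw [pz_eq_toFun] at hp
  have := eval_eq_zero hp (exists_sphere_point ha 0)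
  rw [eval_aeval_X] at this
  simpa using this

/-- `x` is transcendental over `ℝ(z)`, in terms of polynomials. -/
theorem eval_x_ne_zero {P : Polynomial (Polynomial ℝ)} (hP : P ≠ 0) :
    P.eval₂ (pz : Polynomial ℝ →+* FunField) (coord 0) ≠ 0 := by
  intro h
  apply hP
  have h0 : P.eval₂ (pz : Polynomial ℝ →+* FunField) (coord 0) =
      toFun (P.eval₂ ((Polynomial.aeval (MvPolynomial.X 2) : Polynomial ℝ →ₐ[ℝ] MvPolynomial (Fin 3) ℝ) :
        Polynomial ℝ →+* MvPolynomial (Fin 3) ℝ) (MvPolynomial.X 0)) := by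
    change _ = (toFun : MvPolynomial (Fin 3) ℝ →+* FunField) _
    rw [Polynomial.hom_eval₂]
    congr 1
    ext p
    · simp
    · simp [coord]
  rw [h0] at h
  -- The circle z = a projects onto a whole interval of the x-axis, so the specialized polynomial
  -- has infinitely many zeros.
  have h1 : ∀ a ∈ Set.Ioo (-1 : ℝ) 1, P.map (Polynomial.evalRingHom a) = 0 := by
    intro a ha
    have hpos : 0 < 1 - a ^ 2 := by nlinarith [ha.1, ha.2]
    refine Polynomial.eq_zero_of_infinite_isRoot _ (Set.Infinite.mono ?_
      (Set.Icc_infinite (show -Real.sqrt (1 - a ^ 2) < Real.sqrt (1 - a ^ 2) by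
        linarith [Real.sqrt_pos.2 hpos])))
    intro b hb
    have hb2 : b ^ 2 ≤ 1 - a ^ 2 := by
      nlinarith [Real.sq_sqrt hpos.le, hb.1, hb.2, Real.sqrt_nonneg (1 - a ^ 2)]
    have hq : (WithLp.toLp 2 ![b, Real.sqrt (1 - a ^ 2 - b ^ 2), a] : E3) ∈
        Metric.sphere (0 : E3) 1 := by
      apply mem_sphere_of_sum_sq
      simp [Real.sq_sqrt (show 0 ≤ 1 - a ^ 2 - b ^ 2 by linarith)]
    have := eval_eq_zero h hq
    rw [Polynomial.hom_eval₂] at this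
    simp only [Set.mem_ofPred_eq, Polynomial.IsRoot, Polynomial.eval_map]
    rw [← this]
    simp only [MvPolynomial.eval_X]
    congr 1
    ext p
    · simp
    · simp
  ext n m
  simp only [Polynomial.coeff_zero]
  suffices P.coeff n = 0 by rw [this]; simp
  refine Polynomial.eq_zero_of_infinite_isRoot _ (Set.Infinite.mono ?_
      (Set.Ioo_infinite (show (-1 : ℝ) < 1 by norm_num)))
  intro a ha
  have := congrArg (fun Q => Q.coeff n) (h1 a ha)
  simpa using this

end RealSphere

/-! ### The complexified generic fibre and its Möbius transformations -/

namespace RealSphere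

open scoped QuadraticAlgebra

open Polynomial in
/-- An automorphism of a purely transcendental extension `k(t)` is a Möbius transformation. -/
theorem exists_moebius {k M : Type*} [Field k] [Field M] [Algebra k M] {t : M}
    (ht : Transcendental k t) (htop : k⟮t⟯ = ⊤) (σ : M ≃ₐ[k] M) :
    ∃ a b c d : k, (c ≠ 0 ∨ d ≠ 0) ∧
      (algebraMap k M c * t + algebraMap k M d) * σ t = algebraMap k M a * t + algebraMap k M b := by
  let e : RatFunc k ≃ₐ[k] M := (RatFunc.algEquivOfTranscendental t ht).trans
    ((IntermediateField.equivOfEq htop).trans IntermediateField.topEquiv)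
  have he : ∀ u : RatFunc k, e u = RatFunc.algEquivOfTranscendental t ht u := fun u => rfl
  have heX : e RatFunc.X = t := by rw [he, RatFunc.algEquivOfTranscendental_X]
  set f : RatFunc k := e.symm (σ t) with hf
  have hftop : k⟮f⟯ = ⊤ := by
    have h1 := IntermediateField.adjoin_map k {(RatFunc.X : RatFunc k)}
      ((e.trans (σ.trans e.symm)) : RatFunc k →ₐ[k] RatFunc k)
    rw [RatFunc.adjoin_X, Set.image_singleton] at h1
    have h2 : ((e.trans (σ.trans e.symm)) : RatFunc k →ₐ[k] RatFunc k) RatFunc.X = f := by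
      change e.symm (σ (e RatFunc.X)) = f
      rw [heX]
    rw [h2] at h1
    rw [← h1]
    ext u
    simp only [IntermediateField.mem_top, iff_true]
    exact ⟨(e.trans (σ.trans e.symm)).symm u, trivial, (e.trans (σ.trans e.symm)).apply_symm_apply u⟩
  -- The image f of the generator generates k(X) as well, so [k(X) : k(f)] = 1; this degree is the
  -- larger of the degrees of numerator and denominator.
  have hrank := RatFunc.finrank_eq_max_natDegree f
  rw [hftop, IntermediateField.finrank_top] at hrank
  have hn : f.num.natDegree ≤ 1 := by rw [hrank]; exact le_max_left _ _
  have hd : f.denom.natDegree ≤ 1 := by rw [hrank]; exact le_max_right _ _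
  have hden := f.denom_ne_zero
  have hnum := Polynomial.eq_X_add_C_of_natDegree_le_one hn
  have hdenom := Polynomial.eq_X_add_C_of_natDegree_le_one hd
  refine ⟨f.num.coeff 1, f.num.coeff 0, f.denom.coeff 1, f.denom.coeff 0, ?_, ?_⟩
  · by_contra! h
    rw [h.1, h.2] at hdenom
    exact hden (by rw [hdenom]; simp)
  · have h1 : f * algebraMap k[X] (RatFunc k) f.denom = algebraMap k[X] (RatFunc k) f.num := by
      have h0 : algebraMap k[X] (RatFunc k) f.denom ≠ 0 :=
        RatFunc.algebraMap_ne_zero hden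
      conv_lhs => rw [← RatFunc.num_div_denom f]
      rw [RatFunc.num_div_denom f]
      conv_lhs => enter [1]; rw [← RatFunc.num_div_denom f]
      exact div_mul_cancel₀ _ h0
    have h2 := congrArg e h1
    have hp : ∀ p : k[X], e (algebraMap k[X] (RatFunc k) p) = aeval t p := by
      intro p
      rw [he, RatFunc.algEquivOfTranscendental_algebraMap]
      exact (Polynomial.aeval_algebraMap_apply M (IntermediateField.AdjoinSimple.gen k t) p).symm
    rw [map_mul, hp, hp, hf, e.apply_symm_apply, ← hf, hnum, hdenom] at h2
    simp only [map_add, map_mul, aeval_C, aeval_X] at h2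
    rw [mul_comm] at h2
    exact h2

/-- An involution of `k(t)` is given by a Möbius transformation of trace zero. -/
theorem exists_moebius_of_involution {k M : Type*} [Field k] [Field M] [Algebra k M] {t : M}
    (ht : Transcendental k t) (htop : k⟮t⟯ = ⊤) (σ : M ≃ₐ[k] M) (h1 : σ ≠ 1) (h2 : σ (σ t) = t) :
    ∃ a b c : k, (a ≠ 0 ∨ c ≠ 0) ∧ algebraMap k M c * (t * σ t) =
      algebraMap k M a * (t + σ t) + algebraMap k M b := by
  obtain ⟨a, b, c, d, hcd, h⟩ := exists_moebius ht htop σ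
  have h' := congrArg σ h
  simp only [map_mul, map_add, h2, AlgEquiv.commutes] at h'
  have hne : σ t ≠ t := by
    intro h3
    apply h1
    apply AlgEquiv.ext
    intro u
    have hu : u ∈ k⟮t⟯ := htop ▸ IntermediateField.mem_top
    have h4 : k⟮t⟯ ≤ IntermediateField.fixedField (Subgroup.zpowers σ) := by
      rw [IntermediateField.adjoin_simple_le_iff]
      rintro ⟨τ, n, rfl⟩
      change (σ ^ n) t = t
      exact MulAction.mem_stabilizer_iff.1
        ((MulAction.stabilizer _ t).zpow_mem (MulAction.mem_stabilizer_iff.2 (show σ • t = t from h3)) n)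
    exact h4 hu ⟨σ, Subgroup.mem_zpowers σ⟩
  -- Applying σ exchanges t and σ t in the relation. The difference of the two relations isolates
  -- the trace of the matrix.
  have h5 : (algebraMap k M (d + a)) * (σ t - t) = 0 := by
    rw [map_add]; linear_combination h - h'
  have h6 : d + a = 0 := by
    rcases mul_eq_zero.1 h5 with h6 | h6
    · exact (map_eq_zero _).1 h6
    · exact absurd (sub_eq_zero.1 h6) hne
  have h7 : d = -a := eq_neg_of_add_eq_zero_left h6
  subst h7
  refine ⟨a, b, c, ?_, ?_⟩
  · rcases hcd with h8 | h8
    · exact Or.inr h8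
    · exact Or.inl (neg_ne_zero.1 h8)
  · rw [map_neg] at h
    linear_combination h

/-- Since the function field is formally real, -1 is not a square in it; this makes the quadratic
algebra below a field. -/
instance : Fact (∀ r : FunField, r ^ 2 ≠ -1 + 0 * r) := ⟨fun r h => by
  have : r ^ 2 + 1 ^ 2 = 0 := by rw [h]; ring
  exact one_ne_zero (eq_zero_of_sq_add_sq this).2⟩

/-- The function field `ℂ(S) = ℝ(S)(i)` of the complexification of the sphere. -/
abbrev CFunField : Type := QuadraticAlgebra FunField (-1) 0

/-- The extension of a birational transformation to the complexification. -/
noncomputable def complexify (g : Bir) : CFunField ≃+* CFunField where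
  toFun w := ⟨g w.re, g w.im⟩
  invFun w := ⟨g.symm w.re, g.symm w.im⟩
  left_inv w := by ext <;> simp
  right_inv w := by ext <;> simp
  map_mul' v w := by ext <;> simp
  map_add' v w := by ext <;> simp

/-- The field `ℝ(z)`. -/
noncomputable abbrev baseField : IntermediateField ℝ FunField := ℝ⟮coord 2⟯

/-- The field `ℂ(z)`. -/
noncomputable def cBaseField : Subfield CFunField where
  carrier := {w | w.re ∈ baseField ∧ w.im ∈ baseField}
  mul_mem' {v w} hv hw := by
    simp only [Set.mem_ofPred_eq, QuadraticAlgebra.re_mul, QuadraticAlgebra.im_mul, neg_mul,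
      one_mul, zero_mul, add_zero] at *
    exact ⟨add_mem (mul_mem hv.1 hw.1) (neg_mem (mul_mem hv.2 hw.2)),
      add_mem (mul_mem hv.1 hw.2) (mul_mem hv.2 hw.1)⟩
  one_mem' := by
    exact ⟨one_mem baseField, zero_mem baseField⟩
  add_mem' {v w} hv hw := ⟨add_mem hv.1 hw.1, add_mem hv.2 hw.2⟩
  zero_mem' := ⟨zero_mem baseField, zero_mem baseField⟩
  neg_mem' {v} hv := ⟨neg_mem hv.1, neg_mem hv.2⟩
  inv_mem' v hv := by
    have hn : v.norm ∈ baseField := by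
      rw [QuadraticAlgebra.norm_def]
      have := hv.1
      have := hv.2
      exact sub_mem (add_mem (mul_mem hv.1 hv.1)
        (mul_mem (mul_mem (zero_mem _) hv.1) hv.2))
        (mul_mem (mul_mem (neg_mem (one_mem _)) hv.2) hv.2)
    rw [Set.mem_ofPred_eq, QuadraticAlgebra.inv_def]
    simp only [QuadraticAlgebra.re_smul, QuadraticAlgebra.im_smul, smul_eq_mul,
      QuadraticAlgebra.re_star, QuadraticAlgebra.im_star, zero_mul, add_zero]
    exact ⟨mul_mem (inv_mem hn) hv.1, mul_mem (inv_mem hn) (neg_mem hv.2)⟩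

instance : CharZero FunField :=
  charZero_of_injective_algebraMap (algebraMap ℝ FunField).injective

theorem mem_baseField_iff {f : FunField} :
    f ∈ baseField ↔ ∃ a b : Polynomial ℝ, f = pz a / pz b :=
  IntermediateField.mem_adjoin_simple_iff ℝ f

theorem pz_mem_baseField (p : Polynomial ℝ) : pz p ∈ baseField :=
  mem_baseField_iff.2 ⟨p, 1, by simp⟩

open Polynomial in
theorem coord_zero_not_isAlgebraic :
    let := (pz : ℝ[X] →+* FunField).toAlgebra
    Transcendental ℝ[X] (coord 0) := by
  intro inst
  rintro ⟨P, hP, h⟩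
  exact eval_x_ne_zero hP h

/-- The coordinate `t = x + i y`. -/
noncomputable def tcoord : CFunField := ⟨coord 0, coord 1⟩

noncomputable abbrev iC : CFunField := ⟨0, 1⟩

/-- The equation of the conic in the coordinate t = x + iy. -/
theorem tcoord_mul_star : tcoord * star tcoord = ⟨1 - coord 2 ^ 2, 0⟩ := by
  have := coord_sum_sq
  ext
  · simp [tcoord]
    linear_combination this
  · simp [tcoord]
    ring

theorem one_sub_sq_ne_zero : 1 - coord 2 ^ 2 ≠ 0 := by
  have : pz (1 - Polynomial.X ^ 2) ≠ 0 := by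
    rw [Ne, map_eq_zero_iff _ pz_injective]
    intro h
    simpa using congrArg (Polynomial.eval 0) h
  simpa using this

theorem one_sub_sq_mem : 1 - coord 2 ^ 2 ∈ baseField := by
  have h := pz_mem_baseField (1 - Polynomial.X ^ 2)
  simp only [map_sub, map_one, map_pow, Polynomial.aeval_X] at h
  exact h

theorem tcoord_ne_zero : tcoord ≠ 0 := by
  intro h
  have := tcoord_mul_star
  rw [h, zero_mul] at this
  exact one_sub_sq_ne_zero (congrArg QuadraticAlgebra.re this).symm

-- If t were algebraic over ℂ(z), then so would be its conjugate δ/t, and hence 2x = t + t̄; but x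
-- is transcendental over ℝ(z).
open Polynomial in
theorem transcendental_tcoord : Transcendental cBaseField tcoord := by
  intro halg
  let : Algebra ℝ[X] FunField := (pz : ℝ[X] →+* FunField).toAlgebra
  have : IsScalarTower ℝ[X] FunField CFunField := IsScalarTower.of_algebraMap_eq fun _ => rfl
  have hpz : ∀ p : ℝ[X], (algebraMap FunField CFunField (pz p)) ∈ cBaseField :=
    fun p => ⟨pz_mem_baseField p, zero_mem baseField⟩
  let : Algebra ℝ[X] cBaseField :=
    (((algebraMap FunField CFunField).comp (pz : ℝ[X] →+* FunField)).codRestrict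
      cBaseField hpz).toAlgebra
  have : IsScalarTower ℝ[X] cBaseField CFunField := IsScalarTower.of_algebraMap_eq fun _ => rfl
  have : FaithfulSMul ℝ[X] FunField :=
    (faithfulSMul_iff_algebraMap_injective _ _).2 pz_injective
  have hK : ∀ f ∈ baseField, IsAlgebraic ℝ[X] (algebraMap FunField CFunField f) := by
    intro f hf
    obtain ⟨a, b, rfl⟩ := mem_baseField_iff.1 hf
    have h : ∀ p : ℝ[X], IsAlgebraic ℝ[X] (algebraMap FunField CFunField (pz p)) :=
      fun p => isAlgebraic_algebraMap (A := CFunField) p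
    rw [map_div₀, div_eq_mul_inv]
    exact (h a).mul (h b).inv
  have hi : IsAlgebraic ℝ[X] iC := by
    refine ⟨X ^ 2 + 1, ?_, ?_⟩
    · exact (monic_X_pow_add_C (1 : ℝ[X]) two_ne_zero).ne_zero
    · simp only [map_add, map_pow, aeval_X, map_one]
      ext <;> simp [sq]
  have : Algebra.IsAlgebraic ℝ[X] cBaseField := by
    refine ⟨fun w => ?_⟩
    have : IsAlgebraic ℝ[X] (algebraMap cBaseField CFunField w) := by
      have h : algebraMap cBaseField CFunField w =
          algebraMap FunField CFunField w.1.re + algebraMap FunField CFunField w.1.im * iC := by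
        change w.1 = _
        ext <;> simp
      rw [h]
      exact (hK _ w.2.1).add ((hK _ w.2.2).mul hi)
    exact (isAlgebraic_algebraMap_iff (Subtype.val_injective)).1 this
  have h1 : IsAlgebraic ℝ[X] tcoord := halg.restrictScalars ℝ[X]
  have hd : IsAlgebraic ℝ[X] (⟨1 - coord 2 ^ 2, 0⟩ : CFunField) := hK _ one_sub_sq_mem
  have h2 : IsAlgebraic ℝ[X] (star tcoord) := by
    have : star tcoord = ⟨1 - coord 2 ^ 2, 0⟩ * tcoord⁻¹ := by
      rw [← tcoord_mul_star]
      field_simp [tcoord_ne_zero]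
    rw [this]
    exact hd.mul h1.inv
  have h3 : IsAlgebraic ℝ[X] (algebraMap FunField CFunField (coord 0 + coord 0)) := by
    have : algebraMap FunField CFunField (coord 0 + coord 0) = tcoord + star tcoord := by
      ext <;> simp [tcoord]
    rw [this]
    exact h1.add h2
  have h4 : IsAlgebraic ℝ[X] (coord 0 + coord 0) :=
    (isAlgebraic_algebraMap_iff (FaithfulSMul.algebraMap_injective _ _)).1 h3
  have h5 : coord 0 = (coord 0 + coord 0) * (algebraMap ℝ[X] FunField (C (1 / 2))) := by
    have : algebraMap ℝ[X] FunField (C (1 / 2)) = 1 / 2 := by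
      change pz _ = _
      rw [aeval_C, map_div₀, map_one, map_ofNat]
    rw [this]
    ring
  apply coord_zero_not_isAlgebraic
  rw [h5]
  exact h4.mul (isAlgebraic_algebraMap _)

/-- As t̄ = δ/t, both x = (t + t̄)/2 and y = i(t̄ - t)/2 are rational in t: over ℂ(z) the conic is
parametrized by t. -/
theorem adjoin_tcoord : IntermediateField.adjoin cBaseField {tcoord} = ⊤ := by
  set E := IntermediateField.adjoin cBaseField {tcoord}
  have hk : ∀ w ∈ cBaseField, w ∈ E := fun w hw => E.algebraMap_mem ⟨w, hw⟩
  have hi : iC ∈ E := hk _ ⟨zero_mem baseField, one_mem baseField⟩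
  have ht : tcoord ∈ E := IntermediateField.mem_adjoin_simple_self _ _
  have hd : (⟨1 - coord 2 ^ 2, 0⟩ : CFunField) ∈ E := hk _ ⟨one_sub_sq_mem, zero_mem baseField⟩
  have hst : star tcoord ∈ E := by
    have : star tcoord = ⟨1 - coord 2 ^ 2, 0⟩ * tcoord⁻¹ := by
      rw [← tcoord_mul_star]
      field_simp [tcoord_ne_zero]
    rw [this]
    exact mul_mem hd (inv_mem ht)
  have hhalf : (⟨1 / 2, 0⟩ : CFunField) ∈ E := hk _ ⟨by simp, zero_mem baseField⟩
  have hF : ∀ f : FunField, algebraMap FunField CFunField f ∈ E := by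
    intro f
    refine subfield_eq_top (E.toSubfield.comap (algebraMap FunField CFunField)) ?_ ?_ f
    · intro c
      refine hk _ ⟨?_, zero_mem baseField⟩
      simp
    · intro i
      fin_cases i
      · have : algebraMap FunField CFunField (coord 0) =
            (tcoord + star tcoord) * ⟨1 / 2, 0⟩ := by
          ext
          · simp [tcoord]
            ring
          · simp [tcoord]
        change algebraMap FunField CFunField (coord 0) ∈ E
        rw [this]
        exact mul_mem (add_mem ht hst) hhalf
      · have : algebraMap FunField CFunField (coord 1) =
            (star tcoord - tcoord) * iC * ⟨1 / 2, 0⟩ := by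
          ext
          · simp [tcoord]
            ring
          · simp [tcoord]
        change algebraMap FunField CFunField (coord 1) ∈ E
        rw [this]
        exact mul_mem (mul_mem (sub_mem hst ht) hi) hhalf
      · refine hk _ ⟨?_, zero_mem baseField⟩
        simpa using pz_mem_baseField Polynomial.X
  ext w
  simp only [IntermediateField.mem_top, iff_true]
  have : w = algebraMap FunField CFunField w.re + algebraMap FunField CFunField w.im * iC := by
    ext <;> simp
  rw [this]
  exact add_mem (hF _) (mul_mem (hF _) hi)

end RealSphere

/-! ### Involutions over the projective line are reflections -/

namespace RealSphere

open scoped QuadraticAlgebra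

open Polynomial

/-- `g` is the reflection of the conic `x² + y² = 1 - z²` over `ℝ(z)` given by the pure quaternion
`iα + (β + iγ)j`, i.e. `t ↦ (iαt + (1 - z²)b) / (b̄t - iα)` with `t = x + iy` and `b = β + iγ`. -/
def IsRefl (g : Bir) (α β γ : ℝ[X]) : Prop :=
  g (coord 2) = coord 2 ∧
    (pz β * coord 0 + pz γ * coord 1) * g (coord 0) -
        (pz β * coord 1 - pz γ * coord 0 - pz α) * g (coord 1) =
      (1 - coord 2 ^ 2) * pz β - pz α * coord 1 ∧
    (pz β * coord 1 - pz γ * coord 0 - pz α) * g (coord 0) +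
        (pz β * coord 0 + pz γ * coord 1) * g (coord 1) =
      (1 - coord 2 ^ 2) * pz γ + pz α * coord 0

theorem complexify_tcoord (g : Bir) : complexify g tcoord = ⟨g (coord 0), g (coord 1)⟩ := rfl

/-- The two real equations are the real and imaginary parts of b̄tT = iα(t + T) + δb with T the
image of t. Identities about composition are easier in this form. -/
theorem isRefl_iff {g : Bir} {α β γ : ℝ[X]} : IsRefl g α β γ ↔ g (coord 2) = coord 2 ∧
    (⟨pz β, -pz γ⟩ : CFunField) * (tcoord * complexify g tcoord) =
      ⟨0, pz α⟩ * (tcoord + complexify g tcoord) +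
        ⟨1 - coord 2 ^ 2, 0⟩ * ⟨pz β, pz γ⟩ := by
  unfold IsRefl
  rw [complexify_tcoord]
  refine and_congr Iff.rfl ?_
  rw [QuadraticAlgebra.ext_iff]
  simp only [tcoord, QuadraticAlgebra.re_mul, QuadraticAlgebra.im_mul, QuadraticAlgebra.re_add,
    QuadraticAlgebra.im_add]
  constructor
  · rintro ⟨h1, h2⟩
    constructor
    · linear_combination h1
    · linear_combination h2
  · rintro ⟨h1, h2⟩
    constructor
    · linear_combination h1
    · linear_combination h2

theorem star_mem_cBaseField {w : CFunField} (hw : w ∈ cBaseField) : star w ∈ cBaseField := by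
  refine ⟨?_, ?_⟩
  · simpa using hw.1
  · simpa using hw.2

theorem complexify_star (g : Bir) (w : CFunField) :
    complexify g (star w) = star (complexify g w) := by
  ext <;> simp [complexify]

theorem map_pz {g : Bir} (hz : g (coord 2) = coord 2) (p : ℝ[X]) : g (pz p) = pz p := by
  rw [← Polynomial.aeval_algHom_apply, hz]

theorem map_baseField {g : Bir} (hz : g (coord 2) = coord 2) {f : FunField} (hf : f ∈ baseField) :
    g f = f := by
  obtain ⟨a, b, rfl⟩ := mem_baseField_iff.1 hf
  rw [map_div₀, map_pz hz, map_pz hz]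

/-- The automorphism of `ℂ(S)` over `ℂ(z)` induced by a birational transformation over `ℝ(z)`. -/
noncomputable def complexifyAlg (g : Bir) (hz : g (coord 2) = coord 2) :
    CFunField ≃ₐ[cBaseField] CFunField :=
  AlgEquiv.ofRingEquiv (f := complexify g) fun w => by
    change complexify g w.1 = w.1
    ext
    · exact map_baseField hz w.2.1
    · exact map_baseField hz w.2.2

/-- Hilbert 90 for the coefficients of an involution of a conic. -/
theorem exists_hermitian_coeff {M : Type*} [Field M] [StarRing M] (k : Subfield M)
    (hk : ∀ w ∈ k, star w ∈ k) {t T δ ι : M} (hδk : δ ∈ k) (hδs : star δ = δ)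
    (hι : ι ∈ k) (hι0 : ι ≠ 0) (hιs : star ι = -ι) (htt : t * star t = δ) (hTT : T * star T = δ)
    (htr : Transcendental k t) {a b c : M} (ha : a ∈ k) (hb : b ∈ k) (hc : c ∈ k)
    (hac : a ≠ 0 ∨ c ≠ 0) (h : c * (t * T) = a * (t + T) + b) :
    ∃ v ∈ k, ∃ w ∈ k, star v = -v ∧ (v ≠ 0 ∨ w ≠ 0) ∧
      w * (t * T) = v * (t + T) + δ * star w := by
  -- Conjugate the relation and clear the denominators of t̄ = δ/t and T̄ = δ/T: a second linear
  -- relation between 1, t + T and tT.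
  have hconj : star c * δ ^ 2 = star a * δ * (t + T) + star b * (t * T) := by
    have := congrArg star h
    simp only [star_mul, star_add] at this
    linear_combination (t * T) * this - (δ * star c - star a * T) * htt -
      (star c * (t * star t) - star a * t) * hTT
  have hind : ∀ S ∈ k, ∀ P ∈ k, ¬ (t + T = S ∧ t * T = P) := by
    rintro S hS P hP ⟨h3, h4⟩
    refine htr ⟨X ^ 2 - C ⟨S, hS⟩ * X + C ⟨P, hP⟩, ?_, ?_⟩
    · intro h0
      have := congrArg (fun p => p.coeff 2) h0
      simp at this
    · simp only [map_add, map_sub, map_mul, map_pow, aeval_X, aeval_C]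
      change t ^ 2 - S * t + P = 0
      rw [← h3, ← h4]
      ring
  have ha' := hk _ ha
  have hb' := hk _ hb
  have hc' := hk _ hc
  have hm : c * star a * δ + a * star b = 0 := by
    by_contra hm
    have e1 : (c * star a * δ + a * star b) * (t + T) = c * star c * δ ^ 2 - b * star b := by
      linear_combination -star b * h - c * hconj
    have hS : t + T ∈ k := by
      have : t + T = (c * star c * δ ^ 2 - b * star b) / (c * star a * δ + a * star b) := by
        rw [← e1, mul_div_cancel_left₀ _ hm]
      rw [this]
      exact div_mem (sub_mem (mul_mem (mul_mem hc hc') (pow_mem hδk 2)) (mul_mem hb hb'))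
        (add_mem (mul_mem (mul_mem hc ha') hδk) (mul_mem ha hb'))
    have hP : t * T ∈ k := by
      by_cases hc0 : c = 0
      · have hb0 : star b ≠ 0 := by
          intro h0
          apply hm
          rw [h0, hc0]
          ring
        have : t * T = (star c * δ ^ 2 - star a * δ * (t + T)) / star b := by
          rw [hconj, add_sub_cancel_left, mul_div_cancel_left₀ _ hb0]
        rw [this]
        exact div_mem (sub_mem (mul_mem hc' (pow_mem hδk 2)) (mul_mem (mul_mem ha' hδk) hS)) hb'
      · have : t * T = (a * (t + T) + b) / c := by
          rw [← h, mul_div_cancel_left₀ _ hc0]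
        rw [this]
        exact div_mem (add_mem (mul_mem ha hS) hb) hc
    exact hind _ hS _ hP ⟨rfl, rfl⟩
  -- A multiplier κ that makes the relation Hermitian is wanted. If a ≠ 0, then κ = ιā works. If a =
  -- 0, then κ = c̄δ + b̄ works, and if this is zero, κ = ιc̄.
  have main : ∀ κ ∈ k, κ ≠ 0 → star (κ * a) = -(κ * a) → κ * b = δ * star (κ * c) →
      ∃ v ∈ k, ∃ w ∈ k, star v = -v ∧ (v ≠ 0 ∨ w ≠ 0) ∧
        w * (t * T) = v * (t + T) + δ * star w := by
    intro κ hκ hκ0 hv hw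
    refine ⟨κ * a, mul_mem hκ ha, κ * c, mul_mem hκ hc, hv, ?_, ?_⟩
    · exact hac.imp (mul_ne_zero hκ0) (mul_ne_zero hκ0)
    · rw [← hw]
      linear_combination κ * h
  by_cases ha0 : a = 0
  · subst ha0
    have hc0 : c ≠ 0 := by simpa using hac
    have hm2 : c * star c * δ ^ 2 = b * star b := by
      simp only [star_zero] at hconj
      linear_combination star b * h + c * hconj
    by_cases hκ : star c * δ + star b = 0
    · refine main (ι * star c) (mul_mem hι hc') (mul_ne_zero hι0 fun h0 => hc0 ?_) (by simp) ?_
      · rw [← star_star c, h0, star_zero]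
      · have h5 : star (star c * δ + star b) = 0 := by rw [hκ, star_zero]
        simp only [star_add, star_mul, star_star, hδs] at h5
        simp only [star_mul, star_star, hιs]
        linear_combination ι * star c * h5
    · refine main _ (add_mem (mul_mem hc' hδk) hb') hκ (by simp) ?_
      simp only [star_add, star_mul, star_star, hδs]
      linear_combination -hm2
  · have hsa : star a ≠ 0 := fun h0 => ha0 (by rw [← star_star a, h0, star_zero])
    refine main (ι * star a) (mul_mem hι ha') (mul_ne_zero hι0 hsa) ?_ ?_
    · simp only [star_mul, star_star, hιs]
      ring
    · have := congrArg star hm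
      simp only [star_add, star_mul, star_star, hδs, star_zero] at this
      simp only [star_mul, star_star, hιs]
      linear_combination ι * this

/-- The Möbius relation has coefficients in ℂ(z). As g commutes with conjugation, it can be scaled
so that the middle coefficient is purely imaginary, that is iα, and the outer ones are w and δw̄. -/
theorem exists_real_moebius {g : Bir} (hz : g (coord 2) = coord 2) (h1 : g ≠ 1)
    (h2 : g * g = 1) : ∃ α ∈ baseField, ∃ w ∈ cBaseField, (α ≠ 0 ∨ w ≠ 0) ∧
      w * (tcoord * complexify g tcoord) = ⟨0, α⟩ * (tcoord + complexify g tcoord) +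
        ⟨1 - coord 2 ^ 2, 0⟩ * star w := by
  have hinv : ∀ f, g (g f) = f := fun f => congrArg (fun h : Bir => h f) h2
  have hδk : (⟨1 - coord 2 ^ 2, 0⟩ : CFunField) ∈ cBaseField :=
    ⟨one_sub_sq_mem, zero_mem baseField⟩
  have hTT : complexify g tcoord * star (complexify g tcoord) = ⟨1 - coord 2 ^ 2, 0⟩ := by
    rw [← complexify_star, ← map_mul, tcoord_mul_star]
    exact (complexifyAlg g hz).commutes ⟨_, hδk⟩
  obtain ⟨a, b, c, hac, h⟩ := exists_moebius_of_involution transcendental_tcoord adjoin_tcoord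
    (complexifyAlg g hz) (by
      intro h3
      apply h1
      apply AlgEquiv.ext
      intro f
      have := congrArg (fun σ : CFunField ≃ₐ[cBaseField] CFunField => (σ ⟨f, 0⟩).re) h3
      exact this) (by
      change complexify g (complexify g tcoord) = tcoord
      ext
      · exact hinv _
      · exact hinv _)
  obtain ⟨v, hv, w, hw, hvs, hvw, e⟩ := exists_hermitian_coeff cBaseField
    (fun w hw => star_mem_cBaseField hw) hδk (ι := iC) (by ext <;> simp)
    ⟨zero_mem baseField, one_mem baseField⟩
    (fun h0 => one_ne_zero (congrArg QuadraticAlgebra.im h0)) (by ext <;> simp)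
    tcoord_mul_star hTT transcendental_tcoord a.2 b.2 c.2
    (hac.imp (fun h h' => h (Subtype.ext h')) (fun h h' => h (Subtype.ext h'))) h
  have hv0 : v = ⟨0, v.im⟩ := by
    have : v.re = - v.re := by simpa using congrArg QuadraticAlgebra.re hvs
    ext
    · exact self_eq_neg.1 this
    · rfl
  have hne : v ≠ 0 → v.im ≠ 0 := fun h h' => h (by
    rw [hv0]; ext
    · rfl
    · exact h')
  exact ⟨v.im, hv.2, w, hw, hvw.imp hne id, by rw [← hv0]; exact e⟩

/-- The three polynomials have no common real zero. -/
def NoCommonRoot (α β γ : ℝ[X]) : Prop :=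
  ∀ a : ℝ, ¬ (α.eval a = 0 ∧ β.eval a = 0 ∧ γ.eval a = 0)

/-- As ℝ[z] is principal, one can divide by a generator of the ideal of the three polynomials; the
quotients generate the unit ideal. -/
theorem exists_noCommonRoot {α β γ : ℝ[X]} (h : α ≠ 0 ∨ β ≠ 0 ∨ γ ≠ 0) :
    ∃ d α' β' γ' : ℝ[X], d ≠ 0 ∧ α = d * α' ∧ β = d * β' ∧ γ = d * γ' ∧ NoCommonRoot α' β' γ' := by
  set I : Ideal ℝ[X] := Ideal.span {α, β, γ}
  have hα : α ∈ I := Ideal.subset_span (by simp)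
  have hβ : β ∈ I := Ideal.subset_span (by simp)
  have hγ : γ ∈ I := Ideal.subset_span (by simp)
  obtain ⟨d, hd⟩ : ∃ d, I = Ideal.span {d} := ⟨_, (Ideal.span_singleton_generator I).symm⟩
  rw [hd, Ideal.mem_span_singleton] at hα hβ hγ
  obtain ⟨α', rfl⟩ := hα
  obtain ⟨β', rfl⟩ := hβ
  obtain ⟨γ', rfl⟩ := hγ
  have hd0 : d ≠ 0 := by
    rintro rfl
    simp at h
  refine ⟨d, α', β', γ', hd0, rfl, rfl, rfl, fun a ha => ?_⟩
  have h1 : d ∈ I := by rw [hd]; exact Ideal.mem_span_singleton_self d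
  obtain ⟨r, s, t, hrst⟩ : ∃ r s t, d = r * (d * α') + s * (d * β') + t * (d * γ') := by
    obtain ⟨r, y, hy, e⟩ := Ideal.mem_span_insert.1 h1
    obtain ⟨s, t, hst⟩ := Ideal.mem_span_pair.1 hy
    exact ⟨r, s, t, by linear_combination e - hst⟩
  have h2 : 1 = r * α' + s * β' + t * γ' := by
    apply mul_left_cancel₀ hd0
    linear_combination hrst
  have := congrArg (Polynomial.eval a) h2
  simp [ha.1, ha.2.1, ha.2.2] at this

theorem isRefl_mul {g : Bir} {α β γ d : ℝ[X]} (hd : d ≠ 0) :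
    IsRefl g (d * α) (d * β) (d * γ) ↔ IsRefl g α β γ := by
  have hd' : pz d ≠ 0 := by rwa [Ne, map_eq_zero_iff _ pz_injective]
  unfold IsRefl
  simp only [map_mul]
  refine and_congr Iff.rfl (and_congr ?_ ?_)
  · constructor <;> intro h
    · apply mul_left_cancel₀ hd'
      linear_combination h
    · linear_combination pz d * h
  · constructor <;> intro h
    · apply mul_left_cancel₀ hd'
      linear_combination h
    · linear_combination pz d * h

/-- Every involution of the sphere over `ℙ¹` is a reflection. -/
theorem exists_isRefl {g : Bir} (hz : g (coord 2) = coord 2) (h1 : g ≠ 1) (h2 : g * g = 1) :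
    ∃ α β γ, NoCommonRoot α β γ ∧ IsRefl g α β γ := by
  obtain ⟨α, hα, w, hw, hne, h⟩ := exists_real_moebius hz h1 h2
  obtain ⟨a₁, a₂, ha⟩ := mem_baseField_iff.1 hα
  obtain ⟨b₁, b₂, hb⟩ := mem_baseField_iff.1 hw.1
  obtain ⟨c₁, c₂, hc⟩ := mem_baseField_iff.1 hw.2
  -- A fraction with denominator zero has the value zero, so it is rewritten with denominator 1.
  have reduce : ∀ {f : FunField} {p q : ℝ[X]}, f = pz p / pz q →
      ∃ p' q' : ℝ[X], q' ≠ 0 ∧ f * pz q' = pz p' := by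
    intro f p q hf
    by_cases hq : q = 0
    · exact ⟨0, 1, one_ne_zero, by rw [hf, hq]; simp⟩
    · refine ⟨p, q, hq, ?_⟩
      rw [hf, div_mul_cancel₀]
      rwa [Ne, map_eq_zero_iff _ pz_injective]
  obtain ⟨a, a', ha0, ha⟩ := reduce ha
  obtain ⟨b, b', hb0, hb⟩ := reduce hb
  obtain ⟨c, c', hc0, hc⟩ := reduce hc
  have hD : pz (a' * b' * c') ≠ 0 := by
    rw [Ne, map_eq_zero_iff _ pz_injective]
    exact mul_ne_zero (mul_ne_zero ha0 hb0) hc0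
  -- The coefficient w of tT is b̄ and not b, whence the sign of the last entry.
  have hR : IsRefl g (a * b' * c') (b * a' * c') (-(c * a' * b')) := by
    have e := congrArg (fun v : CFunField => ⟨pz (a' * b' * c'), 0⟩ * v) h
    rw [isRefl_iff]
    refine ⟨hz, ?_⟩
    have e1 : (⟨pz (b * a' * c'), -pz (-(c * a' * b'))⟩ : CFunField) =
        ⟨pz (a' * b' * c'), 0⟩ * w := by
      ext
      · simp only [map_mul, QuadraticAlgebra.re_mul, ← hb]; ring
      · simp only [map_mul, map_neg, QuadraticAlgebra.im_mul, ← hc]; ring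
    have e2 : (⟨0, pz (a * b' * c')⟩ : CFunField) = ⟨pz (a' * b' * c'), 0⟩ * ⟨0, α⟩ := by
      ext
      · simp
      · simp only [map_mul, QuadraticAlgebra.im_mul, ← ha]; ring
    have e3 : (⟨pz (b * a' * c'), pz (-(c * a' * b'))⟩ : CFunField) =
        ⟨pz (a' * b' * c'), 0⟩ * star w := by
      ext
      · simp only [map_mul, QuadraticAlgebra.re_mul, ← hb, QuadraticAlgebra.re_star]; ring
      · simp only [map_mul, map_neg, QuadraticAlgebra.im_mul, ← hc, QuadraticAlgebra.im_star,
          QuadraticAlgebra.re_star]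
        ring
    rw [e1, e2, e3, mul_assoc (⟨pz (a' * b' * c'), 0⟩ : CFunField) w,
      mul_assoc (⟨pz (a' * b' * c'), 0⟩ : CFunField) ⟨0, α⟩]
    rw [e, mul_add]
    exact congrArg _ (mul_left_comm _ _ _)
  obtain ⟨d, α', β', γ', hd, e1, e2, e3, hN⟩ := exists_noCommonRoot
    (α := a * b' * c') (β := b * a' * c') (γ := -(c * a' * b')) (by
      by_contra! h0
      simp only [mul_eq_zero, ha0, hb0, hc0, or_false, neg_eq_zero] at h0
      obtain ⟨rfl, rfl, rfl⟩ := h0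
      have nz : ∀ {q : ℝ[X]}, q ≠ 0 → pz q ≠ 0 := fun hq => by
        rwa [Ne, map_eq_zero_iff _ pz_injective]
      rw [map_zero] at ha hb hc
      rcases hne with h3 | h3
      · exact h3 ((mul_eq_zero.1 ha).resolve_right (nz ha0))
      · apply h3
        ext
        · exact (mul_eq_zero.1 hb).resolve_right (nz hb0)
        · exact (mul_eq_zero.1 hc).resolve_right (nz hc0))
  rw [e1, e2, e3, isRefl_mul hd] at hR
  exact ⟨α', β', γ', hN, hR⟩

end RealSphere

/-! ### The reflection attached to a pure quaternion -/

namespace RealSphere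

open scoped QuadraticAlgebra

open Polynomial

section Formulas

variable {F : Type*} [Field F] {x y δ α β γ X Y : F}

/-- With u + il = b̄t - iα the system says (u + il)(X + iY) = δb + iαt. On the conic tt̄ = δ the
norm of δb + iαt is δ times that of b̄t - iα. -/
theorem refl_sq_add_sq (hδ : x ^ 2 + y ^ 2 = δ)
    (he : (β * x + γ * y) ^ 2 + (β * y - γ * x - α) ^ 2 ≠ 0)
    (hX : (β * x + γ * y) * X - (β * y - γ * x - α) * Y = δ * β - α * y)
    (hY : (β * y - γ * x - α) * X + (β * x + γ * y) * Y = δ * γ + α * x) :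
    X ^ 2 + Y ^ 2 = δ := by
  apply mul_left_cancel₀ he
  subst hδ
  linear_combination ((β * x + γ * y) * X - (β * y - γ * x - α) * Y +
      ((x ^ 2 + y ^ 2) * β - α * y)) * hX +
    ((β * y - γ * x - α) * X + (β * x + γ * y) * Y + ((x ^ 2 + y ^ 2) * γ + α * x)) * hY

/-- In terms of e = u² + l², the reflection multiplies u by -N/e and the form l of the line by N/e.
Thus l = 0 is preserved, and there e = u² = -N, so that u is fixed. -/
theorem refl_form_mul (hδ : x ^ 2 + y ^ 2 = δ)
    (hX : (β * x + γ * y) * X - (β * y - γ * x - α) * Y = δ * β - α * y)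
    (hY : (β * y - γ * x - α) * X + (β * x + γ * y) * Y = δ * γ + α * x) :
    ((β * x + γ * y) ^ 2 + (β * y - γ * x - α) ^ 2) * (β * X + γ * Y) =
        -(α ^ 2 - δ * (β ^ 2 + γ ^ 2)) * (β * x + γ * y) ∧
      ((β * x + γ * y) ^ 2 + (β * y - γ * x - α) ^ 2) * (β * Y - γ * X - α) =
        (α ^ 2 - δ * (β ^ 2 + γ ^ 2)) * (β * y - γ * x - α) := by
  subst hδ
  constructor
  · linear_combination (β * (β * x + γ * y) - γ * (β * y - γ * x - α)) * hX +
      (β * (β * y - γ * x - α) + γ * (β * x + γ * y)) * hY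
  · linear_combination (-β * (β * y - γ * x - α) - γ * (β * x + γ * y)) * hX +
      (β * (β * x + γ * y) - γ * (β * y - γ * x - α)) * hY

/-- The denominators at a point and at its image have product N². Hence the image avoids the zeros
of the denominator as long as N does not vanish. -/
theorem refl_norm_mul (hδ : x ^ 2 + y ^ 2 = δ)
    (he : (β * x + γ * y) ^ 2 + (β * y - γ * x - α) ^ 2 ≠ 0)
    (hX : (β * x + γ * y) * X - (β * y - γ * x - α) * Y = δ * β - α * y)
    (hY : (β * y - γ * x - α) * X + (β * x + γ * y) * Y = δ * γ + α * x) :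
    ((β * x + γ * y) ^ 2 + (β * y - γ * x - α) ^ 2) *
        ((β * X + γ * Y) ^ 2 + (β * Y - γ * X - α) ^ 2) =
      (α ^ 2 - δ * (β ^ 2 + γ ^ 2)) ^ 2 := by
  obtain ⟨h1, h2⟩ := refl_form_mul hδ hX hY
  apply mul_left_cancel₀ he
  linear_combination (((β * x + γ * y) ^ 2 + (β * y - γ * x - α) ^ 2) * (β * X + γ * Y) -
    (α ^ 2 - δ * (β ^ 2 + γ ^ 2)) * (β * x + γ * y)) * h1 +
    (((β * x + γ * y) ^ 2 + (β * y - γ * x - α) ^ 2) * (β * Y - γ * X - α) +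
    (α ^ 2 - δ * (β ^ 2 + γ ^ 2)) * (β * y - γ * x - α)) * h2

theorem refl_unique {X' Y' : F} {r s : F}
    (he : (β * x + γ * y) ^ 2 + (β * y - γ * x - α) ^ 2 ≠ 0)
    (hX : (β * x + γ * y) * X - (β * y - γ * x - α) * Y = r)
    (hY : (β * y - γ * x - α) * X + (β * x + γ * y) * Y = s)
    (hX' : (β * x + γ * y) * X' - (β * y - γ * x - α) * Y' = r)
    (hY' : (β * y - γ * x - α) * X' + (β * x + γ * y) * Y' = s) : X = X' ∧ Y = Y' := by
  constructor
  · apply mul_left_cancel₀ he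
    linear_combination (β * x + γ * y) * (hX - hX') + (β * y - γ * x - α) * (hY - hY')
  · apply mul_left_cancel₀ he
    linear_combination (β * x + γ * y) * (hY - hY') - (β * y - γ * x - α) * (hX - hX')

end Formulas

/-- The denominator of a reflection. -/
noncomputable def reflDen (α β γ : ℝ[X]) : FunField :=
  (pz β * coord 0 + pz γ * coord 1) ^ 2 + (pz β * coord 1 - pz γ * coord 0 - pz α) ^ 2

/-- The reduced norm of a pure quaternion. -/
noncomputable def nrd (α β γ : ℝ[X]) : ℝ[X] := α ^ 2 - (1 - X ^ 2) * (β ^ 2 + γ ^ 2)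

theorem pz_nrd (α β γ : ℝ[X]) :
    pz (nrd α β γ) = pz α ^ 2 - (1 - coord 2 ^ 2) * (pz β ^ 2 + pz γ ^ 2) := by
  simp [nrd]

theorem coord_sq_add_sq : coord 0 ^ 2 + coord 1 ^ 2 = 1 - coord 2 ^ 2 := by
  linear_combination coord_sum_sq

theorem poly_eq_zero_of_sq_add_sq {β γ : ℝ[X]} (h : β ^ 2 + γ ^ 2 = 0) : β = 0 ∧ γ = 0 := by
  have h0 : pz β ^ 2 + pz γ ^ 2 = 0 := by rw [← map_pow, ← map_pow, ← map_add, h, map_zero]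
  simpa [map_eq_zero_iff _ pz_injective] using eq_zero_of_sq_add_sq h0

theorem pz_mul_coord_add {p q : ℝ[X]} (h : pz p * coord 0 + pz q = 0) : p = 0 ∧ q = 0 := by
  have h1 : (C p * X + C q : ℝ[X][X]) = 0 := by
    by_contra hne
    exact eval_x_ne_zero hne (by simpa using h)
  constructor
  · simpa using congrArg (fun P => P.coeff 1) h1
  · simpa using congrArg (fun P => P.coeff 0) h1

/-- In a formally real field both squares would vanish; eliminating y from the two linear forms
leaves (β² + γ²)x + αγ = 0, which contradicts the transcendence of x. -/
theorem reflDen_ne_zero {α β γ : ℝ[X]} (h : α ≠ 0 ∨ β ≠ 0 ∨ γ ≠ 0) : reflDen α β γ ≠ 0 := by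
  intro h0
  obtain ⟨h1, h2⟩ := eq_zero_of_sq_add_sq h0
  have h3 : pz (β ^ 2 + γ ^ 2) * coord 0 + pz (α * γ) = 0 := by
    simp only [map_add, map_pow, map_mul]
    linear_combination pz β * h1 - pz γ * h2
  obtain ⟨rfl, rfl⟩ := poly_eq_zero_of_sq_add_sq (pz_mul_coord_add h3).1
  simp [map_eq_zero_iff _ pz_injective] at h2
  simp [h2] at h

theorem ne_zero_of_nrd_ne_zero {α β γ : ℝ[X]} (h : nrd α β γ ≠ 0) : α ≠ 0 ∨ β ≠ 0 ∨ γ ≠ 0 := by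
  by_contra! h0
  obtain ⟨rfl, rfl, rfl⟩ := h0
  simp [nrd] at h

theorem IsRefl.eq {g g' : Bir} {α β γ : ℝ[X]} (h0 : α ≠ 0 ∨ β ≠ 0 ∨ γ ≠ 0)
    (h : IsRefl g α β γ) (h' : IsRefl g' α β γ) : g = g' := by
  obtain ⟨hz, hX, hY⟩ := h
  obtain ⟨hz', hX', hY'⟩ := h'
  obtain ⟨e1, e2⟩ := refl_unique (reflDen_ne_zero h0) hX hY hX' hY'
  apply bir_ext
  intro i
  fin_cases i
  · exact e1
  · exact e2
  · exact hz.trans hz'.symm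

theorem IsRefl.map_form {g : Bir} {α β γ : ℝ[X]} (h : IsRefl g α β γ) :
    g (pz β * coord 0 + pz γ * coord 1) = pz β * g (coord 0) + pz γ * g (coord 1) ∧
    g (pz β * coord 1 - pz γ * coord 0 - pz α) =
      pz β * g (coord 1) - pz γ * g (coord 0) - pz α := by
  simp only [map_add, map_sub, map_mul, map_pz h.1, and_self]

/-- The defining system is symmetric in (x, y) and (X, Y): the pair (x, y) solves the system
transported by g, which has a unique solution. -/
theorem IsRefl.mul_self {g : Bir} {α β γ : ℝ[X]} (h0 : α ≠ 0 ∨ β ≠ 0 ∨ γ ≠ 0)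
    (h : IsRefl g α β γ) : g * g = 1 := by
  obtain ⟨hz, hX, hY⟩ := id h
  have gX := congrArg g hX
  have gY := congrArg g hY
  simp only [map_add, map_sub, map_mul, map_pow, map_one, map_pz hz, hz] at gX gY
  have he : g (reflDen α β γ) ≠ 0 := (map_ne_zero g).2 (reflDen_ne_zero h0)
  simp only [reflDen, map_add, map_sub, map_mul, map_pow, map_pz hz] at he
  obtain ⟨e1, e2⟩ := refl_unique he gX gY (X' := coord 0) (Y' := coord 1)
    (by linear_combination hX) (by linear_combination hY)
  apply bir_ext
  intro i
  fin_cases i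
  · exact e1
  · exact e2
  · change g (g (coord 2)) = coord 2
    rw [hz, hz]

theorem IsRefl.nrd_ne_zero {g : Bir} {α β γ : ℝ[X]} (h0 : α ≠ 0 ∨ β ≠ 0 ∨ γ ≠ 0)
    (h : IsRefl g α β γ) : nrd α β γ ≠ 0 := by
  intro hn
  have h1 := refl_norm_mul coord_sq_add_sq (reflDen_ne_zero h0) h.2.1 h.2.2
  rw [← pz_nrd, hn, map_zero] at h1
  have he : g (reflDen α β γ) ≠ 0 := (map_ne_zero g).2 (reflDen_ne_zero h0)
  have h2 : g (reflDen α β γ) = (pz β * g (coord 0) + pz γ * g (coord 1)) ^ 2 +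
      (pz β * g (coord 1) - pz γ * g (coord 0) - pz α) ^ 2 := by
    simp only [reflDen, map_add, map_sub, map_mul, map_pow, map_pz h.1]
  rw [h2] at he
  exact mul_ne_zero (reflDen_ne_zero h0) he (h1.trans (by ring))

theorem HasValueAt.sub {f f' : FunField} {p : E3} {c c' : ℝ} (h : HasValueAt f p c)
    (h' : HasValueAt f' p c') : HasValueAt (f - f') p (c - c') := by
  have h1 : HasValueAt (-1 : FunField) p (-1) := by
    simpa using HasValueAt.of_poly (p := p) (-1)
  simpa [sub_eq_add_neg] using h.add (h1.mul h')

theorem HasValueAt.pow {f : FunField} {p : E3} {c : ℝ} (h : HasValueAt f p c) (n : ℕ) :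
    HasValueAt (f ^ n) p (c ^ n) := by
  induction n with
  | zero => simpa using HasValueAt.of_poly (p := p) 1
  | succ n ih => simpa only [pow_succ] using ih.mul h

theorem HasValueAt.const (p : E3) (c : ℝ) : HasValueAt (algebraMap ℝ FunField c) p c := by
  have h := HasValueAt.of_poly (p := p) (MvPolynomial.C c)
  have h1 : toFun (MvPolynomial.C c) = algebraMap ℝ FunField c := toFun.commutes c
  rw [h1] at h
  simpa using h

theorem HasValueAt.div {f f' : FunField} {p : E3} (hp : p ∈ Metric.sphere (0 : E3) 1) {c c' : ℝ}
    (h : HasValueAt f p c) (h' : HasValueAt f' p c') (hc : c' ≠ 0) :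
    HasValueAt (f / f') p (c / c') := by
  simpa only [div_eq_mul_inv] using h.mul (h'.inv hp hc)

theorem HasValueAt.aeval {f : Fin 3 → FunField} {p : E3} {q : Fin 3 → ℝ}
    (h : ∀ i, HasValueAt (f i) p (q i)) (P : MvPolynomial (Fin 3) ℝ) :
    HasValueAt (MvPolynomial.aeval f P) p (MvPolynomial.eval q P) := by
  induction P using MvPolynomial.induction_on with
  | C r => simpa using HasValueAt.const p r
  | add P Q hP hQ => simpa only [map_add] using hP.add hQ
  | mul_X P i hP =>
    rw [map_mul, map_mul, MvPolynomial.eval_X, MvPolynomial.aeval_X]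
    exact hP.mul (h i)

theorem HasValueAt.form (α β γ : ℝ[X]) (p : E3) :
    HasValueAt (pz β * coord 0 + pz γ * coord 1) p
        (β.eval (p 2) * p 0 + γ.eval (p 2) * p 1) ∧
      HasValueAt (pz β * coord 1 - pz γ * coord 0 - pz α) p
        (β.eval (p 2) * p 1 - γ.eval (p 2) * p 0 - α.eval (p 2)) :=
  ⟨((HasValueAt.of_pz β p).mul (.of_coord 0 p)).add ((HasValueAt.of_pz γ p).mul (.of_coord 1 p)),
    (((HasValueAt.of_pz β p).mul (.of_coord 1 p)).sub ((HasValueAt.of_pz γ p).mul (.of_coord 0 p))).sub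
      (.of_pz α p)⟩

theorem HasValueAt.rhs (α β γ : ℝ[X]) (p : E3) :
    HasValueAt ((1 - coord 2 ^ 2) * pz β - pz α * coord 1) p
        ((1 - p 2 ^ 2) * β.eval (p 2) - α.eval (p 2) * p 1) ∧
      HasValueAt ((1 - coord 2 ^ 2) * pz γ + pz α * coord 0) p
        ((1 - p 2 ^ 2) * γ.eval (p 2) + α.eval (p 2) * p 0) := by
  have h1 : HasValueAt (1 - coord 2 ^ 2) p (1 - p 2 ^ 2) := by
    simpa using (HasValueAt.const p 1).sub ((HasValueAt.of_coord 2 p).pow 2)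
  exact ⟨(h1.mul (.of_pz β p)).sub ((HasValueAt.of_pz α p).mul (.of_coord 1 p)),
    (h1.mul (.of_pz γ p)).add ((HasValueAt.of_pz α p).mul (.of_coord 0 p))⟩

/-- The solution of the linear system that defines a reflection. -/
theorem solve_refl {F : Type*} [Field F] {u l e r s : F} (he : u ^ 2 + l ^ 2 = e) (h0 : e ≠ 0) :
    u * ((u * r + l * s) / e) - l * ((u * s - l * r) / e) = r ∧
      l * ((u * r + l * s) / e) + u * ((u * s - l * r) / e) = s := by
  constructor
  · field_simp
    linear_combination r * he
  · field_simp
    linear_combination s * he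

/-- A solution of the linear system that defines a reflection satisfies no more polynomial
equations than `x, y, z` do. -/
theorem toFun_eq_zero_of_aeval_refl {α β γ : ℝ[X]} (hN : nrd α β γ ≠ 0) {X' Y' : FunField}
    (hX : (pz β * coord 0 + pz γ * coord 1) * X' -
        (pz β * coord 1 - pz γ * coord 0 - pz α) * Y' =
      (1 - coord 2 ^ 2) * pz β - pz α * coord 1)
    (hY : (pz β * coord 1 - pz γ * coord 0 - pz α) * X' +
        (pz β * coord 0 + pz γ * coord 1) * Y' =
      (1 - coord 2 ^ 2) * pz γ + pz α * coord 0) {P : MvPolynomial (Fin 3) ℝ}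
    (hf : MvPolynomial.aeval ![X', Y', coord 2] P = 0) : toFun P = 0 := by
  have he := reflDen_ne_zero (ne_zero_of_nrd_ne_zero hN)
  set u := pz β * coord 0 + pz γ * coord 1 with hu
  set l := pz β * coord 1 - pz γ * coord 0 - pz α with hl
  set r := (1 - coord 2 ^ 2) * pz β - pz α * coord 1 with hr
  set s := (1 - coord 2 ^ 2) * pz γ + pz α * coord 0 with hs
  have hee : u ^ 2 + l ^ 2 = reflDen α β γ := rfl
  set e := reflDen α β γ
  obtain ⟨rfl, rfl⟩ : X' = (u * r + l * s) / e ∧ Y' = (u * s - l * r) / e := by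
    obtain ⟨h1, h2⟩ := solve_refl (r := r) (s := s) hee he
    exact refl_unique he hX hY h1 h2
  set X' := (u * r + l * s) / e
  set Y' := (u * s - l * r) / e
  have hval : ∀ p ∈ Metric.sphere (0 : E3) 1, ∀ U L R S E : ℝ,
      U = β.eval (p 2) * p 0 + γ.eval (p 2) * p 1 →
      L = β.eval (p 2) * p 1 - γ.eval (p 2) * p 0 - α.eval (p 2) →
      R = (1 - p 2 ^ 2) * β.eval (p 2) - α.eval (p 2) * p 1 →
      S = (1 - p 2 ^ 2) * γ.eval (p 2) + α.eval (p 2) * p 0 →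
      E = U ^ 2 + L ^ 2 → E ≠ 0 →
      HasValueAt X' p ((U * R + L * S) / E) ∧ HasValueAt Y' p ((U * S - L * R) / E) := by
    rintro p hp U L R S E hU hL hR hS hE hE0
    have h1 := HasValueAt.form α β γ p
    have h2 := HasValueAt.rhs α β γ p
    rw [← hu, ← hl, ← hU, ← hL] at h1
    rw [← hr, ← hs, ← hR, ← hS] at h2
    have h3 : HasValueAt e p E := by
      rw [hE]; exact (h1.1.pow 2).add (h1.2.pow 2)
    exact ⟨((h1.1.mul h2.1).add (h1.2.mul h2.2)).div hp h3 hE0,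
      ((h1.1.mul h2.2).sub (h1.2.mul h2.1)).div hp h3 hE0⟩
  let mz : ℝ[X] → MvPolynomial (Fin 3) ℝ := fun p => Polynomial.aeval (MvPolynomial.X 2) p
  let E : MvPolynomial (Fin 3) ℝ :=
    (mz β * MvPolynomial.X 0 + mz γ * MvPolynomial.X 1) ^ 2 +
      (mz β * MvPolynomial.X 1 - mz γ * MvPolynomial.X 0 - mz α) ^ 2
  have hE : toFun E = e := by
    simp only [E, mz, map_add, map_pow, map_mul, map_sub, ← pz_eq_toFun]
    rfl
  -- This is tested at real points. Where E and N do not vanish, p has an image q on the sphere, and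
  -- the formulas take q back to p; so P(p) is the value at q of P(X', Y', z) = 0. The factors E and
  -- N take care of the other points.
  have h0 : toFun (P * (E * mz (nrd α β γ))) = 0 := by
    refine toFun_eq_zero_of_eval fun p hp => ?_
    have hsum := sum_sq_eq_one hp
    simp only [map_mul]
    by_cases hEp : MvPolynomial.eval (fun i => p i) E = 0
    · rw [hEp]; ring
    by_cases hNp : MvPolynomial.eval (fun i => p i) (mz (nrd α β γ)) = 0
    · rw [hNp]; ring
    have hEp' : (β.eval (p 2) * p 0 + γ.eval (p 2) * p 1) ^ 2 +
        (β.eval (p 2) * p 1 - γ.eval (p 2) * p 0 - α.eval (p 2)) ^ 2 ≠ 0 := by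
      simpa [E, mz, eval_aeval_X] using hEp
    obtain ⟨Xp, Yp, e1, e2⟩ : ∃ Xp Yp : ℝ,
        (β.eval (p 2) * p 0 + γ.eval (p 2) * p 1) * Xp -
            (β.eval (p 2) * p 1 - γ.eval (p 2) * p 0 - α.eval (p 2)) * Yp =
          (1 - p 2 ^ 2) * β.eval (p 2) - α.eval (p 2) * p 1 ∧
        (β.eval (p 2) * p 1 - γ.eval (p 2) * p 0 - α.eval (p 2)) * Xp +
            (β.eval (p 2) * p 0 + γ.eval (p 2) * p 1) * Yp =
          (1 - p 2 ^ 2) * γ.eval (p 2) + α.eval (p 2) * p 0 :=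
      ⟨_, _, solve_refl rfl hEp'⟩
    have hδp : p 0 ^ 2 + p 1 ^ 2 = 1 - p 2 ^ 2 := by linarith
    have hsq := refl_sq_add_sq hδp hEp' e1 e2
    have hmul := refl_norm_mul hδp hEp' e1 e2
    have hE2 : (β.eval (p 2) * Xp + γ.eval (p 2) * Yp) ^ 2 +
        (β.eval (p 2) * Yp - γ.eval (p 2) * Xp - α.eval (p 2)) ^ 2 ≠ 0 := by
      intro h
      rw [h, mul_zero] at hmul
      apply hNp
      simp only [mz, eval_aeval_X, nrd, eval_sub, eval_mul, eval_pow, eval_add, eval_X, eval_one]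
      exact pow_eq_zero_iff two_ne_zero |>.1 hmul.symm
    have hq : (WithLp.toLp 2 ![Xp, Yp, p 2] : E3) ∈ Metric.sphere (0 : E3) 1 := by
      apply mem_sphere_of_sum_sq
      simp
      linarith
    obtain ⟨v1, v2⟩ := hval _ hq _ _ _ _ _ rfl rfl rfl rfl rfl hE2
    obtain ⟨f1, f2⟩ := solve_refl
      (r := (1 - p 2 ^ 2) * β.eval (p 2) - α.eval (p 2) * Yp)
      (s := (1 - p 2 ^ 2) * γ.eval (p 2) + α.eval (p 2) * Xp) rfl hE2
    obtain ⟨w1, w2⟩ := refl_unique hE2 f1 f2 (X' := p 0) (Y' := p 1)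
      (by linear_combination e1) (by linear_combination e2)
    have v1' : HasValueAt X' (WithLp.toLp 2 ![Xp, Yp, p 2] : E3) (p 0) := w1 ▸ v1
    have v2' : HasValueAt Y' (WithLp.toLp 2 ![Xp, Yp, p 2] : E3) (p 1) := w2 ▸ v2
    have v3 : HasValueAt (coord 2) (WithLp.toLp 2 ![Xp, Yp, p 2] : E3) (p 2) :=
      HasValueAt.of_coord 2 _
    have hP := HasValueAt.aeval (f := ![X', Y', coord 2]) (q := fun i => p i)
      (p := (WithLp.toLp 2 ![Xp, Yp, p 2] : E3)) (by
        intro i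
        fin_cases i
        · exact v1'
        · exact v2'
        · exact v3) P
    rw [hf] at hP
    have : MvPolynomial.eval (fun i => p i) P = 0 :=
      hP.unique hq (by simpa using HasValueAt.of_poly (p := (WithLp.toLp 2 ![Xp, Yp, p 2] : E3)) 0)
    rw [this]; ring
  rw [map_mul, map_mul, hE, ← pz_eq_toFun] at h0
  have hN' : pz (nrd α β γ) ≠ 0 := by rwa [Ne, map_eq_zero_iff _ pz_injective]
  exact (mul_eq_zero.1 h0).resolve_right (mul_ne_zero he hN')

/-- The formulas define a homomorphism on the coordinate ring, and it is injective, so it extends to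
the function field. By the symmetry of the system its square is the identity, which makes it an
automorphism. -/
theorem exists_isRefl_of_nrd_ne_zero {α β γ : ℝ[X]} (hN : nrd α β γ ≠ 0) :
    ∃ g, IsRefl g α β γ := by
  have hne := ne_zero_of_nrd_ne_zero hN
  have he := reflDen_ne_zero hne
  set u := pz β * coord 0 + pz γ * coord 1 with hu
  set l := pz β * coord 1 - pz γ * coord 0 - pz α with hl
  set r := (1 - coord 2 ^ 2) * pz β - pz α * coord 1 with hr
  set s := (1 - coord 2 ^ 2) * pz γ + pz α * coord 0 with hs
  have hee : u ^ 2 + l ^ 2 = reflDen α β γ := rfl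
  set e := reflDen α β γ
  set X' := (u * r + l * s) / e with hX'
  set Y' := (u * s - l * r) / e with hY'
  obtain ⟨hX, hY⟩ : u * X' - l * Y' = r ∧ l * X' + u * Y' = s := solve_refl hee he
  have hδ : X' ^ 2 + Y' ^ 2 = 1 - coord 2 ^ 2 :=
    refl_sq_add_sq coord_sq_add_sq he hX hY
  have hker : ∀ P ∈ Ideal.span {sphereEq}, MvPolynomial.aeval ![X', Y', coord 2] P = 0 := by
    intro P hP
    obtain ⟨Q, rfl⟩ := Ideal.mem_span_singleton'.1 hP
    have : MvPolynomial.aeval ![X', Y', coord 2] sphereEq = 0 := by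
      simp [sphereEq]
      linear_combination hδ
    rw [map_mul, this, mul_zero]
  let φ : (MvPolynomial (Fin 3) ℝ ⧸ Ideal.span {sphereEq}) →ₐ[ℝ] FunField :=
    Ideal.Quotient.liftₐ _ (MvPolynomial.aeval ![X', Y', coord 2]) hker
  have hφ : ∀ P, φ (Ideal.Quotient.mk _ P) = MvPolynomial.aeval ![X', Y', coord 2] P :=
    fun P => rfl
  have hinj : Function.Injective φ := by
    rw [injective_iff_map_eq_zero]
    intro f hf
    obtain ⟨P, rfl⟩ := Ideal.Quotient.mk_surjective f
    rw [hφ] at hf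
    exact Ideal.Quotient.eq_zero_iff_mem.2 (toFun_eq_zero_iff.1
      (toFun_eq_zero_of_aeval_refl hN hX hY hf))
  let ψ : FunField →ₐ[ℝ] FunField := IsFractionRing.liftAlgHom hinj
  have hψ : ∀ P, ψ (toFun P) = MvPolynomial.aeval ![X', Y', coord 2] P := fun P =>
    IsFractionRing.lift_algebraMap hinj (Ideal.Quotient.mk _ P)
  have h0 : ψ (coord 0) = X' := by rw [coord, hψ]; simp
  have h1 : ψ (coord 1) = Y' := by rw [coord, hψ]; simp
  have h2 : ψ (coord 2) = coord 2 := by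
    conv_lhs => rw [coord, hψ]
    simp
  have hpz : ∀ p, ψ (pz p) = pz p := fun p => by rw [← Polynomial.aeval_algHom_apply, h2]
  have gX := congrArg ψ hX
  have gY := congrArg ψ hY
  simp only [hu, hl, hr, hs, map_add, map_sub, map_mul, map_pow, map_one, hpz, h0, h1, h2] at gX gY
  have heψ : ψ e ≠ 0 := (map_ne_zero ψ).2 he
  simp only [e, reflDen, map_add, map_sub, map_mul, map_pow, hpz, h0, h1] at heψ
  obtain ⟨e1, e2⟩ := refl_unique heψ gX gY (X' := coord 0) (Y' := coord 1)
    (by linear_combination hX) (by linear_combination hY)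
  have hψψ : ψ.comp ψ = AlgHom.id ℝ FunField := by
    apply AlgHom.ext
    refine subfield_eq_top (RingHom.eqLocusField (ψ.comp ψ : FunField →+* FunField)
      (AlgHom.id ℝ FunField : FunField →+* FunField)) (fun c => ?_) (fun i => ?_)
    · change ψ (ψ _) = _
      rw [AlgHom.commutes, AlgHom.commutes]
      rfl
    · change ψ (ψ _) = coord i
      fin_cases i
      · change ψ (ψ (coord 0)) = _
        rw [h0]; exact e1
      · change ψ (ψ (coord 1)) = _
        rw [h1]; exact e2
      · change ψ (ψ (coord 2)) = _
        rw [h2]; exact h2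
  refine ⟨AlgEquiv.ofAlgHom ψ ψ hψψ hψψ, h2, ?_, ?_⟩
  · change _ * ψ (coord 0) - _ * ψ (coord 1) = _
    rw [h0, h1]; exact hX
  · change _ * ψ (coord 0) + _ * ψ (coord 1) = _
    rw [h0, h1]; exact hY

end RealSphere

/-! ### Regularity of timelike and spacelike reflections -/

namespace RealSphere

open scoped QuadraticAlgebra

open Polynomial Filter Topology

/-- The pure quaternion has positive norm over the real points of the sphere. -/
def IsTimelike (α β γ : ℝ[X]) : Prop :=
  ∀ a ∈ Set.Icc (-1 : ℝ) 1, 0 < α.eval a ^ 2 - (1 - a ^ 2) * (β.eval a ^ 2 + γ.eval a ^ 2)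

/-- The pure quaternion `i(1 - z²)α + (β + iγ)j` has negative norm over the real points of the
sphere, in the sense that the quotient by `1 - z²` of this norm is negative. -/
def IsSpacelike (α β γ : ℝ[X]) : Prop :=
  ∀ a ∈ Set.Icc (-1 : ℝ) 1, 0 < β.eval a ^ 2 + γ.eval a ^ 2 - (1 - a ^ 2) * α.eval a ^ 2

theorem mem_Icc_of_mem_sphere {p : E3} (hp : p ∈ Metric.sphere (0 : E3) 1) :
    p 2 ∈ Set.Icc (-1 : ℝ) 1 := by
  have := sum_sq_eq_one hp
  constructor <;> nlinarith [sq_nonneg (p 0), sq_nonneg (p 1)]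

/-- `x` and `y` are linear in `x, y` after a reflection, with coefficients regular at the real points
of the sphere and prescribed values at the north pole. -/
structure HasLinearForm (g : Bir) (a b c d : ℝ) : Prop where
  map_z : g (coord 2) = coord 2
  exists_coeff : ∃ A B C D : FunField, g (coord 0) = coord 0 * A + coord 1 * B ∧
    g (coord 1) = coord 0 * C + coord 1 * D ∧
    (∀ p ∈ Metric.sphere (0 : E3) 1, ∀ f ∈ [A, B, C, D], ∃ v, HasValueAt f p v) ∧
    HasValueAt A (WithLp.toLp 2 ![0, 0, 1]) a ∧ HasValueAt B (WithLp.toLp 2 ![0, 0, 1]) b ∧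
    HasValueAt C (WithLp.toLp 2 ![0, 0, 1]) c ∧ HasValueAt D (WithLp.toLp 2 ![0, 0, 1]) d

theorem northPole_mem : (WithLp.toLp 2 ![0, 0, 1] : E3) ∈ Metric.sphere (0 : E3) 1 :=
  mem_sphere_of_sum_sq (by simp)

theorem IsTimelike.ne_zero {α β γ : ℝ[X]} (h : IsTimelike α β γ) :
    α ≠ 0 ∨ β ≠ 0 ∨ γ ≠ 0 := by
  by_contra! h0
  obtain ⟨rfl, rfl, rfl⟩ := h0
  simpa using h 0 (by simp)

theorem IsSpacelike.ne_zero {α β γ : ℝ[X]} (h : IsSpacelike α β γ) : β ≠ 0 ∨ γ ≠ 0 := by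
  by_contra! h0
  obtain ⟨rfl, rfl⟩ := h0
  simpa using h 1 (by simp)

theorem eq_div_of_refl {F : Type*} [Field F] {u l e r s X Y : F} (he : u ^ 2 + l ^ 2 = e)
    (h0 : e ≠ 0) (h1 : u * X - l * Y = r) (h2 : l * X + u * Y = s) :
    X = (u * r + l * s) / e ∧ Y = (u * s - l * r) / e := by
  subst he
  constructor
  · rw [eq_div_iff h0]
    linear_combination u * h1 + l * h2
  · rw [eq_div_iff h0]
    linear_combination u * h2 - l * h1

/-- At a real zero of the denominator u² + l² one would have α = βy - γx, hence α² ≤ (x² + y²)(β² +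
γ²) by Cauchy–Schwarz, that is N ≤ 0. At the north pole the linear part is t ↦ -t. -/
theorem IsRefl.hasLinearForm_of_isTimelike {g : Bir} {α β γ : ℝ[X]} (h : IsRefl g α β γ)
    (hq : IsTimelike α β γ) : HasLinearForm g (-1) 0 0 (-1) := by
  have he := reflDen_ne_zero hq.ne_zero
  obtain ⟨e1, e2⟩ := eq_div_of_refl rfl he h.2.1 h.2.2
  have hE : ∀ p ∈ Metric.sphere (0 : E3) 1, ∃ c ≠ 0, HasValueAt (reflDen α β γ) p c := by
    intro p hp
    obtain ⟨h1, h2⟩ := HasValueAt.form α β γ p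
    refine ⟨_, ?_, (h1.pow 2).add (h2.pow 2)⟩
    intro h0
    have hs := sum_sq_eq_one hp
    have hu : β.eval (p 2) * p 0 + γ.eval (p 2) * p 1 = 0 := by
      nlinarith [sq_nonneg (β.eval (p 2) * p 0 + γ.eval (p 2) * p 1),
        sq_nonneg (β.eval (p 2) * p 1 - γ.eval (p 2) * p 0 - α.eval (p 2))]
    have hl : β.eval (p 2) * p 1 - γ.eval (p 2) * p 0 - α.eval (p 2) = 0 := by
      nlinarith [sq_nonneg (β.eval (p 2) * p 0 + γ.eval (p 2) * p 1),
        sq_nonneg (β.eval (p 2) * p 1 - γ.eval (p 2) * p 0 - α.eval (p 2))]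
    have h3 := hq _ (mem_Icc_of_mem_sphere hp)
    have h4 : 1 - p 2 ^ 2 = p 0 ^ 2 + p 1 ^ 2 := by linarith
    have h5 : α.eval (p 2) = β.eval (p 2) * p 1 - γ.eval (p 2) * p 0 := by linarith
    rw [h4, h5] at h3
    nlinarith
  have hP : HasValueAt (reflDen α β γ) (WithLp.toLp 2 ![0, 0, 1]) (α.eval 1 ^ 2) := by
    obtain ⟨h1, h2⟩ := HasValueAt.form α β γ (WithLp.toLp 2 ![0, 0, 1])
    have := (h1.pow 2).add (h2.pow 2)
    simpa [reflDen] using this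
  have hα : α.eval 1 ≠ 0 := by
    have := hq 1 (by simp)
    intro h0
    rw [h0] at this
    simp at this
  set l := pz β * coord 1 - pz γ * coord 0 - pz α with hl
  set r := (1 - coord 2 ^ 2) * pz β - pz α * coord 1 with hr
  set s := (1 - coord 2 ^ 2) * pz γ + pz α * coord 0 with hs
  -- The numerators ur + ls and us - lr are split along u = βx + γy, and δ is replaced by x² + y² in
  -- s and r respectively, to exhibit factors x and y.
  refine ⟨h.1, (pz β * r + l * (coord 0 * pz γ + pz α)) / reflDen α β γ,
    (pz γ * r + l * (coord 1 * pz γ)) / reflDen α β γ,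
    (pz β * s - l * (coord 0 * pz β)) / reflDen α β γ,
    (pz γ * s - l * (coord 1 * pz β - pz α)) / reflDen α β γ, ?_, ?_, ?_, ?_⟩
  · rw [e1, mul_div_assoc', mul_div_assoc', ← add_div, hs, ← coord_sq_add_sq]
    congr 1
    ring
  · rw [e2, mul_div_assoc', mul_div_assoc', ← add_div]
    congr 1
    rw [hr, ← coord_sq_add_sq]
    ring
  · intro p hp f hf
    obtain ⟨c, hc, hv⟩ := hE p hp
    have h1 := (HasValueAt.form α β γ p).2
    obtain ⟨h2, h3⟩ := HasValueAt.rhs α β γ p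
    have x := HasValueAt.of_coord 0 p
    have y := HasValueAt.of_coord 1 p
    have a := HasValueAt.of_pz α p
    have b := HasValueAt.of_pz β p
    have c := HasValueAt.of_pz γ p
    simp only [List.mem_cons, List.not_mem_nil, or_false] at hf
    rcases hf with rfl | rfl | rfl | rfl
    · exact ⟨_, ((b.mul h2).add (h1.mul ((x.mul c).add a))).div hp hv hc⟩
    · exact ⟨_, ((c.mul h2).add (h1.mul (y.mul c))).div hp hv hc⟩
    · exact ⟨_, ((b.mul h3).sub (h1.mul (x.mul b))).div hp hv hc⟩
    · exact ⟨_, ((c.mul h3).sub (h1.mul ((y.mul b).sub a))).div hp hv hc⟩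
  · have hp := northPole_mem
    set p : E3 := WithLp.toLp 2 ![0, 0, 1] with hpdef
    have hc : α.eval 1 ^ 2 ≠ 0 := pow_ne_zero 2 hα
    have h1 := (HasValueAt.form α β γ p).2
    obtain ⟨h2, h3⟩ := HasValueAt.rhs α β γ p
    have x := HasValueAt.of_coord 0 p
    have y := HasValueAt.of_coord 1 p
    have a := HasValueAt.of_pz α p
    have b := HasValueAt.of_pz β p
    have c := HasValueAt.of_pz γ p
    have p0 : p 0 = 0 := rfl
    have p1 : p 1 = 0 := rfl
    have p2 : p 2 = 1 := rfl
    simp only [p0, p1, p2] at h1 h2 h3 x y a b c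
    refine ⟨?_, ?_, ?_, ?_⟩
    · convert! ((b.mul h2).add (h1.mul ((x.mul c).add a))).div hp hP hc using 1
      field_simp; ring
    · convert! ((c.mul h2).add (h1.mul (y.mul c))).div hp hP hc using 1
      field_simp; ring
    · convert! ((b.mul h3).sub (h1.mul (x.mul b))).div hp hP hc using 1
      field_simp; ring
    · convert! ((c.mul h3).sub (h1.mul ((y.mul b).sub a))).div hp hP hc using 1
      field_simp; ring

/-- Since δ divides the i-component, it divides the denominator and both right-hand sides. After
cancellation the denominator is v² + w² with v = β - αy and w = γ + αx, which has no zero on the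
real sphere, again by Cauchy–Schwarz. -/
theorem IsRefl.hasLinearForm_of_isSpacelike {g : Bir} {α β γ : ℝ[X]}
    (h : IsRefl g ((1 - X ^ 2) * α) β γ) (hq : IsSpacelike α β γ) :
    ∃ a b c d : ℝ, a * d - b * c = -1 ∧ HasLinearForm g a b c d := by
  have hz2 : pz (1 - X ^ 2) = 1 - coord 2 ^ 2 := by simp
  obtain ⟨hz, hX, hY⟩ := h
  simp only [map_mul, hz2] at hX hY
  set v := pz β - pz α * coord 1 with hv
  set w := pz γ + pz α * coord 0 with hw
  set u := pz β * coord 0 + pz γ * coord 1 with hu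
  set l := pz β * coord 1 - pz γ * coord 0 - (1 - coord 2 ^ 2) * pz α with hl
  have hE : ∀ p ∈ Metric.sphere (0 : E3) 1, ∃ c ≠ 0, HasValueAt (v ^ 2 + w ^ 2) p c := by
    intro p hp
    have hvp : HasValueAt v p (β.eval (p 2) - α.eval (p 2) * p 1) :=
      (HasValueAt.of_pz β p).sub ((HasValueAt.of_pz α p).mul (.of_coord 1 p))
    have hwp : HasValueAt w p (γ.eval (p 2) + α.eval (p 2) * p 0) :=
      (HasValueAt.of_pz γ p).add ((HasValueAt.of_pz α p).mul (.of_coord 0 p))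
    refine ⟨_, ?_, (hvp.pow 2).add (hwp.pow 2)⟩
    intro h0
    have hs := sum_sq_eq_one hp
    have h1 : β.eval (p 2) - α.eval (p 2) * p 1 = 0 := by
      nlinarith [sq_nonneg (β.eval (p 2) - α.eval (p 2) * p 1),
        sq_nonneg (γ.eval (p 2) + α.eval (p 2) * p 0)]
    have h2 : γ.eval (p 2) + α.eval (p 2) * p 0 = 0 := by
      nlinarith [sq_nonneg (β.eval (p 2) - α.eval (p 2) * p 1),
        sq_nonneg (γ.eval (p 2) + α.eval (p 2) * p 0)]
    have h3 := hq _ (mem_Icc_of_mem_sphere hp)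
    have h4 : 1 - p 2 ^ 2 = p 0 ^ 2 + p 1 ^ 2 := by linarith
    rw [h4, sub_eq_zero.1 h1, eq_neg_of_add_eq_zero_left h2] at h3
    nlinarith
  have he0 : v ^ 2 + w ^ 2 ≠ 0 := by
    intro h0
    obtain ⟨c, hc, hv⟩ := hE _ northPole_mem
    rw [h0] at hv
    exact hc (hv.unique northPole_mem
      (by simpa using HasValueAt.of_poly (p := (WithLp.toLp 2 ![0, 0, 1] : E3)) 0))
  have hδ0 := one_sub_sq_ne_zero
  have he : u ^ 2 + l ^ 2 = (1 - coord 2 ^ 2) * (v ^ 2 + w ^ 2) := by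
    rw [hu, hl, hv, hw, ← coord_sq_add_sq]
    ring
  obtain ⟨e1, e2⟩ := eq_div_of_refl (r := (1 - coord 2 ^ 2) * v) (s := (1 - coord 2 ^ 2) * w)
    he (mul_ne_zero hδ0 he0) (hX.trans (by rw [hv]; ring)) (hY.trans (by rw [hw]; ring))
  have e1' : g (coord 0) = (u * v + l * w) / (v ^ 2 + w ^ 2) := by
    rw [e1, div_eq_div_iff (mul_ne_zero hδ0 he0) he0]; ring
  have e2' : g (coord 1) = (u * w - l * v) / (v ^ 2 + w ^ 2) := by
    rw [e2, div_eq_div_iff (mul_ne_zero hδ0 he0) he0]; ring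
  have hb : β.eval 1 ^ 2 + γ.eval 1 ^ 2 ≠ 0 := by
    have := hq 1 (by simp)
    simp at this
    exact this.ne'
  have hP : HasValueAt (v ^ 2 + w ^ 2) (WithLp.toLp 2 ![0, 0, 1])
      (β.eval 1 ^ 2 + γ.eval 1 ^ 2) := by
    have hvp := (HasValueAt.of_pz β (WithLp.toLp 2 ![0, 0, 1])).sub
      ((HasValueAt.of_pz α _).mul (.of_coord 1 _))
    have hwp := (HasValueAt.of_pz γ (WithLp.toLp 2 ![0, 0, 1])).add
      ((HasValueAt.of_pz α _).mul (.of_coord 0 _))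
    have := (hvp.pow 2).add (hwp.pow 2)
    simpa using this
  -- The linear part at the north pole is t ↦ (b²/|b|²)t̄ with b = β(1) + iγ(1), a reflection of the
  -- tangent plane.
  refine ⟨(β.eval 1 ^ 2 - γ.eval 1 ^ 2) / (β.eval 1 ^ 2 + γ.eval 1 ^ 2),
    2 * β.eval 1 * γ.eval 1 / (β.eval 1 ^ 2 + γ.eval 1 ^ 2),
    2 * β.eval 1 * γ.eval 1 / (β.eval 1 ^ 2 + γ.eval 1 ^ 2),
    (γ.eval 1 ^ 2 - β.eval 1 ^ 2) / (β.eval 1 ^ 2 + γ.eval 1 ^ 2), by field_simp; ring,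
    hz, (pz β * v - w * w) / (v ^ 2 + w ^ 2), (pz γ * v + v * w) / (v ^ 2 + w ^ 2),
    (pz β * w + w * v) / (v ^ 2 + w ^ 2), (pz γ * w - v * v) / (v ^ 2 + w ^ 2), ?_, ?_, ?_, ?_⟩
  · rw [e1', mul_div_assoc', mul_div_assoc', ← add_div]
    congr 1
    rw [hu, hl, hv, hw, ← coord_sq_add_sq]
    ring
  · rw [e2', mul_div_assoc', mul_div_assoc', ← add_div]
    congr 1
    rw [hu, hl, hv, hw, ← coord_sq_add_sq]
    ring
  · intro p hp f hf
    obtain ⟨c, hc, hvw⟩ := hE p hp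
    have x := HasValueAt.of_coord 0 p
    have y := HasValueAt.of_coord 1 p
    have a := HasValueAt.of_pz α p
    have b := HasValueAt.of_pz β p
    have c := HasValueAt.of_pz γ p
    have v' := b.sub (a.mul y)
    have w' := c.add (a.mul x)
    simp only [List.mem_cons, List.not_mem_nil, or_false] at hf
    rcases hf with rfl | rfl | rfl | rfl
    · exact ⟨_, ((b.mul v').sub (w'.mul w')).div hp hvw hc⟩
    · exact ⟨_, ((c.mul v').add (v'.mul w')).div hp hvw hc⟩
    · exact ⟨_, ((b.mul w').add (w'.mul v')).div hp hvw hc⟩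
    · exact ⟨_, ((c.mul w').sub (v'.mul v')).div hp hvw hc⟩
  · have hp := northPole_mem
    set p : E3 := WithLp.toLp 2 ![0, 0, 1] with hpdef
    have x := HasValueAt.of_coord 0 p
    have y := HasValueAt.of_coord 1 p
    have a := HasValueAt.of_pz α p
    have b := HasValueAt.of_pz β p
    have c := HasValueAt.of_pz γ p
    have p0 : p 0 = 0 := rfl
    have p1 : p 1 = 0 := rfl
    have p2 : p 2 = 1 := rfl
    simp only [p0, p1, p2] at x y a b c
    have v' := b.sub (a.mul y)
    have w' := c.add (a.mul x)
    refine ⟨?_, ?_, ?_, ?_⟩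
    · convert! ((b.mul v').sub (w'.mul w')).div hp hP hb using 2
      ring
    · convert! ((c.mul v').add (v'.mul w')).div hp hP hb using 2
      ring
    · convert! ((b.mul w').add (w'.mul v')).div hp hP hb using 2
      ring
    · convert! ((c.mul w').sub (v'.mul v')).div hp hP hb using 2
      ring

theorem HasLinearForm.isDefinedAt {g : Bir} {a b c d : ℝ} (h : HasLinearForm g a b c d) {p : E3}
    (hp : p ∈ Metric.sphere (0 : E3) 1) : IsDefinedAt g p := by
  obtain ⟨hz, A, B, C, D, e1, e2, hreg, -⟩ := h
  obtain ⟨vA, hA⟩ := hreg p hp A (by simp)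
  obtain ⟨vB, hB⟩ := hreg p hp B (by simp)
  obtain ⟨vC, hC⟩ := hreg p hp C (by simp)
  obtain ⟨vD, hD⟩ := hreg p hp D (by simp)
  have x := HasValueAt.of_coord 0 p
  have y := HasValueAt.of_coord 1 p
  refine isDefinedAt_of_hasValueAt (q := ![p 0 * vA + p 1 * vB, p 0 * vC + p 1 * vD, p 2]) ?_
  intro i
  fin_cases i
  · change HasValueAt (g (coord 0)) p _
    rw [e1]; exact (x.mul hA).add (y.mul hB)
  · change HasValueAt (g (coord 1)) p _
    rw [e2]; exact (x.mul hC).add (y.mul hD)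
  · change HasValueAt (g (coord 2)) p _
    rw [hz]; exact HasValueAt.of_coord 2 p

theorem mem_autRealOverPi {g : Bir} {a b c d : ℝ} (h : HasLinearForm g a b c d)
    (hg : g * g = 1) : g ∈ autRealOverPi := by
  have hi : g⁻¹ = g := inv_eq_of_mul_eq_one_right hg
  refine ⟨⟨fun p hp => h.isDefinedAt hp, ?_⟩, h.map_z⟩
  rw [hi]
  exact fun p hp => h.isDefinedAt hp

end RealSphere

/-! ### Orientation, tested at the north pole -/

namespace RealSphere

open scoped QuadraticAlgebra

open Filter Topology

theorem contDiff_eval (P : MvPolynomial (Fin 3) ℝ) :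
    ContDiff ℝ 1 fun v : E3 => MvPolynomial.eval (fun i => v i) P := by
  induction P using MvPolynomial.induction_on with
  | C r => simpa using contDiff_const
  | add P Q hP hQ =>
    simp only [map_add]
    exact hP.add hQ
  | mul_X P i hP =>
    have : ContDiff ℝ 1 fun v : E3 => v i := (EuclideanSpace.proj (𝕜 := ℝ) i).contDiff
    simp only [map_mul, MvPolynomial.eval_X]
    exact hP.mul this

/-- The radial extension of degree `0` of a rational function near a real point where it is
regular. -/
theorem HasValueAt.exists_contDiffAt {f : FunField} {p : E3} {c : ℝ}
    (hp : p ∈ Metric.sphere (0 : E3) 1) (h : HasValueAt f p c) :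
    ∃ φ : E3 → ℝ, ContDiffAt ℝ 1 φ p ∧ φ p = c ∧
      ∀ᶠ v in 𝓝 p, HasValueAt f (‖v‖⁻¹ • v) (φ v) := by
  obtain ⟨a, b, hb, e, hv⟩ := h
  have hp0 : p ≠ 0 := ne_zero_of_mem hp
  have hp1 : ‖p‖ = 1 := by simpa using hp
  have hup : ‖p‖⁻¹ • p = p := by simp [hp1]
  have hu : ContDiffAt ℝ 1 (fun v : E3 => ‖v‖⁻¹ • v) p :=
    ((contDiffAt_norm ℝ hp0).inv (norm_ne_zero_iff.2 hp0)).smul contDiffAt_id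
  have hA (P : MvPolynomial (Fin 3) ℝ) : ContDiffAt ℝ 1
      (fun v : E3 => MvPolynomial.eval (fun i => (‖v‖⁻¹ • v) i) P) p :=
    ContDiffAt.comp (g := fun v : E3 => MvPolynomial.eval (fun i => v i) P) p
      (contDiff_eval P).contDiffAt hu
  have hb' : MvPolynomial.eval (fun i => (‖p‖⁻¹ • p) i) b ≠ 0 := by rw [hup]; exact hb
  refine ⟨fun v => MvPolynomial.eval (fun i => (‖v‖⁻¹ • v) i) a /
    MvPolynomial.eval (fun i => (‖v‖⁻¹ • v) i) b, (hA a).div (hA b) hb', ?_, ?_⟩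
  · simp only [hup]
    rw [← hv, mul_div_cancel_right₀ _ hb]
  · filter_upwards [(hA b).continuousAt.eventually_ne hb'] with w hw
    exact ⟨a, b, hw, e, div_mul_cancel₀ _ hw⟩

theorem contDiffAt_radialExt {g : Bir} {p : E3} (hp : p ∈ Metric.sphere (0 : E3) 1)
    (h : IsDefinedAt g p) : ContDiffAt ℝ 1 (radialExt g) p := by
  have hp0 : p ≠ 0 := ne_zero_of_mem hp
  rw [contDiffAt_euclidean]
  intro i
  obtain ⟨φ, hφ, -, hev⟩ := ((realMap_spec hp h).2 i).exists_contDiffAt hp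
  refine ((contDiffAt_norm ℝ hp0).mul hφ).congr_of_eventuallyEq ?_
  filter_upwards [hev, continuousAt_id.eventually_ne hp0] with w hw hw0
  change ‖w‖ * valueAt (g (coord i)) (‖w‖⁻¹ • w) = _
  have hw0 : w ≠ 0 := hw0
  rw [hw.valueAt_eq (normalize_mem hw0)]

theorem continuousOn_det_fderiv {g : Bir}
    (h : ∀ p ∈ Metric.sphere (0 : E3) 1, IsDefinedAt g p) :
    ContinuousOn (fun p => (fderiv ℝ (radialExt g) p).det) (Metric.sphere (0 : E3) 1) := by
  intro p hp
  have h1 : ContinuousAt (fderiv ℝ (radialExt g)) p :=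
    ((contDiffAt_radialExt hp (h p hp)).fderiv_right (m := 0) (by norm_num)).continuousAt
  exact (ContinuousAt.comp (g := fun A : E3 →L[ℝ] E3 => A.det)
    (ContinuousLinearMap.continuous_det).continuousAt h1).continuousWithinAt

/-- The chain rule applied to g and its inverse. -/
theorem det_fderiv_ne_zero {g : Bir} (hg : g ∈ autReal) {p : E3}
    (hp : p ∈ Metric.sphere (0 : E3) 1) : (fderiv ℝ (radialExt g) p).det ≠ 0 := by
  have h := det_fderiv_mul hg (inv_mem hg) hp
  rw [mul_inv_cancel, det_fderiv_one hp] at h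
  intro h0
  rw [h0, mul_zero] at h
  exact one_ne_zero h

theorem isPreconnected_sphere_E3 : IsPreconnected (Metric.sphere (0 : E3) 1) := by
  refine isPreconnected_sphere ?_ 0 1
  rw [rank_eq_card_basis (EuclideanSpace.basisFun (Fin 3) ℝ).toBasis]
  simp

/-- The orientation behaviour can be tested at one point. -/
theorem isOrientationPreserving_iff {g : Bir} (hg : g ∈ autReal) {p : E3}
    (hp : p ∈ Metric.sphere (0 : E3) 1) :
    IsOrientationPreserving g ↔ 0 < (fderiv ℝ (radialExt g) p).det := by
  refine ⟨fun h => h p hp, fun h q hq => ?_⟩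
  by_contra hcon
  obtain ⟨r, hr, h0⟩ := isPreconnected_sphere_E3.intermediate_value hq hp
    (continuousOn_det_fderiv hg.1) (show (0 : ℝ) ∈ Set.Icc _ _ from ⟨not_lt.1 hcon, h.le⟩)
  exact det_fderiv_ne_zero hg hr h0

/-- Where the linear factor vanishes, the product rule needs only the continuity of the other
factor. So nothing about the derivatives of the coefficients in a `HasLinearForm` is required. -/
theorem hasFDerivAt_mul_of_eq_zero {E : Type*} [NormedAddCommGroup E] [NormedSpace ℝ E]
    (L : E →L[ℝ] ℝ) {φ : E → ℝ} {p : E} (h : L p = 0) (hφ : ContinuousAt φ p) :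
    HasFDerivAt (fun v => L v * φ v) (φ p • L) p := by
  rw [hasFDerivAt_iff_isLittleO]
  have h1 : (fun v => L v * φ v - L p * φ p - (φ p • L) (v - p)) =
      fun v => L (v - p) * (φ v - φ p) := by
    funext v
    simp only [smul_apply, map_sub, h, smul_eq_mul]
    ring
  rw [h1]
  have h2 : (fun v => φ v - φ p) =o[𝓝 p] fun _ => (1 : ℝ) := by
    rw [Asymptotics.isLittleO_one_iff]
    simpa using hφ.tendsto.sub_const (φ p)
  have h3 : (fun v => L (v - p)) =O[𝓝 p] fun v => v - p := L.isBigO_sub (𝓝 p) p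
  have := h3.norm_right.mul_isLittleO h2
  simpa using this

/-- The radial extension is xA + yB, xC + yD, z with A, B, C, D extended by degree zero. At the
north pole x = y = 0, so its differential has the values of A, B, C, D as a block, beside a 1 for z.
-/
theorem HasLinearForm.det_fderiv {g : Bir} {a b c d : ℝ} (h : HasLinearForm g a b c d) :
    (fderiv ℝ (radialExt g) (WithLp.toLp 2 ![0, 0, 1])).det = a * d - b * c := by
  obtain ⟨hz, A, B, C, D, e1, e2, -, hA, hB, hC, hD⟩ := h
  have hp := northPole_mem
  set p : E3 := WithLp.toLp 2 ![0, 0, 1] with hpd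
  have hp0 : p ≠ 0 := ne_zero_of_mem hp
  let π : Fin 3 → E3 →L[ℝ] ℝ := fun i => EuclideanSpace.proj i
  have hπ0 : π 0 p = 0 := rfl
  have hπ1 : π 1 p = 0 := rfl
  have key : ∀ (i : Fin 3) (f f' : FunField) (s s' : ℝ), HasValueAt f p s → HasValueAt f' p s' →
      g (coord i) = coord 0 * f + coord 1 * f' →
      HasFDerivAt (fun v => radialExt g v i) (s • π 0 + s' • π 1) p := by
    intro i f f' s s' hf hf' e
    obtain ⟨φ, hφ, rfl, hev⟩ := hf.exists_contDiffAt hp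
    obtain ⟨ψ, hψ, rfl, hev'⟩ := hf'.exists_contDiffAt hp
    refine ((hasFDerivAt_mul_of_eq_zero (π 0) hπ0 hφ.continuousAt).add
      (hasFDerivAt_mul_of_eq_zero (π 1) hπ1 hψ.continuousAt)).congr_of_eventuallyEq ?_
    filter_upwards [hev, hev', continuousAt_id.eventually_ne hp0] with w hw hw' hw0
    change ‖w‖ * valueAt (g (coord i)) (‖w‖⁻¹ • w) = w 0 * φ w + w 1 * ψ w
    have hval := ((HasValueAt.of_coord 0 (‖w‖⁻¹ • w)).mul hw).add
      ((HasValueAt.of_coord 1 (‖w‖⁻¹ • w)).mul hw')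
    rw [← e] at hval
    have hw0 : w ≠ 0 := hw0
    rw [hval.valueAt_eq (normalize_mem hw0)]
    have hn : ‖w‖ ≠ 0 := norm_ne_zero_iff.2 hw0
    simp only [PiLp.smul_apply, smul_eq_mul]
    field_simp
  have k0 := key 0 A B a b hA hB e1
  have k1 := key 1 C D c d hC hD e2
  have k2 : HasFDerivAt (fun v => radialExt g v 2) (π 2) p := by
    refine (π 2).hasFDerivAt.congr_of_eventuallyEq ?_
    filter_upwards [continuousAt_id.eventually_ne hp0] with w hw0
    change ‖w‖ * valueAt (g (coord 2)) (‖w‖⁻¹ • w) = w 2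
    have hw0 : w ≠ 0 := hw0
    rw [hz, (HasValueAt.of_coord 2 (‖w‖⁻¹ • w)).valueAt_eq (normalize_mem hw0)]
    have hn : ‖w‖ ≠ 0 := norm_ne_zero_iff.2 hw0
    simp only [PiLp.smul_apply, smul_eq_mul]
    field_simp
  have hd : DifferentiableAt ℝ (radialExt g) p := by
    rw [differentiableAt_euclidean]
    intro i
    fin_cases i
    · exact k0.differentiableAt
    · exact k1.differentiableAt
    · exact k2.differentiableAt
  have hcomp : ∀ (i : Fin 3) (M : E3 →L[ℝ] ℝ), HasFDerivAt (fun v => radialExt g v i) M p →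
      ∀ v, fderiv ℝ (radialExt g) p v i = M v := by
    intro i M hM v
    have h1 : HasFDerivAt (fun v => radialExt g v i) ((π i).comp (fderiv ℝ (radialExt g) p)) p :=
      (π i).hasFDerivAt.comp p hd.hasFDerivAt
    rw [← h1.unique hM]
    rfl
  change LinearMap.det (fderiv ℝ (radialExt g) p : E3 →ₗ[ℝ] E3) = _
  rw [← LinearMap.det_toMatrix (EuclideanSpace.basisFun (Fin 3) ℝ).toBasis, Matrix.det_fin_three]
  have hent : ∀ i j, LinearMap.toMatrix (EuclideanSpace.basisFun (Fin 3) ℝ).toBasis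
      (EuclideanSpace.basisFun (Fin 3) ℝ).toBasis
      (fderiv ℝ (radialExt g) p : E3 →ₗ[ℝ] E3) i j =
        fderiv ℝ (radialExt g) p (EuclideanSpace.single j 1) i := by
    intro i j
    rw [LinearMap.toMatrix_apply]
    simp
  simp only [hent, hcomp 0 _ k0, hcomp 1 _ k1, hcomp 2 _ k2]
  simp [π]

theorem IsRefl.mem_autRealOverPiPlus {g : Bir} {α β γ : Polynomial ℝ} (h : IsRefl g α β γ)
    (hq : IsTimelike α β γ) : g ∈ autRealOverPiPlus := by
  have hl := h.hasLinearForm_of_isTimelike hq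
  have hm := mem_autRealOverPi hl (h.mul_self hq.ne_zero)
  refine ⟨hm, (isOrientationPreserving_iff hm.1 northPole_mem).2 ?_⟩
  rw [hl.det_fderiv]
  norm_num

theorem ne_zero_of_isSpacelike {α β γ : Polynomial ℝ} (hq : IsSpacelike α β γ) :
    (1 - Polynomial.X ^ 2) * α ≠ 0 ∨ β ≠ 0 ∨ γ ≠ 0 :=
  Or.inr hq.ne_zero

theorem IsRefl.mem_autRealOverPi_of_isSpacelike {g : Bir} {α β γ : Polynomial ℝ}
    (h : IsRefl g ((1 - Polynomial.X ^ 2) * α) β γ) (hq : IsSpacelike α β γ) :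
    g ∈ autRealOverPi ∧ g ∉ autRealOverPiPlus := by
  obtain ⟨a, b, c, d, hdet, hl⟩ := h.hasLinearForm_of_isSpacelike hq
  refine ⟨mem_autRealOverPi hl (h.mul_self (ne_zero_of_isSpacelike hq)), fun hcon => ?_⟩
  have := hcon.2 _ northPole_mem
  rw [hl.det_fderiv, hdet] at this
  norm_num at this

end RealSphere

/-! ### The two kinds of involutive birational diffeomorphisms -/

namespace RealSphere

open scoped QuadraticAlgebra

open Polynomial Filter Topology

theorem eval_nrd (α β γ : ℝ[X]) (a : ℝ) : (nrd α β γ).eval a =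
    α.eval a ^ 2 - (1 - a ^ 2) * (β.eval a ^ 2 + γ.eval a ^ 2) := by
  simp [nrd]

theorem IsRefl.realMap_eq {g : Bir} (hg : g ∈ autReal) {α β γ : ℝ[X]} (h : IsRefl g α β γ)
    {p : E3} (hp : p ∈ Metric.sphere (0 : E3) 1) {X' Y' : ℝ}
    (he : (β.eval (p 2) * p 0 + γ.eval (p 2) * p 1) ^ 2 +
      (β.eval (p 2) * p 1 - γ.eval (p 2) * p 0 - α.eval (p 2)) ^ 2 ≠ 0)
    (hX : (β.eval (p 2) * p 0 + γ.eval (p 2) * p 1) * X' -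
        (β.eval (p 2) * p 1 - γ.eval (p 2) * p 0 - α.eval (p 2)) * Y' =
      (1 - p 2 ^ 2) * β.eval (p 2) - α.eval (p 2) * p 1)
    (hY : (β.eval (p 2) * p 1 - γ.eval (p 2) * p 0 - α.eval (p 2)) * X' +
        (β.eval (p 2) * p 0 + γ.eval (p 2) * p 1) * Y' =
      (1 - p 2 ^ 2) * γ.eval (p 2) + α.eval (p 2) * p 0) :
    realMap g p = WithLp.toLp 2 ![X', Y', p 2] := by
  obtain ⟨-, hv⟩ := realMap_spec hp (hg.1 p hp)
  obtain ⟨h1, h2⟩ := HasValueAt.form α β γ p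
  obtain ⟨h3, h4⟩ := HasValueAt.rhs α β γ p
  obtain ⟨e1, e2⟩ := refl_unique he
    (((h1.mul (hv 0)).sub (h2.mul (hv 1))).unique hp (h.2.1 ▸ h3))
    (((h2.mul (hv 0)).add (h1.mul (hv 1))).unique hp (h.2.2 ▸ h4)) hX hY
  ext i
  fin_cases i
  · exact e1
  · exact e2
  · have h5 := hv 2
    rw [h.1] at h5
    exact h5.unique hp (HasValueAt.of_coord 2 p)

/-- A reflection that is a birational diffeomorphism does not contract any circle. -/
theorem IsRefl.eval_nrd_ne_zero {g : Bir} (hg : g ∈ autReal) {α β γ : ℝ[X]}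
    (h : IsRefl g α β γ) (hroot : NoCommonRoot α β γ) (h0 : α ≠ 0 ∨ β ≠ 0 ∨ γ ≠ 0) {a : ℝ}
    (ha : a ∈ Set.Ioo (-1 : ℝ) 1) : (nrd α β γ).eval a ≠ 0 := by
  rw [eval_nrd]
  intro hN
  have hr := hroot a
  set A := α.eval a with hA
  set B := β.eval a with hB
  set C := γ.eval a with hC
  have hδ : 0 < 1 - a ^ 2 := by nlinarith [ha.1, ha.2]
  have hn : 0 < B ^ 2 + C ^ 2 := by
    rcases (by positivity : 0 ≤ B ^ 2 + C ^ 2).eq_or_lt with hn | hn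
    · rw [← hn] at hN
      exact absurd ⟨by simpa using hN, by nlinarith [sq_nonneg B, sq_nonneg C],
        by nlinarith [sq_nonneg B, sq_nonneg C]⟩ hr
    · exact hn
  have hA0 : A ≠ 0 := by
    intro h1
    rw [h1] at hN
    nlinarith
  set n := B ^ 2 + C ^ 2
  have hn0 := hn.ne'
  have hA2 : A ^ 2 = (1 - a ^ 2) * n := by linarith
  -- Over a zero of N the Möbius transformation has determinant zero. With b = B + iC it sends the
  -- whole circle to iAb/n, apart from the point iAb/n itself, where numerator and denominator
  -- vanish. The points -iAb/n and -Ab/n are different and have the same image, against injectivity.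
  have hp₁ : (WithLp.toLp 2 ![A * C / n, -(A * B / n), a] : E3) ∈ Metric.sphere (0 : E3) 1 := by
    apply mem_sphere_of_sum_sq
    simp
    field_simp
    linear_combination n * hA2
  have hp₂ : (WithLp.toLp 2 ![-(A * B / n), -(A * C / n), a] : E3) ∈
      Metric.sphere (0 : E3) 1 := by
    apply mem_sphere_of_sum_sq
    simp
    field_simp
    linear_combination n * hA2
  have e₁ : realMap g (WithLp.toLp 2 ![A * C / n, -(A * B / n), a]) =
      WithLp.toLp 2 ![-(A * C / n), A * B / n, a] := by
    refine h.realMap_eq hg hp₁ ?_ ?_ ?_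
    · change (B * (A * C / n) + C * (-(A * B / n))) ^ 2 +
        (B * (-(A * B / n)) - C * (A * C / n) - A) ^ 2 ≠ 0
      have : B * (-(A * B / n)) - C * (A * C / n) - A = -2 * A := by
        field_simp; ring
      rw [this]
      positivity
    · change (B * (A * C / n) + C * (-(A * B / n))) * (-(A * C / n)) -
        (B * (-(A * B / n)) - C * (A * C / n) - A) * (A * B / n) =
          (1 - a ^ 2) * B - A * (-(A * B / n))
      field_simp
      linear_combination n * B * hA2
    · change (B * (-(A * B / n)) - C * (A * C / n) - A) * (-(A * C / n)) +
        (B * (A * C / n) + C * (-(A * B / n))) * (A * B / n) =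
          (1 - a ^ 2) * C + A * (A * C / n)
      field_simp
      linear_combination n * C * hA2
  have e₂ : realMap g (WithLp.toLp 2 ![-(A * B / n), -(A * C / n), a]) =
      WithLp.toLp 2 ![-(A * C / n), A * B / n, a] := by
    refine h.realMap_eq hg hp₂ ?_ ?_ ?_
    · change (B * (-(A * B / n)) + C * (-(A * C / n))) ^ 2 +
        (B * (-(A * C / n)) - C * (-(A * B / n)) - A) ^ 2 ≠ 0
      have : B * (-(A * B / n)) + C * (-(A * C / n)) = -A := by
        field_simp; ring
      rw [this, neg_sq]
      positivity
    · change (B * (-(A * B / n)) + C * (-(A * C / n))) * (-(A * C / n)) -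
        (B * (-(A * C / n)) - C * (-(A * B / n)) - A) * (A * B / n) =
          (1 - a ^ 2) * B - A * (-(A * C / n))
      field_simp
      linear_combination n * B * hA2
    · change (B * (-(A * C / n)) - C * (-(A * B / n)) - A) * (-(A * C / n)) +
        (B * (-(A * B / n)) + C * (-(A * C / n))) * (A * B / n) =
          (1 - a ^ 2) * C + A * (-(A * B / n))
      field_simp
      linear_combination n * C * hA2
  have hinv : ∀ p ∈ Metric.sphere (0 : E3) 1, realMap g (realMap g p) = p := by
    intro p hp
    rw [← realMap_mul hp (hg.1 p hp) (hg.1 _ (realMap_spec hp (hg.1 p hp)).1), h.mul_self h0,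
      realMap_one hp]
  have e : (WithLp.toLp 2 ![A * C / n, -(A * B / n), a] : E3) =
      WithLp.toLp 2 ![-(A * B / n), -(A * C / n), a] := by
    rw [← hinv _ hp₁, ← hinv _ hp₂, e₁, e₂]
  have e0 : A * C / n = -(A * B / n) := congrArg (fun p : E3 => p 0) e
  have e1 : -(A * B / n) = -(A * C / n) := congrArg (fun p : E3 => p 1) e
  have f0 : C = -B := by
    apply mul_left_cancel₀ hA0
    field_simp at e0
    linear_combination A * e0
  have f1 : B = C := by
    apply mul_left_cancel₀ hA0
    field_simp at e1
    linear_combination -A * e1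
  have hB0 : B = 0 := by linarith
  have hC0 : C = 0 := by linarith
  exact absurd hn (by simp [n, hB0, hC0])

theorem NoCommonRoot.ne_zero {α β γ : ℝ[X]} (h : NoCommonRoot α β γ) :
    α ≠ 0 ∨ β ≠ 0 ∨ γ ≠ 0 := by
  by_contra! h0
  obtain ⟨rfl, rfl, rfl⟩ := h0
  exact h 0 (by simp)

theorem nonpos_of_neg_on_Ioo {f : ℝ → ℝ} (hf : Continuous f) (h : ∀ a ∈ Set.Ioo (-1 : ℝ) 1, f a < 0)
    {a : ℝ} (ha : a ∈ Set.Icc (-1 : ℝ) 1) : f a ≤ 0 := by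
  rw [← closure_Ioo (by norm_num)] at ha
  exact closure_minimal (fun b hb => (h b hb).le) (isClosed_le hf continuous_const) ha

/-- Only the poles c = ±1 need an argument; there N = α². If α vanishes at c, then N has the linear
term 2c(β² + γ²)(c)(z - c), which is negative inside the interval unless β and γ vanish at c as
well. -/
theorem isTimelike_of_pos {α β γ : ℝ[X]} (hroot : NoCommonRoot α β γ)
    (h : ∀ a ∈ Set.Ioo (-1 : ℝ) 1, 0 < (nrd α β γ).eval a) : IsTimelike α β γ := by
  have key : ∀ c : ℝ, c ^ 2 = 1 → α.eval c ≠ 0 := by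
    intro c hc h0
    obtain ⟨α', rfl⟩ := dvd_iff_isRoot.2 h0
    have hle := nonpos_of_neg_on_Ioo (a := c)
      (f := fun a => c * ((a - c) * α'.eval a ^ 2 + (a + c) * (β.eval a ^ 2 + γ.eval a ^ 2)))
      (by fun_prop) (fun a ha => by
        have h1 := h a ha
        rw [eval_nrd] at h1
        simp only [eval_mul, eval_sub, eval_X, eval_C] at h1
        have h2 : 0 < (a - c) * ((a - c) * α'.eval a ^ 2 +
            (a + c) * (β.eval a ^ 2 + γ.eval a ^ 2)) := by
          calc _ < _ := h1
            _ = _ := by linear_combination (β.eval a ^ 2 + γ.eval a ^ 2) * hc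
        have h3 : c * (a - c) < 0 := by
          rcases eq_or_eq_neg_of_sq_eq_sq c 1 (by rw [hc, one_pow]) with rfl | rfl <;> linarith [ha.1, ha.2]
        nlinarith) (by
        rcases eq_or_eq_neg_of_sq_eq_sq c 1 (by rw [hc, one_pow]) with rfl | rfl <;> simp)
    have h4 : β.eval c ^ 2 + γ.eval c ^ 2 ≤ 0 := by
      simp only [sub_self, zero_mul, zero_add] at hle
      nlinarith
    exact hroot c ⟨h0, by nlinarith [sq_nonneg (β.eval c), sq_nonneg (γ.eval c)],
      by nlinarith [sq_nonneg (β.eval c), sq_nonneg (γ.eval c)]⟩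
  intro a ha
  by_cases ha2 : a ^ 2 = 1
  · have := key a ha2
    rw [ha2, sub_self, zero_mul, sub_zero]
    positivity
  · have := h a ⟨lt_of_le_of_ne ha.1 (by rintro rfl; norm_num at ha2),
      lt_of_le_of_ne ha.2 (by rintro rfl; norm_num at ha2)⟩
    rwa [eval_nrd] at this

/-- At the poles N = α² ≤ 0 forces α = 0, so 1 - z² divides α. The quotient -N/δ equals β² + γ² at
the poles, and this is not zero for lack of a common root. -/
theorem exists_isSpacelike_of_neg {α β γ : ℝ[X]} (hroot : NoCommonRoot α β γ)
    (h : ∀ a ∈ Set.Ioo (-1 : ℝ) 1, (nrd α β γ).eval a < 0) :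
    ∃ α', α = (1 - X ^ 2) * α' ∧ IsSpacelike α' β γ := by
  have key : ∀ c ∈ Set.Icc (-1 : ℝ) 1, c ^ 2 = 1 → α.eval c = 0 := by
    intro c hcI hc
    have := nonpos_of_neg_on_Ioo (nrd α β γ).continuous h hcI
    rw [eval_nrd, hc] at this
    nlinarith [sq_nonneg (α.eval c)]
  have k1 := key 1 (by simp) (by norm_num)
  have k2 := key (-1) (by simp) (by norm_num)
  obtain ⟨α₁, rfl⟩ := dvd_iff_isRoot.2 k1
  have k3 : α₁.eval (-1) = 0 := by
    simp only [eval_mul, eval_sub, eval_X, eval_C] at k2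
    linarith
  obtain ⟨α₂, rfl⟩ := dvd_iff_isRoot.2 k3
  refine ⟨-α₂, by simp only [map_one, map_neg]; ring, fun a ha => ?_⟩
  by_cases ha2 : a ^ 2 = 1
  · have hα : ((X - C 1) * ((X - C (-1)) * α₂)).eval a = 0 := by
      simp only [eval_mul, eval_sub, eval_X, eval_C]
      linear_combination α₂.eval a * ha2
    rw [ha2, sub_self, zero_mul, sub_zero]
    rcases (by positivity : 0 ≤ β.eval a ^ 2 + γ.eval a ^ 2).eq_or_lt with hn | hn
    · exact absurd ⟨hα, by nlinarith [sq_nonneg (β.eval a), sq_nonneg (γ.eval a)],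
        by nlinarith [sq_nonneg (β.eval a), sq_nonneg (γ.eval a)]⟩ (hroot a)
    · exact hn
  · have h1 := h a ⟨lt_of_le_of_ne ha.1 (by rintro rfl; norm_num at ha2),
      lt_of_le_of_ne ha.2 (by rintro rfl; norm_num at ha2)⟩
    rw [eval_nrd] at h1
    simp only [eval_mul, eval_sub, eval_X, eval_C, eval_neg] at h1 ⊢
    have hδ : 0 < 1 - a ^ 2 :=
      lt_of_le_of_ne (by nlinarith [ha.1, ha.2]) fun h => ha2 (by linarith)
    have : 0 < (1 - a ^ 2) * (β.eval a ^ 2 + γ.eval a ^ 2 - (1 - a ^ 2) * (-α₂.eval a) ^ 2) := by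
      linear_combination h1
    exact (mul_pos_iff_of_pos_left hδ).1 this

/-- Involutive birational diffeomorphisms over `ℙ¹` are of one of two kinds. -/
theorem IsRefl.isTimelike_or_isSpacelike {g : Bir} (hg : g ∈ autReal) {α β γ : ℝ[X]}
    (h : IsRefl g α β γ) (hroot : NoCommonRoot α β γ) :
    IsTimelike α β γ ∨ ∃ α', α = (1 - X ^ 2) * α' ∧ IsSpacelike α' β γ := by
  have hne : ∀ a ∈ Set.Ioo (-1 : ℝ) 1, (nrd α β γ).eval a ≠ 0 := fun a ha =>
    h.eval_nrd_ne_zero hg hroot hroot.ne_zero ha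
  have h0 : (0 : ℝ) ∈ Set.Ioo (-1 : ℝ) 1 := by simp
  rcases lt_or_gt_of_ne (hne 0 h0) with hlt | hgt
  · refine Or.inr (exists_isSpacelike_of_neg hroot fun a ha => ?_)
    by_contra hcon
    obtain ⟨b, hb, hb0⟩ := isPreconnected_Ioo.intermediate_value h0 ha
      (nrd α β γ).continuous.continuousOn
      (show (0 : ℝ) ∈ Set.Icc _ _ from ⟨hlt.le, not_lt.1 hcon⟩)
    exact hne b hb hb0
  · refine Or.inl (isTimelike_of_pos hroot fun a ha => ?_)
    by_contra hcon
    obtain ⟨b, hb, hb0⟩ := isPreconnected_Ioo.intermediate_value ha h0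
      (nrd α β γ).continuous.continuousOn
      (show (0 : ℝ) ∈ Set.Icc _ _ from ⟨not_lt.1 hcon, hgt.le⟩)
    exact hne b hb hb0

theorem exists_isTimelike_of_mem {g : Bir} (hg : g ∈ autRealOverPiPlus) (ho : orderOf g = 2) :
    ∃ α β γ, IsRefl g α β γ ∧ IsTimelike α β γ := by
  obtain ⟨α, β, γ, hroot, h⟩ := exists_isRefl hg.1.2 (by rintro rfl; simp at ho)
    (by rw [← pow_two, ← ho, pow_orderOf_eq_one])
  rcases h.isTimelike_or_isSpacelike hg.1.1 hroot with hq | ⟨α', rfl, hq⟩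
  · exact ⟨α, β, γ, h, hq⟩
  · exact absurd hg (h.mem_autRealOverPi_of_isSpacelike hq).2

theorem exists_isSpacelike_of_mem {g : Bir} (hg : g ∈ autRealOverPi) (ho : orderOf g = 2)
    (hg' : g ∉ autRealOverPiPlus) :
    ∃ α β γ, IsRefl g ((1 - X ^ 2) * α) β γ ∧ IsSpacelike α β γ := by
  obtain ⟨α, β, γ, hroot, h⟩ := exists_isRefl hg.2 (by rintro rfl; simp at ho)
    (by rw [← pow_two, ← ho, pow_orderOf_eq_one])
  rcases h.isTimelike_or_isSpacelike hg.1 hroot with hq | ⟨α', rfl, hq⟩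
  · exact absurd (h.mem_autRealOverPiPlus hq) hg'
  · exact ⟨α', β, γ, h, hq⟩

theorem pz_quadratic {u v w : ℝ[X]} (h : pz u * coord 0 ^ 2 + pz v * coord 0 + pz w = 0) :
    u = 0 ∧ v = 0 ∧ w = 0 := by
  have hP0 : (C u * X ^ 2 + C v * X + C w : ℝ[X][X]) = 0 := by
    by_contra hne
    exact eval_x_ne_zero hne (by simpa [eval₂_add, eval₂_mul] using h)
  refine ⟨?_, ?_, ?_⟩
  · simpa [coeff_X, coeff_C] using congrArg (fun p => coeff p 2) hP0
  · simpa [coeff_X, coeff_C] using congrArg (fun p => coeff p 1) hP0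
  · simpa [coeff_X, coeff_C] using congrArg (fun p => coeff p 0) hP0

/-- On the line, γx + α = βy; squaring eliminates y through y² = δ - x² and leaves a quadratic
equation for x over ℝ(z) with leading coefficient β² + γ². -/
theorem line_ne_zero {α β γ : ℝ[X]} (h0 : α ≠ 0 ∨ β ≠ 0 ∨ γ ≠ 0) :
    pz β * coord 1 - pz γ * coord 0 - pz α ≠ 0 := by
  intro hl
  obtain ⟨c2, -, c0⟩ := pz_quadratic (u := β ^ 2 + γ ^ 2) (v := 2 * α * γ)
    (w := α ^ 2 - (1 - X ^ 2) * β ^ 2) (by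
      have : pz X = coord 2 := aeval_X _
      simp only [map_add, map_mul, map_pow, map_sub, map_one, map_ofNat, this]
      linear_combination -(pz β * coord 1 + pz γ * coord 0 + pz α) * hl +
        pz β ^ 2 * coord_sq_add_sq)
  obtain ⟨hβ, hγ⟩ := poly_eq_zero_of_sq_add_sq c2
  rw [hβ] at c0
  have hα : α = 0 := by simpa using c0
  simp [hα, hβ, hγ] at h0

/-- For the identity the defining system reduces to xl = yl = 0, where l is the form of the line. -/
theorem IsRefl.ne_one {g : Bir} {α β γ : ℝ[X]} (h0 : α ≠ 0 ∨ β ≠ 0 ∨ γ ≠ 0)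
    (h : IsRefl g α β γ) : g ≠ 1 := by
  rintro rfl
  apply line_ne_zero h0
  obtain ⟨-, h1, h2⟩ := h
  simp only [AlgEquiv.one_apply] at h1 h2
  have e1 : coord 1 * (pz β * coord 1 - pz γ * coord 0 - pz α) = 0 := by
    linear_combination (-h1 + pz β * coord_sq_add_sq) / 2
  have e2 : coord 0 * (pz β * coord 1 - pz γ * coord 0 - pz α) = 0 := by
    linear_combination (h2 - pz γ * coord_sq_add_sq) / 2
  apply mul_left_cancel₀ one_sub_sq_ne_zero
  linear_combination coord 0 * e2 + coord 1 * e1 -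
    (pz β * coord 1 - pz γ * coord 0 - pz α) * coord_sq_add_sq

theorem IsRefl.orderOf_eq {g : Bir} {α β γ : ℝ[X]} (h0 : α ≠ 0 ∨ β ≠ 0 ∨ γ ≠ 0)
    (h : IsRefl g α β γ) : orderOf g = 2 :=
  orderOf_eq_prime (by rw [pow_two]; exact h.mul_self h0) (h.ne_one h0)

end RealSphere

/-! ### Conjugation of one reflection by another -/

namespace RealSphere

open scoped QuadraticAlgebra

open Polynomial

/-- The product of three matrices, read off from Möbius relations t → S → Z → G: (s1 : s2) and (z1 :
z2) are homogeneous coordinates of S and Z. For pure quaternions p, q this is the identity that pqp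
is, up to sign, N(p)q - 2B(p, q)p, with B the polar form of the norm. -/
theorem refl_conj_aux {M : Type*} [Field M] {t S Z G v w W v' w' W' δ : M}
    (h1 : w * (t * S) = v * (t + S) + δ * W) (h2 : w' * (S * Z) = v' * (S + Z) + δ * W')
    (h3 : w * (Z * G) = v * (Z + G) + δ * W) :
    ((-(v * v) - δ * (w * W)) * w' - (-(v * v' + v * v') - δ * (w * W' + W * w')) * w) * (t * G) =
      ((-(v * v) - δ * (w * W)) * v' - (-(v * v' + v * v') - δ * (w * W' + W * w')) * v) * (t + G) +
        δ * ((-(v * v) - δ * (w * W)) * W' - (-(v * v' + v * v') - δ * (w * W' + W * w')) * W) := by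
  have e1 : (w * t - v) * S = v * t + δ * W := by linear_combination h1
  generalize hs1 : v * t + δ * W = s1 at e1
  generalize hs2 : w * t - v = s2 at e1
  have e2 : (w' * s1 - v' * s2) * Z = v' * s1 + δ * W' * s2 := by
    linear_combination s2 * h2 - (w' * Z - v') * e1
  generalize hz1 : v' * s1 + δ * W' * s2 = z1 at e2
  generalize hz2 : w' * s1 - v' * s2 = z2 at e2
  have e3 : (w * z1 - v * z2) * G = v * z1 + δ * W * z2 := by
    linear_combination z2 * h3 - (w * G - v) * e2
  subst hz1 hz2 hs1 hs2
  linear_combination e3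

/-- The bilinear form attached to `nrd`. -/
noncomputable def nrdB (α β γ α' β' γ' : ℝ[X]) : ℝ[X] :=
  α * α' - (1 - X ^ 2) * (β * β' + γ * γ')

/-- The conjugate of a reflection by a reflection. -/
theorem IsRefl.conj {P g : Bir} {α β γ α' β' γ' : ℝ[X]} (hP : IsRefl P α β γ)
    (hg : IsRefl g α' β' γ') :
    IsRefl (P * g * P) (nrd α β γ * α' - 2 * nrdB α β γ α' β' γ' * α)
      (nrd α β γ * β' - 2 * nrdB α β γ α' β' γ' * β)
      (nrd α β γ * γ' - 2 * nrdB α β γ α' β' γ' * γ) := by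
  have hzP := hP.1
  have hzg := hg.1
  have hX : pz X = coord 2 := aeval_X _
  rw [isRefl_iff] at hP hg ⊢
  have hzPg : (P * g) (coord 2) = coord 2 := by rw [AlgEquiv.mul_apply, hzg, hzP]
  have hc : ∀ h : Bir, h (coord 2) = coord 2 → ∀ p q : ℝ[X],
      complexify h ⟨pz p, pz q⟩ = ⟨pz p, pz q⟩ := fun h hh p q => by
    change (⟨h (pz p), h (pz q)⟩ : CFunField) = _
    rw [map_pz hh, map_pz hh]
  have hcomp : ∀ (h h' : Bir) (m : CFunField),
      complexify (h * h') m = complexify h (complexify h' m) := fun _ _ _ => rfl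
  have c0 : ∀ p : ℝ[X], (⟨pz p, 0⟩ : CFunField) = ⟨pz p, pz 0⟩ := fun p => by rw [map_zero]
  have c1 : ∀ p : ℝ[X], (⟨0, pz p⟩ : CFunField) = ⟨pz 0, pz p⟩ := fun p => by rw [map_zero]
  have c2 : (⟨1 - coord 2 ^ 2, 0⟩ : CFunField) = ⟨pz (1 - X ^ 2), pz 0⟩ := by
    simp [hX]
  have c3 : ∀ p q : ℝ[X], (⟨pz p, -pz q⟩ : CFunField) = ⟨pz p, pz (-q)⟩ := fun p q => by
    rw [map_neg]
  refine ⟨by rw [AlgEquiv.mul_apply, hzP, hzPg], ?_⟩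
  have h2 := congrArg (complexify P) hg.2
  have h3 := congrArg (complexify (P * g)) hP.2
  have h1 := hP.2
  simp only [c1, c2, c3] at h1 h2 h3 ⊢
  simp only [map_mul, map_add, hc P hzP, hc _ hzPg] at h2 h3
  have h4 := refl_conj_aux h1 h2 h3
  have e : complexify (P * g * P) tcoord = complexify (P * g) (complexify P tcoord) := rfl
  rw [e]
  refine Eq.trans ?_ (h4.trans ?_)
  · congr 1
    ext <;> simp [nrd, nrdB, map_ofNat] <;> ring
  · congr 2
    · ext <;> simp [nrd, nrdB, map_ofNat] <;> ring
    · ext <;> simp [nrd, nrdB, map_ofNat] <;> ring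

end RealSphere

/-! ### Conjugacy of orientation preserving involutions -/

namespace RealSphere

open scoped QuadraticAlgebra

open Polynomial

theorem pos_or_neg_of_ne_zero {f : ℝ → ℝ} (hf : Continuous f)
    (h : ∀ a ∈ Set.Icc (-1 : ℝ) 1, f a ≠ 0) :
    (∀ a ∈ Set.Icc (-1 : ℝ) 1, 0 < f a) ∨ ∀ a ∈ Set.Icc (-1 : ℝ) 1, f a < 0 := by
  have h0 : (0 : ℝ) ∈ Set.Icc (-1 : ℝ) 1 := by simp
  rcases lt_or_gt_of_ne (h 0 h0) with hlt | hgt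
  · refine Or.inr fun a ha => ?_
    by_contra hcon
    obtain ⟨b, hb, hb0⟩ := isPreconnected_Icc.intermediate_value h0 ha hf.continuousOn
      (show (0 : ℝ) ∈ Set.Icc _ _ from ⟨hlt.le, not_lt.1 hcon⟩)
    exact h b hb hb0
  · refine Or.inl fun a ha => ?_
    by_contra hcon
    obtain ⟨b, hb, hb0⟩ := isPreconnected_Icc.intermediate_value ha h0 hf.continuousOn
      (show (0 : ℝ) ∈ Set.Icc _ _ from ⟨not_lt.1 hcon, hgt.le⟩)
    exact h b hb hb0

/-- Equality of square classes can be realized by factors that are positive on `[-1, 1]`. -/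
theorem exists_pos_of_sq_mul_eq {f f' r r' : ℝ[X]} (hf : ∀ a ∈ Set.Icc (-1 : ℝ) 1, 0 < f.eval a)
    (hf' : ∀ a ∈ Set.Icc (-1 : ℝ) 1, 0 < f'.eval a) (hr : r ≠ 0) (h : r ^ 2 * f = r' ^ 2 * f') :
    ∃ s s' : ℝ[X], (∀ a ∈ Set.Icc (-1 : ℝ) 1, 0 < s.eval a) ∧
      (∀ a ∈ Set.Icc (-1 : ℝ) 1, 0 < s'.eval a) ∧ s ^ 2 * f = s' ^ 2 * f' := by
  -- After division by the greatest common divisor, s and s' are coprime. A zero of one of them in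
  -- [-1, 1] would be a zero of the other, because f and f' have no zeros there; so both have
  -- constant sign.
  obtain ⟨d, s, s', hd, hcop, rfl, rfl⟩ :
      ∃ d s s' : ℝ[X], d ≠ 0 ∧ IsCoprime s s' ∧ r = d * s ∧ r' = d * s' := by
    have hd : EuclideanDomain.gcd r r' ≠ 0 := fun h0 => hr (EuclideanDomain.gcd_eq_zero_iff.1 h0).1
    obtain ⟨s, hs⟩ := EuclideanDomain.gcd_dvd_left r r'
    obtain ⟨s', hs'⟩ := EuclideanDomain.gcd_dvd_right r r'
    refine ⟨_, s, s', hd, ⟨EuclideanDomain.gcdA r r', EuclideanDomain.gcdB r r', ?_⟩, hs, hs'⟩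
    apply mul_left_cancel₀ hd
    have := EuclideanDomain.gcd_eq_gcd_ab r r'
    rw [mul_one]
    conv_rhs => rw [this]
    conv_rhs => arg 1; arg 1; rw [hs]
    conv_rhs => arg 2; arg 1; rw [hs']
    ring
  have hss : s ^ 2 * f = s' ^ 2 * f' := by
    apply mul_left_cancel₀ (pow_ne_zero 2 hd)
    linear_combination h
  have hne : ∀ a ∈ Set.Icc (-1 : ℝ) 1, s.eval a ≠ 0 ∧ s'.eval a ≠ 0 := by
    intro a ha
    have he := congrArg (eval a) hss
    simp only [eval_mul, eval_pow] at he
    obtain ⟨u, v, huv⟩ := hcop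
    have huv' := congrArg (eval a) huv
    simp only [eval_add, eval_mul, eval_one] at huv'
    have h1 := (hf a ha).ne'
    have h2 := (hf' a ha).ne'
    constructor
    · intro h0
      simp only [h0, ne_eq, OfNat.ofNat_ne_zero, not_false_eq_true, zero_pow, zero_mul, zero_eq_mul,
        pow_eq_zero_iff, h2, or_false] at he
      simp [h0, he] at huv'
    · intro h0
      simp only [h0, ne_eq, OfNat.ofNat_ne_zero, not_false_eq_true, zero_pow, zero_mul, mul_eq_zero,
        pow_eq_zero_iff, h1, or_false] at he
      simp [h0, he] at huv'
  obtain ⟨t, ht, hts⟩ : ∃ t : ℝ[X], (∀ a ∈ Set.Icc (-1 : ℝ) 1, 0 < t.eval a) ∧ t ^ 2 = s ^ 2 := by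
    rcases pos_or_neg_of_ne_zero s.continuous fun a ha => (hne a ha).1 with hp | hn
    · exact ⟨s, hp, rfl⟩
    · exact ⟨-s, fun a ha => by simpa using hn a ha, by ring⟩
  obtain ⟨t', ht', hts'⟩ :
      ∃ t : ℝ[X], (∀ a ∈ Set.Icc (-1 : ℝ) 1, 0 < t.eval a) ∧ t ^ 2 = s' ^ 2 := by
    rcases pos_or_neg_of_ne_zero s'.continuous fun a ha => (hne a ha).2 with hp | hn
    · exact ⟨s', hp, rfl⟩
    · exact ⟨-s', fun a ha => by simpa using hn a ha, by ring⟩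
  exact ⟨t, t', ht, ht', by rw [hts, hts', hss]⟩

theorem ne_zero_of_pos {s : ℝ[X]} (h : ∀ a ∈ Set.Icc (-1 : ℝ) 1, 0 < s.eval a) : s ≠ 0 := by
  rintro rfl
  simpa using h 0 (by simp)

/-- Two reflections of equal norm are conjugate by the reflection in the sum. -/
theorem conj_eq_of_nrd_eq {P g g' : Bir} {α β γ α' β' γ' : ℝ[X]} (hg : IsRefl g α β γ)
    (hg' : IsRefl g' α' β' γ') (hN : nrd α β γ = nrd α' β' γ') (h0 : nrd α' β' γ' ≠ 0)
    (hP : IsRefl P (α + α') (β + β') (γ + γ')) (hP0 : nrd (α + α') (β + β') (γ + γ') ≠ 0) :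
    P * g * P⁻¹ = g' := by
  have hinv : P⁻¹ = P := inv_eq_of_mul_eq_one_left (hP.mul_self (ne_zero_of_nrd_ne_zero hP0))
  rw [hinv]
  have hc := hP.conj hg
  -- For N(q) = N(q') and p = q + q' one has 2B(p, q) = N(p). So N(p)q - 2B(p, q)p = -N(p)q', a
  -- multiple of q'.
  have hB : 2 * nrdB (α + α') (β + β') (γ + γ') α β γ = nrd (α + α') (β + β') (γ + γ') := by
    unfold nrd nrdB at *
    linear_combination hN
  rw [hB] at hc
  have hd : -nrd (α + α') (β + β') (γ + γ') ≠ 0 := neg_ne_zero.2 hP0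
  refine IsRefl.eq (ne_zero_of_nrd_ne_zero h0) ((isRefl_mul hd).1 ?_) hg'
  convert hc using 1 <;> ring

theorem nrd_smul (r α β γ : ℝ[X]) : nrd (r * α) (r * β) (r * γ) = r ^ 2 * nrd α β γ := by
  unfold nrd; ring

theorem IsTimelike.eval_nrd_pos {α β γ : ℝ[X]} (h : IsTimelike α β γ) {a : ℝ}
    (ha : a ∈ Set.Icc (-1 : ℝ) 1) : 0 < (nrd α β γ).eval a := by
  rw [eval_nrd]; exact h a ha

/-- The reversed Cauchy–Schwarz inequality: two vectors in the same half of the light cone satisfy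
αα' ≥ δ(ββ' + γγ'), so the mixed term of the norm of the sum is not negative. -/
theorem IsTimelike.add {α β γ α' β' γ' : ℝ[X]} (h : IsTimelike α β γ) (h' : IsTimelike α' β' γ')
    (hpos : ∀ a ∈ Set.Icc (-1 : ℝ) 1, 0 < α.eval a * α'.eval a) :
    IsTimelike (α + α') (β + β') (γ + γ') := by
  intro a ha
  have h1 := h a ha
  have h2 := h' a ha
  have h3 := hpos a ha
  simp only [eval_add]
  set A := α.eval a
  set B := β.eval a
  set C := γ.eval a
  set A' := α'.eval a
  set B' := β'.eval a
  set C' := γ'.eval a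
  have hδ : 0 ≤ 1 - a ^ 2 := by nlinarith [ha.1, ha.2]
  have hle : ((1 - a ^ 2) * (B * B' + C * C')) ^ 2 ≤ (A * A') ^ 2 := by
    calc ((1 - a ^ 2) * (B * B' + C * C')) ^ 2
        ≤ ((1 - a ^ 2) * (B ^ 2 + C ^ 2)) * ((1 - a ^ 2) * (B' ^ 2 + C' ^ 2)) := by
          have : 0 ≤ (1 - a ^ 2) ^ 2 * (B * C' - C * B') ^ 2 := by positivity
          linear_combination this
      _ ≤ A ^ 2 * A' ^ 2 := by
          apply mul_le_mul <;> first | linarith | positivity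
      _ = _ := by ring
  have := (abs_le.1 (abs_le_of_sq_le_sq hle h3.le)).2
  linear_combination h1 + h2 + 2 * this

theorem IsTimelike.smul {α β γ r : ℝ[X]} (h : IsTimelike α β γ)
    (hr : ∀ a ∈ Set.Icc (-1 : ℝ) 1, r.eval a ≠ 0) :
    IsTimelike (r * α) (r * β) (r * γ) := by
  intro a ha
  have h1 := h a ha
  have : 0 < (r.eval a) ^ 2 := by have := hr a ha; positivity
  simp only [eval_mul]
  have := mul_pos this h1
  linear_combination this

theorem IsTimelike.eval_ne_zero {α β γ : ℝ[X]} (h : IsTimelike α β γ) {a : ℝ}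
    (ha : a ∈ Set.Icc (-1 : ℝ) 1) : α.eval a ≠ 0 := by
  intro h0
  have h1 := h a ha
  have hδ : 0 ≤ 1 - a ^ 2 := by nlinarith [ha.1, ha.2]
  rw [h0] at h1
  nlinarith [mul_nonneg hδ (add_nonneg (sq_nonneg (β.eval a)) (sq_nonneg (γ.eval a)))]

theorem IsTimelike.nrd_ne_zero {α β γ : ℝ[X]} (h : IsTimelike α β γ) : nrd α β γ ≠ 0 :=
  ne_zero_of_pos fun _ ha => h.eval_nrd_pos ha

/-- Orientation preserving involutions with norms in the same square class are conjugate. -/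
theorem exists_conj_of_isTimelike {g g' : Bir} {α β γ α' β' γ' r r' : ℝ[X]} (hg : IsRefl g α β γ)
    (hg' : IsRefl g' α' β' γ') (hq : IsTimelike α β γ) (hq' : IsTimelike α' β' γ') (hr : r ≠ 0)
    (h : r ^ 2 * nrd α β γ = r' ^ 2 * nrd α' β' γ') :
    ∃ P ∈ autRealOverPiPlus, P * g * P⁻¹ = g' := by
  obtain ⟨s, s', hs, hs', hss⟩ := exists_pos_of_sq_mul_eq (fun a ha => hq.eval_nrd_pos ha)
    (fun a ha => hq'.eval_nrd_pos ha) hr h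
  -- A quaternion and its negative define the same reflection, and the sign decides in which half of
  -- the light cone it lies.
  wlog hpos : ∀ a ∈ Set.Icc (-1 : ℝ) 1, 0 < α.eval a * α'.eval a generalizing α' β' γ'
  · rcases pos_or_neg_of_ne_zero (f := fun a => α.eval a * α'.eval a) (by fun_prop)
      (fun a ha => mul_ne_zero (hq.eval_ne_zero ha) (hq'.eval_ne_zero ha)) with h1 | h1
    · exact absurd h1 hpos
    · refine this (α' := -1 * α') (β' := -1 * β') (γ' := -1 * γ')
        ((isRefl_mul (neg_ne_zero.2 one_ne_zero)).2 hg') (hq'.smul (by simp)) ?_ ?_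
        fun a ha => ?_
      · rw [nrd_smul, h]; ring
      · rw [nrd_smul, hss]; ring
      · have := h1 a ha
        simp only [eval_mul, eval_neg, eval_one]
        linarith
  have hsq := hq.smul fun a ha => (hs a ha).ne'
  have hsq' := hq'.smul fun a ha => (hs' a ha).ne'
  have hp := hsq.add hsq' fun a ha => by
    simp only [eval_mul]
    have := mul_pos (mul_pos (hs a ha) (hs' a ha)) (hpos a ha)
    linear_combination this
  obtain ⟨P, hP⟩ := exists_isRefl_of_nrd_ne_zero hp.nrd_ne_zero
  exact ⟨P, hP.mem_autRealOverPiPlus hp, conj_eq_of_nrd_eq ((isRefl_mul (ne_zero_of_pos hs)).2 hg)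
    ((isRefl_mul (ne_zero_of_pos hs')).2 hg') (by rw [nrd_smul, nrd_smul, hss])
    hsq'.nrd_ne_zero hP hp.nrd_ne_zero⟩

end RealSphere

/-! ### Conjugacy of orientation reversing involutions -/

namespace RealSphere

open scoped QuadraticAlgebra

open Polynomial

/-- Polynomial approximation of a square root of a nonvanishing complex function on `[-1, 1]`. -/
theorem exists_sq_approx {u v : ℝ[X]}
    (h : ∀ a ∈ Set.Icc (-1 : ℝ) 1, 0 < u.eval a ^ 2 + v.eval a ^ 2) :
    ∃ c d : ℝ[X], ∀ a ∈ Set.Icc (-1 : ℝ) 1,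
      0 < (c.eval a ^ 2 - d.eval a ^ 2) * u.eval a + 2 * c.eval a * d.eval a * v.eval a := by
  -- The function u + iv is extended to ℝ by its end values. It has no zeros, and on the simply
  -- connected line it has a continuous square root s.
  let τ : ℝ → ℝ := fun a => Set.projIcc (-1 : ℝ) 1 (by norm_num) a
  have hτ : Continuous τ := continuous_subtype_val.comp continuous_projIcc
  have hτm : ∀ a, τ a ∈ Set.Icc (-1 : ℝ) 1 := fun a => Subtype.coe_prop _
  have hτe : ∀ a ∈ Set.Icc (-1 : ℝ) 1, τ a = a := fun a ha => by
    simp only [τ, Set.projIcc_of_mem (by norm_num) ha]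
  have hw : Continuous fun a => (⟨u.eval (τ a), v.eval (τ a)⟩ : ℂ) := by
    have : (fun a => (⟨u.eval (τ a), v.eval (τ a)⟩ : ℂ)) =
        fun a => ((u.eval (τ a) : ℝ) : ℂ) + (v.eval (τ a) : ℝ) * Complex.I := by
      funext a
      apply Complex.ext <;> simp
    rw [this]
    fun_prop
  obtain ⟨s, hs, hsq⟩ := Complex.exists_continuousOn_pow_eq (U := Set.univ)
    (g := fun a : ℝ => (⟨u.eval (τ a), v.eval (τ a)⟩ : ℂ)) (by
      
      have : SimplyConnectedSpace (Set.univ : Set ℝ) :=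
        have : ContractibleSpace (Set.univ : Set ℝ) :=
          (Homeomorph.Set.univ ℝ).contractibleSpace
        inferInstance
      exact this) isOpen_univ
    hw.continuousOn (by
      rintro ⟨a, -, ha⟩
      have h1 := congrArg Complex.re ha
      have h2 := congrArg Complex.im ha
      simp only [Complex.zero_re, Complex.zero_im] at h1 h2
      have := h _ (hτm a)
      rw [h1, h2] at this
      simp at this) (n := 2) two_ne_zero
  have hsc : Continuous s := continuousOn_univ.1 hs
  have hre : ∀ a ∈ Set.Icc (-1 : ℝ) 1, (s a).re ^ 2 - (s a).im ^ 2 = u.eval a := fun a ha => by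
    have := congrArg Complex.re (hsq a)
    simp only [hτe a ha, pow_two, Complex.mul_re] at this
    linear_combination this
  have him : ∀ a ∈ Set.Icc (-1 : ℝ) 1, 2 * ((s a).re * (s a).im) = v.eval a := fun a ha => by
    have := congrArg Complex.im (hsq a)
    simp only [hτe a ha, pow_two, Complex.mul_im] at this
    linear_combination this
  have hcr : Continuous fun a => (s a).re := Complex.continuous_re.comp hsc
  have hci : Continuous fun a => (s a).im := Complex.continuous_im.comp hsc
  have hpos : ∀ a ∈ Set.Icc (-1 : ℝ) 1, 0 < (s a).re ^ 2 + (s a).im ^ 2 := by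
    intro a ha
    have h1 := h a ha
    rw [← hre a ha, ← him a ha] at h1
    have : 0 < ((s a).re ^ 2 + (s a).im ^ 2) ^ 2 := by linear_combination h1
    refine lt_of_le_of_ne (by positivity) fun h0 => ?_
    rw [← h0] at this
    simp at this
  obtain ⟨m, hm, hmin⟩ : ∃ m > 0, ∀ a ∈ Set.Icc (-1 : ℝ) 1, m ^ 2 ≤ (s a).re ^ 2 + (s a).im ^ 2 := by
    obtain ⟨a, ha, hmin⟩ := isCompact_Icc.exists_isMinOn (s := Set.Icc (-1 : ℝ) 1) ⟨0, by simp⟩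
      (f := fun a => (s a).re ^ 2 + (s a).im ^ 2) (by fun_prop)
    refine ⟨√((s a).re ^ 2 + (s a).im ^ 2), Real.sqrt_pos.2 (hpos a ha), fun b hb => ?_⟩
    rw [Real.sq_sqrt (hpos a ha).le]
    exact hmin hb
  obtain ⟨c, hc⟩ := exists_polynomial_near_of_continuousOn (-1) 1 _ hcr.continuousOn (m / 16)
    (by positivity)
  obtain ⟨d, hd⟩ := exists_polynomial_near_of_continuousOn (-1) 1 _ hci.continuousOn (m / 16)
    (by positivity)
  refine ⟨c, d, fun a ha => ?_⟩
  have h1 := abs_lt.1 (hc a ha)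
  have h2 := abs_lt.1 (hd a ha)
  have h3 := hmin a ha
  rw [← hre a ha, ← him a ha]
  generalize (s a).re = x at *
  generalize (s a).im = y at *
  obtain ⟨e, he⟩ : ∃ e, c.eval a = x + e := ⟨c.eval a - x, by ring⟩
  obtain ⟨f, hf⟩ : ∃ f, d.eval a = y + f := ⟨d.eval a - y, by ring⟩
  rw [he, add_sub_cancel_left] at h1
  rw [hf, add_sub_cancel_left] at h2
  rw [he, hf]
  have hn : 0 < x ^ 2 + y ^ 2 := lt_of_lt_of_le (by positivity) h3
  have he2 : e ^ 2 ≤ (m / 16) ^ 2 := sq_le_sq' h1.1.le h1.2.le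
  have hf2 : f ^ 2 ≤ (m / 16) ^ 2 := sq_le_sq' h2.1.le h2.2.le
  -- For c + id = s + ε the error bound gives |εs̄| ≤ |s|²/4. So (c + id)s̄ has argument less than
  -- π/4, and its square has positive real part; this is the product of the two factors below.
  have hpq : (e * x + f * y) ^ 2 + (f * x - e * y) ^ 2 ≤ ((x ^ 2 + y ^ 2) / 4) ^ 2 := by
    have : (e ^ 2 + f ^ 2) * (x ^ 2 + y ^ 2) ≤ (x ^ 2 + y ^ 2) / 16 * (x ^ 2 + y ^ 2) :=
      mul_le_mul_of_nonneg_right (by nlinarith) hn.le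
    linear_combination this
  have hp := abs_le.1 (abs_le_of_sq_le_sq (a := e * x + f * y) (b := (x ^ 2 + y ^ 2) / 4)
    (by nlinarith [sq_nonneg (f * x - e * y)]) (by positivity))
  have hq := abs_le.1 (abs_le_of_sq_le_sq (a := f * x - e * y) (b := (x ^ 2 + y ^ 2) / 4)
    (by nlinarith [sq_nonneg (e * x + f * y)]) (by positivity))
  have k1 : 0 < (x ^ 2 + y ^ 2) + (e * x + f * y) + (f * x - e * y) := by linarith
  have k2 : 0 < (x ^ 2 + y ^ 2) + (e * x + f * y) - (f * x - e * y) := by linarith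
  linear_combination mul_pos k1 k2

theorem nrd_spacelike (α β γ : ℝ[X]) : nrd ((1 - X ^ 2) * α) β γ =
    -(1 - X ^ 2) * (β ^ 2 + γ ^ 2 - (1 - X ^ 2) * α ^ 2) := by
  unfold nrd; ring

theorem IsSpacelike.nrd_ne_zero {α β γ : ℝ[X]} (h : IsSpacelike α β γ) :
    nrd ((1 - X ^ 2) * α) β γ ≠ 0 := by
  rw [nrd_spacelike]
  intro h0
  have h1 := h 0 (by simp)
  have := congrArg (eval 0) h0
  simp at this h1
  linarith

theorem IsSpacelike.eval_pos {α β γ : ℝ[X]} (h : IsSpacelike α β γ) :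
    ∀ a ∈ Set.Icc (-1 : ℝ) 1, 0 < (β ^ 2 + γ ^ 2 - (1 - X ^ 2) * α ^ 2).eval a := by
  intro a ha
  simpa using h a ha

/-- An orientation reversing involution is conjugate to one that exchanges the poles of each
circle. -/
theorem exists_conj_of_isSpacelike {g g' : Bir} {α β γ β' γ' r r' : ℝ[X]}
    (hg : IsRefl g ((1 - X ^ 2) * α) β γ) (hg' : IsRefl g' 0 β' γ') (hq : IsSpacelike α β γ)
    (hq' : IsSpacelike 0 β' γ') (hr : r ≠ 0)
    (h : r ^ 2 * (β ^ 2 + γ ^ 2 - (1 - X ^ 2) * α ^ 2) = r' ^ 2 * (β' ^ 2 + γ' ^ 2)) :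
    ∃ P ∈ autRealOverPi, P * g * P⁻¹ = g' := by
  obtain ⟨s, s', hs, hs', hss⟩ := exists_pos_of_sq_mul_eq hq.eval_pos (f' := β' ^ 2 + γ' ^ 2)
    (fun a ha => by simpa using hq'.eval_pos a ha) hr h
  have hb : ∀ a ∈ Set.Icc (-1 : ℝ) 1, 0 < β.eval a ^ 2 + γ.eval a ^ 2 := fun a ha => by
    have h1 := hq a ha
    have hδ : 0 ≤ 1 - a ^ 2 := by nlinarith [ha.1, ha.2]
    nlinarith [mul_nonneg hδ (sq_nonneg (α.eval a))]
  have hb' : ∀ a ∈ Set.Icc (-1 : ℝ) 1, 0 < β'.eval a ^ 2 + γ'.eval a ^ 2 := fun a ha => by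
    simpa using hq' a ha
  -- Here u + iv = bb'. Up to a scalar factor, conjugation by the reflection in (c + id)j sends b to
  -- (c + id)²b̄, whose inner product with b' is Re((c + id)²·conj(bb')) > 0.
  obtain ⟨c, d, hcd⟩ := exists_sq_approx (u := β * β' - γ * γ') (v := β * γ' + γ * β') fun a ha => by
    have := mul_pos (hb a ha) (hb' a ha)
    simp only [eval_sub, eval_mul, eval_add]
    linear_combination this
  have hcd0 : ∀ a ∈ Set.Icc (-1 : ℝ) 1, 0 < (c ^ 2 + d ^ 2).eval a := fun a ha => by
    simp only [eval_add, eval_pow]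
    refine lt_of_le_of_ne (by positivity) fun h0 => ?_
    have hc0 : c.eval a = 0 := by nlinarith [sq_nonneg (c.eval a), sq_nonneg (d.eval a)]
    have hd0 : d.eval a = 0 := by nlinarith [sq_nonneg (c.eval a), sq_nonneg (d.eval a)]
    have := hcd a ha
    simp [hc0, hd0] at this
  have hqQ : IsSpacelike 0 c d := fun a ha => by simpa using hcd0 a ha
  have hNQ : nrd 0 c d ≠ 0 := by simpa using hqQ.nrd_ne_zero
  obtain ⟨Q, hQ⟩ := exists_isRefl_of_nrd_ne_zero hNQ
  have hQm : Q ∈ autRealOverPi :=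
    (IsRefl.mem_autRealOverPi_of_isSpacelike (α := 0) (by simpa using hQ) hqQ).1
  have hQinv : Q⁻¹ = Q := inv_eq_of_mul_eq_one_left (hQ.mul_self (ne_zero_of_nrd_ne_zero hNQ))
  set β₁ := (c ^ 2 - d ^ 2) * β + 2 * c * d * γ with hβ₁
  set γ₁ := 2 * c * d * β - (c ^ 2 - d ^ 2) * γ with hγ₁
  have hδ0 : (1 - X ^ 2 : ℝ[X]) ≠ 0 := fun h0 => by simpa using congrArg (eval 0) h0
  have hg₁ : IsRefl (Q * g * Q) ((1 - X ^ 2) * (-(c ^ 2 + d ^ 2) * α)) β₁ γ₁ := by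
    rw [← isRefl_mul hδ0]
    convert hQ.conj hg using 1 <;> simp only [nrd, nrdB, hβ₁, hγ₁] <;> ring
  set e := c ^ 2 + d ^ 2 with he
  have hsq₁ : IsRefl (Q * g * Q) (s * ((1 - X ^ 2) * (-e * α))) (s * β₁) (s * γ₁) :=
    (isRefl_mul (ne_zero_of_pos hs)).2 hg₁
  have hse : s' * e ≠ 0 := mul_ne_zero (ne_zero_of_pos hs') (ne_zero_of_pos hcd0)
  have hsq' : IsRefl g' (s' * e * 0) (s' * e * β') (s' * e * γ') := (isRefl_mul hse).2 hg'
  -- As the second quaternion has no i-component, the form at the sum consists of the two positive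
  -- norms and twice the inner product of the j-parts.
  have hp : IsSpacelike (s * (-e * α)) (s * β₁ + s' * e * β') (s * γ₁ + s' * e * γ') := by
    intro a ha
    have h1 := hq a ha
    have h2 := hb' a ha
    have h3 := hcd a ha
    have h4 := hs a ha
    have h5 := hs' a ha
    have h6 := hcd0 a ha
    have h7 : e.eval a = c.eval a ^ 2 + d.eval a ^ 2 := by simp [he]
    simp only [hβ₁, hγ₁, eval_sub, eval_mul, eval_add, eval_neg, eval_pow, eval_ofNat] at h3 h6 ⊢
    rw [h7] at h6 ⊢
    have k1 := mul_pos (mul_pos (pow_pos h4 2) (pow_pos h6 2)) h1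
    have k2 := mul_pos (mul_pos (pow_pos h5 2) (pow_pos h6 2)) h2
    have k3 := mul_pos (mul_pos (mul_pos h4 h5) h6) h3
    linear_combination k1 + k2 + 2 * k3
  have hadd : s * ((1 - X ^ 2) * (-e * α)) + s' * e * 0 = (1 - X ^ 2) * (s * (-e * α)) := by ring
  have hpN := hp.nrd_ne_zero
  obtain ⟨P, hP⟩ := exists_isRefl_of_nrd_ne_zero hpN
  have hPm := (hP.mem_autRealOverPi_of_isSpacelike hp).1
  rw [← hadd] at hP hpN
  have hN' : nrd (s' * e * 0) (s' * e * β') (s' * e * γ') ≠ 0 := by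
    rw [nrd_smul]
    refine mul_ne_zero (pow_ne_zero 2 hse) ?_
    simpa using hq'.nrd_ne_zero
  have := conj_eq_of_nrd_eq hsq₁ hsq' (by
    rw [nrd_smul, nrd_smul]
    simp only [nrd, hβ₁, hγ₁, he]
    linear_combination -(1 - X ^ 2) * (c ^ 2 + d ^ 2) ^ 2 * hss) hN' hP hpN
  refine ⟨P * Q, mul_mem hPm hQm, ?_⟩
  rw [← this, mul_inv_rev, hQinv]
  group

end RealSphere

/-! ### Sums of two squares and the values of the norm -/

namespace RealSphere

open scoped QuadraticAlgebra

open Polynomial Filter Topology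

theorem nonneg_of_nonneg_ne {f : ℝ[X]} {r : ℝ} (h : ∀ a, a ≠ r → 0 ≤ f.eval a) (a : ℝ) :
    0 ≤ f.eval a := by
  have hd : Dense ({r}ᶜ : Set ℝ) := dense_compl_singleton r
  exact closure_minimal (fun b hb => h b hb) (isClosed_le continuous_const f.continuous) (hd a)

/-- A real polynomial without negative values is a sum of two squares. -/
theorem exists_eq_sq_add_sq (f : ℝ[X]) (hf : ∀ a, 0 ≤ f.eval a) :
    ∃ β γ : ℝ[X], f = β ^ 2 + γ ^ 2 := by
  induction hn : f.natDegree using Nat.strong_induction_on generalizing f with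
  | _ n ih =>
    by_cases hd : f.natDegree = 0
    · obtain ⟨c, rfl⟩ := natDegree_eq_zero.1 hd
      have hc : 0 ≤ c := by simpa using hf 0
      exact ⟨C √c, 0, by rw [← C_pow, Real.sq_sqrt hc]; ring⟩
    have hf0 : f ≠ 0 := by rintro rfl; simp at hd
    obtain ⟨w, hw⟩ := IsAlgClosed.exists_aeval_eq_zero ℂ f (by
      rw [degree_eq_natDegree hf0]; exact_mod_cast hd)
    by_cases him : w.im = 0
    · have hroot : f.IsRoot w.re := by
        have hw' : w = algebraMap ℝ ℂ w.re := by
          apply Complex.ext <;> simp [him]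
        rw [hw', aeval_algebraMap_apply] at hw
        simpa using hw
      obtain ⟨f₁, rfl⟩ := dvd_iff_isRoot.2 hroot
      -- A real zero has even multiplicity, since f does not change sign there.
      have h1 : f₁.IsRoot w.re := by
        have hge : 0 ≤ f₁.eval w.re := by
          have hcl : w.re ∈ closure (Set.Ioi w.re) := by simp
          refine closure_minimal (fun b hb => ?_) (isClosed_le continuous_const f₁.continuous) hcl
          have := hf b
          simp only [eval_mul, eval_sub, eval_X, eval_C] at this
          exact nonneg_of_mul_nonneg_right this (sub_pos.2 hb)
        have hle : f₁.eval w.re ≤ 0 := by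
          have hcl : w.re ∈ closure (Set.Iio w.re) := by simp
          refine closure_minimal (fun b hb => ?_) (isClosed_le f₁.continuous continuous_const) hcl
          have := hf b
          simp only [eval_mul, eval_sub, eval_X, eval_C] at this
          have hb' : b - w.re < 0 := sub_neg.2 hb
          by_contra hcon
          exact absurd this (not_le.2 (mul_neg_of_neg_of_pos hb' (not_le.1 hcon)))
        exact le_antisymm hle hge
      obtain ⟨f₂, rfl⟩ := dvd_iff_isRoot.2 h1
      obtain ⟨β, γ, rfl⟩ := ih f₂.natDegree (by
        rw [← hn, natDegree_mul (X_sub_C_ne_zero _) (right_ne_zero_of_mul hf0),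
          natDegree_mul (X_sub_C_ne_zero _) (right_ne_zero_of_mul (right_ne_zero_of_mul hf0)),
          natDegree_X_sub_C]
        omega) f₂ (nonneg_of_nonneg_ne (r := w.re) fun a ha => by
          have := hf a
          simp only [eval_mul, eval_sub, eval_X, eval_C] at this
          have hpos : 0 < (a - w.re) ^ 2 := by
            have := sub_ne_zero.2 ha
            positivity
          rw [← mul_assoc, ← pow_two] at this
          exact nonneg_of_mul_nonneg_right this hpos) rfl
      exact ⟨(X - C w.re) * β, (X - C w.re) * γ, by ring⟩
    · obtain ⟨f₁, rfl⟩ := quadratic_dvd_of_aeval_eq_zero_im_ne_zero f hw him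
      have hp : ∀ a, (X ^ 2 - C (2 * w.re) * X + C (‖w‖ ^ 2)).eval a = (a - w.re) ^ 2 + w.im ^ 2 := by
        intro a
        simp only [eval_add, eval_sub, eval_mul, eval_pow, eval_X, eval_C]
        rw [← Complex.normSq_eq_norm_sq, Complex.normSq_apply]
        ring
      have hdeg : (X ^ 2 - C (2 * w.re) * X + C (‖w‖ ^ 2)).natDegree = 2 := by compute_degree!
      obtain ⟨β, γ, rfl⟩ := ih f₁.natDegree (by
        rw [← hn, natDegree_mul (left_ne_zero_of_mul hf0) (right_ne_zero_of_mul hf0), hdeg]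
        omega) f₁ (fun a => by
          have := hf a
          rw [eval_mul, hp] at this
          exact nonneg_of_mul_nonneg_right this (by positivity)) rfl
      have hpe : X ^ 2 - C (2 * w.re) * X + C (‖w‖ ^ 2) = (X - C w.re) ^ 2 + C w.im ^ 2 := by
        rw [← Complex.normSq_eq_norm_sq, Complex.normSq_apply]
        simp only [map_add, map_mul, map_ofNat]
        ring
      -- The product of two sums of two squares, as norms of Gaussian-type polynomials.
      exact ⟨(X - C w.re) * β - C w.im * γ, (X - C w.re) * γ + C w.im * β, by rw [hpe]; ring⟩

theorem exists_pos_le_eval {f : ℝ[X]} (hf : ∀ a, 0 < f.eval a) : ∃ m > 0, ∀ a, m ≤ f.eval a := by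
  obtain ⟨b, hb⟩ := f.exists_forall_norm_le
  refine ⟨f.eval b, hf b, fun a => ?_⟩
  have := hb a
  rwa [Real.norm_eq_abs, Real.norm_eq_abs, abs_of_pos (hf b), abs_of_pos (hf a)] at this

/-- Every positive polynomial is, up to a square, the norm of an orientation preserving
involution. -/
theorem exists_isTimelike_nrd_eq {f : ℝ[X]} (hf : ∀ a, 0 < f.eval a) :
    ∃ α β γ m : ℝ[X], m ≠ 0 ∧ IsTimelike α β γ ∧ nrd α β γ = m ^ 2 * f := by
  set u := √(f.eval 1) with hu
  set v := √(f.eval (-1)) with hv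
  have hu2 : u ^ 2 = f.eval 1 := Real.sq_sqrt (hf 1).le
  have hv2 : v ^ 2 = f.eval (-1) := Real.sq_sqrt (hf _).le
  have hu0 : 0 < u := Real.sqrt_pos.2 (hf _)
  have hv0 : 0 < v := Real.sqrt_pos.2 (hf _)
  -- This is the affine function with l(±1) = √f(±1). It is positive on [-1, 1], and z² - 1 divides
  -- f - l². It becomes the component α, whose square has to agree with the norm at the poles.
  set l : ℝ[X] := C ((u - v) / 2) * X + C ((u + v) / 2) with hl
  have hle : ∀ a, l.eval a = (u - v) / 2 * a + (u + v) / 2 := fun a => by simp [hl]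
  obtain ⟨e, he⟩ : ∃ e : ℝ[X], f - l ^ 2 = (X ^ 2 - 1) * e := by
    have h1 : (f - l ^ 2).IsRoot 1 := by
      simp only [IsRoot, eval_sub, eval_pow, hle, ← hu2]; ring
    obtain ⟨e₁, he₁⟩ := dvd_iff_isRoot.2 h1
    have h2 : e₁.IsRoot (-1) := by
      have := congrArg (eval (-1)) he₁
      simp only [eval_sub, eval_pow, hle, ← hv2, eval_mul, eval_X, eval_C] at this
      simp only [IsRoot]
      linarith
    obtain ⟨e₂, rfl⟩ := dvd_iff_isRoot.2 h2
    exact ⟨e₂, by rw [he₁]; simp only [map_one, map_neg]; ring⟩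
  have hee : ∀ a, f.eval a - l.eval a ^ 2 = (a ^ 2 - 1) * e.eval a := fun a => by
    simpa using congrArg (eval a) he
  -- The function s is 1 at ±1, smaller between and larger outside, and s - 1 = (z² - 1)/2. By the
  -- geometric series G n is (s²ⁿf - l²)/(z² - 1), and it increases with n. Once it is positive, it
  -- is a sum β² + γ², and then (l, β, γ) has the norm s²ⁿf.
  set s : ℝ[X] := C (1 / 2) * (1 + X ^ 2) with hs
  have hse : ∀ a, s.eval a = (1 + a ^ 2) / 2 := fun a => by simp [hs]; ring
  set G : ℕ → ℝ[X] := fun n => C (1 / 2) * f * ∑ k ∈ Finset.range (2 * n), s ^ k + e with hG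
  have hGe : ∀ n a, (G n).eval a =
      f.eval a / 2 * ∑ k ∈ Finset.range (2 * n), s.eval a ^ k + e.eval a := fun n a => by
    simp only [hG, eval_add, eval_mul, eval_C, eval_finsetSum, eval_pow]; ring
  have hGs : ∀ n, (X ^ 2 - 1) * G n = (s ^ n) ^ 2 * f - l ^ 2 := by
    intro n
    have h1 := geom_sum_mul s (2 * n)
    have h2 : s - 1 = C (1 / 2) * (X ^ 2 - 1) := by
      rw [hs]
      have : (1 : ℝ[X]) = C (1 / 2) * 2 := by
        rw [← C_ofNat, ← C_mul]; norm_num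
      linear_combination -this
    rw [h2] at h1
    simp only [hG]
    rw [← pow_mul, mul_comm n 2]
    linear_combination f * h1 - he
  have hGes : ∀ n a, (a ^ 2 - 1) * (G n).eval a = (s.eval a ^ n) ^ 2 * f.eval a - l.eval a ^ 2 :=
    fun n a => by simpa using congrArg (eval a) (hGs n)
  have hs0 : ∀ a, 0 < s.eval a := fun a => by rw [hse]; positivity
  have hmono : ∀ a, Monotone fun n => (G n).eval a := by
    intro a m n hmn
    simp only [hGe]
    gcongr
    · exact (half_pos (hf a)).le
    · exact fun i _ _ => pow_nonneg (hs0 a).le i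
  obtain ⟨m, hm, hmf⟩ := exists_pos_le_eval hf
  have hsum : ∀ n a, 1 ≤ a ^ 2 → m * n ≤ f.eval a / 2 * ∑ k ∈ Finset.range (2 * n), s.eval a ^ k := by
    intro n a ha
    have h1 : ((2 * n : ℕ) : ℝ) ≤ ∑ k ∈ Finset.range (2 * n), s.eval a ^ k := by
      calc ((2 * n : ℕ) : ℝ) = ∑ k ∈ Finset.range (2 * n), (1 : ℝ) := by simp
        _ ≤ _ := Finset.sum_le_sum fun k _ => one_le_pow₀ (by rw [hse]; linarith)
    calc m * n = m / 2 * ((2 * n : ℕ) : ℝ) := by push_cast; ring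
      _ ≤ _ := mul_le_mul (by linarith [hmf a]) h1 (by positivity) (half_pos (hf a)).le
  -- Each point has some n with G n > 0: for |z| < 1 because s²ⁿf tends to 0 and l > 0, for |z| ≥ 1
  -- because the geometric sum is at least 2n. By monotonicity and compactness one n serves the
  -- whole interval [-2, 2].
  obtain ⟨N₁, hN₁⟩ : ∃ n, Set.Icc (-2 : ℝ) 2 ⊆ {a | 0 < (G n).eval a} := by
    refine isCompact_Icc.elim_directed_cover (fun n => {a | 0 < (G n).eval a})
      (fun n => isOpen_lt continuous_const (G n).continuous) (fun a _ => ?_)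
      (directed_of_isDirected_le fun i j hij a ha => lt_of_lt_of_le ha (hmono a hij))
    rw [Set.mem_iUnion]
    by_cases ha : 1 ≤ a ^ 2
    · obtain ⟨n, hn⟩ := exists_nat_gt (-e.eval a / m)
      refine ⟨n, ?_⟩
      change 0 < (G n).eval a
      rw [hGe]
      have := hsum n a ha
      rw [div_lt_iff₀ hm] at hn
      linarith
    · have ha' : a ^ 2 < 1 := not_le.1 ha
      have hl0 : 0 < l.eval a := by
        rw [hle]
        have h1 : -1 < a := by nlinarith
        have h2 : a < 1 := by nlinarith
        nlinarith
      have ht : Tendsto (fun n : ℕ => (s.eval a ^ n) ^ 2 * f.eval a) atTop (𝓝 0) := by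
        have := (tendsto_pow_atTop_nhds_zero_of_lt_one (hs0 a).le (r := s.eval a)
          (by rw [hse]; linarith))
        simpa using (this.pow 2).mul_const (f.eval a)
      obtain ⟨n, hn⟩ := (ht.eventually_lt_const (pow_pos hl0 2)).exists
      refine ⟨n, ?_⟩
      change 0 < (G n).eval a
      have := hGes n a
      by_contra hcon
      nlinarith [mul_nonneg (sub_nonneg.2 ha'.le) (sub_nonneg.2 (not_lt.1 hcon))]
  -- For |z| > 2 the quotient e = (f - l²)/(z² - 1) is bounded below by -((u - v)² + (u + v)²),
  -- since l² grows only quadratically; the other summand of G n is at least mn.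
  obtain ⟨N₂, hN₂⟩ := exists_nat_gt (((u - v) ^ 2 + (u + v) ^ 2) / m)
  have hpos : ∀ a, 0 < (G (max N₁ N₂)).eval a := by
    intro a
    by_cases ha : a ∈ Set.Icc (-2 : ℝ) 2
    · exact lt_of_lt_of_le (hN₁ ha) (hmono a (le_max_left _ _))
    · have ha4 : 4 ≤ a ^ 2 := by
        by_contra hcon
        exact ha ⟨by nlinarith, by nlinarith⟩
      refine lt_of_lt_of_le ?_ (hmono a (le_max_right _ _))
      simp only [hGe]
      have h1 := hsum N₂ a (by linarith)
      rw [div_lt_iff₀ hm] at hN₂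
      have h2 := hee a
      rw [hle] at h2
      have h3 := hf a
      have h4 : 0 < (a ^ 2 - 1) * (e.eval a + ((u - v) ^ 2 + (u + v) ^ 2)) := by
        have k1 : 0 ≤ ((u - v) / 2 * a - (u + v) / 2) ^ 2 := sq_nonneg _
        have k2 : 0 ≤ (a ^ 2 - 4) * (u - v) ^ 2 := mul_nonneg (by linarith) (sq_nonneg _)
        have k3 : 0 ≤ (a ^ 2 - 4) * (u + v) ^ 2 := mul_nonneg (by linarith) (sq_nonneg _)
        nlinarith [sq_nonneg (u - v), sq_nonneg (u + v)]
      have h5 := (mul_pos_iff_of_pos_left (by linarith : 0 < a ^ 2 - 1)).1 h4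
      linarith
  obtain ⟨β, γ, hβγ⟩ := exists_eq_sq_add_sq _ fun a => (hpos a).le
  have hN : nrd l β γ = (s ^ max N₁ N₂) ^ 2 * f := by
    rw [nrd, ← hβγ]
    linear_combination hGs (max N₁ N₂)
  refine ⟨l, β, γ, s ^ max N₁ N₂, pow_ne_zero _ ?_, fun a _ => ?_, hN⟩
  · intro h0
    have := hs0 0
    simp [h0] at this
  · rw [← eval_nrd, hN]
    simp only [eval_mul, eval_pow]
    have := hs0 a
    have := hf a
    positivity

end RealSphere

/-! ### Quadratic extensions of the rational function field -/

namespace RealSphere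

open scoped QuadraticAlgebra

open Polynomial

/-- The polynomial `f` is not a square in `ℝ(X)`. -/
def NotSq (f : ℝ[X]) : Prop := ∀ a b : ℝ[X], a ^ 2 = b ^ 2 * f → b = 0

theorem NotSq.ne_zero {f : ℝ[X]} (h : NotSq f) : f ≠ 0 := by
  rintro rfl
  exact one_ne_zero (h 0 1 (by simp))

theorem NotSq.of_eval_neg {f : ℝ[X]} {s : Set ℝ} (hs : s.Infinite) (h : ∀ a ∈ s, f.eval a < 0) :
    NotSq f := by
  intro a b hab
  refine Polynomial.eq_zero_of_infinite_isRoot b (hs.mono fun c hc => ?_)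
  have h1 := congrArg (eval c) hab
  simp only [eval_pow, eval_mul] at h1
  have h2 := h c hc
  by_contra hb
  have : 0 < b.eval c ^ 2 := by
    have : b.eval c ≠ 0 := hb
    positivity
  nlinarith [sq_nonneg (a.eval c)]

section

variable {M : Type*} [Field M]

/-- `M = ℝ(ζ)(√f(ζ))`, where the field `M` is an extension of `ℝ` through `ρ`. -/
def IsQuadExt (ρ : ℝ →+* M) (ζ : M) (f : ℝ[X]) : Prop :=
  (∀ p : ℝ[X], p.eval₂ ρ ζ = 0 → p = 0) ∧ ∃ u : M, u ^ 2 = f.eval₂ ρ ζ ∧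
    ∀ m : M, ∃ a b d : ℝ[X], d ≠ 0 ∧ m * d.eval₂ ρ ζ = a.eval₂ ρ ζ + b.eval₂ ρ ζ * u

theorem eq_zero_of_add_mul_eq_zero {ρ : ℝ →+* M} {ζ u : M} {f : ℝ[X]} (hf : NotSq f)
    (hζ : ∀ p : ℝ[X], p.eval₂ ρ ζ = 0 → p = 0) (hu : u ^ 2 = f.eval₂ ρ ζ) {a b : ℝ[X]}
    (h : a.eval₂ ρ ζ + b.eval₂ ρ ζ * u = 0) : a = 0 ∧ b = 0 := by
  have h1 : a ^ 2 = b ^ 2 * f := by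
    apply sub_eq_zero.1
    apply hζ
    rw [eval₂_sub, eval₂_mul, eval₂_pow, eval₂_pow, ← hu]
    linear_combination (a.eval₂ ρ ζ - b.eval₂ ρ ζ * u) * h
  have hb := hf a b h1
  refine ⟨?_, hb⟩
  rw [hb] at h1
  simpa using h1

theorem IsQuadExt.of_sq_mul_eq {ρ : ℝ →+* M} {ζ : M} {f f' r r' : ℝ[X]} (h : IsQuadExt ρ ζ f)
    (hr : r ≠ 0) (hr' : r' ≠ 0) (e : r ^ 2 * f = r' ^ 2 * f') : IsQuadExt ρ ζ f' := by
  obtain ⟨hζ, u, hu, hm⟩ := h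
  have h0 : r.eval₂ ρ ζ ≠ 0 := fun h0 => hr (hζ _ h0)
  have h0' : r'.eval₂ ρ ζ ≠ 0 := fun h0 => hr' (hζ _ h0)
  refine ⟨hζ, r.eval₂ ρ ζ * u / r'.eval₂ ρ ζ, ?_, fun m => ?_⟩
  · have := congrArg (eval₂ ρ ζ) e
    simp only [eval₂_mul, eval₂_pow] at this
    field_simp
    rw [hu, this]
  · obtain ⟨a, b, d, hd, hm⟩ := hm m
    refine ⟨a * r, b * r', d * r, mul_ne_zero hd hr, ?_⟩
    simp only [eval₂_mul]
    field_simp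
    linear_combination hm

/-- Kummer theory in degree two: write the image of u as (a + bu')/d and square. The mixed term
forces ab = 0; b = 0 would make f a square, so a = 0 and d²f = b²f'. A homomorphism suffices for
this. -/
theorem IsQuadExt.exists_sq_mul_eq {M' : Type*} [Field M'] {ρ : ℝ →+* M} {ζ : M} {ρ' : ℝ →+* M'}
    {ζ' : M'} {f f' : ℝ[X]} (hf : NotSq f) (hf' : NotSq f') (h : IsQuadExt ρ ζ f)
    (h' : IsQuadExt ρ' ζ' f') (e : M →+* M') (hρ : e.comp ρ = ρ') (hζ : e ζ = ζ') :
    ∃ r r' : ℝ[X], r ≠ 0 ∧ r' ≠ 0 ∧ r ^ 2 * f = r' ^ 2 * f' := by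
  obtain ⟨h1, u, hu, -⟩ := h
  obtain ⟨h1', u', hu', hm⟩ := h'
  obtain ⟨a, b, d, hd, h2⟩ := hm (e u)
  have h3 : (e u) ^ 2 = f.eval₂ ρ' ζ' := by
    rw [← map_pow, hu, hom_eval₂, hρ, hζ]
  obtain ⟨h4, h5⟩ := eq_zero_of_add_mul_eq_zero hf' h1' hu' (a := a ^ 2 + b ^ 2 * f' - d ^ 2 * f)
    (b := 2 * a * b) (by
      simp only [eval₂_sub, eval₂_add, eval₂_mul, eval₂_pow, eval₂_ofNat, ← h3, ← hu']
      linear_combination -(e u * d.eval₂ ρ' ζ' + (a.eval₂ ρ' ζ' + b.eval₂ ρ' ζ' * u')) * h2)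
  have h6 : a * b = 0 := by
    have : 2 * (a * b) = 0 := by rw [← h5]; ring
    simpa using this
  rcases mul_eq_zero.1 h6 with rfl | rfl
  · have h7 : d ^ 2 * f = b ^ 2 * f' := by linear_combination -h4
    refine ⟨d, b, hd, ?_, h7⟩
    rintro rfl
    simp [hd, hf.ne_zero] at h7
  · exact absurd (hf a d (by linear_combination h4)) hd

theorem IsQuadExt.map {M' : Type*} [Field M'] {ρ : ℝ →+* M} {ζ : M} {f : ℝ[X]}
    (h : IsQuadExt ρ ζ f) (e : M ≃+* M') : IsQuadExt ((e : M →+* M').comp ρ) (e ζ) f := by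
  obtain ⟨hζ, u, hu, hm⟩ := h
  have he : ∀ p : ℝ[X], p.eval₂ ((e : M →+* M').comp ρ) (e ζ) = e (p.eval₂ ρ ζ) := fun p =>
    (hom_eval₂ p ρ (e : M →+* M') ζ).symm
  refine ⟨fun p hp => hζ p (by simpa [he] using hp), e u, by rw [he, ← map_pow, hu], fun m => ?_⟩
  obtain ⟨a, b, d, hd, hm⟩ := hm (e.symm m)
  exact ⟨a, b, d, hd, by
    rw [he, he, he, ← map_mul, ← map_add, ← hm, map_mul, e.apply_symm_apply]⟩

/-- The ring `ℝ[X][√f]`. -/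
abbrev QuadRing (f : ℝ[X]) : Type := AdjoinRoot (X ^ 2 - C f : ℝ[X][X])

theorem QuadRing.exists_eq {f : ℝ[X]} (m : QuadRing f) :
    ∃ a b : ℝ[X], m = algebraMap ℝ[X] (QuadRing f) a +
      algebraMap ℝ[X] (QuadRing f) b * AdjoinRoot.root (X ^ 2 - C f) := by
  obtain ⟨P, rfl⟩ := AdjoinRoot.mk_surjective m
  have hm : (X ^ 2 - C f : ℝ[X][X]).Monic := monic_X_pow_sub_C f two_ne_zero
  have hd : (X ^ 2 - C f : ℝ[X][X]).natDegree = 2 := natDegree_X_pow_sub_C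
  have h1 : AdjoinRoot.mk (X ^ 2 - C f) P = AdjoinRoot.mk (X ^ 2 - C f) (P %ₘ (X ^ 2 - C f)) := by
    rw [AdjoinRoot.mk_eq_mk, modByMonic_eq_sub_mul_div]
    exact ⟨P /ₘ (X ^ 2 - C f), by ring⟩
  have h2 : (P %ₘ (X ^ 2 - C f)).natDegree ≤ 1 := by
    have := natDegree_modByMonic_lt P hm (by
      intro h
      rw [h] at hd
      simp at hd)
    omega
  refine ⟨(P %ₘ (X ^ 2 - C f)).coeff 0, (P %ₘ (X ^ 2 - C f)).coeff 1, ?_⟩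
  rw [h1]
  conv_lhs => rw [eq_X_add_C_of_natDegree_le_one h2]
  simp only [map_add, map_mul, AdjoinRoot.mk_C, AdjoinRoot.mk_X]
  rw [add_comm]
  rfl

/-- The homomorphism on `ℝ[X][√f]` with given values at `X` and `√f`. -/
noncomputable def QuadRing.lift {A : Type*} [CommRing A] {f : ℝ[X]} (φ : ℝ[X] →+* A) (u : A)
    (hu : u ^ 2 = φ f) : QuadRing f →+* A :=
  AdjoinRoot.lift φ u (by simp [hu])

theorem QuadRing.lift_algebraMap {A : Type*} [CommRing A] {f : ℝ[X]} (φ : ℝ[X] →+* A) (u : A)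
    (hu : u ^ 2 = φ f) (a : ℝ[X]) : QuadRing.lift φ u hu (algebraMap _ _ a) = φ a :=
  AdjoinRoot.lift_of _

theorem QuadRing.lift_root {A : Type*} [CommRing A] {f : ℝ[X]} (φ : ℝ[X] →+* A) (u : A)
    (hu : u ^ 2 = φ f) : QuadRing.lift φ u hu (AdjoinRoot.root _) = u :=
  AdjoinRoot.lift_root _

/-- A quadratic extension of `ℝ(X)` is the field of fractions of `ℝ[X][√f]`. -/
theorem IsQuadExt.exists_isFractionRing {ρ : ℝ →+* M} {ζ : M} {f : ℝ[X]} (hf : NotSq f)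
    (h : IsQuadExt ρ ζ f) : ∃ φ : QuadRing f →+* M,
      (∀ a : ℝ[X], φ (algebraMap _ _ a) = a.eval₂ ρ ζ) ∧
        (let := φ.toAlgebra; IsFractionRing (QuadRing f) M) := by
  obtain ⟨hζ, u, hu, hm⟩ := h
  let φ : QuadRing f →+* M := QuadRing.lift (eval₂RingHom ρ ζ) u hu
  have hφa : ∀ a : ℝ[X], φ (algebraMap _ _ a) = a.eval₂ ρ ζ := fun a => QuadRing.lift_algebraMap _ _ _ a
  have hφu : φ (AdjoinRoot.root _) = u := QuadRing.lift_root _ _ _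
  refine ⟨φ, hφa, ?_⟩
  let := φ.toAlgebra
  have hinj : Function.Injective φ := by
    rw [injective_iff_map_eq_zero]
    intro m hm
    obtain ⟨a, b, rfl⟩ := QuadRing.exists_eq m
    rw [map_add, map_mul, hφa, hφa, hφu] at hm
    obtain ⟨rfl, rfl⟩ := eq_zero_of_add_mul_eq_zero hf hζ hu hm
    simp
  have : FaithfulSMul (QuadRing f) M := (faithfulSMul_iff_algebraMap_injective _ _).2 hinj
  refine IsFractionRing.of_field _ _ fun m => ?_
  obtain ⟨a, b, d, hd, hm⟩ := hm m
  refine ⟨algebraMap _ _ a + algebraMap _ _ b * AdjoinRoot.root _, algebraMap _ _ d, ?_⟩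
  change m = φ _ / φ _
  rw [map_add, map_mul, hφa, hφa, hφa, hφu, eq_div_iff (fun h0 => hd (hζ _ h0)), hm]

/-- Quadratic extensions of `ℝ(X)` are determined by `f`. -/
theorem IsQuadExt.exists_ringEquiv {M' : Type*} [Field M'] {ρ : ℝ →+* M} {ζ : M} {ρ' : ℝ →+* M'}
    {ζ' : M'} {f : ℝ[X]} (hf : NotSq f) (h : IsQuadExt ρ ζ f) (h' : IsQuadExt ρ' ζ' f) :
    ∃ e : M ≃+* M', (e : M →+* M').comp ρ = ρ' ∧ e ζ = ζ' := by
  obtain ⟨φ, hφ, h1⟩ := h.exists_isFractionRing hf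
  obtain ⟨φ', hφ', h1'⟩ := h'.exists_isFractionRing hf
  let := φ.toAlgebra
  let := φ'.toAlgebra
  let e : M ≃ₐ[QuadRing f] M' := IsLocalization.algEquiv (nonZeroDivisors (QuadRing f)) M M'
  have he : ∀ a : ℝ[X], e (a.eval₂ ρ ζ) = a.eval₂ ρ' ζ' := fun a => by
    rw [← hφ, ← hφ']
    exact e.commutes _
  refine ⟨e.toRingEquiv, ?_, by simpa using he X⟩
  ext r
  simpa using he (C r)

end

end RealSphere

/-! ### Residue fields of valuation rings over ℝ(z) -/

namespace RealSphere

open scoped QuadraticAlgebra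

open Polynomial

section

variable {V : ValuationSubring FunField}

/-- The inverse of p(z) also belongs to ℝ(z), hence to the valuation ring. -/
theorem valuation_pz (hV : ∀ f ∈ baseField, f ∈ V) {p : ℝ[X]} (hp : p ≠ 0) :
    V.valuation (pz p) = 1 := by
  have h0 : pz p ≠ 0 := by rwa [Ne, map_eq_zero_iff _ pz_injective]
  have h1 := (V.valuation_le_one_iff _).2 (hV _ (pz_mem_baseField p))
  have h2 := (V.valuation_le_one_iff _).2 (hV _ (inv_mem (pz_mem_baseField p)))
  refine le_antisymm h1 ?_
  rw [map_inv₀] at h2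
  exact (inv_le_one₀ (zero_lt_iff.2 ((_root_.map_ne_zero _).2 h0))).1 h2

theorem eq_zero_of_valuation_pz_lt_one (hV : ∀ f ∈ baseField, f ∈ V) {p : ℝ[X]}
    (h : V.valuation (pz p) < 1) : p = 0 := by
  by_contra hp
  exact h.ne (valuation_pz hV hp)

theorem eval₂_pz_mem (hV : ∀ f ∈ baseField, f ∈ V) {l : FunField} (hl : l ∈ V) (P : ℝ[X][X]) :
    P.eval₂ (pz : ℝ[X] →+* FunField) l ∈ V := by
  rw [eval₂_eq_sum_range]
  exact sum_mem fun i _ => mul_mem (hV _ (pz_mem_baseField _)) (pow_mem hl i)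

theorem eval₂_pz_eq (P : ℝ[X][X]) (l : FunField) : P.eval₂ (pz : ℝ[X] →+* FunField) l =
    P.divX.eval₂ (pz : ℝ[X] →+* FunField) l * l + pz (P.coeff 0) := by
  conv_lhs => rw [← P.divX_mul_X_add]
  simp

theorem valuation_mul_lt_one {x y : FunField} (hx : x ∈ V) (hy : V.valuation y < 1) :
    V.valuation (x * y) < 1 := by
  rw [map_mul]
  exact (mul_le_of_le_one_left' ((V.valuation_le_one_iff x).2 hx)).trans_lt hy

theorem mem_of_valuation_lt_one {x : FunField} (hx : V.valuation x < 1) : x ∈ V :=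
  V.mem_of_valuation_le_one x hx.le

theorem valuation_eval₂_sub_lt_one (hV : ∀ f ∈ baseField, f ∈ V) {l : FunField}
    (hl : V.valuation l < 1) (P : ℝ[X][X]) :
    V.valuation (P.eval₂ (pz : ℝ[X] →+* FunField) l - pz (P.coeff 0)) < 1 := by
  rw [eval₂_pz_eq, add_sub_cancel_right]
  exact valuation_mul_lt_one (eval₂_pz_mem hV (mem_of_valuation_lt_one hl) _) hl

/-- Modulo the maximal ideal u is a square root of f. Multiplication by a - bu puts a² - b²f into
the maximal ideal, which contains no nonzero polynomial in z; and f is not a square. -/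
theorem eq_zero_of_valuation_add_mul_lt_one (hV : ∀ f ∈ baseField, f ∈ V) {u : FunField} {f : ℝ[X]}
    (hf : NotSq f) (hu : V.valuation (u ^ 2 - pz f) < 1) {a b : ℝ[X]}
    (h : V.valuation (pz a + pz b * u) < 1) : a = 0 ∧ b = 0 := by
  have huV : u ∈ V := by
    have : u ^ 2 ∈ V := by
      have := add_mem (mem_of_valuation_lt_one hu) (hV _ (pz_mem_baseField f))
      rwa [sub_add_cancel] at this
    rw [← V.valuation_le_one_iff, map_pow] at this
    rw [← V.valuation_le_one_iff]
    exact (pow_le_one_iff two_ne_zero).1 this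
  have hV' : ∀ p, pz p ∈ V := fun p => hV _ (pz_mem_baseField p)
  have h1 : a ^ 2 - b ^ 2 * f = 0 := by
    apply eq_zero_of_valuation_pz_lt_one hV
    have e : pz (a ^ 2 - b ^ 2 * f) =
        (pz a - pz b * u) * (pz a + pz b * u) + pz b ^ 2 * (u ^ 2 - pz f) := by
      simp only [map_sub, map_mul, map_pow]; ring
    rw [e]
    exact V.valuation.map_add_lt
      (valuation_mul_lt_one (sub_mem (hV' a) (mul_mem (hV' b) huV)) h)
      (valuation_mul_lt_one (pow_mem (hV' b) 2) hu)
  have hb := hf a b (sub_eq_zero.1 h1)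
  refine ⟨?_, hb⟩
  rw [hb] at h1
  simpa using h1

/-- An element of the valuation ring can be written with a denominator that is a unit. -/
theorem exists_reduced_form (hV : ∀ f ∈ baseField, f ∈ V) {l u : FunField} {f : ℝ[X]}
    (hf : NotSq f) (hl : V.valuation l < 1) (hl0 : l ≠ 0) (hu : V.valuation (u ^ 2 - pz f) < 1)
    {m : FunField} (hm : m ∈ V) {A B D : ℝ[X][X]}
    (hD : D ≠ 0) (h : m * D.eval₂ (pz : ℝ[X] →+* FunField) l =
      A.eval₂ (pz : ℝ[X] →+* FunField) l + B.eval₂ (pz : ℝ[X] →+* FunField) l * u) :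
    ∃ A B D : ℝ[X][X], D.coeff 0 ≠ 0 ∧ m * D.eval₂ (pz : ℝ[X] →+* FunField) l =
      A.eval₂ (pz : ℝ[X] →+* FunField) l + B.eval₂ (pz : ℝ[X] →+* FunField) l * u := by
  induction hn : D.natDegree using Nat.strong_induction_on generalizing A B D with
  | _ n ih =>
    by_cases hD0 : D.coeff 0 = 0
    · have huV : u ∈ V := by
        have : u ^ 2 ∈ V := by
          have := add_mem (mem_of_valuation_lt_one hu) (hV _ (pz_mem_baseField f))
          rwa [sub_add_cancel] at this
        rw [← V.valuation_le_one_iff, map_pow] at this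
        rw [← V.valuation_le_one_iff]
        exact (pow_le_one_iff two_ne_zero).1 this
      have hmem := fun P => eval₂_pz_mem hV (mem_of_valuation_lt_one hl) P
      have eD := eval₂_pz_eq D l
      rw [hD0, map_zero, add_zero] at eD
      have eA := eval₂_pz_eq A l
      have eB := eval₂_pz_eq B l
      -- If D(0) = 0, then m being in the valuation ring puts A(0) + B(0)u into the maximal ideal.
      -- So A(0) = B(0) = 0, and l can be cancelled.
      obtain ⟨hA, hB⟩ := eq_zero_of_valuation_add_mul_lt_one hV hf hu
        (a := A.coeff 0) (b := B.coeff 0) (by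
          have : pz (A.coeff 0) + pz (B.coeff 0) * u =
              (m * D.divX.eval₂ (pz : ℝ[X] →+* FunField) l -
                (A.divX.eval₂ (pz : ℝ[X] →+* FunField) l +
                  B.divX.eval₂ (pz : ℝ[X] →+* FunField) l * u)) * l := by
            rw [eA, eB, eD] at h
            linear_combination -h
          rw [this]
          exact valuation_mul_lt_one (sub_mem (mul_mem hm (hmem _))
            (add_mem (hmem _) (mul_mem (hmem _) huV))) hl)
      rw [hA, map_zero, add_zero] at eA
      rw [hB, map_zero, add_zero] at eB
      have hD1 : D.divX ≠ 0 := by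
        intro h0
        have := D.divX_mul_X_add
        rw [h0, hD0] at this
        exact hD (by simpa using this.symm)
      have hdeg : D.divX.natDegree < n := by
        rw [← hn, natDegree_divX_eq_natDegree_tsub_one]
        have : D.natDegree ≠ 0 := by
          intro h0
          rw [eq_C_of_natDegree_eq_zero h0, hD0] at hD
          simp at hD
        omega
      refine ih _ hdeg hD1 (A := A.divX) (B := B.divX) ?_ rfl
      apply mul_right_cancel₀ hl0
      rw [eA, eB, eD] at h
      linear_combination h
    · exact ⟨A, B, D, hD0, h⟩

end

/-- The rational functions that can be expressed through `l` and `u`. -/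
def HasForm (l u m : FunField) : Prop :=
  ∃ A B D : ℝ[X][X], D.eval₂ (pz : ℝ[X] →+* FunField) l ≠ 0 ∧
    m * D.eval₂ (pz : ℝ[X] →+* FunField) l =
      A.eval₂ (pz : ℝ[X] →+* FunField) l + B.eval₂ (pz : ℝ[X] →+* FunField) l * u

/-- As u² is a polynomial in l, the functions (A(l) + B(l)u)/D(l) form a field, so the coordinates
suffice. -/
theorem hasForm_of_coord {l u : FunField} {U : ℝ[X][X]}
    (hu : u ^ 2 = U.eval₂ (pz : ℝ[X] →+* FunField) l) (h0 : HasForm l u (coord 0))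
    (h1 : HasForm l u (coord 1)) (m : FunField) : HasForm l u m := by
  let E : Subfield FunField :=
    { carrier := {m | HasForm l u m}
      mul_mem' := by
        rintro m m' ⟨A, B, D, hD, h⟩ ⟨A', B', D', hD', h'⟩
        refine ⟨A * A' + B * B' * U, A * B' + B * A', D * D', ?_, ?_⟩
        · rw [eval₂_mul]; exact mul_ne_zero hD hD'
        · simp only [eval₂_mul, eval₂_add, ← hu]
          linear_combination m' * D'.eval₂ (pz : ℝ[X] →+* FunField) l * h +
            (A.eval₂ (pz : ℝ[X] →+* FunField) l + B.eval₂ (pz : ℝ[X] →+* FunField) l * u) * h'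
      one_mem' := ⟨1, 0, 1, by simp, by simp⟩
      add_mem' := by
        rintro m m' ⟨A, B, D, hD, h⟩ ⟨A', B', D', hD', h'⟩
        refine ⟨A * D' + A' * D, B * D' + B' * D, D * D', ?_, ?_⟩
        · rw [eval₂_mul]; exact mul_ne_zero hD hD'
        · simp only [eval₂_mul, eval₂_add]
          linear_combination D'.eval₂ (pz : ℝ[X] →+* FunField) l * h +
            D.eval₂ (pz : ℝ[X] →+* FunField) l * h'
      zero_mem' := ⟨0, 0, 1, by simp, by simp⟩
      neg_mem' := by
        rintro m ⟨A, B, D, hD, h⟩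
        refine ⟨-A, -B, D, hD, ?_⟩
        simp only [eval₂_neg]
        linear_combination -h
      inv_mem' := by
        rintro m ⟨A, B, D, hD, h⟩
        by_cases hm : m = 0
        · subst hm
          exact ⟨0, 0, 1, by simp, by simp⟩
        have hne : A.eval₂ (pz : ℝ[X] →+* FunField) l + B.eval₂ (pz : ℝ[X] →+* FunField) l * u ≠ 0 :=
          h ▸ mul_ne_zero hm hD
        -- Inverses come from rationalizing the denominator. If the conjugate A - Bu happens to
        -- vanish, then A + Bu = 2A and this is not needed.
        by_cases hc : A.eval₂ (pz : ℝ[X] →+* FunField) l - B.eval₂ (pz : ℝ[X] →+* FunField) l * u = 0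
        · refine ⟨D, 0, 2 * A, ?_, ?_⟩
          · rw [eval₂_mul, eval₂_ofNat]
            intro h2
            exact hne (by linear_combination h2 - hc)
          · simp only [eval₂_mul, eval₂_ofNat, eval₂_zero]
            field_simp
            linear_combination hc - h
        · refine ⟨D * A, -(D * B), A ^ 2 - B ^ 2 * U, ?_, ?_⟩
          · rw [eval₂_sub, eval₂_mul, eval₂_pow, eval₂_pow, ← hu]
            intro h2
            exact mul_ne_zero hne hc (by linear_combination h2)
          · rw [eval₂_sub, eval₂_mul, eval₂_pow, eval₂_pow, ← hu, eval₂_neg, eval₂_mul, eval₂_mul]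
            field_simp
            linear_combination -(A.eval₂ (pz : ℝ[X] →+* FunField) l -
              B.eval₂ (pz : ℝ[X] →+* FunField) l * u) * h }
  refine subfield_eq_top E (fun c => ⟨C (C c), 0, 1, by simp, ?_⟩) (fun i => ?_) m
  · have : pz (C c) = algebraMap ℝ FunField c := aeval_C _ _
    simp [this]
  · fin_cases i
    · exact h0
    · exact h1
    · refine ⟨C X, 0, 1, by simp, ?_⟩
      have : pz X = coord 2 := aeval_X _
      simp [this]

namespace FixedCurve

variable {g : Bir} (F : FixedCurve g)

theorem residue_pz (p : ℝ[X]) :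
    IsLocalRing.residue F.V ⟨pz p, F.base_le _ (pz_mem_baseField p)⟩ = p.eval₂ F.const F.z := by
  let φ : ℝ[X] →+* F.V := (pz : ℝ[X] →+* FunField).codRestrict F.V.toSubring
    fun p => F.base_le _ (pz_mem_baseField p)
  have : (IsLocalRing.residue F.V).comp φ = eval₂RingHom F.const F.z := by
    apply Polynomial.ringHom_ext
    · intro a
      simp only [RingHom.comp_apply, coe_eval₂RingHom, eval₂_C]
      have : φ (C a) = ⟨algebraMap ℝ FunField a, F.base_le _ (ℝ⟮coord 2⟯.algebraMap_mem a)⟩ :=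
        Subtype.ext (aeval_C _ _)
      rw [this]
      rfl
    · simp only [RingHom.comp_apply, coe_eval₂RingHom, eval₂_X]
      have : φ X = ⟨coord 2, F.base_le _ (IntermediateField.mem_adjoin_simple_self ℝ _)⟩ :=
        Subtype.ext (aeval_X _)
      rw [this]
      rfl
  exact congrArg (fun h : ℝ[X] →+* F.field => h p) this

theorem residue_eq_iff {x y : F.V} : IsLocalRing.residue F.V x = IsLocalRing.residue F.V y ↔
    F.V.valuation ((x : FunField) - y) < 1 := by
  rw [← sub_eq_zero, ← map_sub, IsLocalRing.residue_eq_zero_iff, ValuationSubring.valuation_lt_one_iff]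
  rfl

/-- Modulo l a reduced form becomes (a + bū)/d with d ≠ 0 and ū² = U(0) = f. So the residue field is
found without knowing that the valuation is discrete. -/
theorem isQuadExt {l u : FunField} {U : ℝ[X][X]} {f : ℝ[X]} (hf : NotSq f) (hUf : U.coeff 0 = f)
    (hl : F.V.valuation l < 1) (hl0 : l ≠ 0) (hu : u ^ 2 = U.eval₂ (pz : ℝ[X] →+* FunField) l)
    (h : ∀ m, HasForm l u m) : IsQuadExt F.const F.z f := by
  have hV : ∀ f ∈ baseField, f ∈ F.V := F.base_le
  have hu' : F.V.valuation (u ^ 2 - pz f) < 1 := by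
    rw [hu, ← hUf]
    exact valuation_eval₂_sub_lt_one hV hl U
  have huV : u ∈ F.V := by
    have : u ^ 2 ∈ F.V := by
      rw [hu]
      exact eval₂_pz_mem hV (mem_of_valuation_lt_one hl) U
    rw [← F.V.valuation_le_one_iff, map_pow] at this
    rw [← F.V.valuation_le_one_iff]
    exact (pow_le_one_iff two_ne_zero).1 this
  refine ⟨fun p hp => ?_, IsLocalRing.residue F.V ⟨u, huV⟩, ?_, fun m => ?_⟩
  · rw [← F.residue_pz, ← map_zero (IsLocalRing.residue F.V), residue_eq_iff] at hp
    apply eq_zero_of_valuation_pz_lt_one hV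
    simpa using hp
  · rw [← F.residue_pz, ← map_pow, residue_eq_iff]
    exact hu'
  · obtain ⟨⟨m, hm⟩, rfl⟩ := IsLocalRing.residue_surjective m
    obtain ⟨A, B, D, hD, e⟩ := h m
    obtain ⟨A, B, D, hD, e⟩ := exists_reduced_form hV hf hl hl0 hu' hm
      (by rintro rfl; simp at hD) e
    refine ⟨A.coeff 0, B.coeff 0, D.coeff 0, hD, ?_⟩
    rw [← F.residue_pz, ← F.residue_pz, ← F.residue_pz, ← map_mul, ← map_mul, ← map_add,
      residue_eq_iff]
    change F.V.valuation (m * pz (D.coeff 0) - (pz (A.coeff 0) + pz (B.coeff 0) * u)) < 1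
    have e' : m * pz (D.coeff 0) - (pz (A.coeff 0) + pz (B.coeff 0) * u) =
        -(m * (D.eval₂ (pz : ℝ[X] →+* FunField) l - pz (D.coeff 0))) +
        ((A.eval₂ (pz : ℝ[X] →+* FunField) l - pz (A.coeff 0)) +
          u * (B.eval₂ (pz : ℝ[X] →+* FunField) l - pz (B.coeff 0))) := by
      linear_combination e
    rw [e']
    have hs := fun P => valuation_eval₂_sub_lt_one hV hl P
    refine F.V.valuation.map_add_lt ?_ (F.V.valuation.map_add_lt (hs A)
      (valuation_mul_lt_one huV (hs B)))
    rw [Valuation.map_neg]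
    exact valuation_mul_lt_one hm (hs D)

end FixedCurve

end RealSphere

/-! ### The residue field of the curve of fixed points -/

namespace RealSphere

open scoped QuadraticAlgebra

open Polynomial

/-- In the coordinates u along the line and l + α across it, the conic becomes u² + (l + α)² = δ(β²
+ γ²). -/
theorem line_sq_add_sq (α β γ : ℝ[X]) :
    (pz β * coord 0 + pz γ * coord 1) ^ 2 =
      (-X ^ 2 - C (2 * α) * X - C (nrd α β γ) : ℝ[X][X]).eval₂ (pz : ℝ[X] →+* FunField)
        (pz β * coord 1 - pz γ * coord 0 - pz α) := by
  simp only [eval₂_sub, eval₂_neg, eval₂_mul, eval₂_pow, eval₂_X, eval₂_C, RingHom.coe_coe, pz_nrd]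
  simp only [map_mul, map_ofNat]
  linear_combination (pz β ^ 2 + pz γ ^ 2) * coord_sq_add_sq

/-- The change from (x, y) to (u, l + α) is linear with determinant β² + γ², up to sign. -/
theorem hasForm_line {β γ : ℝ[X]} (α : ℝ[X]) (h0 : β ≠ 0 ∨ γ ≠ 0) (m : FunField) :
    HasForm (pz β * coord 1 - pz γ * coord 0 - pz α) (pz β * coord 0 + pz γ * coord 1) m := by
  have hn : pz (β ^ 2 + γ ^ 2) ≠ 0 := by
    rw [Ne, map_eq_zero_iff _ pz_injective]
    intro h
    obtain ⟨rfl, rfl⟩ := poly_eq_zero_of_sq_add_sq h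
    simp at h0
  refine hasForm_of_coord (line_sq_add_sq α β γ) ?_ ?_ m
  · refine ⟨C (-γ) * (X + C α), C β, C (β ^ 2 + γ ^ 2), by rwa [eval₂_C], ?_⟩
    simp only [eval₂_mul, eval₂_add, eval₂_X, eval₂_C, RingHom.coe_coe]
    simp only [map_add, map_pow, map_neg]
    ring
  · refine ⟨C β * (X + C α), C γ, C (β ^ 2 + γ ^ 2), by rwa [eval₂_C], ?_⟩
    simp only [eval₂_mul, eval₂_add, eval₂_X, eval₂_C, RingHom.coe_coe]
    simp only [map_add, map_pow]
    ring

theorem IsRefl.mul_form {g : Bir} {α β γ : ℝ[X]} (h : IsRefl g α β γ) :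
    reflDen α β γ * g (pz β * coord 0 + pz γ * coord 1) =
        -pz (nrd α β γ) * (pz β * coord 0 + pz γ * coord 1) ∧
      reflDen α β γ * g (pz β * coord 1 - pz γ * coord 0 - pz α) =
        pz (nrd α β γ) * (pz β * coord 1 - pz γ * coord 0 - pz α) := by
  rw [h.map_form.1, h.map_form.2, pz_nrd]
  exact refl_form_mul coord_sq_add_sq h.2.1 h.2.2

theorem reflDen_eq (α β γ : ℝ[X]) : reflDen α β γ =
    -pz (nrd α β γ) - 2 * pz α * (pz β * coord 1 - pz γ * coord 0 - pz α) := by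
  rw [pz_nrd, reflDen]
  linear_combination (pz β ^ 2 + pz γ ^ 2) * coord_sq_add_sq

theorem mem_of_sq_mem {V : ValuationSubring FunField} {u : FunField} (h : u ^ 2 ∈ V) : u ∈ V := by
  rw [← V.valuation_le_one_iff, map_pow] at h
  rw [← V.valuation_le_one_iff]
  exact (pow_le_one_iff two_ne_zero).1 h

theorem valuation_lt_one_of_mul {V : ValuationSubring FunField} {x y : FunField}
    (h : V.valuation (x * y) < 1) (hx : V.valuation x = 1) : V.valuation y < 1 := by
  rwa [map_mul, hx, one_mul] at h

namespace FixedCurve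

variable {g : Bir} (F : FixedCurve g)

theorem valuation_two_mul_lt_one {x : FunField} (h : F.V.valuation (2 * x) < 1) :
    F.V.valuation x < 1 := by
  refine valuation_lt_one_of_mul h ?_
  have := valuation_pz F.base_le (p := 2) two_ne_zero
  rwa [map_ofNat] at this

/-- The points fixed by a reflection lie on a line. -/
theorem valuation_line_lt_one {α β γ : ℝ[X]} (h0 : β ≠ 0 ∨ γ ≠ 0) (h : IsRefl g α β γ) :
    F.V.valuation (pz β * coord 1 - pz γ * coord 0 - pz α) < 1 := by
  have hV : ∀ f ∈ baseField, f ∈ F.V := F.base_le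
  have hVp : ∀ p, pz p ∈ F.V := fun p => hV _ (pz_mem_baseField p)
  have hN0 := h.nrd_ne_zero (Or.inr h0)
  have hN := valuation_pz hV hN0
  have hu2 := line_sq_add_sq α β γ
  simp only [eval₂_sub, eval₂_neg, eval₂_mul, eval₂_pow, eval₂_X, eval₂_C, RingHom.coe_coe] at hu2
  simp only [map_mul, map_ofNat] at hu2
  obtain ⟨h1, h2⟩ := h.mul_form
  rw [reflDen_eq] at h1 h2
  have he0 : -pz (nrd α β γ) - 2 * pz α * (pz β * coord 1 - pz γ * coord 0 - pz α) ≠ 0 := by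
    rw [← reflDen_eq]
    exact reflDen_ne_zero (Or.inr h0)
  have hl0 := line_ne_zero (α := α) (Or.inr h0)
  set l := pz β * coord 1 - pz γ * coord 0 - pz α with hl
  set u := pz β * coord 0 + pz γ * coord 1 with hu
  by_cases hlV : l ∈ F.V
  -- Suppose that l is a unit. Then e(gl - l) = 2l(N + αl) and e(gu - u) = 2αlu show that N + αl and
  -- αu are in the maximal ideal. With the equation of the conic this gives N(α² - N) = 0, hence
  -- δ(β² + γ²) = 0.
  · by_contra hcon
    have hl1 : F.V.valuation l = 1 :=
      le_antisymm ((F.V.valuation_le_one_iff _).2 hlV) (not_lt.1 hcon)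
    have huV : u ∈ F.V := by
      apply mem_of_sq_mem
      rw [hu2]
      exact sub_mem (sub_mem (neg_mem (pow_mem hlV 2)) (mul_mem (mul_mem (by
        simp) (hVp α)) hlV)) (hVp _)
    have heV : -pz (nrd α β γ) - 2 * pz α * l ∈ F.V :=
      sub_mem (neg_mem (hVp _)) (mul_mem (mul_mem (by simp) (hVp α)) hlV)
    have k1 : F.V.valuation (pz (nrd α β γ) + pz α * l) < 1 := by
      have := valuation_mul_lt_one heV (F.fixed l hlV)
      apply F.valuation_two_mul_lt_one
      refine valuation_lt_one_of_mul (x := l) ?_ hl1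
      convert this using 2
      linear_combination -h2
    have k2 : F.V.valuation (pz α * u) < 1 := by
      have := valuation_mul_lt_one heV (F.fixed u huV)
      apply F.valuation_two_mul_lt_one
      refine valuation_lt_one_of_mul (x := l) ?_ hl1
      convert this using 2
      linear_combination -h1
    have k3 : nrd α β γ * (α ^ 2 - nrd α β γ) = 0 := by
      apply eq_zero_of_valuation_pz_lt_one hV
      have : pz (nrd α β γ * (α ^ 2 - nrd α β γ)) = pz α * u * (pz α * u) +
          (pz (nrd α β γ) + pz α * l - (2 * pz (nrd α β γ) - 2 * pz α ^ 2)) *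
            (pz (nrd α β γ) + pz α * l) := by
        simp only [map_mul, map_sub, map_pow]
        linear_combination -pz α ^ 2 * hu2
      rw [this]
      have h2V : (2 : FunField) ∈ F.V := by simp
      exact F.V.valuation.map_add_lt (valuation_mul_lt_one (mul_mem (hVp α) huV) k2)
        (valuation_mul_lt_one (sub_mem (add_mem (hVp _) (mul_mem (hVp α) hlV))
          (sub_mem (mul_mem h2V (hVp _)) (mul_mem h2V (pow_mem (hVp α) 2)))) k1)
    have k4 : (1 - X ^ 2 : ℝ[X]) * (β ^ 2 + γ ^ 2) = 0 := by
      have := (mul_eq_zero.1 k3).resolve_left hN0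
      unfold nrd at this
      linear_combination this
    have hδ0 : (1 - X ^ 2 : ℝ[X]) ≠ 0 := fun h0 => by simpa using congrArg (eval 0) h0
    obtain ⟨rfl, rfl⟩ := poly_eq_zero_of_sq_add_sq ((mul_eq_zero.1 k4).resolve_left hδ0)
    simp at h0
  -- If l has a pole, the place lies at infinity. There s = u/l satisfies s² ≡ -1, whereas gs = -s
  -- forces s ≡ 0: the points at infinity are exchanged and not fixed.
  · exfalso
    have hw : F.V.valuation l⁻¹ < 1 := by
      rw [← F.V.mem_nonunits_iff, F.V.inv_mem_nonunits_iff]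
      exact Or.inr hlV
    have hwV := mem_of_valuation_lt_one hw
    have hs2 : (u * l⁻¹) ^ 2 = -1 - (2 * pz α + pz (nrd α β γ) * l⁻¹) * l⁻¹ := by
      rw [mul_pow, hu2]
      field_simp
      ring
    have h2V : (2 : FunField) ∈ F.V := by simp
    have hcV : 2 * pz α + pz (nrd α β γ) * l⁻¹ ∈ F.V :=
      add_mem (mul_mem h2V (hVp α)) (mul_mem (hVp _) hwV)
    have hsV : u * l⁻¹ ∈ F.V := by
      apply mem_of_sq_mem
      rw [hs2]
      exact sub_mem (neg_mem (one_mem _)) (mul_mem hcV hwV)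
    have hgl0 : g l ≠ 0 := by simpa using hl0
    have hgs : g (u * l⁻¹) = -(u * l⁻¹) := by
      rw [map_mul, map_inv₀]
      field_simp
      apply mul_left_cancel₀ he0
      linear_combination l * h1 + u * h2
    have k1 : F.V.valuation (u * l⁻¹) < 1 := by
      have := F.fixed _ hsV
      apply F.valuation_two_mul_lt_one
      rw [hgs] at this
      rw [← Valuation.map_neg]
      convert this using 2
      ring
    have k2 : F.V.valuation (pz 1) < 1 := by
      have : pz 1 = -((u * l⁻¹) * (u * l⁻¹) + (2 * pz α + pz (nrd α β γ) * l⁻¹) * l⁻¹) := by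
        rw [map_one]; linear_combination hs2
      rw [this, Valuation.map_neg]
      exact F.V.valuation.map_add_lt (valuation_mul_lt_one hsV k1) (valuation_mul_lt_one hcV hw)
    exact one_ne_zero (eq_zero_of_valuation_pz_lt_one hV k2)

/-- The curve of fixed points of a reflection is the double cover given by its norm. -/
theorem isQuadExt_of_isRefl {α β γ : ℝ[X]} (hN : NotSq (-nrd α β γ)) (h : IsRefl g α β γ) :
    IsQuadExt F.const F.z (-nrd α β γ) := by
  have hV : ∀ f ∈ baseField, f ∈ F.V := F.base_le
  have hVp : ∀ p, pz p ∈ F.V := fun p => hV _ (pz_mem_baseField p)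
  by_cases h0 : β ≠ 0 ∨ γ ≠ 0
  · exact F.isQuadExt hN (by simp) (F.valuation_line_lt_one h0 h) (line_ne_zero (Or.inr h0))
      (line_sq_add_sq α β γ) (hasForm_line α h0)
  -- For β = γ = 0 the involution is (x, y) ↦ (-x, -y) and its fixed points lie at infinity. There
  -- 1/y plays the part of l and x/y that of u, with (x/y)² = δ/y² - 1; the residue field is
  -- ℝ(z)(√-1), in accordance with -N = -α².
  · push Not at h0
    obtain ⟨rfl, rfl⟩ := h0
    have hα : α ≠ 0 := by
      rintro rfl
      exact hN.ne_zero (by simp [nrd])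
    have hα' : pz α ≠ 0 := by rwa [Ne, map_eq_zero_iff _ pz_injective]
    obtain ⟨-, h1, h2⟩ := h
    simp only [map_zero, zero_mul, add_zero, sub_zero, zero_sub, mul_zero, zero_add] at h1 h2
    have hgx : g (coord 0) = -coord 0 := by
      apply mul_left_cancel₀ hα'
      linear_combination -h2
    have hy : coord 1 ∉ F.V := by
      intro hy
      have hgy : g (coord 1) = -coord 1 := by
        apply mul_left_cancel₀ hα'
        linear_combination h1
      have key : ∀ w : FunField, w ∈ F.V → g w = -w → F.V.valuation w < 1 := by
        intro w hw hgw
        have := F.fixed _ hw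
        apply F.valuation_two_mul_lt_one
        rw [hgw] at this
        rw [← Valuation.map_neg]
        convert this using 2
        ring
      have hδ : pz (1 - X ^ 2) = coord 0 * coord 0 + coord 1 * coord 1 := by
        simp only [map_sub, map_one, map_pow, aeval_X]
        linear_combination -coord_sq_add_sq
      have hx : coord 0 ∈ F.V := by
        apply mem_of_sq_mem
        have : coord 0 ^ 2 = pz (1 - X ^ 2) - coord 1 ^ 2 := by rw [hδ]; ring
        rw [this]
        exact sub_mem (hVp _) (pow_mem hy 2)
      have := eq_zero_of_valuation_pz_lt_one hV (p := 1 - X ^ 2) (by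
        rw [hδ]
        exact F.V.valuation.map_add_lt (valuation_mul_lt_one hx (key _ hx hgx))
          (valuation_mul_lt_one hy (key _ hy hgy)))
      simpa using congrArg (eval 0) this
    have hy0 : coord 1 ≠ 0 := fun h0 => hy (h0 ▸ zero_mem _)
    have hw : F.V.valuation (coord 1)⁻¹ < 1 := by
      rw [← F.V.mem_nonunits_iff, F.V.inv_mem_nonunits_iff]
      exact Or.inr hy
    have hu2 : (coord 0 * (coord 1)⁻¹) ^ 2 =
        (C (1 - X ^ 2) * X ^ 2 - 1 : ℝ[X][X]).eval₂ (pz : ℝ[X] →+* FunField) (coord 1)⁻¹ := by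
      have : pz (1 - X ^ 2) = 1 - coord 2 ^ 2 := by simp
      simp only [eval₂_sub, eval₂_mul, eval₂_pow, eval₂_X, eval₂_C, RingHom.coe_coe, eval₂_one,
        this]
      field_simp
      linear_combination coord_sq_add_sq
    have hneg : NotSq (-1) := by
      refine NotSq.of_eval_neg (s := Set.univ) Set.infinite_univ fun a _ => ?_
      simp
    refine (F.isQuadExt hneg ?_ hw (inv_ne_zero hy0) hu2 (hasForm_of_coord hu2 ?_ ?_)).of_sq_mul_eq
      (r := α) (r' := 1) hα one_ne_zero ?_
    · simp
    · refine ⟨0, 1, X, by simpa using hy0, ?_⟩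
      simp
    · refine ⟨1, 0, X, by simpa using hy0, ?_⟩
      simp [hy0]
    · simp [nrd]

end FixedCurve

end RealSphere

/-! ### Existence of the curve of fixed points -/

namespace RealSphere

open scoped QuadraticAlgebra

open Polynomial

/-- Real points of the base over which a given line meets the complexified sphere cannot all be
zeros of a nonzero polynomial. -/
theorem pz_ne_line_mul {α β γ p : ℝ[X]} (h0 : β ≠ 0 ∨ γ ≠ 0) (hp : p ≠ 0)
    (P : MvPolynomial (Fin 3) ℝ) :
    (pz β * coord 1 - pz γ * coord 0 - pz α) * toFun P ≠ pz p := by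
  intro h
  have hn : p * (β ^ 2 + γ ^ 2) ≠ 0 := mul_ne_zero hp fun h => by
    obtain ⟨rfl, rfl⟩ := poly_eq_zero_of_sq_add_sq h
    simp at h0
  obtain ⟨a, ha⟩ : ∃ a, (p * (β ^ 2 + γ ^ 2)).eval a ≠ 0 := by
    by_contra! hall
    exact hn (Polynomial.funext fun a => by rw [hall a, eval_zero])
  rw [eval_mul] at ha
  have hpa := left_ne_zero_of_mul ha
  have hna : ((β.eval a : ℝ) : ℂ) ^ 2 + ((γ.eval a : ℝ) : ℂ) ^ 2 ≠ 0 := by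
    have := right_ne_zero_of_mul ha
    simp only [eval_add, eval_pow] at this
    exact_mod_cast this
  -- Over a suitable real z = a the line meets the complex conic where u = w with w² = -N(a). At
  -- this point the left side of the supposed identity vanishes, and p does not.
  obtain ⟨w, hw⟩ := IsAlgClosed.exists_pow_nat_eq (k := ℂ)
    (-(((nrd α β γ).eval a : ℝ) : ℂ)) (n := 2) two_pos
  rw [eval_nrd] at hw
  push_cast at hw
  let x : ℂ := (β.eval a * w - γ.eval a * α.eval a) / (((β.eval a : ℝ) : ℂ) ^ 2 + ((γ.eval a : ℝ) : ℂ) ^ 2)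
  let y : ℂ := (γ.eval a * w + β.eval a * α.eval a) / (((β.eval a : ℝ) : ℂ) ^ 2 + ((γ.eval a : ℝ) : ℂ) ^ 2)
  have hline : β.eval a * y - γ.eval a * x - α.eval a = 0 := by
    simp only [x, y]; field_simp; ring
  have hxy : x ^ 2 + y ^ 2 + (a : ℂ) ^ 2 - 1 = 0 := by
    simp only [x, y]; field_simp
    linear_combination (((β.eval a : ℝ) : ℂ) ^ 2 + ((γ.eval a : ℝ) : ℂ) ^ 2) * hw
  let ψ : MvPolynomial (Fin 3) ℝ →ₐ[ℝ] ℂ := MvPolynomial.aeval ![x, y, (a : ℂ)]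
  have hψ : ∀ Q, toFun Q = 0 → ψ Q = 0 := by
    intro Q hQ
    obtain ⟨s, rfl⟩ := Ideal.mem_span_singleton'.1 (toFun_eq_zero_iff.1 hQ)
    have : ψ sphereEq = 0 := by simpa [sphereEq, ψ] using hxy
    rw [map_mul, this, mul_zero]
  have hz : ∀ q : ℝ[X], ψ (aeval (MvPolynomial.X 2) q) = ((q.eval a : ℝ) : ℂ) := fun q => by
    rw [← aeval_algHom_apply]
    have : ψ (MvPolynomial.X 2) = algebraMap ℝ ℂ a := by simp [ψ]
    rw [this, aeval_algebraMap_apply]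
    simp
  have key := hψ ((aeval (MvPolynomial.X 2) β * MvPolynomial.X 1 -
    aeval (MvPolynomial.X 2) γ * MvPolynomial.X 0 - aeval (MvPolynomial.X 2) α) * P -
      aeval (MvPolynomial.X 2) p) (by
    simp only [map_sub, map_mul, ← pz_eq_toFun]
    exact sub_eq_zero.2 h)
  have hX0 : ψ (MvPolynomial.X 0) = x := by simp [ψ]
  have hX1 : ψ (MvPolynomial.X 1) = y := by simp [ψ]
  rw [map_sub, map_mul, map_sub, map_sub, map_mul, map_mul, hz, hz, hz, hz, hX0, hX1, hline,
    zero_mul, zero_sub, neg_eq_zero] at key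
  exact hpa (by exact_mod_cast key)

/-- The coordinate ring of the affine sphere over `ℝ(z)`. -/
noncomputable def affineRing : Subring FunField where
  carrier := {f | ∃ (P : MvPolynomial (Fin 3) ℝ) (p : ℝ[X]), p ≠ 0 ∧ f * pz p = toFun P}
  mul_mem' := by
    rintro f f' ⟨P, p, hp, h⟩ ⟨P', p', hp', h'⟩
    refine ⟨P * P', p * p', mul_ne_zero hp hp', ?_⟩
    rw [map_mul, map_mul, ← h, ← h']; ring
  one_mem' := ⟨1, 1, one_ne_zero, by simp⟩
  add_mem' := by
    rintro f f' ⟨P, p, hp, h⟩ ⟨P', p', hp', h'⟩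
    refine ⟨P * aeval (MvPolynomial.X 2) p' + P' * aeval (MvPolynomial.X 2) p, p * p',
      mul_ne_zero hp hp', ?_⟩
    rw [map_mul, map_add, map_mul, map_mul, ← h, ← h', ← pz_eq_toFun, ← pz_eq_toFun]; ring
  zero_mem' := ⟨0, 1, one_ne_zero, by simp⟩
  neg_mem' := by
    rintro f ⟨P, p, hp, h⟩
    exact ⟨-P, p, hp, by rw [map_neg, ← h]; ring⟩

theorem coord_mem_affineRing (i : Fin 3) : coord i ∈ affineRing :=
  ⟨MvPolynomial.X i, 1, one_ne_zero, by simp [coord]⟩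

theorem baseField_le_affineRing {f : FunField} (hf : f ∈ baseField) : f ∈ affineRing := by
  obtain ⟨a, b, rfl⟩ := mem_baseField_iff.1 hf
  by_cases hb : b = 0
  · simp [hb, zero_mem]
  · have hb' : pz b ≠ 0 := by rwa [Ne, map_eq_zero_iff _ pz_injective]
    exact ⟨aeval (MvPolynomial.X 2) a, b, hb, by rw [← pz_eq_toFun, div_mul_cancel₀ _ hb']⟩

/-- A proper ideal of a subring is dominated by the maximal ideal of a valuation ring. The form l
generates a proper ideal of the affine conic over ℝ(z), because the line meets it in a complex
point. -/
theorem exists_valuationSubring {α β γ : ℝ[X]} (h0 : β ≠ 0 ∨ γ ≠ 0) :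
    ∃ V : ValuationSubring FunField, (∀ f ∈ baseField, f ∈ V) ∧
      V.valuation (pz β * coord 1 - pz γ * coord 0 - pz α) < 1 := by
  have hl : pz β * coord 1 - pz γ * coord 0 - pz α ∈ affineRing :=
    sub_mem (sub_mem (mul_mem (baseField_le_affineRing (pz_mem_baseField _))
      (coord_mem_affineRing 1)) (mul_mem (baseField_le_affineRing (pz_mem_baseField _))
      (coord_mem_affineRing 0))) (baseField_le_affineRing (pz_mem_baseField _))
  obtain ⟨V, hV, hI⟩ := Ideal.image_subset_nonunits_valuationSubring
    (Ideal.span {(⟨_, hl⟩ : affineRing)}) (by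
      rw [Ne, Ideal.eq_top_iff_one, Ideal.mem_span_singleton']
      rintro ⟨⟨f, P, p, hp, hf⟩, h⟩
      have h' : f * (pz β * coord 1 - pz γ * coord 0 - pz α) = 1 := congrArg Subtype.val h
      refine pz_ne_line_mul h0 hp P (α := α) ?_
      rw [← hf]
      linear_combination pz p * h')
  refine ⟨V, fun f hf => hV (baseField_le_affineRing hf), ?_⟩
  rw [← V.mem_nonunits_iff]
  exact hI ⟨_, Ideal.mem_span_singleton_self _, rfl⟩

/-- At a place centred on the line, e ≡ -N is a unit, hence gl ≡ 0 and gu ≡ u. Every element of the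
valuation ring has a reduced form in l and u, so g acts trivially on all residues, and in particular
preserves the ring. -/
theorem nonempty_fixedCurve_of_ne_zero {g : Bir} {α β γ : ℝ[X]} (h0 : β ≠ 0 ∨ γ ≠ 0)
    (hN : NotSq (-nrd α β γ)) (h : IsRefl g α β γ) : Nonempty (FixedCurve g) := by
  obtain ⟨V, hV, hl⟩ := exists_valuationSubring (α := α) h0
  have hVp : ∀ p, pz p ∈ V := fun p => hV _ (pz_mem_baseField p)
  have hl0 := line_ne_zero (α := α) (Or.inr h0)
  have hu2 := line_sq_add_sq α β γ
  have hform := hasForm_line α h0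
  obtain ⟨h1, h2⟩ := h.mul_form
  have he0 := reflDen_ne_zero (α := α) (Or.inr h0)
  have heq := reflDen_eq α β γ
  set l := pz β * coord 1 - pz γ * coord 0 - pz α
  set u := pz β * coord 0 + pz γ * coord 1
  set e := reflDen α β γ
  have hlV := mem_of_valuation_lt_one hl
  have huV : u ∈ V := by
    apply mem_of_sq_mem
    rw [hu2]
    exact eval₂_pz_mem hV hlV _
  have hu2' : V.valuation (u ^ 2 - pz (-nrd α β γ)) < 1 := by
    have := valuation_eval₂_sub_lt_one hV hl (-X ^ 2 - C (2 * α) * X - C (nrd α β γ))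
    rw [← hu2] at this
    convert this using 4
    simp
  have heV : V.valuation e = 1 := by
    have hN1 : V.valuation (-pz (nrd α β γ)) = 1 := by
      rw [Valuation.map_neg]
      exact valuation_pz hV fun h0 => hN.ne_zero (by rw [h0, neg_zero])
    rw [heq, sub_eq_add_neg, ← hN1]
    apply Valuation.map_add_eq_of_lt_left
    rw [hN1, Valuation.map_neg]
    exact valuation_mul_lt_one (mul_mem (by simp) (hVp α)) hl
  have hgl : V.valuation (g l) < 1 := by
    refine valuation_lt_one_of_mul ?_ heV
    rw [h2]
    exact valuation_mul_lt_one (hVp _) hl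
  have hgu : V.valuation (g u - u) < 1 := by
    refine valuation_lt_one_of_mul ?_ heV
    have : e * (g u - u) = 2 * pz α * u * l := by
      rw [mul_sub, h1, heq]; ring
    rw [this]
    exact valuation_mul_lt_one (mul_mem (mul_mem (by simp) (hVp α)) huV) hl
  have hguV : g u ∈ V := by
    have := add_mem (mem_of_valuation_lt_one hgu) huV
    rwa [sub_add_cancel] at this
  have hgP : ∀ P : ℝ[X][X], g (P.eval₂ (pz : ℝ[X] →+* FunField) l) =
      P.eval₂ (pz : ℝ[X] →+* FunField) (g l) := fun P => by
    change (g : FunField →+* FunField) _ = _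
    rw [hom_eval₂]
    congr 1
    ext p
    · simp
    · simp [h.1]
  refine ⟨⟨V, ?_, hV, fun m hm => ?_⟩⟩
  · rintro rfl
    have := (ValuationSubring.mem_nonunits_iff_or _).1 ((ValuationSubring.mem_nonunits_iff _).2 hl)
    exact this.elim hl0 fun h => h trivial
  · obtain ⟨A, B, D, hD, e1⟩ := hform m
    obtain ⟨A, B, D, hD, e1⟩ := exists_reduced_form hV hN hl hl0 hu2' hm
      (by rintro rfl; simp at hD) e1
    have e2 := congrArg g e1
    rw [map_add, map_mul, map_mul, hgP, hgP, hgP] at e2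
    have s1 := fun P => valuation_eval₂_sub_lt_one hV hl P
    have s2 := fun P => valuation_eval₂_sub_lt_one hV hgl P
    have hDl : V.valuation (D.eval₂ (pz : ℝ[X] →+* FunField) l) = 1 := by
      rw [← valuation_pz hV hD]
      have := s1 D
      rw [← valuation_pz hV hD] at this
      exact (Valuation.map_eq_of_sub_lt _ this)
    have hDgl : V.valuation (D.eval₂ (pz : ℝ[X] →+* FunField) (g l)) = 1 := by
      rw [← valuation_pz hV hD]
      have := s2 D
      rw [← valuation_pz hV hD] at this
      exact (Valuation.map_eq_of_sub_lt _ this)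
    have hd : ∀ P : ℝ[X][X], V.valuation (P.eval₂ (pz : ℝ[X] →+* FunField) (g l) -
        P.eval₂ (pz : ℝ[X] →+* FunField) l) < 1 := fun P => by
      have := V.valuation.map_sub_lt (s2 P) (s1 P)
      convert this using 2
      ring
    refine valuation_lt_one_of_mul (x := D.eval₂ (pz : ℝ[X] →+* FunField) (g l)) ?_ hDgl
    have e3 : D.eval₂ (pz : ℝ[X] →+* FunField) (g l) * (g m - m) =
        (A.eval₂ (pz : ℝ[X] →+* FunField) (g l) - A.eval₂ (pz : ℝ[X] →+* FunField) l) +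
        (g u * (B.eval₂ (pz : ℝ[X] →+* FunField) (g l) - B.eval₂ (pz : ℝ[X] →+* FunField) l) +
        (B.eval₂ (pz : ℝ[X] →+* FunField) l * (g u - u) +
        -(m * (D.eval₂ (pz : ℝ[X] →+* FunField) (g l) -
          D.eval₂ (pz : ℝ[X] →+* FunField) l)))) := by
      linear_combination e2 - e1
    rw [e3]
    refine V.valuation.map_add_lt (hd A) (V.valuation.map_add_lt (valuation_mul_lt_one hguV (hd B))
      (V.valuation.map_add_lt (valuation_mul_lt_one (eval₂_pz_mem hV hlV B) hgu) ?_))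
    rw [Valuation.map_neg]
    exact valuation_mul_lt_one hm (hd D)

/-- The curve of fixed points of a conjugate. -/
noncomputable def FixedCurve.ofConj {g P : Bir} (hz : P (coord 2) = coord 2)
    (F : FixedCurve (P * g * P⁻¹)) : FixedCurve g where
  V := F.V.comap (P : FunField →+* FunField)
  ne_top h := F.ne_top (by
    rw [eq_top_iff]
    intro f _
    have : P⁻¹ f ∈ F.V.comap (P : FunField →+* FunField) := h ▸ trivial
    have h2 : P (P⁻¹ f) ∈ F.V := this
    have h3 : P (P⁻¹ f) = f := P.apply_symm_apply f
    rwa [h3] at h2)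
  base_le f hf := by
    change P f ∈ F.V
    rw [map_baseField hz hf]
    exact F.base_le f hf
  fixed f hf := by
    have h1 := F.fixed (P f) hf
    have h2 : (P * g * P⁻¹) (P f) = P (g f) :=
      congrArg (fun w => P (g w)) (P.symm_apply_apply f)
    rw [h2, ← map_sub, ← ValuationSubring.mem_nonunits_iff,
      ValuationSubring.mem_nonunits_iff_or] at h1
    rw [← ValuationSubring.mem_nonunits_iff, ValuationSubring.mem_nonunits_iff_or]
    refine h1.imp (fun h => (_root_.map_eq_zero P).1 h) fun h h' => h ?_
    change P _ ∈ F.V at h'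
    rwa [map_inv₀] at h'

/-- An involution has a curve of fixed points. -/
theorem nonempty_fixedCurve {g : Bir} {α β γ : ℝ[X]} (hN : NotSq (-nrd α β γ))
    (h : IsRefl g α β γ) : Nonempty (FixedCurve g) := by
  by_cases h0 : β ≠ 0 ∨ γ ≠ 0
  · exact nonempty_fixedCurve_of_ne_zero h0 hN h
  push Not at h0
  obtain ⟨rfl, rfl⟩ := h0
  have hα : α ≠ 0 := by
    rintro rfl
    exact hN.ne_zero (by simp [nrd])
  -- For β = γ = 0 the fixed points at infinity are moved into the affine part by conjugation with
  -- the reflection in 2i + j, whose norm is 3 + z².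
  have hq : IsTimelike 2 1 0 := fun a ha => by
    simp
    nlinarith [sq_nonneg a]
  obtain ⟨P, hP⟩ := exists_isRefl_of_nrd_ne_zero hq.nrd_ne_zero
  have hinv : P⁻¹ = P :=
    inv_eq_of_mul_eq_one_left (hP.mul_self (ne_zero_of_nrd_ne_zero hq.nrd_ne_zero))
  have hc := hP.conj h
  have e : P * g * P = P * g * P⁻¹ := by rw [hinv]
  rw [e] at hc
  have hne : nrd 2 1 0 * 0 - 2 * nrdB 2 1 0 α 0 0 * 1 ≠ 0 := by
    simp [nrdB, hα]
  obtain ⟨F⟩ := nonempty_fixedCurve_of_ne_zero (Or.inl hne) (g := P * g * P⁻¹) (by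
    intro a b hab
    have h3 : nrd (nrd 2 1 0 * α - 2 * nrdB 2 1 0 α 0 0 * 2)
        (nrd 2 1 0 * 0 - 2 * nrdB 2 1 0 α 0 0 * 1) (nrd 2 1 0 * 0 - 2 * nrdB 2 1 0 α 0 0 * 0) =
        nrd 2 1 0 ^ 2 * nrd α 0 0 := by
      simp only [nrd, nrdB]; ring
    rw [h3] at hab
    have := hN a (b * nrd 2 1 0) (by rw [hab]; ring)
    exact (mul_eq_zero.1 this).resolve_right hq.nrd_ne_zero) hc
  exact ⟨F.ofConj hP.1⟩

end RealSphere

namespace RealSphere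

open scoped QuadraticAlgebra

open Polynomial HomogeneousLocalization

/-! ### Affine charts of the projective line -/

theorem isHomogeneous_eval₂_mul {L : Type*} [CommRing L] (ρ : ℝ →+* L) {n : MvPolynomial (Fin 2) ℝ}
    {k : ℕ} (hn : n.IsHomogeneous k) (c : L) (v : Fin 2 → L) :
    n.eval₂ ρ (fun j => c * v j) = c ^ k * n.eval₂ ρ v := by
  rw [MvPolynomial.eval₂_eq', MvPolynomial.eval₂_eq', Finset.mul_sum]
  refine Finset.sum_congr rfl fun d hd => ?_
  have h : d 0 + d 1 = k := by
    have := hn (MvPolynomial.mem_support_iff.1 hd)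
    rw [Finsupp.weight_apply, Finsupp.sum_fintype _ _ (by simp)] at this
    simpa [Fin.sum_univ_two] using this
  rw [Fin.prod_univ_two, Fin.prod_univ_two, ← h]
  ring

namespace P1

variable {L : Type} [CommRing L]

/-- The homogeneous coordinates of the point with affine coordinate `ζ` in the `i`-th chart. -/
def affVec (i : Fin 2) (ζ : L) (j : Fin 2) : L := if j = i then 1 else ζ

/-- The analogue of `P1.chartHom` for the `i`-th chart. -/
noncomputable def affHom (i : Fin 2) (ρ : ℝ →+* L) (ζ : L) :
    Away gradingP1 (MvPolynomial.X i) →+* L :=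
  (Localization.awayLift (MvPolynomial.eval₂Hom ρ (affVec i ζ)) (MvPolynomial.X i)
    (by simp [affVec])).comp
    (algebraMap (Away gradingP1 (MvPolynomial.X i))
      (Localization.Away (MvPolynomial.X i : MvPolynomial (Fin 2) ℝ)))

theorem X_mem (i : Fin 2) : (MvPolynomial.X i : MvPolynomial (Fin 2) ℝ) ∈ gradingP1 1 :=
  MvPolynomial.isHomogeneous_X ℝ i

theorem affHom_mk (i : Fin 2) (ρ : ℝ →+* L) (ζ : L) (n : ℕ) (x : MvPolynomial (Fin 2) ℝ)
    (hx : x ∈ gradingP1 (n • 1)) :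
    affHom i ρ ζ (Away.mk gradingP1 (X_mem i) n x hx) = x.eval₂ ρ (affVec i ζ) := by
  rw [affHom, RingHom.comp_apply, HomogeneousLocalization.algebraMap_apply, Away.val_mk,
    Localization.awayLift_mk (v := 1) (hv := by simp [affVec])]
  simp

theorem affHom_zero (ρ : ℝ →+* L) (ζ : L) : affHom 0 ρ ζ = chartHom ρ ζ := by
  have h : affVec 0 ζ = ![1, ζ] := by
    funext j
    fin_cases j <;> simp [affVec]
  ext y
  simp only [affHom, chartHom, RingHom.comp_apply]
  congr 1
  simp only [h]

/-- The affine coordinate in the `i`-th chart. -/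
noncomputable def affCoord (i : Fin 2) : Away gradingP1 (MvPolynomial.X i : MvPolynomial (Fin 2) ℝ) :=
  Away.mk gradingP1 (X_mem i) 1 (MvPolynomial.X (1 - i)) (by simpa using X_mem (1 - i))

/-- The constants in the coordinate ring of the `i`-th chart. -/
noncomputable def affConst (i : Fin 2) :
    ℝ →+* Away gradingP1 (MvPolynomial.X i : MvPolynomial (Fin 2) ℝ) :=
  (fromZeroRingHom gradingP1 _).comp (algebraMap ℝ (gradingP1 0))

theorem affHom_affConst (i : Fin 2) (ρ : ℝ →+* L) (ζ : L) (r : ℝ) :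
    affHom i ρ ζ (affConst i r) = ρ r := by
  have h : affConst i r = Away.mk gradingP1 (X_mem i) 0 (MvPolynomial.C r)
      (by simp) := by
    apply HomogeneousLocalization.val_injective
    rw [Away.val_mk]
    simp [affConst, fromZeroRingHom]
    rfl
  rw [h, affHom_mk]
  simp

theorem affHom_affCoord (i : Fin 2) (ρ : ℝ →+* L) (ζ : L) :
    affHom i ρ ζ (affCoord i) = ζ := by
  rw [affCoord, affHom_mk]
  fin_cases i <;> simp [affVec]

/-- Dehomogenization: a fraction p/Xᵢⁿ of degree zero is p evaluated at the quotients Xⱼ/Xᵢ. -/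
theorem eval₂_affConst_surjective (i : Fin 2) :
    Function.Surjective (eval₂RingHom (affConst i) (affCoord i)) := by
  intro y
  obtain ⟨n, x, hx, rfl⟩ := Away.mk_surjective gradingP1 (X_mem i) y
  refine ⟨x.eval₂ C (affVec i X), ?_⟩
  have h1 : ∀ p : MvPolynomial (Fin 2) ℝ,
      eval₂RingHom (affConst i) (affCoord i) (p.eval₂ C (affVec i X)) =
        p.eval₂ (affConst i) (affVec i (affCoord i)) := by
    intro p
    rw [MvPolynomial.hom_eval₂]
    congr 1
    · ext r; simp
    · funext j
      simp only [affVec]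
      split_ifs <;> simp
  rw [h1]
  apply HomogeneousLocalization.val_injective
  rw [Away.val_mk]
  let a : MvPolynomial (Fin 2) ℝ →+* Localization.Away (MvPolynomial.X i : MvPolynomial (Fin 2) ℝ) :=
    algebraMap _ _
  let v : Away gradingP1 (MvPolynomial.X i : MvPolynomial (Fin 2) ℝ) →+*
    Localization.Away (MvPolynomial.X i : MvPolynomial (Fin 2) ℝ) := algebraMap _ _
  have h2 : v (x.eval₂ (affConst i) (affVec i (affCoord i))) =
      x.eval₂ (a.comp MvPolynomial.C) (fun j => v (affVec i (affCoord i) j)) := by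
    rw [MvPolynomial.hom_eval₂]
    congr 1
  have hv : ∀ j, a (MvPolynomial.X i) * v (affVec i (affCoord i) j) = a (MvPolynomial.X j) := by
    intro j
    by_cases hj : j = i
    · subst hj; simp [affVec]
    · have hj' : j = 1 - i := by
        fin_cases i <;> fin_cases j <;> simp_all
      have h3 : v (affCoord i) = Localization.mk (MvPolynomial.X (1 - i))
          (⟨MvPolynomial.X i ^ 1, 1, rfl⟩ : Submonoid.powers (MvPolynomial.X i)) := Away.val_mk gradingP1 1 (X_mem i) _ _
      rw [affVec, if_neg hj, h3, Localization.mk_eq_mk'_apply, ← hj']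
      have := IsLocalization.mk'_spec' (Localization.Away (MvPolynomial.X i : MvPolynomial (Fin 2) ℝ))
        (MvPolynomial.X j) (⟨MvPolynomial.X i ^ 1, 1, rfl⟩ : Submonoid.powers (MvPolynomial.X i : MvPolynomial (Fin 2) ℝ))
      have e : a (MvPolynomial.X i) = a (MvPolynomial.X i ^ 1) := by rw [pow_one]
      rw [e]
      exact this
  change v _ = _
  rw [h2, Localization.mk_eq_mk'_apply, IsLocalization.eq_mk'_iff_mul_eq, mul_comm]
  have hx' : x.IsHomogeneous n := by simpa using hx
  change a (MvPolynomial.X i ^ n) * _ = a x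
  rw [map_pow, ← isHomogeneous_eval₂_mul _ hx']
  simp only [hv]
  conv_rhs => rw [← MvPolynomial.eval₂_eta x, MvPolynomial.hom_eval₂]

theorem affHom_ext {i : Fin 2} {φ ψ : Away gradingP1 (MvPolynomial.X i) →+* L}
    (h : φ.comp (affConst i) = ψ.comp (affConst i)) (h' : φ (affCoord i) = ψ (affCoord i)) :
    φ = ψ := by
  ext y
  obtain ⟨p, rfl⟩ := eval₂_affConst_surjective i y
  simp only [coe_eval₂RingHom, hom_eval₂, h, h']

theorem affHom_bijective (i : Fin 2) : Function.Bijective (affHom i C (X : ℝ[X])) := by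
  have h : (affHom i C (X : ℝ[X])).comp (eval₂RingHom (affConst i) (affCoord i)) =
      RingHom.id _ := by
    ext r
    · simp [affHom_affConst]
    · simp [affHom_affCoord]
  refine ⟨fun y z hyz => ?_, fun p => ⟨_, DFunLike.congr_fun h p⟩⟩
  obtain ⟨p, rfl⟩ := eval₂_affConst_surjective i y
  obtain ⟨q, rfl⟩ := eval₂_affConst_surjective i z
  have hp := DFunLike.congr_fun h p
  have hq := DFunLike.congr_fun h q
  simp only [RingHom.comp_apply, RingHom.id_apply] at hp hq
  rw [← hp, ← hq, hyz]

/-- The affine chart of `ℙ¹` where the `i`-th homogeneous coordinate does not vanish. -/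
noncomputable def chart (i : Fin 2) : Spec (.of ℝ[X]) ⟶ P1 :=
  Spec.map (CommRingCat.ofHom (affHom i C X)) ≫
    Proj.awayι gradingP1 (MvPolynomial.X i) (X_mem i) one_pos

instance (i : Fin 2) : IsIso (Spec.map (CommRingCat.ofHom (affHom i C (X : ℝ[X])))) :=
  isIso_SpecMap_iff.2 (affHom_bijective i)

instance (i : Fin 2) : IsOpenImmersion (chart i) := by
  unfold chart; infer_instance

theorem eval₂_comp_affHom (i : Fin 2) (ρ : ℝ →+* L) (ζ : L) :
    (eval₂RingHom ρ ζ).comp (affHom i C X) = affHom i ρ ζ := by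
  refine affHom_ext ?_ ?_
  · ext r; simp [affHom_affConst]
  · simp [affHom_affCoord]

theorem SpecMap_eval₂_chart (i : Fin 2) (ρ : ℝ →+* L) (ζ : L) :
    Spec.map (CommRingCat.ofHom (eval₂RingHom ρ ζ)) ≫ chart i =
      Spec.map (CommRingCat.ofHom (affHom i ρ ζ)) ≫
        Proj.awayι gradingP1 (MvPolynomial.X i) (X_mem i) one_pos := by
  rw [chart, ← Spec.map_comp_assoc, ← CommRingCat.ofHom_comp, eval₂_comp_affHom]

theorem point_eq (ρ : ℝ →+* L) (ζ : L) :
    point ρ ζ = Spec.map (CommRingCat.ofHom (eval₂RingHom ρ ζ)) ≫ chart 0 := by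
  rw [SpecMap_eval₂_chart, affHom_zero]
  rfl

theorem exists_mem_range_chart (x : P1) : ∃ i, x ∈ (chart i).opensRange := by
  have h : ⨆ i : Fin 2, Proj.basicOpen gradingP1 (MvPolynomial.X i) = ⊤ := by
    refine Proj.iSup_basicOpen_eq_top' gradingP1 _ (fun i => ⟨1, X_mem i⟩) ?_
    refine Algebra.eq_top_iff.2 fun p => ?_
    induction p using MvPolynomial.induction_on with
    | C r =>
      exact Subalgebra.algebraMap_mem _
        (⟨MvPolynomial.C r, MvPolynomial.isHomogeneous_C (Fin 2) r⟩ : gradingP1 0)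
    | add p q hp hq => exact add_mem hp hq
    | mul_X p i hp => exact mul_mem hp (Algebra.subset_adjoin ⟨i, rfl⟩)
  have hx : x ∈ (⊤ : P1.Opens) := trivial
  rw [← h, TopologicalSpace.Opens.mem_iSup] at hx
  obtain ⟨i, hi⟩ := hx
  refine ⟨i, ?_⟩
  have hr : (chart i).opensRange = Proj.basicOpen gradingP1 (MvPolynomial.X i) := by
    unfold chart
    rw [Scheme.Hom.opensRange_comp_of_isIso, Proj.opensRange_awayι]
  rwa [hr]

theorem chart_toSpec (i : Fin 2) :
    chart i ≫ P1.toSpec = Spec.map (CommRingCat.ofHom (C : ℝ →+* ℝ[X])) := by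
  rw [chart, P1.toSpec, Category.assoc, Proj.awayι_toSpecZero_assoc, ← Spec.map_comp,
    ← Spec.map_comp, ← CommRingCat.ofHom_comp, ← CommRingCat.ofHom_comp]
  congr 2
  ext r : 1
  exact affHom_affConst i C X r

/-- The two affine coordinates are inverse to each other. -/
theorem SpecMap_eval₂_chart_eq (ρ : ℝ →+* L) {ζ ζ' : L} (h : ζ * ζ' = 1) :
    Spec.map (CommRingCat.ofHom (eval₂RingHom ρ ζ)) ≫ chart 0 =
      Spec.map (CommRingCat.ofHom (eval₂RingHom ρ ζ')) ≫ chart 1 := by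
  let x : MvPolynomial (Fin 2) ℝ := MvPolynomial.X 0 * MvPolynomial.X 1
  have hu : IsUnit (MvPolynomial.eval₂Hom ρ (affVec 0 ζ) x) := by
    simpa [x, affVec] using IsUnit.of_mul_eq_one _ h
  -- Both morphisms factor through the overlap of the charts, where X₀X₁ is invertible; η is the
  -- evaluation there at (1, ζ). On the second chart one compares homogeneous coordinates (1, ζ) =
  -- ζ(ζ', 1).
  let η : Away gradingP1 x →+* L := (Localization.awayLift _ x hu).comp (algebraMap _ _)
  have hη : ∀ (p : MvPolynomial (Fin 2) ℝ) (n : ℕ) (hp : p ∈ gradingP1 (n • 2)),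
      ζ ^ n * η (Away.mk gradingP1 (d := 2) (SetLike.mul_mem_graded (X_mem 0) (X_mem 1)) n p hp) =
        p.eval₂ ρ (affVec 0 ζ) := by
    intro p n hp
    simp only [η, RingHom.comp_apply]
    rw [HomogeneousLocalization.algebraMap_apply, Away.val_mk,
      Localization.awayLift_mk (v := ζ') (hv := by simpa [x, affVec] using h)]
    simp only [MvPolynomial.coe_eval₂Hom]
    linear_combination (p.eval₂ ρ (affVec 0 ζ)) * congrArg (· ^ n) h
  have hc : ∀ (n : ℕ) {a b : L}, ζ ^ n * a = ζ ^ n * b → a = b := fun n a b e =>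
    ((IsUnit.of_mul_eq_one _ h).pow n).mul_left_cancel e
  rw [SpecMap_eval₂_chart, SpecMap_eval₂_chart]
  have h0 : η.comp (awayMap gradingP1 (X_mem 1) (f := MvPolynomial.X 0) rfl) = affHom 0 ρ ζ := by
    ext y
    obtain ⟨n, p, hp, rfl⟩ := Away.mk_surjective gradingP1 (X_mem 0) y
    rw [RingHom.comp_apply, awayMap_mk, affHom_mk]
    refine hc n ?_
    rw [hη]
    simp [affVec, mul_comm]
  have h1 : η.comp (awayMap gradingP1 (X_mem 0) (f := MvPolynomial.X 1) (mul_comm _ _)) =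
      affHom 1 ρ ζ' := by
    ext y
    obtain ⟨n, p, hp, rfl⟩ := Away.mk_surjective gradingP1 (X_mem 1) y
    rw [RingHom.comp_apply, awayMap_mk, affHom_mk]
    refine hc n ?_
    have hp' : p.IsHomogeneous n := by simpa using hp
    rw [← isHomogeneous_eval₂_mul ρ hp']
    refine (hη _ n _).trans ?_
    have hv : (fun j => ζ * affVec 1 ζ' j) = affVec 0 ζ := by
      funext j
      fin_cases j <;> simp [affVec, h]
    rw [hv]
    simp [affVec]
  have e0 := Proj.SpecMap_awayMap_awayι gradingP1 (X_mem 0) one_pos (X_mem 1)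
    (x := x) rfl
  have e1 := Proj.SpecMap_awayMap_awayι gradingP1 (X_mem 1) one_pos (X_mem 0)
    (x := x) (mul_comm _ _)
  rw [← h0, ← h1, CommRingCat.ofHom_comp (f := awayMap gradingP1 (X_mem 1) (f := MvPolynomial.X 0) rfl),
    CommRingCat.ofHom_comp (f := awayMap gradingP1 (X_mem 0) (f := MvPolynomial.X 1) (mul_comm _ _)),
    Spec.map_comp, Spec.map_comp, Category.assoc, Category.assoc, e0, e1]

end P1

end RealSphere

namespace RealSphere

open scoped QuadraticAlgebra

open Polynomial

/-! ### Smooth quadratic algebras over the ring of real polynomials -/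

section QuadBasis

variable {B : Type} [CommRing B]

/-- The `ℝ[X]`-algebra `B` has the basis `1, u`, and `u² = f`. -/
def IsQuadBasis (φ : ℝ[X] →+* B) (f : ℝ[X]) (u : B) : Prop :=
  u ^ 2 = φ f ∧ (∀ b, ∃ p q, b = φ p + φ q * u) ∧ ∀ p q, φ p + φ q * u = 0 → p = 0 ∧ q = 0

namespace IsQuadBasis

variable {φ : ℝ[X] →+* B} {f : ℝ[X]} {u : B}

theorem injective (h : IsQuadBasis φ f u) : Function.Injective φ := by
  rw [injective_iff_map_eq_zero]
  intro p hp
  exact (h.2.2 p 0 (by simp [hp])).1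

theorem notSq [IsDomain B] (h : IsQuadBasis φ f u) : NotSq f := by
  intro a b e
  have h1 : (φ a + φ b * u) * (φ a + φ (-b) * u) = 0 := by
    have := congrArg φ e
    simp only [map_pow, map_mul, ← h.1] at this
    rw [map_neg]
    linear_combination this
  rcases mul_eq_zero.1 h1 with h2 | h2
  · exact (h.2.2 _ _ h2).2
  · simpa using (h.2.2 _ _ h2).2

theorem finite_free_finrank [Algebra ℝ[X] B] (h : IsQuadBasis (algebraMap ℝ[X] B) f u) :
    Module.Finite ℝ[X] B ∧ Module.Free ℝ[X] B ∧ Module.finrank ℝ[X] B = 2 := by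
  let l : (ℝ[X] × ℝ[X]) →ₗ[ℝ[X]] B :=
    (LinearMap.toSpanSingleton ℝ[X] B 1).coprod (LinearMap.toSpanSingleton ℝ[X] B u)
  have hl : ∀ x, l x = algebraMap ℝ[X] B x.1 + algebraMap ℝ[X] B x.2 * u := by
    intro x
    simp [l, Algebra.smul_def]
  let e : (ℝ[X] × ℝ[X]) ≃ₗ[ℝ[X]] B := LinearEquiv.ofBijective l ⟨by
    rw [injective_iff_map_eq_zero]
    intro x hx
    rw [hl] at hx
    exact Prod.ext_iff.2 (h.2.2 _ _ hx), fun b => by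
    obtain ⟨p, q, rfl⟩ := h.2.1 b
    exact ⟨(p, q), hl _⟩⟩
  exact ⟨Module.Finite.equiv e, Module.Free.of_equiv e, by rw [← e.finrank_eq]; simp⟩

theorem exists_ringEquiv (h : IsQuadBasis φ f u) :
    ∃ e : QuadRing f ≃+* B, (∀ p, e (algebraMap _ _ p) = φ p) ∧ e (AdjoinRoot.root _) = u := by
  have hroot := QuadRing.lift_root φ u h.1
  have hmap := QuadRing.lift_algebraMap φ u h.1
  refine ⟨RingEquiv.ofBijective (QuadRing.lift φ u h.1) ⟨?_, fun b => ?_⟩, hmap, hroot⟩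
  · rw [injective_iff_map_eq_zero]
    intro m hm
    obtain ⟨a, b, rfl⟩ := QuadRing.exists_eq m
    rw [map_add, map_mul, hroot, hmap, hmap] at hm
    obtain ⟨rfl, rfl⟩ := h.2.2 _ _ hm
    simp
  · obtain ⟨p, q, rfl⟩ := h.2.1 b
    refine ⟨algebraMap _ _ p + algebraMap _ _ q * AdjoinRoot.root _, ?_⟩
    rw [map_add, map_mul, hroot, hmap, hmap]

/-- The Jacobian criterion. -/
theorem formallySmooth [Algebra ℝ B] (hφ : φ.comp C = algebraMap ℝ B) (h : IsQuadBasis φ f u)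
    (hf : Squarefree f) : Algebra.FormallySmooth ℝ B := by
  obtain ⟨s, t, hst⟩ : IsCoprime f (derivative f) := PerfectField.separable_iff_squarefree.2 hf
  refine Algebra.FormallySmooth.of_comp_surjective fun A _ _ I hI g => ?_
  obtain ⟨a, ha⟩ := Ideal.Quotient.mk_surjective (g (φ X))
  obtain ⟨b, hb⟩ := Ideal.Quotient.mk_surjective (g u)
  have hg : ∀ p : ℝ[X], g (φ p) = Ideal.Quotient.mk I (aeval a p) := by
    intro p
    have : (g : B →+* A ⧸ I).comp φ = (Ideal.Quotient.mk I).comp (aeval a : ℝ[X] →ₐ[ℝ] A) := by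
      ext r
      · have h1 := DFunLike.congr_fun hφ r
        simp only [RingHom.comp_apply] at h1
        simp only [RingHom.comp_apply, h1]
        simp
      · simp [ha]
    exact DFunLike.congr_fun this p
  set ε : A := b ^ 2 - aeval a f with hε
  have hεI : ε ∈ I := by
    rw [← Ideal.Quotient.eq_zero_iff_mem, hε, map_sub, map_pow, hb, ← hg, ← h.1, map_pow, sub_self]
  have hI2 : ∀ x ∈ I, ∀ y ∈ I, x * y = 0 := by
    intro x hx y hy
    have : x * y ∈ I ^ 2 := by rw [sq]; exact Ideal.mul_mem_mul hx hy
    simpa [hI] using this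
  have hst' : aeval a s * aeval a f + aeval a t * aeval a (derivative f) = 1 := by
    rw [← map_mul, ← map_mul, ← map_add, hst, map_one]
  have h2 : algebraMap ℝ A (1 / 2) * 2 = 1 := by
    rw [← map_ofNat (algebraMap ℝ A) 2, ← map_mul]
    norm_num
  -- One Newton step corrects the error ε = b² - f(a): a moves by εt and b by -εbs/2. Modulo ε² the
  -- error becomes ε(1 - sf - tf'), which is zero by the Bézout identity.
  set σ : A := ε * aeval a t with hσ
  set τ : A := -(ε * b * aeval a s * algebraMap ℝ A (1 / 2)) with hτ
  have hσI : σ ∈ I := Ideal.mul_mem_right _ _ hεI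
  have hτI : τ ∈ I := by
    have : τ = ε * (-(b * aeval a s * algebraMap ℝ A (1 / 2))) := by rw [hτ]; ring
    rw [this]
    exact Ideal.mul_mem_right _ _ hεI
  have hnew : (b + τ) ^ 2 = (aeval (a + σ) : ℝ[X] →ₐ[ℝ] A).toRingHom f := by
    change _ = aeval (a + σ) f
    rw [Polynomial.aeval_add_of_sq_eq_zero f a σ (by rw [sq]; exact hI2 _ hσI _ hσI)]
    have h3 : τ * τ = 0 := hI2 _ hτI _ hτI
    have h4 : ε * ε = 0 := hI2 _ hεI _ hεI
    have h5 : aeval a f = b ^ 2 - ε := by rw [hε]; ring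
    rw [h5] at hst' ⊢
    linear_combination h3 - ε * hst' - aeval a s * h4 - ε * b ^ 2 * aeval a s * h2 +
      2 * b * hτ - aeval a (derivative f) * hσ
  obtain ⟨e, he, heu⟩ := h.exists_ringEquiv
  let k : B →+* A := (QuadRing.lift _ _ hnew).comp (e.symm : B →+* QuadRing f)
  have hk : ∀ p, k (φ p) = aeval (a + σ) p := by
    intro p
    change QuadRing.lift _ _ hnew (e.symm (φ p)) = _
    rw [← he, e.symm_apply_apply, QuadRing.lift_algebraMap]
    rfl
  have hku : k u = b + τ := by
    change QuadRing.lift _ _ hnew (e.symm u) = _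
    rw [← heu, e.symm_apply_apply, QuadRing.lift_root]
  refine ⟨⟨k, fun r => ?_⟩, ?_⟩
  · have := hk (C r)
    rw [aeval_C] at this
    rw [← hφ]
    exact this
  · ext x
    obtain ⟨p, q, rfl⟩ := h.2.1 x
    have hI0 : ∀ x ∈ I, Ideal.Quotient.mk I x = 0 := fun x hx => Ideal.Quotient.eq_zero_iff_mem.2 hx
    have hmk : ∀ p : ℝ[X], Ideal.Quotient.mk I (aeval (a + σ) p) = g (φ p) := by
      intro p
      rw [Polynomial.aeval_add_of_sq_eq_zero p a σ (by rw [sq]; exact hI2 _ hσI _ hσI), map_add,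
        map_mul, hI0 σ hσI, mul_zero, add_zero, hg]
    change Ideal.Quotient.mk I (k (φ p + φ q * u)) = g _
    simp only [map_add, map_mul, hk, hku, hmk, hI0 τ hτI, hb, add_zero]

theorem smooth [Algebra ℝ B] (hφ : φ.comp C = algebraMap ℝ B) (h : IsQuadBasis φ f u)
    (hf : Squarefree f) : Algebra.Smooth ℝ B := by
  have := h.formallySmooth hφ hf
  refine ⟨inferInstance, Algebra.FinitePresentation.of_finiteType.1 ?_⟩
  let := φ.toAlgebra
  have : IsScalarTower ℝ ℝ[X] B := IsScalarTower.of_algebraMap_eq' hφ.symm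
  have := (IsQuadBasis.finite_free_finrank (B := B) h).1
  exact Algebra.FiniteType.trans (S := ℝ[X]) inferInstance inferInstance

theorem _root_.RealSphere.isNilpotent_of_mul_eq_zero {R : Type*} [CommRing R] {I : Ideal R}
    (h : ∀ x ∈ I, ∀ y ∈ I, x * y = 0) : IsNilpotent I := by
  refine ⟨2, ?_⟩
  rw [sq, Submodule.zero_eq_bot, eq_bot_iff, Ideal.mul_le]
  exact h

theorem _root_.RealSphere.exists_quotient_sq {P : Type} [CommRing P] [Algebra ℝ P]
    [Algebra ℝ B] (G : P →ₐ[ℝ] B) (w : P) (hw : G w = 0) :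
    ∃ (A : Type) (_ : CommRing A) (_ : Algebra ℝ A) (mk : P →ₐ[ℝ] A) (g : A →ₐ[ℝ] B),
      Function.Surjective mk ∧ (∀ p, mk p = 0 ↔ w ^ 2 ∣ p) ∧ ∀ p, g (mk p) = G p := by
  refine ⟨P ⧸ Ideal.span {w ^ 2}, inferInstance, inferInstance, Ideal.Quotient.mkₐ ℝ _,
    Ideal.Quotient.liftₐ _ G fun x hx => ?_, Ideal.Quotient.mkₐ_surjective ℝ _, fun p => ?_,
    fun p => rfl⟩
  · obtain ⟨y, rfl⟩ := Ideal.mem_span_singleton.1 hx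
    simp [hw]
  · rw [Ideal.Quotient.mkₐ_eq_mk, Ideal.Quotient.eq_zero_iff_mem, Ideal.mem_span_singleton]

/-- With w = Y² - f, lift the identity of B to ℝ[X][Y]/(w²). If X and Y lift with corrections ws and
wt, then u² = f gives 1 + 2Yt - f's ≡ 0 modulo w. The coefficient of 1 in the basis 1, u is a Bézout
identity for f and f'. -/
theorem squarefree [Algebra ℝ B] (hφ : φ.comp C = algebraMap ℝ B) (h : IsQuadBasis φ f u)
    [Algebra.FormallySmooth ℝ B] : Squarefree f := by
  rw [← PerfectField.separable_iff_squarefree]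
  obtain ⟨e, he, heu⟩ := h.exists_ringEquiv
  let w : ℝ[X][X] := X ^ 2 - C f
  have hw : w.Monic := monic_X_pow_sub_C f two_ne_zero
  let G : ℝ[X][X] →ₐ[ℝ] B :=
    ⟨(e : QuadRing f →+* B).comp (AdjoinRoot.mk w), fun r =>
      (he (C r)).trans (DFunLike.congr_fun hφ r)⟩
  have hG0 : ∀ p, G p = 0 ↔ w ∣ p := fun p => by
    rw [← AdjoinRoot.mk_eq_zero]
    exact e.map_eq_zero_iff
  have hGC : ∀ p, G (C p) = φ p := he
  have hGX : G X = u := heu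
  have hGs : Function.Surjective G := e.surjective.comp AdjoinRoot.mk_surjective
  clear_value G
  obtain ⟨A, _, _, mk, g, hmk, hA, hg⟩ := exists_quotient_sq G w ((hG0 w).2 dvd_rfl)
  have hgs : Function.Surjective g := by
    intro b
    obtain ⟨p, rfl⟩ := hGs b
    exact ⟨mk p, hg p⟩
  have hker : ∀ x : A, g x = 0 → ∃ s, x = mk (w * s) := by
    intro x hx
    obtain ⟨p, rfl⟩ := hmk x
    obtain ⟨s, rfl⟩ := (hG0 p).1 (by rw [← hg, hx])
    exact ⟨s, rfl⟩
  have hnil : IsNilpotent (RingHom.ker (g : A →+* B)) := by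
    refine isNilpotent_of_mul_eq_zero fun x hx y hy => ?_
    obtain ⟨s, rfl⟩ := hker x hx
    obtain ⟨t, rfl⟩ := hker y hy
    rw [← map_mul, hA]
    exact ⟨s * t, by ring⟩
  let τ := Algebra.FormallySmooth.liftOfSurjective (AlgHom.id ℝ B) g hgs hnil
  have hτ : ∀ b, g (τ b) = b := Algebra.FormallySmooth.liftOfSurjective_apply _ g hgs hnil
  obtain ⟨s, hs⟩ := hker (τ (φ X) - mk (C X)) (by rw [map_sub, hτ, hg, hGC, sub_self])
  obtain ⟨t, ht⟩ := hker (τ u - mk X) (by rw [map_sub, hτ, hg, hGX, sub_self])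
  have hφτ : ∀ p, τ (φ p) = aeval (τ (φ X)) p := by
    intro p
    have : (τ : B →+* A).comp φ = (aeval (τ (φ X)) : ℝ[X] →ₐ[ℝ] A).toRingHom := by
      ext r
      · have h1 := DFunLike.congr_fun hφ r
        simp only [RingHom.comp_apply] at h1
        simp only [RingHom.comp_apply, h1]
        simp
      · simp
    exact DFunLike.congr_fun this p
  have hmkC : ∀ p : ℝ[X], aeval (mk (C X)) p = mk (C p) := by
    intro p
    have : (aeval (mk (C X)) : ℝ[X] →ₐ[ℝ] A).toRingHom = (mk : ℝ[X][X] →+* A).comp C := by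
      ext r
      · simp only [AlgHom.toRingHom_eq_coe, RingHom.comp_apply, RingHom.coe_coe, aeval_C]
        exact (mk.commutes r).symm
      · simp
    exact DFunLike.congr_fun this p
  have e1 : τ (φ X) = mk (C X) + mk (w * s) := by rw [← hs]; ring
  have e2 : τ u = mk X + mk (w * t) := by rw [← ht]; ring
  have e3 : τ u ^ 2 = τ (φ f) := by rw [← map_pow, h.1]
  have hsq : (mk (w * s)) ^ 2 = 0 := by
    rw [← map_pow, hA]
    exact ⟨s ^ 2, by ring⟩
  rw [hφτ, e1, e2, Polynomial.aeval_add_of_sq_eq_zero f _ _ hsq, hmkC, hmkC, ← map_add, ← map_pow,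
    ← map_mul, ← map_add, ← sub_eq_zero, ← map_sub, hA] at e3
  have e4 : w ^ 2 ∣ w * (1 + 2 * X * t - C (derivative f) * s) := by
    have h1 : w * (1 + 2 * X * t - C (derivative f) * s) =
        (X + w * t) ^ 2 - (C f + C (derivative f) * (w * s)) - w ^ 2 * t ^ 2 := by
      simp only [w]; ring
    rw [h1]
    exact dvd_sub e3 ⟨_, rfl⟩
  rw [sq, mul_dvd_mul_iff_left hw.ne_zero, ← hG0] at e4
  obtain ⟨p, q, hpq⟩ := h.2.1 (G s)
  obtain ⟨p', q', hpq'⟩ := h.2.1 (G t)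
  simp only [map_add, map_sub, map_mul, map_one, map_ofNat, hGX, hGC, hpq, hpq'] at e4
  have e5 := (h.2.2 (1 + 2 * q' * f - derivative f * p) (2 * p' - derivative f * q) (by
    simp only [map_add, map_sub, map_mul, map_one, map_ofNat, ← h.1]
    linear_combination e4)).1
  exact ⟨-2 * q', p, by linear_combination -e5⟩

end IsQuadBasis

end QuadBasis

end RealSphere

/-! ### Quadratic bases and integral closures -/

namespace RealSphere

open scoped QuadraticAlgebra

open Polynomial

section QuadBasis

variable {B : Type} [CommRing B]

/-- A finite flat module over a principal ideal domain is free. The coordinates of 1 are coprime: a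
common divisor is a unit in B, hence in ℝ[X] by integrality. So 1 extends to a basis 1, v, and
completing the square replaces v by u. -/
theorem exists_isQuadBasis [IsDomain B] [Algebra ℝ[X] B] [Module.Finite ℝ[X] B]
    [Module.Flat ℝ[X] B] (h2 : Module.finrank ℝ[X] B = 2) :
    ∃ f u, IsQuadBasis (algebraMap ℝ[X] B) f u := by
  have htf : Module.IsTorsionFree ℝ[X] B := inferInstance
  have hfree : Module.Free ℝ[X] B := inferInstance
  let bs := Module.finBasisOfFinrankEq ℝ[X] B h2
  have hsum : ∀ x : B, ∃ p q : ℝ[X], x = p • bs 0 + q • bs 1 := fun x =>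
    ⟨bs.repr x 0, bs.repr x 1, by
      conv_lhs => rw [← bs.sum_repr x]
      rw [Fin.sum_univ_two]⟩
  have hind : ∀ p q : ℝ[X], p • bs 0 + q • bs 1 = 0 → p = 0 ∧ q = 0 := by
    intro p q e
    have := Fintype.linearIndependent_iff.1 bs.linearIndependent ![p, q] (by
      simpa [Fin.sum_univ_two] using e)
    exact ⟨this 0, this 1⟩
  obtain ⟨s, t, hst⟩ := hsum 1
  have hcop : IsCoprime s t := by
    rw [← EuclideanDomain.gcd_isUnit_iff]
    obtain ⟨s', hs'⟩ := EuclideanDomain.gcd_dvd_left s t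
    obtain ⟨t', ht'⟩ := EuclideanDomain.gcd_dvd_right s t
    have hu : IsUnit (algebraMap ℝ[X] B (EuclideanDomain.gcd s t)) := by
      refine IsUnit.of_mul_eq_one (s' • bs 0 + t' • bs 1) ?_
      rw [← Algebra.smul_def, smul_add, smul_smul, smul_smul, ← hs', ← ht', hst]
    exact isUnit_of_map_unit (algebraMap ℝ[X] B) _ hu
  obtain ⟨s', t', hc⟩ := hcop
  let v : B := -t' • bs 0 + s' • bs 1
  have hspan : ∀ x : B, ∃ p q : ℝ[X], x = algebraMap _ _ p + algebraMap _ _ q * v := by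
    intro x
    obtain ⟨p, q, rfl⟩ := hsum x
    refine ⟨p * s' + q * t', -p * t + q * s, ?_⟩
    rw [Algebra.algebraMap_eq_smul_one, hst, ← Algebra.smul_def]
    simp only [v, smul_add, smul_smul]
    have h0 : p = (p * s' + q * t') * s + (-p * t + q * s) * -t' := by
      linear_combination -p * hc
    have h1 : q = (p * s' + q * t') * t + (-p * t + q * s) * s' := by
      linear_combination -q * hc
    rw [add_add_add_comm, ← add_smul, ← add_smul, ← h0, ← h1]
  have hind' : ∀ p q : ℝ[X], algebraMap _ B p + algebraMap _ _ q * v = 0 → p = 0 ∧ q = 0 := by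
    intro p q e
    rw [Algebra.algebraMap_eq_smul_one, hst, ← Algebra.smul_def] at e
    simp only [v, smul_add, smul_smul] at e
    rw [add_add_add_comm, ← add_smul, ← add_smul] at e
    obtain ⟨e0, e1⟩ := hind _ _ e
    exact ⟨by linear_combination -p * hc + s' * e0 + t' * e1,
      by linear_combination -q * hc - t * e0 + s * e1⟩
  obtain ⟨a, b, hv⟩ := hspan (v ^ 2)
  let k : ℝ[X] := C (1 / 2)
  have hk : k * 2 = 1 := by
    rw [← C_ofNat, ← C_mul]; norm_num
  have hkB : algebraMap ℝ[X] B k * 2 = 1 := by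
    rw [← map_ofNat (algebraMap ℝ[X] B) 2, ← map_mul, hk, map_one]
  refine ⟨a + (k * b) ^ 2, v - algebraMap _ _ (k * b), ?_, fun x => ?_, fun p q e => ?_⟩
  · simp only [map_add, map_pow, map_mul]
    linear_combination hv - v * algebraMap ℝ[X] B b * hkB
  · obtain ⟨p, q, rfl⟩ := hspan x
    refine ⟨p + q * (k * b), q, ?_⟩
    simp only [map_add, map_mul]
    ring
  · obtain ⟨h0, h1⟩ := hind' (p - q * (k * b)) q (by
      rw [← e]
      simp only [map_sub, map_mul]
      ring)
    refine ⟨?_, h1⟩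
    rw [h1] at h0
    simpa using h0

/-- After division by the greatest common divisor, the square of the remaining factor of d divides
f, so that factor is a unit. -/
theorem dvd_of_sq_dvd_mul_sq {d b f : ℝ[X]} (hf : Squarefree f) (h : d ^ 2 ∣ f * b ^ 2)
    (hd : d ≠ 0) : d ∣ b := by
  obtain ⟨d', hd'⟩ := EuclideanDomain.gcd_dvd_left d b
  obtain ⟨b', hb'⟩ := EuclideanDomain.gcd_dvd_right d b
  set g := EuclideanDomain.gcd d b with hg
  have hg0 : g ≠ 0 := fun h0 => hd (by rw [hd', h0, zero_mul])
  have hcop : IsCoprime d' b' := by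
    have h1 := EuclideanDomain.gcd_eq_gcd_ab d b
    rw [← hg] at h1
    refine ⟨EuclideanDomain.gcdA d b, EuclideanDomain.gcdB d b, mul_left_cancel₀ hg0 ?_⟩
    conv_rhs => rw [mul_one, h1]
    linear_combination -EuclideanDomain.gcdA d b * hd' - EuclideanDomain.gcdB d b * hb'
  have h1 : d' ^ 2 ∣ f * b' ^ 2 := by
    rw [hd', hb'] at h
    rw [← mul_dvd_mul_iff_left (pow_ne_zero 2 hg0)]
    convert h using 1 <;> ring
  have h2 : d' * d' ∣ f := by
    rw [← sq]
    exact (hcop.pow (m := 2) (n := 2)).dvd_of_dvd_mul_right h1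
  obtain ⟨d'', hd''⟩ := (hf d' h2).exists_right_inv
  exact ⟨d'' * b', by
    conv_lhs => rw [hb']
    conv_rhs => rw [hd']
    linear_combination -g * b' * hd''⟩

theorem exists_eval₂_of_isIntegralElem {M : Type*} [Field M] {ρ : ℝ →+* M} {ζ : M}
    (hζ : ∀ p : ℝ[X], p.eval₂ ρ ζ = 0 → p = 0) {a d : ℝ[X]} (hd : d ≠ 0) {m : M}
    (hm : (eval₂RingHom ρ ζ).IsIntegralElem m) (h : m * d.eval₂ ρ ζ = a.eval₂ ρ ζ) : d ∣ a := by
  let φ := eval₂RingHom ρ ζ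
  have hφ : Function.Injective φ := (injective_iff_map_eq_zero φ).2 hζ
  let := φ.toAlgebra
  have : FaithfulSMul ℝ[X] M := (faithfulSMul_iff_algebraMap_injective _ _).2 hφ
  let K := FractionRing ℝ[X]
  let i : K →+* M := IsFractionRing.lift (A := ℝ[X]) hφ
  let x : K := algebraMap _ _ a / algebraMap _ _ d
  have hdM : φ d ≠ 0 := fun h0 => hd (hζ d h0)
  have hix : i x = m := by
    rw [map_div₀, IsFractionRing.lift_algebraMap, IsFractionRing.lift_algebraMap]
    rw [div_eq_iff hdM]
    exact h.symm
  have hx : IsIntegral ℝ[X] x := by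
    obtain ⟨P, hP, e⟩ := hm
    refine ⟨P, hP, i.injective ?_⟩
    rw [map_zero, hom_eval₂, hix, ← e]
    congr 1
    exact RingHom.ext fun r => IsFractionRing.lift_algebraMap hφ r
  obtain ⟨y, hy⟩ := IsIntegrallyClosed.isIntegral_iff.1 hx
  refine ⟨y, IsFractionRing.injective ℝ[X] K ?_⟩
  rw [map_mul, hy, mul_div_cancel₀]
  exact (map_ne_zero_iff _ (IsFractionRing.injective ℝ[X] K)).2 hd

/-- The integral closure of `ℝ[X]` in `ℝ(X)(√f)` is `ℝ[X][√f]` if `f` is squarefree. -/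
theorem IsQuadBasis.bijOn_integral {M : Type*} [Field M] {φ : ℝ[X] →+* B} {f : ℝ[X]} {u : B}
    (h : IsQuadBasis φ f u) (hf : Squarefree f) (hN : NotSq f) {ρ : ℝ →+* M} {ζ : M}
    (hM : IsQuadExt ρ ζ f) {ψ : B →+* M} (hψ : ψ.comp φ = eval₂RingHom ρ ζ) :
    Function.Injective ψ ∧ ∀ m, (∃ b, ψ b = m) ↔ (eval₂RingHom ρ ζ).IsIntegralElem m := by
  obtain ⟨hζ, v, hv, hm⟩ := hM
  set E := eval₂RingHom ρ ζ with hE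
  have hEφ : ∀ p, ψ (φ p) = E p := fun p => DFunLike.congr_fun hψ p
  have hw : ψ u ^ 2 = E f := by rw [← map_pow, h.1, hEφ]
  have hsp : ∀ m : M, ∃ a b d : ℝ[X], d ≠ 0 ∧ m * E d = E a + E b * ψ u := by
    intro m
    obtain ⟨a, b, d, hd, e⟩ := hm m
    rcases sq_eq_sq_iff_eq_or_eq_neg.1 (hv.trans hw.symm) with h1 | h1
    · exact ⟨a, b, d, hd, by rw [← h1]; exact e⟩
    · exact ⟨a, -b, d, hd, by rw [map_neg, neg_mul_comm, ← h1]; exact e⟩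
  have hind : ∀ (w : M), w ^ 2 = E f → ∀ a b : ℝ[X], E a + E b * w = 0 → a = 0 ∧ b = 0 :=
    fun w hw a b e => eq_zero_of_add_mul_eq_zero hN hζ hw e
  refine ⟨?_, fun m => ⟨?_, fun hmi => ?_⟩⟩
  · rw [injective_iff_map_eq_zero]
    intro b hb
    obtain ⟨p, q, rfl⟩ := h.2.1 b
    rw [map_add, map_mul, hEφ, hEφ] at hb
    obtain ⟨rfl, rfl⟩ := hind _ hw _ _ hb
    simp
  · rintro ⟨b, rfl⟩
    obtain ⟨p, q, rfl⟩ := h.2.1 b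
    rw [map_add, map_mul, hEφ, hEφ]
    refine (E.isIntegralElem_map).add _ ((E.isIntegralElem_map).mul _
      ⟨X ^ 2 - C f, monic_X_pow_sub_C f two_ne_zero, ?_⟩)
    simp [hw]
  · obtain ⟨a, b, d, hd, e⟩ := hsp m
    have hEd : E d ≠ 0 := fun h0 => hd (hζ d h0)
    let cj (w : M) (hw : w ^ 2 = E f) : QuadRing f →+* M := QuadRing.lift E w hw
    have hw' : (-ψ u) ^ 2 = E f := by rw [neg_sq, hw]
    have hcj : ∀ w hw p, cj w hw (algebraMap _ _ p) = E p := fun w hw p =>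
      QuadRing.lift_algebraMap E w hw p
    have hcr : ∀ w hw, cj w hw (AdjoinRoot.root _) = w := fun w hw => QuadRing.lift_root E w hw
    have hinj : ∀ z, cj (ψ u) hw z = 0 → z = 0 := by
      intro z hz
      obtain ⟨p, q, rfl⟩ := QuadRing.exists_eq z
      rw [map_add, map_mul, hcj, hcj, hcr] at hz
      obtain ⟨rfl, rfl⟩ := hind _ hw _ _ hz
      simp
    let c : QuadRing f := algebraMap _ _ a + algebraMap _ _ b * AdjoinRoot.root _
    have hc : ∀ w hw, cj w hw c = E a + E b * w := fun w hw => by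
      rw [map_add, map_mul, hcj, hcj, hcr]
    have hcomp : ∀ w hw, (cj w hw).comp (algebraMap ℝ[X] (QuadRing f)) = E := fun w hw =>
      RingHom.ext (hcj w hw)
    set m' : M := (E a - E b * ψ u) / E d with hm'
    have e' : E d * m' = E a - E b * ψ u := mul_div_cancel₀ _ hEd
    -- The conjugate of m satisfies the same integral equation. Conjugation is available only on
    -- ℝ[X][√f], so the denominator d is first cleared by scaling the roots of the equation.
    have hmi' : E.IsIntegralElem m' := by
      obtain ⟨P, hP, hP0⟩ := hmi
      refine ⟨P, hP, ?_⟩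
      have hz : eval₂ (algebraMap ℝ[X] (QuadRing f)) c (P.scaleRoots d) = 0 := by
        apply hinj
        rw [hom_eval₂, hcomp, hc, ← e, mul_comm]
        exact scaleRoots_eval₂_eq_zero E hP0
      have hz' := congrArg (cj _ hw') hz
      rw [hom_eval₂, hcomp, hc, map_zero, mul_neg, ← sub_eq_add_neg, ← e',
        scaleRoots_eval₂_mul] at hz'
      exact (mul_eq_zero.1 hz').resolve_left (pow_ne_zero _ hEd)
    -- The trace 2a/d and the norm (a² - fb²)/d² are integral over ℝ[X], hence polynomials. The
    -- first gives d ∣ a, and then d² ∣ fb² gives d ∣ b because f is squarefree.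
    have hda : d ∣ a := by
      have h1 : d ∣ 2 * a := exists_eval₂_of_isIntegralElem hζ hd (hmi.add E hmi') (by
        change (m + m') * E d = E (2 * a)
        rw [map_mul, map_ofNat]
        linear_combination e + e')
      have h2 : a = C (1 / 2) * (2 * a) := by
        rw [← mul_assoc, ← C_ofNat, ← C_mul]; norm_num
      rw [h2]
      exact h1.mul_left _
    have hdb : d ∣ b := by
      refine dvd_of_sq_dvd_mul_sq hf ?_ hd
      have h1 : d ^ 2 ∣ a ^ 2 - f * b ^ 2 :=
        exists_eval₂_of_isIntegralElem hζ (pow_ne_zero 2 hd) (hmi.mul E hmi') (by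
          change (m * m') * E (d ^ 2) = E (a ^ 2 - f * b ^ 2)
          simp only [map_sub, map_mul, map_pow, ← hw]
          linear_combination (E d * m') * e + (E a + E b * ψ u) * e')
      have h2 : d ^ 2 ∣ a ^ 2 := pow_dvd_pow_of_dvd hda 2
      exact (dvd_sub_right h2).1 h1
    obtain ⟨a', rfl⟩ := hda
    obtain ⟨b', rfl⟩ := hdb
    refine ⟨φ a' + φ b' * u, mul_right_cancel₀ hEd ?_⟩
    rw [map_add, map_mul, hEφ, hEφ, e]
    simp only [map_mul]
    ring

end QuadBasis

end RealSphere

namespace RealSphere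

open scoped QuadraticAlgebra

open Polynomial Limits

/-! ### Affine charts of schemes over the projective line -/

theorem exists_isPullback_SpecMap {T Y : Scheme.{0}} (π : T ⟶ Y) [IsAffineHom π] {R : Type}
    [CommRing R] (g : Spec (.of R) ⟶ Y) :
    ∃ (B : Type) (_ : CommRing B) (φ : R →+* B) (j : Spec (.of B) ⟶ T),
      IsPullback j (Spec.map (CommRingCat.ofHom φ)) π g := by
  let e := (pullback π g).isoSpec
  obtain ⟨φ, hφ⟩ := Spec.map_surjective (e.inv ≫ pullback.snd π g)
  refine ⟨Γ(pullback π g, ⊤), inferInstance, φ.hom, e.inv ≫ pullback.fst π g, ?_⟩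
  refine IsPullback.of_iso_pullback ⟨?_⟩ e.symm rfl ?_
  · rw [CommRingCat.ofHom_hom, hφ, Category.assoc, Category.assoc, pullback.condition]
  · exact hφ.symm

/-- The inverse image of the `i`-th chart of `ℙ¹` under `π`, as the spectrum of a ring. -/
structure Chart {T : Scheme.{0}} (π : T ⟶ P1) (i : Fin 2) where
  /-- The coordinate ring. -/
  B : Type
  [commRing : CommRing B]
  /-- The morphism to the chart of `ℙ¹`. -/
  φ : ℝ[X] →+* B
  /-- The open immersion into `T`. -/
  j : Spec (.of B) ⟶ T
  isPullback : IsPullback j (Spec.map (CommRingCat.ofHom φ)) π (P1.chart i)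

namespace Chart

attribute [instance] Chart.commRing

variable {T : Scheme.{0}} {π : T ⟶ P1} {i : Fin 2}

theorem nonempty (π : T ⟶ P1) [IsAffineHom π] (i : Fin 2) : Nonempty (Chart π i) := by
  obtain ⟨B, _, φ, j, h⟩ := exists_isPullback_SpecMap π (P1.chart i)
  exact ⟨⟨B, φ, j, h⟩⟩

instance (K : Chart π i) : IsOpenImmersion K.j :=
  MorphismProperty.of_isPullback K.isPullback.flip inferInstance

theorem w (K : Chart π i) :
    K.j ≫ π = Spec.map (CommRingCat.ofHom K.φ) ≫ P1.chart i := K.isPullback.w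

theorem opensRange (K : Chart π i) : K.j.opensRange = π ⁻¹ᵁ (P1.chart i).opensRange := by
  rw [← Scheme.Hom.opensRange_pullbackFst, ← Scheme.Hom.opensRange_comp_of_isIso
    K.isPullback.isoPullback.hom]
  simp only [IsPullback.isoPullback_hom_fst]

theorem exists_mem_opensRange (K : ∀ i, Chart π i) (x : T) : ∃ i, x ∈ (K i).j.opensRange := by
  obtain ⟨i, hi⟩ := P1.exists_mem_range_chart (π x)
  refine ⟨i, ?_⟩
  rw [opensRange]
  exact hi

/-- The open cover given by the two charts. -/
noncomputable def cover (K : ∀ i, Chart π i) : T.OpenCover :=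
  Scheme.Cover.mkOfCovers (Fin 2) (fun i => Spec (.of (K i).B)) (fun i => (K i).j)
    (fun x => by
      obtain ⟨i, y, hy⟩ := exists_mem_opensRange K x
      exact ⟨i, y, hy⟩) (fun i => inferInstance)

theorem finite (K : Chart π i) [IsFinite π] : K.φ.Finite :=
  (IsFinite.SpecMap_iff _).1 (MorphismProperty.of_isPullback K.isPullback inferInstance)

theorem isIntegral (K : Chart π i) [IsIntegralHom π] : K.φ.IsIntegral :=
  IsIntegralHom.SpecMap_iff.1 (MorphismProperty.of_isPullback (P := @IsIntegralHom) K.isPullback inferInstance)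

theorem flat (K : Chart π i) [Flat π] : K.φ.Flat :=
  Flat.SpecMap_iff.1 (MorphismProperty.of_isPullback K.isPullback inferInstance)

theorem smooth (K : Chart π i) [Smooth (π ≫ P1.toSpec)] : (K.φ.comp C).Smooth := by
  have h : K.j ≫ π ≫ P1.toSpec = Spec.map (CommRingCat.ofHom (K.φ.comp C)) := by
    rw [← Category.assoc, K.w, Category.assoc, P1.chart_toSpec, ← Spec.map_comp]
    rfl
  have : Smooth (Spec.map (CommRingCat.ofHom (K.φ.comp C))) := by
    rw [← h]; infer_instance
  exact (HasRingHomProperty.Spec_iff (P := @Smooth)).1 this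

theorem of_forall_chart {P : MorphismProperty Scheme.{0}} [IsZariskiLocalAtTarget P]
    (K : ∀ i, Chart π i) (h : ∀ i, P (Spec.map (CommRingCat.ofHom (K i).φ))) : P π := by
  let U : P1.OpenCover := Scheme.Cover.mkOfCovers (Fin 2) (fun i => Spec (.of ℝ[X]))
    (fun i => P1.chart i) (fun x => by
      obtain ⟨i, y, hy⟩ := P1.exists_mem_range_chart x
      exact ⟨i, y, hy⟩) (fun i => inferInstance)
  refine IsZariskiLocalAtTarget.of_openCover U fun (i : Fin 2) => ?_
  have e : (K i).isPullback.isoPullback.inv ≫ Spec.map (CommRingCat.ofHom (K i).φ) =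
    Scheme.Cover.pullbackHom U π i := IsPullback.isoPullback_inv_snd _
  have h2 : P ((K i).isPullback.isoPullback.inv ≫ Spec.map (CommRingCat.ofHom (K i).φ)) :=
    (P.cancel_left_of_respectsIso _ _).2 (h i)
  exact e ▸ h2

theorem smooth_of_forall (K : ∀ i, Chart π i) (h : ∀ i, ((K i).φ.comp C).Smooth) :
    Smooth (π ≫ P1.toSpec) := by
  have : IsZariskiLocalAtSource (@Smooth.{0} : MorphismProperty Scheme.{0}) :=
    HasRingHomProperty.instIsZariskiLocalAtSource (P := @Smooth.{0}) (Q := RingHom.Smooth)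
  refine IsZariskiLocalAtSource.of_openCover (P := @Smooth.{0}) (cover K) fun (i : Fin 2) => ?_
  change Smooth ((K i).j ≫ π ≫ P1.toSpec)
  rw [← Category.assoc, (K i).w, Category.assoc, P1.chart_toSpec, ← Spec.map_comp]
  exact (HasRingHomProperty.Spec_iff (P := @Smooth)).2 (h i)

theorem finrank_eq (K : Chart π i) [IsFinite π] [Flat π] (y : PrimeSpectrum ℝ[X]) :
    K.φ.finrank y = π.finrank (P1.chart i y) := by
  refine Eq.trans ?_ (Scheme.Hom.finrank_of_isPullback _ _ _ _ K.isPullback y)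
  exact (congrFun (Scheme.Hom.finrank_SpecMap_eq_finrank (f := CommRingCat.ofHom K.φ) K.finite K.flat) y).symm

/-- A morphism of affine schemes over `ℙ¹` is an isomorphism if it is so over the charts. -/
theorem isIso_of_forall {N : Scheme.{0}} (K : ∀ i, Chart π i) (d : N ⟶ T) [IsAffineHom d]
    {π' : N ⟶ P1} (hd : d ≫ π = π') (h : ∀ i (K' : Chart π' i) (δ : (K i).B →+* K'.B), δ.comp (K i).φ = K'.φ →
      Spec.map (CommRingCat.ofHom δ) ≫ (K i).j = K'.j ≫ d → Function.Bijective δ) : IsIso d := by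
  subst hd
  refine IsZariskiLocalAtTarget.of_openCover (P := MorphismProperty.isomorphisms Scheme)
    (cover K) fun (i : Fin 2) => ?_
  obtain ⟨B', _, δ, j', hp⟩ := exists_isPullback_SpecMap d (K i).j
  have hp' := hp.paste_vert (K i).isPullback
  rw [← Spec.map_comp, ← CommRingCat.ofHom_comp] at hp'
  have hb := h i ⟨B', δ.comp (K i).φ, j', hp'⟩ δ rfl hp.w.symm
  have : IsIso (Spec.map (CommRingCat.ofHom δ)) := isIso_SpecMap_iff.2 hb
  have e : Scheme.Cover.pullbackHom (cover K) d i =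
    hp.isoPullback.inv ≫ Spec.map (CommRingCat.ofHom δ) :=
    (IsPullback.isoPullback_inv_snd _).symm
  have h2 : IsIso (hp.isoPullback.inv ≫ Spec.map (CommRingCat.ofHom δ)) := IsIso.comp_isIso
  exact e.symm ▸ h2

end Chart

end RealSphere

namespace RealSphere

open scoped QuadraticAlgebra

open Polynomial Limits

/-! ### Normalization of the projective line in a function field -/

section

variable {T : Scheme.{0}} {B M : Type} [CommRing B] [CommRing M]

/-- The restriction of functions on `V` to an affine scheme mapping to `V`. -/
noncomputable def resHom (j : Spec (.of B) ⟶ T) (V : T.Opens) (h : ⊤ ≤ j ⁻¹ᵁ V) : Γ(T, V) →+* B :=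
  (j.appLE V ⊤ h ≫ (Scheme.ΓSpecIso (.of B)).hom).hom

theorem comp_resHom (j : Spec (.of B) ⟶ T) (V : T.Opens) (h : ⊤ ≤ j ⁻¹ᵁ V) (ψ : B →+* M)
    (h' : ⊤ ≤ (Spec.map (CommRingCat.ofHom ψ) ≫ j) ⁻¹ᵁ V) (x : Γ(T, V)) :
    resHom (Spec.map (CommRingCat.ofHom ψ) ≫ j) V h' x = ψ (resHom j V h x) := by
  have e : (Spec.map (CommRingCat.ofHom ψ) ≫ j).appLE V ⊤ h' ≫ (Scheme.ΓSpecIso (.of M)).hom =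
      (j.appLE V ⊤ h ≫ (Scheme.ΓSpecIso (.of B)).hom) ≫ CommRingCat.ofHom ψ := by
    rw [← Scheme.Hom.appLE_comp_appLE _ _ V ⊤ ⊤ h le_top, Category.assoc, Category.assoc,
      ← Scheme.ΓSpecIso_naturality]
    congr 2
  exact DFunLike.congr_fun (congrArg CommRingCat.Hom.hom e) x

theorem resHom_bijective (j : Spec (.of B) ⟶ T) [IsOpenImmersion j] (V : T.Opens)
    (h : ⊤ ≤ j ⁻¹ᵁ V) (hV : V ≤ j.opensRange) : Function.Bijective (resHom j V h) := by
  have h1 : IsIso (j.app V) := Scheme.Hom.isIso_app j V hV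
  have h2 : j ⁻¹ᵁ V = ⊤ := top_le_iff.1 h
  have h3 : IsIso (homOfLE h) := ⟨eqToHom h2, by subsingleton, by subsingleton⟩
  have : IsIso (j.appLE V ⊤ h) := by
    unfold Scheme.Hom.appLE
    infer_instance
  exact ConcreteCategory.bijective_of_isIso (j.appLE V ⊤ h ≫ (Scheme.ΓSpecIso (.of B)).hom)

theorem resHom_appLE (g : Spec (.of B) ⟶ T) (V : T.Opens) (W : (Spec (.of B)).Opens)
    (e : W ≤ g ⁻¹ᵁ V) (h : ⊤ ≤ g ⁻¹ᵁ V) (hW : ⊤ ≤ 𝟙 (Spec (.of B)) ⁻¹ᵁ W) (x : Γ(T, V)) :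
    resHom (𝟙 _) W hW (g.appLE V W e x) = resHom g V h x := by
  have e : g.appLE V W e ≫ (𝟙 (Spec (.of B)) : Spec (.of B) ⟶ _).appLE W ⊤ hW = g.appLE V ⊤ h := by
    rw [Scheme.Hom.appLE_comp_appLE]
    simp
  have := congrArg (· ≫ (Scheme.ΓSpecIso (.of B)).hom) e
  exact DFunLike.congr_fun (congrArg CommRingCat.Hom.hom this) x

theorem SpecMap_resHom_fromSpec (j : Spec (.of B) ⟶ T) {V : T.Opens} (hV : IsAffineOpen V)
    (h : ⊤ ≤ j ⁻¹ᵁ V) : Spec.map (CommRingCat.ofHom (resHom j V h)) ≫ hV.fromSpec = j := by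
  rw [resHom, CommRingCat.ofHom_hom, Spec.map_comp, Category.assoc,
    hV.SpecMap_appLE_fromSpec j (isAffineOpen_top _) h, IsAffineOpen.fromSpec_top,
    Scheme.isoSpec_Spec_inv, ← Spec.map_comp_assoc]
  simp

theorem SpecMap_injective {ψ ψ' : B →+* M}
    (h : Spec.map (CommRingCat.ofHom ψ) = Spec.map (CommRingCat.ofHom ψ')) : ψ = ψ' :=
  congrArg CommRingCat.Hom.hom (Spec.map_injective h)

end

section

variable {M : Type} [Field M]

/-- The coordinate rings of the charts of the normalization of `ℙ¹` in `Spec M` are the integral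
closures in `M` of the coordinate rings of the charts of `ℙ¹`. -/
theorem normalization_chart (p : Spec (.of M) ⟶ P1) [QuasiCompact p] [QuasiSeparated p]
    {i : Fin 2} {E : ℝ[X] →+* M} (hp : p = Spec.map (CommRingCat.ofHom E) ≫ P1.chart i)
    (K : Chart p.fromNormalization i) {ψ : K.B →+* M}
    (hψ : Spec.map (CommRingCat.ofHom ψ) ≫ K.j = p.toNormalization) :
    Function.Injective ψ ∧ ∀ m, (∃ b, ψ b = m) ↔ E.IsIntegralElem m := by
  have hψE : ψ.comp K.φ = E := by
    apply SpecMap_injective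
    rw [← cancel_mono (P1.chart i), CommRingCat.ofHom_comp, Spec.map_comp, Category.assoc, ← K.w,
      reassoc_of% hψ, p.toNormalization_fromNormalization, hp]
  set U := (P1.chart i).opensRange with hU
  have hUa : IsAffineOpen U := isAffineOpen_opensRange _
  let V := p.fromNormalization ⁻¹ᵁ U
  have hjV : ⊤ ≤ K.j ⁻¹ᵁ V := by
    change ⊤ ≤ K.j ⁻¹ᵁ (p.fromNormalization ⁻¹ᵁ (P1.chart i).opensRange)
    rw [← K.opensRange, Scheme.Hom.preimage_opensRange]
  have hVj : V ≤ K.j.opensRange := K.opensRange.ge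
  have hcU : ⊤ ≤ P1.chart i ⁻¹ᵁ U := by rw [Scheme.Hom.preimage_opensRange]
  have hpU : ⊤ ≤ p ⁻¹ᵁ U := by
    rw [hp, Scheme.Hom.comp_preimage, hU, Scheme.Hom.preimage_opensRange]
    rfl
  have htV : ⊤ ≤ p.toNormalization ⁻¹ᵁ V := by
    rw [← Scheme.Hom.comp_preimage, p.toNormalization_fromNormalization]
    exact hpU
  have hres : ∀ n : Γ(p.normalization, V), resHom p.toNormalization V htV n = ψ (resHom K.j V hjV n) := by
    intro n
    rw [← comp_resHom K.j V hjV ψ (by rw [hψ]; exact htV)]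
    congr 1
    simp only [hψ]
  have hle : p ⁻¹ᵁ U ≤ p.toNormalization ⁻¹ᵁ V := by
    rw [← Scheme.Hom.comp_preimage, p.toNormalization_fromNormalization]
  let := (p.app U).hom.toAlgebra
  have hval : ∀ n : Γ(p.normalization, V), ((p.normalizationObjIso hUa).hom n).1 =
      p.toNormalization.appLE V (p ⁻¹ᵁ U) hle n := fun n =>
    DFunLike.congr_fun (congrArg CommRingCat.Hom.hom (p.normalizationObjIso_hom_val hUa)) n
  have hpU' : ⊤ ≤ 𝟙 (Spec (.of M)) ⁻¹ᵁ (p ⁻¹ᵁ U) := hpU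
  let γ := resHom (𝟙 (Spec (.of M))) (p ⁻¹ᵁ U) hpU'
  have hγ : Function.Bijective γ :=
    resHom_bijective _ _ _ (by rw [Scheme.Hom.opensRange_of_isIso]; exact le_top)
  -- Under the identifications of Γ(V) with the chart ring and of Γ(Spec M) with M, the map ψ is the
  -- inclusion of the integral closure by which the normalization is defined.
  have hpos : ∀ n : Γ(p.normalization, V), ψ (resHom K.j V hjV n) =
      γ ((p.normalizationObjIso hUa).hom n).1 := by
    intro n
    rw [hval, ← hres]
    exact (resHom_appLE _ _ _ _ _ _ _).symm
  have hc := resHom_bijective (P1.chart i) U hcU le_rfl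
  let c := RingEquiv.ofBijective (resHom (P1.chart i) U hcU) hc
  have hγc : ∀ r, γ (p.app U r) = E (c r) := by
    intro r
    have h1 : γ (p.app U r) = resHom p U hpU r := by
      rw [Scheme.Hom.app_eq_appLE]
      exact resHom_appLE _ _ _ _ _ _ _
    rw [h1]
    change _ = E (resHom (P1.chart i) U hcU r)
    rw [← comp_resHom (P1.chart i) U hcU E (by rw [← hp]; exact hpU)]
    congr 1
    simp only [hp]
  have hj := resHom_bijective K.j V hjV hVj
  refine ⟨?_, fun m => ⟨?_, fun hm => ?_⟩⟩
  · rw [injective_iff_map_eq_zero]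
    intro b hb
    obtain ⟨n, rfl⟩ := hj.2 b
    rw [hpos] at hb
    have h1 := (map_eq_zero_iff γ hγ.1).1 hb
    have h2 : (p.normalizationObjIso hUa).hom n = 0 := Subtype.ext h1
    have h3 : n = 0 := (map_eq_zero_iff _
      (ConcreteCategory.bijective_of_isIso (p.normalizationObjIso hUa).hom).1).1 h2
    rw [h3, map_zero]
  · rintro ⟨b, rfl⟩
    obtain ⟨P, hP, hP0⟩ := K.isIntegral b
    exact ⟨P, hP, by rw [← hψE, ← hom_eval₂, hP0, map_zero]⟩
  · obtain ⟨m', rfl⟩ := hγ.2 m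
    obtain ⟨P, hP, hP0⟩ := hm
    have hint : IsIntegral Γ(P1, U) m' := by
      refine ⟨P.map (c.symm : ℝ[X] →+* Γ(P1, U)), hP.map _, hγ.1 ?_⟩
      rw [hom_eval₂, eval₂_map, map_zero, ← hP0]
      congr 1
      refine RingHom.ext fun r => ?_
      change γ (p.app U (c.symm r)) = E r
      rw [hγc, c.apply_symm_apply]
    obtain ⟨n, hn⟩ := (ConcreteCategory.bijective_of_isIso (p.normalizationObjIso hUa).hom).2
      ⟨m', hint⟩
    refine ⟨resHom K.j V hjV n, ?_⟩
    rw [hpos, hn]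

end

end RealSphere

namespace RealSphere

open scoped QuadraticAlgebra

open Polynomial Limits

/-! ### Charts of double covers -/

/-- A denominator p + qu is moved into ℝ[X] by multiplication with p - qu. -/
theorem IsQuadBasis.isQuadExt {B M : Type} [CommRing B] [Field M] {φ : ℝ[X] →+* B}
    {f : ℝ[X]} {u : B} (h : IsQuadBasis φ f u) {ψ : B →+* M} (hψ : Function.Injective ψ)
    (hfr : ∀ m, ∃ b d, d ≠ 0 ∧ m * ψ d = ψ b) {ρ : ℝ →+* M} {ζ : M}
    (hφ : ψ.comp φ = eval₂RingHom ρ ζ) : IsQuadExt ρ ζ f := by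
  have : IsDomain B := hψ.isDomain ψ
  have hE : ∀ p, ψ (φ p) = p.eval₂ ρ ζ := fun p => DFunLike.congr_fun hφ p
  refine ⟨fun p hp => ?_, ψ u, by rw [← map_pow, h.1, hE], fun m => ?_⟩
  · rw [← hE] at hp
    exact (map_eq_zero_iff φ h.injective).1 ((map_eq_zero_iff ψ hψ).1 hp)
  · obtain ⟨b, d, hd, e⟩ := hfr m
    obtain ⟨p, q, rfl⟩ := h.2.1 d
    obtain ⟨a, c, hac⟩ := h.2.1 (b * (φ p - φ q * u))
    refine ⟨a, c, p ^ 2 - q ^ 2 * f, fun h0 => hd ?_, ?_⟩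
    · have h1 : p ^ 2 = q ^ 2 * f := sub_eq_zero.1 h0
      have hq := h.notSq p q h1
      rw [hq] at h1
      have hp : p = 0 := by simpa using h1
      rw [hp, hq]
      simp
    · rw [← hE, ← hE, ← hE, ← map_mul, ← map_add, ← hac, map_mul, ← e, mul_assoc, ← map_mul]
      congr 2
      rw [map_sub, map_mul, map_pow, map_pow, ← h.1]
      ring

namespace P1

/-- The coordinate in the `i`-th chart of the point `(1 : ζ)`. -/
noncomputable def affPt {M : Type} [Field M] (i : Fin 2) (ζ : M) : M := if i = 0 then ζ else ζ⁻¹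

theorem point_eq_affPt {M : Type} [Field M] (ρ : ℝ →+* M) {ζ : M} (hζ : ζ ≠ 0) (i : Fin 2) :
    point ρ ζ = Spec.map (CommRingCat.ofHom (eval₂RingHom ρ (affPt i ζ))) ≫ chart i := by
  rw [point_eq]
  fin_cases i
  · rfl
  · exact SpecMap_eval₂_chart_eq ρ (mul_inv_cancel₀ hζ)

theorem point_injective {M : Type} [Field M] {ρ ρ' : ℝ →+* M} {ζ ζ' : M}
    (h : point ρ ζ = point ρ' ζ') : ρ = ρ' ∧ ζ = ζ' := by
  rw [point_eq, point_eq, cancel_mono] at h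
  have h1 := SpecMap_injective h
  constructor
  · ext r
    simpa using DFunLike.congr_fun h1 (C r)
  · simpa using DFunLike.congr_fun h1 X

theorem SpecMap_point {M M' : Type} [CommRing M] [CommRing M'] (ρ : ℝ →+* M) (ζ : M) (e : M →+* M') :
    Spec.map (CommRingCat.ofHom e) ≫ point ρ ζ = point (e.comp ρ) (e ζ) := by
  rw [point_eq, point_eq, ← Spec.map_comp_assoc, ← CommRingCat.ofHom_comp]
  congr 3
  ext <;> simp

end P1

namespace Chart

theorem exists_lift {T : Scheme.{0}} {π : T ⟶ P1} {i : Fin 2} (K : Chart π i) {M : Type}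
    [CommRing M] (g : Spec (.of M) ⟶ T) {E : ℝ[X] →+* M}
    (h : g ≫ π = Spec.map (CommRingCat.ofHom E) ≫ P1.chart i) :
    ∃ ψ : K.B →+* M, Spec.map (CommRingCat.ofHom ψ) ≫ K.j = g ∧ ψ.comp K.φ = E := by
  obtain ⟨ψ, hψ⟩ := Spec.map_surjective (K.isPullback.lift g _ h)
  refine ⟨ψ.hom, ?_, SpecMap_injective ?_⟩
  · rw [CommRingCat.ofHom_hom, hψ, K.isPullback.lift_fst]
  · rw [CommRingCat.ofHom_comp, Spec.map_comp, CommRingCat.ofHom_hom, hψ, K.isPullback.lift_snd]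

end Chart

namespace DoubleCover

variable (C : DoubleCover)

instance : IsFinite C.π := C.isFinite

instance : Flat C.π := C.flat

instance : Smooth (C.π ≫ P1.toSpec) := C.smooth

/-- An open subscheme of an integral scheme is integral if it is not empty; the chart is not empty
because its rank over the generic point is 2. -/
theorem chart_isDomain {i : Fin 2} (K : Chart C.π i) : IsDomain K.B := by
  have hn : Nontrivial K.B := by
    by_contra hn
    rw [not_nontrivial_iff_subsingleton] at hn
    let y : PrimeSpectrum ℝ[X] := ⟨⊥, Ideal.isPrime_bot⟩
    have h1 := K.finrank_eq y
    rw [C.degree_eq_two] at h1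
    let := K.φ.toAlgebra
    have h2 : K.φ.finrank y = Module.rankAtStalk K.B y := rfl
    rw [h2, Module.rankAtStalk_eq_zero_of_subsingleton] at h1
    simp at h1
  have : Nonempty (Spec (.of K.B)) := inferInstanceAs (Nonempty (PrimeSpectrum K.B))
  have h := isIntegral_of_isOpenImmersion K.j
  exact (affine_isIntegral_iff _).1 h

/-- The chart ring is finite and flat of rank 2 over ℝ[X], which provides the basis 1, u; smoothness
over ℝ makes f squarefree. -/
theorem chart_isQuadBasis {i : Fin 2} (K : Chart C.π i) :
    ∃ f u, IsQuadBasis K.φ f u ∧ Squarefree f := by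
  have := C.chart_isDomain K
  obtain ⟨f, u, h⟩ : ∃ f u, IsQuadBasis K.φ f u := by
    let := K.φ.toAlgebra
    have h1 : Module.Finite ℝ[X] K.B := K.finite
    have h2 : Module.Flat ℝ[X] K.B := K.flat
    refine exists_isQuadBasis (B := K.B) ?_
    have htf : Module.IsTorsionFree ℝ[X] K.B := inferInstance
    have hfree : Module.Free ℝ[X] K.B := inferInstance
    let y : PrimeSpectrum ℝ[X] := ⟨⊥, Ideal.isPrime_bot⟩
    have h3 := K.finrank_eq y
    rw [C.degree_eq_two] at h3
    have h4 : K.φ.finrank y = Module.rankAtStalk K.B y := rfl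
    rwa [h4, Module.rankAtStalk_eq_finrank_of_free] at h3
  refine ⟨f, u, h, ?_⟩
  let := (K.φ.comp Polynomial.C).toAlgebra
  have h5 := K.smooth.formallySmooth
  have : Algebra.FormallySmooth ℝ K.B := h5
  exact h.squarefree rfl

theorem exists_generic {i : Fin 2} (K : Chart C.π i) :
    ∃ ψ : K.B →+* C.Γ.functionField, Function.Injective ψ ∧
      (∀ m, ∃ b d, d ≠ 0 ∧ m * ψ d = ψ b) ∧
      Spec.map (CommRingCat.ofHom ψ) ≫ K.j = C.Γ.fromSpecStalk (genericPoint C.Γ) := by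
  have hdom := C.chart_isDomain K
  let V := K.j.opensRange
  have hx : genericPoint C.Γ ∈ V :=
    ((genericPoint_spec C.Γ).mem_open_set_iff V.isOpen).2 (by
      obtain ⟨y⟩ : Nonempty (Spec (.of K.B)) := inferInstanceAs (Nonempty (PrimeSpectrum K.B))
      exact ⟨K.j y, trivial, ⟨y, rfl⟩⟩)
  have hV : IsAffineOpen V := isAffineOpen_opensRange _
  have hjV : ⊤ ≤ K.j ⁻¹ᵁ V := by rw [Scheme.Hom.preimage_opensRange]
  have hα := resHom_bijective K.j V hjV le_rfl
  let α := RingEquiv.ofBijective (resHom K.j V hjV) hα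
  have : Nonempty V.toScheme := ⟨⟨_, hx⟩⟩
  let β : Γ(C.Γ, V) →+* C.Γ.functionField := algebraMap _ _
  have hfr : IsFractionRing Γ(C.Γ, V) C.Γ.functionField :=
    functionField_isFractionRing_of_isAffineOpen C.Γ V hV
  have hinj : Function.Injective β := IsFractionRing.injective _ _
  refine ⟨β.comp (α.symm : K.B →+* Γ(C.Γ, V)), hinj.comp α.symm.injective, fun m => ?_, ?_⟩
  · obtain ⟨x, y, hy, rfl⟩ := IsFractionRing.div_surjective (A := Γ(C.Γ, V)) m
    have hy0 : y ≠ 0 := nonZeroDivisors.ne_zero hy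
    refine ⟨α x, α y, (map_ne_zero_iff α α.injective).2 hy0, ?_⟩
    simp only [RingHom.comp_apply, RingHom.coe_coe, α.symm_apply_apply]
    exact div_mul_cancel₀ _ ((map_ne_zero_iff β hinj).2 hy0)
  · have h1 := SpecMap_resHom_fromSpec K.j hV hjV
    have h2 : (α.symm : K.B →+* Γ(C.Γ, V)).comp (resHom K.j V hjV) = RingHom.id _ :=
      RingHom.ext α.symm_apply_apply
    rw [CommRingCat.ofHom_comp, Spec.map_comp, Category.assoc]
    conv_lhs => rw [← h1]
    rw [← Spec.map_comp_assoc (CommRingCat.ofHom (resHom K.j V hjV)), ← CommRingCat.ofHom_comp, h2]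
    rw [CommRingCat.ofHom_id]
    rw [Spec.map_id, Category.id_comp]
    exact hV.fromSpecStalk_eq_fromSpecStalk hx

/-- The morphism `π`, restricted to the generic point, is given by `ρ` and `ζ`. -/
def IsGeneric (ρ : ℝ →+* C.Γ.functionField) (ζ : C.Γ.functionField) : Prop :=
  C.Γ.fromSpecStalk (genericPoint C.Γ) ≫ C.π = P1.point ρ ζ

theorem exists_isGeneric : ∃ ρ ζ, C.IsGeneric ρ ζ := by
  obtain ⟨K⟩ := Chart.nonempty C.π 0
  obtain ⟨ψ, -, -, h⟩ := C.exists_generic K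
  refine ⟨(ψ.comp K.φ).comp Polynomial.C, ψ (K.φ X), ?_⟩
  rw [IsGeneric, ← h, Category.assoc, K.w, P1.point_eq, ← Spec.map_comp_assoc,
    ← CommRingCat.ofHom_comp]
  congr 3
  ext <;> simp

variable {C} {ρ : ℝ →+* C.Γ.functionField} {ζ : C.Γ.functionField}

theorem IsGeneric.ne_zero (h : C.IsGeneric ρ ζ) : ζ ≠ 0 := by
  obtain ⟨K⟩ := Chart.nonempty C.π 0
  obtain ⟨f, u, hq, -⟩ := C.chart_isQuadBasis K
  obtain ⟨ψ, hψ, -, e⟩ := C.exists_generic K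
  have h1 : ψ.comp K.φ = eval₂RingHom ρ ζ := by
    apply SpecMap_injective
    rw [← cancel_mono (P1.chart 0), ← P1.point_eq, ← h, ← e, CommRingCat.ofHom_comp, Spec.map_comp,
      Category.assoc, Category.assoc, K.w]
  have h2 : ψ (K.φ X) = ζ := by simpa using DFunLike.congr_fun h1 X
  rw [← h2, Ne, map_eq_zero_iff ψ hψ, map_eq_zero_iff _ hq.injective]
  exact X_ne_zero

theorem IsGeneric.exists_chart (h : C.IsGeneric ρ ζ) {i : Fin 2} (K : Chart C.π i) :
    ∃ ψ : K.B →+* C.Γ.functionField, Function.Injective ψ ∧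
      (∀ m, ∃ b d, d ≠ 0 ∧ m * ψ d = ψ b) ∧
      Spec.map (CommRingCat.ofHom ψ) ≫ K.j = C.Γ.fromSpecStalk (genericPoint C.Γ) ∧
      ψ.comp K.φ = eval₂RingHom ρ (P1.affPt i ζ) := by
  obtain ⟨ψ, hψ, hfr, e⟩ := C.exists_generic K
  refine ⟨ψ, hψ, hfr, e, SpecMap_injective ?_⟩
  rw [← cancel_mono (P1.chart i), ← P1.point_eq_affPt ρ h.ne_zero, ← h, ← e,
    CommRingCat.ofHom_comp, Spec.map_comp, Category.assoc, Category.assoc, K.w]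

theorem IsGeneric.isQuadExt (h : C.IsGeneric ρ ζ) {i : Fin 2} {K : Chart C.π i} {f : ℝ[X]} {u : K.B}
    (hq : IsQuadBasis K.φ f u) : IsQuadExt ρ (P1.affPt i ζ) f := by
  obtain ⟨ψ, hψ, hfr, -, e⟩ := h.exists_chart K
  exact hq.isQuadExt hψ hfr e

/-- The coordinate rings of the charts of a double cover are integrally closed. -/
theorem IsGeneric.chart_integral (h : C.IsGeneric ρ ζ) {i : Fin 2} (K : Chart C.π i) {M : Type}
    [Field M] (e : C.Γ.functionField ≃+* M) {ψ : K.B →+* M}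
    (hψ : Spec.map (CommRingCat.ofHom ψ) ≫ K.j =
      Spec.map (CommRingCat.ofHom (e : C.Γ.functionField →+* M)) ≫
        C.Γ.fromSpecStalk (genericPoint C.Γ)) :
    Function.Injective ψ ∧ ∀ m, (∃ b, ψ b = m) ↔
      (eval₂RingHom ((e : C.Γ.functionField →+* M).comp ρ) (P1.affPt i (e ζ))).IsIntegralElem m := by
  have := C.chart_isDomain K
  obtain ⟨f, u, hq, hf⟩ := C.chart_isQuadBasis K
  obtain ⟨ψ', -, -, e', hφ⟩ := h.exists_chart K
  have h1 : ψ = (e : C.Γ.functionField →+* M).comp ψ' := by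
    apply SpecMap_injective
    rw [← cancel_mono K.j, hψ, CommRingCat.ofHom_comp, Spec.map_comp, Category.assoc, e']
  have he : e (P1.affPt i ζ) = P1.affPt i (e ζ) := by
    unfold P1.affPt
    split_ifs
    · rfl
    · exact map_inv₀ e ζ
  have h2 := (h.isQuadExt hq).map e
  rw [he] at h2
  refine hq.bijOn_integral hf hq.notSq h2 ?_
  rw [h1, RingHom.comp_assoc, hφ, ← he]
  ext <;> simp

end DoubleCover

end RealSphere

/-! ### Double covers are determined by their function fields -/

namespace RealSphere

open scoped QuadraticAlgebra

open Polynomial Limits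

instance : IsSeparated P1.toSpec := by
  unfold P1.toSpec
  infer_instance

instance {M : Type} [CommRing M] (ρ : ℝ →+* M) (ζ : M) : IsAffineHom (P1.point ρ ζ) :=
  IsAffineHom.of_comp _ P1.toSpec

namespace DoubleCover

variable {C C' : DoubleCover}

/-- A double cover is the normalization of the projective line in its function field. -/
theorem IsGeneric.isIso_normalizationDesc {ρ : ℝ →+* C.Γ.functionField} {ζ : C.Γ.functionField}
    (h : C.IsGeneric ρ ζ) {M : Type} [Field M] (e : C.Γ.functionField ≃+* M)
    {p : Spec (.of M) ⟶ P1} [QuasiCompact p] [QuasiSeparated p]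
    (hp : p = P1.point ((e : C.Γ.functionField →+* M).comp ρ) (e ζ))
    (H : p = (Spec.map (CommRingCat.ofHom (e : C.Γ.functionField →+* M)) ≫
      C.Γ.fromSpecStalk (genericPoint C.Γ)) ≫ C.π) :
    IsIso (p.normalizationDesc _ _ H) := by
  let K : ∀ i, Chart C.π i := fun i => (Chart.nonempty C.π i).some
  refine Chart.isIso_of_forall K _ (p.normalizationDesc_comp _ _ H) fun i K' δ hφ hj => ?_
  have hζ : e ζ ≠ 0 := (map_ne_zero e).2 h.ne_zero
  have hp' := hp.trans (P1.point_eq_affPt _ hζ i)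
  obtain ⟨ψ, hψ, -⟩ := K'.exists_lift p.toNormalization
    ((p.toNormalization_fromNormalization).trans hp')
  -- Over each chart of ℙ¹ both coordinate rings are the integral closure of ℝ[X] in M, so the
  -- comparison map is bijective.
  have h1 := normalization_chart p hp' K' hψ
  have h2 := h.chart_integral (K i) e (ψ := ψ.comp δ) (by
    rw [CommRingCat.ofHom_comp, Spec.map_comp, Category.assoc, hj, reassoc_of% hψ,
      p.toNormalization_normalizationDesc])
  refine ⟨Function.Injective.of_comp h2.1, fun b => ?_⟩
  obtain ⟨c, hc⟩ := (h2.2 (ψ b)).2 ((h1.2 _).1 ⟨b, rfl⟩)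
  exact ⟨c, h1.1 hc⟩

/-- Through the isomorphism of function fields both curves become the normalization of one and the
same morphism from Spec of a field to ℙ¹. -/
theorem IsGeneric.equiv {ρ : ℝ →+* C.Γ.functionField} {ζ : C.Γ.functionField}
    {ρ' : ℝ →+* C'.Γ.functionField} {ζ' : C'.Γ.functionField}
    (h : C.IsGeneric ρ ζ) (h' : C'.IsGeneric ρ' ζ')
    (e : C.Γ.functionField ≃+* C'.Γ.functionField)
    (hρ : (e : C.Γ.functionField →+* C'.Γ.functionField).comp ρ = ρ') (hζ : e ζ = ζ') :
    C ≈ C' := by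
  let p := P1.point ρ' ζ'
  have H : p = (Spec.map (CommRingCat.ofHom (e : C.Γ.functionField →+* C'.Γ.functionField)) ≫
      C.Γ.fromSpecStalk (genericPoint C.Γ)) ≫ C.π := by
    rw [Category.assoc, h, P1.SpecMap_point, hρ]
    exact congrArg (P1.point ρ') hζ.symm
  have H' : p = (Spec.map (CommRingCat.ofHom (RingEquiv.refl C'.Γ.functionField :
      C'.Γ.functionField →+* C'.Γ.functionField)) ≫
      C'.Γ.fromSpecStalk (genericPoint C'.Γ)) ≫ C'.π := by
    rw [Category.assoc, h', P1.SpecMap_point]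
    rfl
  have h1 := h.isIso_normalizationDesc e (by rw [hρ, hζ]) H
  have h2 := h'.isIso_normalizationDesc (RingEquiv.refl _) (p := p) rfl H'
  refine ⟨(asIso (p.normalizationDesc _ _ H)).symm ≪≫ asIso (p.normalizationDesc _ _ H'), ?_⟩
  rw [Iso.trans_hom, Category.assoc, asIso_hom, p.normalizationDesc_comp, Iso.symm_hom,
    asIso_inv, IsIso.inv_comp_eq, p.normalizationDesc_comp]

end DoubleCover

end RealSphere

/-! ### Signs of polynomials modulo squares, and the point at infinity -/

namespace RealSphere

open scoped QuadraticAlgebra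

open Polynomial

theorem exists_eq_sq_mul_squarefree {f : ℝ[X]} (hf : f ≠ 0) :
    ∃ m f₀ : ℝ[X], m ≠ 0 ∧ Squarefree f₀ ∧ f = m ^ 2 * f₀ := by
  induction hn : f.natDegree using Nat.strong_induction_on generalizing f with
  | _ n ih =>
    by_cases hs : Squarefree f
    · exact ⟨1, f, one_ne_zero, hs, by ring⟩
    simp only [Squarefree, not_forall] at hs
    obtain ⟨x, ⟨c, rfl⟩, hx⟩ := hs
    have hc : c ≠ 0 := right_ne_zero_of_mul hf
    have hx0 : x ≠ 0 := left_ne_zero_of_mul (left_ne_zero_of_mul hf)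
    have hdx : 0 < x.natDegree := natDegree_pos_iff_degree_pos.2 (degree_pos_of_ne_zero_of_nonunit hx0 hx)
    rw [natDegree_mul (mul_ne_zero hx0 hx0) hc, natDegree_mul hx0 hx0] at hn
    obtain ⟨m, f₀, hm, hf₀, rfl⟩ := ih _ (by omega) hc rfl
    exact ⟨x * m, f₀, mul_ne_zero hx0 hm, hf₀, by ring⟩

theorem NotSq.of_sq_mul_eq {f f' r r' : ℝ[X]} (hf : NotSq f) (hr : r ≠ 0)
    (h : r ^ 2 * f = r' ^ 2 * f') : NotSq f' := by
  intro a b hab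
  have h1 := hf (r' * a) (r * b) (by linear_combination r' ^ 2 * hab - b ^ 2 * h)
  exact (mul_eq_zero.1 h1).resolve_left hr

theorem dense_compl_roots {r : ℝ[X]} (hr : r ≠ 0) : Dense {a : ℝ | r.eval a ≠ 0} := by
  have h : {a : ℝ | r.eval a ≠ 0} = (r.rootSet ℝ)ᶜ := by
    ext a
    simp [mem_rootSet, hr]
  rw [h]
  exact (r.rootSet_finite ℝ).countable.dense_compl ℝ

/-- Factors of a polynomial that are squares do not matter for its sign. -/
theorem nonneg_of_sq_mul_eq {f f' r r' : ℝ[X]} (hr : r ≠ 0) (h : r ^ 2 * f = r' ^ 2 * f') {U : Set ℝ}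
    (hU : IsOpen U) (hf' : ∀ a ∈ U, 0 ≤ f'.eval a) : ∀ a ∈ U, 0 ≤ f.eval a := by
  intro a ha
  have h1 : U ∩ {a : ℝ | r.eval a ≠ 0} ⊆ {a | 0 ≤ f.eval a} := by
    rintro b ⟨hb, hrb⟩
    have h2 := congrArg (eval b) h
    simp only [eval_mul, eval_pow] at h2
    have h3 : 0 < r.eval b ^ 2 := by
      have : r.eval b ≠ 0 := hrb
      positivity
    have h4 : 0 ≤ r.eval b ^ 2 * f.eval b := by
      rw [h2]; exact mul_nonneg (sq_nonneg _) (hf' b hb)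
    exact nonneg_of_mul_nonneg_right h4 h3
  exact closure_minimal h1 (isClosed_le continuous_const f.continuous)
    ((dense_compl_roots hr).open_subset_closure_inter hU ha)

/-- An interior zero of a function without sign change is at least double. -/
theorem pos_of_nonneg_of_squarefree {f : ℝ[X]} (hf : Squarefree f) {U : Set ℝ} (hU : IsOpen U)
    (h : ∀ a ∈ U, 0 ≤ f.eval a) {a : ℝ} (ha : a ∈ U) : 0 < f.eval a := by
  refine lt_of_le_of_ne (h a ha) fun h0 => ?_
  obtain ⟨k, rfl⟩ := dvd_iff_isRoot.2 (show f.IsRoot a from h0.symm)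
  have hk : k.eval a = 0 := by
    have h1 : ∀ b ∈ U ∩ Set.Ioi a, 0 ≤ k.eval b := fun b hb => by
      have := h b hb.1
      rw [eval_mul, eval_sub, eval_X, eval_C] at this
      exact nonneg_of_mul_nonneg_right this (sub_pos.2 hb.2)
    have h2 : ∀ b ∈ U ∩ Set.Iio a, k.eval b ≤ 0 := fun b hb => by
      have := h b hb.1
      rw [eval_mul, eval_sub, eval_X, eval_C] at this
      have hb' : b - a < 0 := sub_neg.2 hb.2
      by_contra hc
      nlinarith [mul_neg_of_neg_of_pos hb' (not_le.1 hc)]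
    apply le_antisymm
    · exact closure_minimal h2 (isClosed_le k.continuous continuous_const)
        (hU.inter_closure ⟨ha, by rw [closure_Iio]; exact Set.self_mem_Iic⟩)
    · exact closure_minimal h1 (isClosed_le continuous_const k.continuous)
        (hU.inter_closure ⟨ha, by rw [closure_Ioi]; exact Set.self_mem_Ici⟩)
  obtain ⟨l, rfl⟩ := dvd_iff_isRoot.2 hk
  exact not_isUnit_X_sub_C a (hf _ ⟨l, by ring⟩)

theorem Squarefree.neg {f : ℝ[X]} (hf : Squarefree f) : Squarefree (-f) :=
  fun x hx => hf x ((dvd_neg).1 hx)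

theorem neg_of_nonpos_of_squarefree {f : ℝ[X]} (hf : Squarefree f) {U : Set ℝ} (hU : IsOpen U)
    (h : ∀ a ∈ U, f.eval a ≤ 0) {a : ℝ} (ha : a ∈ U) : f.eval a < 0 := by
  simpa using pos_of_nonneg_of_squarefree (Squarefree.neg hf) hU (fun a ha => by simpa using h a ha) ha

/-- The change of sign at ±1 forces zeros there. The cofactor k has no sign change, because (1 -
z²)²k = (1 - z²)f ≥ 0, and being squarefree it has no zeros. -/
theorem exists_eq_mul_of_sign {f : ℝ[X]} (hf : Squarefree f)
    (h : ∀ a ∈ Set.Ioo (-1 : ℝ) 1, 0 ≤ f.eval a) (h' : ∀ a ∈ (Set.Icc (-1 : ℝ) 1)ᶜ, f.eval a ≤ 0) :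
    ∃ k : ℝ[X], f = (1 - X ^ 2) * k ∧ ∀ a, 0 < k.eval a := by
  have h1 : ∀ a ∈ Set.Icc (-1 : ℝ) 1, 0 ≤ f.eval a := by
    rw [← closure_Ioo (by norm_num)]
    exact fun a ha => closure_minimal h (isClosed_le continuous_const f.continuous) ha
  have h2 : ∀ a, 1 ≤ a → f.eval a ≤ 0 := fun a ha => by
    refine closure_minimal (s := Set.Ioi 1) (t := {a | f.eval a ≤ 0}) (fun b hb => h' b ?_)
      (isClosed_le f.continuous continuous_const) (by rw [closure_Ioi]; exact ha)
    exact fun hc => not_lt.2 hc.2 hb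
  have h3 : ∀ a, a ≤ -1 → f.eval a ≤ 0 := fun a ha => by
    refine closure_minimal (s := Set.Iio (-1)) (t := {a | f.eval a ≤ 0}) (fun b hb => h' b ?_)
      (isClosed_le f.continuous continuous_const) (by rw [closure_Iio]; exact ha)
    exact fun hc => not_lt.2 hc.1 hb
  have e1 : f.eval 1 = 0 := le_antisymm (h2 1 le_rfl) (h1 1 (by simp))
  have e2 : f.eval (-1) = 0 := le_antisymm (h3 _ le_rfl) (h1 _ (by simp))
  obtain ⟨k, rfl⟩ := dvd_iff_isRoot.2 (show f.IsRoot 1 from e1)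
  have e3 : k.eval (-1) = 0 := by
    simpa [show (-1 - 1 : ℝ) ≠ 0 by norm_num] using e2
  obtain ⟨l, rfl⟩ := dvd_iff_isRoot.2 (show k.IsRoot (-1) from e3)
  have hl : Squarefree (-l) := Squarefree.neg (hf.squarefree_of_dvd ⟨(X - C 1) * (X - C (-1)), by ring⟩)
  refine ⟨-l, by simp only [map_neg, map_one]; ring, fun a =>
    pos_of_nonneg_of_squarefree hl isOpen_univ (fun a _ => ?_) (Set.mem_univ a)⟩
  have hne : (1 - X ^ 2 : ℝ[X]) ≠ 0 := fun h0 => by simpa using congrArg (eval 0) h0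
  refine nonneg_of_sq_mul_eq (r := 1 - X ^ 2) (r' := 1) (f' := (1 - X ^ 2) ^ 2 * -l) hne (by ring)
    isOpen_univ (fun a _ => ?_) a trivial
  have e4 : ((1 - X ^ 2) ^ 2 * -l).eval a =
      (1 - a ^ 2) * ((X - C 1) * ((X - C (-1)) * l)).eval a := by
    simp only [eval_mul, eval_sub, eval_pow, eval_X, eval_C, eval_one, eval_neg]; ring
  rw [e4]
  by_cases ha : a ∈ Set.Icc (-1 : ℝ) 1
  · exact mul_nonneg (by nlinarith [ha.1, ha.2]) (h1 a ha)
  · refine mul_nonneg_of_nonpos_of_nonpos ?_ (h' a ha)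
    rw [Set.mem_Icc, not_and_or, not_le, not_le] at ha
    rcases ha with ha | ha <;> nlinarith

theorem eval₂_reflect {M : Type*} [Field M] (ρ : ℝ →+* M) {ζ : M} (hζ : ζ ≠ 0) {N : ℕ} {f : ℝ[X]}
    (hf : f.natDegree ≤ N) : (f.reflect N).eval₂ ρ ζ⁻¹ * ζ ^ N = f.eval₂ ρ ζ := by
  let := invertibleOfNonzero hζ
  rw [← eval₂_reflect_mul_pow ρ ζ N f hf, invOf_eq_inv]

theorem eval_reflect {a : ℝ} (ha : a ≠ 0) {N : ℕ} {f : ℝ[X]} (hf : f.natDegree ≤ N) :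
    (f.reflect N).eval a⁻¹ * a ^ N = f.eval a :=
  eval₂_reflect (RingHom.id ℝ) ha hf

/-- The equation of a double cover near the point `0` of the other chart. -/
theorem IsQuadExt.reflect {M : Type*} [Field M] {ρ : ℝ →+* M} {ζ : M} {f : ℝ[X]}
    (h : IsQuadExt ρ ζ f) : IsQuadExt ρ ζ⁻¹ (f.reflect (2 * f.natDegree)) := by
  obtain ⟨hζ, u, hu, hm⟩ := h
  have h0 : ζ ≠ 0 := fun h0 => X_ne_zero (hζ X (by simpa using h0))
  -- The substitution ζ ↦ 1/ζ turns f into its reflection divided by a power of the coordinate;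
  -- reflecting in the even degree 2·deg f makes this power a square, absorbed by u.
  refine ⟨fun p hp => ?_, u * (ζ⁻¹) ^ f.natDegree, ?_, fun m => ?_⟩
  · have h1 := eval₂_reflect ρ (inv_ne_zero h0) (f := p) le_rfl
    rw [hp, inv_inv] at h1
    exact reflect_eq_zero_iff.1 (hζ _ ((mul_eq_zero.1 h1).resolve_right
      (pow_ne_zero _ (inv_ne_zero h0))))
  · rw [mul_pow, hu, ← eval₂_reflect ρ h0 (f := f) (N := 2 * f.natDegree) (by omega),
      mul_comm 2, pow_mul, ← pow_mul ζ⁻¹, inv_pow, pow_mul ζ f.natDegree 2]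
    exact mul_inv_cancel_right₀ (pow_ne_zero 2 (pow_ne_zero _ h0)) _
  · obtain ⟨a, b, d, hd, e⟩ := hm m
    let N := max (max a.natDegree d.natDegree) (b * X ^ f.natDegree).natDegree
    refine ⟨a.reflect N, (b * X ^ f.natDegree).reflect N, d.reflect N,
      fun h => hd (reflect_eq_zero_iff.1 h), ?_⟩
    have ha := eval₂_reflect ρ h0 (f := a) (N := N) (by simp [N])
    have hd := eval₂_reflect ρ h0 (f := d) (N := N) (by simp [N])
    have hb := eval₂_reflect ρ h0 (f := b * X ^ f.natDegree) (N := N) (by simp [N])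
    rw [eval₂_mul, eval₂_pow, eval₂_X] at hb
    have hp : ζ ^ N ≠ 0 := pow_ne_zero _ h0
    have hp' : ζ ^ f.natDegree * (ζ⁻¹) ^ f.natDegree = 1 := by
      rw [← mul_pow, mul_inv_cancel₀ h0, one_pow]
    apply mul_right_cancel₀ hp
    linear_combination e + m * hd - ha - u * (ζ⁻¹) ^ f.natDegree * hb - b.eval₂ ρ ζ * u * hp'

/-- Reflection is multiplicative and involutive when the formal degrees add up. The excess degree
contributes only a power of X with even exponent, so squares correspond to squares. -/
theorem NotSq.reflect {f : ℝ[X]} (hf : NotSq f) : NotSq (f.reflect (2 * f.natDegree)) := by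
  intro a b hab
  let N := max a.natDegree b.natDegree
  have h1 : ∀ p : ℝ[X], p.natDegree ≤ N → (p ^ 2).reflect (2 * N) = (p.reflect N) ^ 2 :=
    fun p hp => by rw [sq, two_mul, reflect_mul _ _ hp hp, sq]
  have ha : a.natDegree ≤ N := le_max_left _ _
  have hb : b.natDegree ≤ N := le_max_right _ _
  have hdeg : (f.reflect (2 * f.natDegree)).natDegree ≤ 2 * f.natDegree :=
    natDegree_reflect_le.trans (by simp; omega)
  have h2 := congrArg (Polynomial.reflect (2 * N + 2 * f.natDegree)) hab
  rw [reflect_mul _ _ (natDegree_pow_le_of_le 2 hb |>.trans (by omega)) hdeg, h1 b hb] at h2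
  have h3 : (f.reflect (2 * f.natDegree)).reflect (2 * f.natDegree) = f := by
    ext n; simp
  have h4 := reflect_mul (a ^ 2) (1 : ℝ[X]) (F := 2 * N) (G := 2 * f.natDegree)
    (natDegree_pow_le_of_le 2 ha |>.trans (by omega)) (by simp)
  rw [mul_one, h1 a ha] at h4
  rw [h4, h3] at h2
  have h5 : (1 : ℝ[X]).reflect (2 * f.natDegree) = (X ^ f.natDegree) ^ 2 := by
    rw [← C_1, reflect_C]; ring_nf; simp
  rw [h5, ← mul_pow] at h2
  exact reflect_eq_zero_iff.1 (hf _ _ h2)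

end RealSphere

/-! ### Construction of double covers -/

namespace RealSphere

open scoped QuadraticAlgebra

open Polynomial

theorem isQuadBasis_algebraMap {M : Type} [Field M] {ρ : ℝ →+* M} {ζ : M} {f : ℝ[X]}
    (hN : NotSq f) (h : IsQuadExt ρ ζ f) :
    IsQuadBasis (algebraMap ℝ[X] (QuadRing f)) f (AdjoinRoot.root (X ^ 2 - C f)) := by
  obtain ⟨hζ, u, hu, -⟩ := h
  refine ⟨?_, QuadRing.exists_eq, fun p q hpq => ?_⟩
  · have := AdjoinRoot.eval₂_root (X ^ 2 - C f : ℝ[X][X])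
    rw [eval₂_sub, eval₂_pow, eval₂_X, eval₂_C, sub_eq_zero] at this
    exact this
  · have hu' : u ^ 2 = eval₂RingHom ρ ζ f := hu
    have h1 := congrArg (QuadRing.lift (eval₂RingHom ρ ζ) u hu') hpq
    rw [map_add, map_mul, QuadRing.lift_algebraMap, QuadRing.lift_algebraMap, QuadRing.lift_root,
      map_zero] at h1
    exact eq_zero_of_add_mul_eq_zero hN hζ hu h1

/-- The integral closure of `ℝ[X]` in a quadratic extension of `ℝ(X)` is generated by a square
root. -/
theorem IsQuadExt.exists_isQuadBasis {B M : Type} [CommRing B] [Field M] {ρ : ℝ →+* M} {ζ : M}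
    {f : ℝ[X]} (hf : Squarefree f) (hN : NotSq f) (h : IsQuadExt ρ ζ f) {φ : ℝ[X] →+* B}
    {ψ : B →+* M} (hφ : ψ.comp φ = eval₂RingHom ρ ζ) (hψ : Function.Injective ψ)
    (hi : ∀ m, (∃ b, ψ b = m) ↔ (eval₂RingHom ρ ζ).IsIntegralElem m) :
    ∃ u, IsQuadBasis φ f u := by
  have hb := isQuadBasis_algebraMap hN h
  obtain ⟨v, hv⟩ := h.2
  have hE : ∀ p, ψ (φ p) = p.eval₂ ρ ζ := fun p => DFunLike.congr_fun hφ p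
  let l := QuadRing.lift (eval₂RingHom ρ ζ) v hv.1
  have hl : ∀ p : ℝ[X], l (algebraMap _ _ p) = p.eval₂ ρ ζ := QuadRing.lift_algebraMap _ v hv.1
  have hlr : l (AdjoinRoot.root _) = v := QuadRing.lift_root _ v hv.1
  obtain ⟨-, h2⟩ := hb.bijOn_integral hf hN h (ψ := l) (RingHom.ext hl)
  obtain ⟨u, hu⟩ := (hi v).2 ((h2 v).1 ⟨_, hlr⟩)
  refine ⟨u, hψ ?_, fun b => ?_, fun p q hpq => ?_⟩
  · rw [map_pow, hu, hE, hv.1]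
  · obtain ⟨c, hc⟩ := (h2 (ψ b)).2 ((hi _).1 ⟨b, rfl⟩)
    obtain ⟨p, q, rfl⟩ := QuadRing.exists_eq c
    refine ⟨p, q, hψ ?_⟩
    rw [← hc, map_add, map_add, map_mul, map_mul, hl, hl, hlr, hE, hE, hu]
  · have h3 := congrArg ψ hpq
    rw [map_add, map_mul, hE, hE, hu, map_zero] at h3
    exact eq_zero_of_add_mul_eq_zero hN h.1 hv.1 h3

theorem bijective_algebraMap_gradingP1_zero : Function.Bijective (algebraMap ℝ (gradingP1 0)) := by
  refine ⟨fun x y h => MvPolynomial.C_injective _ _ (congrArg Subtype.val h), fun x => ?_⟩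
  obtain ⟨x, hx⟩ := x
  have h1 : x.totalDegree = 0 := by
    rw [MvPolynomial.mem_homogeneousSubmodule] at hx
    exact Nat.le_zero.1 hx.totalDegree_le
  exact ⟨x.coeff 0, Subtype.ext (MvPolynomial.totalDegree_eq_zero_iff_eq_C.1 h1).symm⟩

instance : IsProper P1.toSpec := by
  have h1 : IsIso (CommRingCat.ofHom (algebraMap ℝ (gradingP1 0))) :=
    (ConcreteCategory.isIso_iff_bijective _).2 bijective_algebraMap_gradingP1_zero
  have h2 : Algebra.FiniteType (gradingP1 0) (MvPolynomial (Fin 2) ℝ) := by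
    have : IsScalarTower ℝ (gradingP1 0) (MvPolynomial (Fin 2) ℝ) :=
      IsScalarTower.of_algebraMap_eq (R := ℝ) (S := gradingP1 0)
        (A := MvPolynomial (Fin 2) ℝ) fun x => rfl
    exact Algebra.FiniteType.of_restrictScalars_finiteType ℝ _ _
  unfold P1.toSpec
  infer_instance

/-- At infinity the reflected equation need not be squarefree, so its square factors are removed;
over the first chart f is kept. -/
theorem IsQuadExt.exists_affPt {M : Type} [Field M] {ρ : ℝ →+* M} {ζ : M} {f : ℝ[X]}
    (hf : Squarefree f) (hN : NotSq f) (h : IsQuadExt ρ ζ f) (i : Fin 2) :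
    ∃ f', Squarefree f' ∧ NotSq f' ∧ IsQuadExt ρ (P1.affPt i ζ) f' ∧ (i = 0 → f' = f) := by
  by_cases hi : i = 0
  · exact ⟨f, hf, hN, by simpa [P1.affPt, hi] using h, fun _ => rfl⟩
  · obtain ⟨m, f', hm, hf', e⟩ := exists_eq_sq_mul_squarefree hN.reflect.ne_zero
    have e' : 1 ^ 2 * f.reflect (2 * f.natDegree) = m ^ 2 * f' := by rw [← e]; ring
    refine ⟨f', hf', hN.reflect.of_sq_mul_eq one_ne_zero e', ?_, fun h0 => absurd h0 hi⟩
    rw [P1.affPt, if_neg hi]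
    exact h.reflect.of_sq_mul_eq one_ne_zero hm e'

/-- Every quadratic extension of `ℝ(X)` is the function field of a double cover. -/
theorem exists_doubleCover {M : Type} [Field M] {ρ : ℝ →+* M} {ζ : M} {f : ℝ[X]}
    (hf : Squarefree f) (hN : NotSq f) (h : IsQuadExt ρ ζ f) :
    ∃ (C : DoubleCover) (ρ' : ℝ →+* C.Γ.functionField) (ζ' : C.Γ.functionField),
      C.IsGeneric ρ' ζ' ∧ IsQuadExt ρ' ζ' f := by
  have hζ : ζ ≠ 0 := fun h0 => X_ne_zero (h.1 X (by simpa using h0))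
  let p := P1.point ρ ζ
  let K : ∀ i, Chart p.fromNormalization i := fun i => (Chart.nonempty _ i).some
  -- The curve is the normalization of ℙ¹ in M. Its chart rings are integral closures, hence of the
  -- form ℝ[X][√f'] with f' squarefree, from which finiteness, flatness, degree and smoothness are
  -- read off.
  have hK : ∀ i, ∃ f' u, Squarefree f' ∧ IsQuadBasis (K i).φ f' u ∧ (i = 0 → f' = f) := fun i => by
    have hp := P1.point_eq_affPt ρ hζ i
    obtain ⟨f', hf', hN', h', h0⟩ := h.exists_affPt hf hN i
    obtain ⟨ψ, hψ, hφ⟩ := (K i).exists_lift p.toNormalization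
      (p.toNormalization_fromNormalization.trans hp)
    obtain ⟨h1, h2⟩ := normalization_chart p hp (K i) hψ
    obtain ⟨u, hu⟩ := h'.exists_isQuadBasis hf' hN' hφ h1 h2
    exact ⟨f', u, hf', hu, h0⟩
  have hfin : ∀ i, (K i).φ.Finite := fun i => by
    obtain ⟨f', u, -, hu, -⟩ := hK i
    let := (K i).φ.toAlgebra
    exact (IsQuadBasis.finite_free_finrank (B := (K i).B) hu).1
  have hflat : ∀ i, (K i).φ.Flat := fun i => by
    obtain ⟨f', u, -, hu, -⟩ := hK i
    let := (K i).φ.toAlgebra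
    have := (IsQuadBasis.finite_free_finrank (B := (K i).B) hu).2.1
    exact inferInstanceAs (Module.Flat ℝ[X] (K i).B)
  have : IsZariskiLocalAtTarget (@IsFinite.{0} : MorphismProperty Scheme.{0}) :=
    (HasAffineProperty.iff.1 ((HasAffineProperty.affineAnd_iff (@IsFinite.{0})
      RingHom.finite_respectsIso RingHom.finite_localizationPreserves.away
      RingHom.finite_ofLocalizationSpan).2 fun f => isFinite_iff f)).1
  have hI : IsFinite p.fromNormalization :=
    Chart.of_forall_chart (P := @IsFinite.{0}) K fun i => (IsFinite.SpecMap_iff _).2 (hfin i)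
  have : IsZariskiLocalAtTarget (@Flat.{0} : MorphismProperty Scheme.{0}) :=
    HasRingHomProperty.instIsZariskiLocalAtTarget (P := @Flat.{0}) (Q := RingHom.Flat)
  have hF : Flat p.fromNormalization :=
    Chart.of_forall_chart (P := @Flat.{0}) K fun i => Flat.SpecMap_iff.2 (hflat i)
  let C : DoubleCover :=
    { Γ := p.normalization
      π := p.fromNormalization
      isIntegral := inferInstance
      smooth := Chart.smooth_of_forall K fun i => by
        obtain ⟨f', u, hf', hu, -⟩ := hK i
        let := ((K i).φ.comp C).toAlgebra
        exact hu.smooth (B := (K i).B) rfl hf'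
      isProper := inferInstance
      isFinite := hI
      flat := hF
      degree_eq_two := fun y => by
        obtain ⟨i, y, rfl⟩ := P1.exists_mem_range_chart y
        obtain ⟨f', u, -, hu, -⟩ := hK i
        let := (K i).φ.toAlgebra
        obtain ⟨h1, h2, h3⟩ := IsQuadBasis.finite_free_finrank (B := (K i).B) hu
        refine ((K i).finrank_eq y).symm.trans ?_
        have h4 : (K i).φ.finrank y = Module.rankAtStalk (K i).B y := rfl
        rw [h4, Module.rankAtStalk_eq_finrank_of_free]
        exact h3 }
  obtain ⟨ρ', ζ', hC⟩ := C.exists_isGeneric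
  obtain ⟨f', u, -, hu, h0⟩ := hK 0
  refine ⟨C, ρ', ζ', hC, ?_⟩
  have h1 := DoubleCover.IsGeneric.isQuadExt (C := C) hC (K := K 0) hu
  rwa [h0 rfl] at h1

end RealSphere

/-! ### Real points of double covers -/

namespace RealSphere

open scoped QuadraticAlgebra

open Polynomial

theorem IsQuadBasis.exists_hom {B : Type} [CommRing B] {φ : ℝ[X] →+* B} {f : ℝ[X]} {u : B}
    (h : IsQuadBasis φ f u) {a c : ℝ} (hc : c ^ 2 = f.eval a) :
    ∃ ψ : B →+* ℝ, (∀ p, ψ (φ p) = p.eval a) ∧ ψ u = c := by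
  obtain ⟨e, he, heu⟩ := h.exists_ringEquiv
  have hc' : c ^ 2 = evalRingHom a f := hc
  refine ⟨(QuadRing.lift (evalRingHom a) c hc').comp (e.symm : B →+* QuadRing f), fun p => ?_, ?_⟩
  · rw [← he, RingHom.comp_apply, RingHom.coe_coe, e.symm_apply_apply, QuadRing.lift_algebraMap]
    rfl
  · rw [← heu, RingHom.comp_apply, RingHom.coe_coe, e.symm_apply_apply, QuadRing.lift_root]

theorem IsQuadBasis.hom_ext {B : Type} [CommRing B] {φ : ℝ[X] →+* B} {f : ℝ[X]} {u : B}
    (h : IsQuadBasis φ f u) {ψ ψ' : B →+* ℝ} (h1 : ψ.comp φ = ψ'.comp φ) (h2 : ψ u = ψ' u) :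
    ψ = ψ' := by
  ext b
  obtain ⟨p, q, rfl⟩ := h.2.1 b
  have h3 : ∀ p, ψ (φ p) = ψ' (φ p) := DFunLike.congr_fun h1
  rw [map_add, map_add, map_mul, map_mul, h3, h3, h2]

/-- The field ℝ has no ring endomorphism other than the identity, so linearity over ℝ is automatic.
-/
theorem eq_evalRingHom (E : ℝ[X] →+* ℝ) : E = evalRingHom (E X) := by
  ext r
  · exact DFunLike.congr_fun (Subsingleton.elim (E.comp C) ((evalRingHom (E X)).comp C)) r
  · simp

theorem evalRingHom_eq (a : ℝ) : evalRingHom a = eval₂RingHom (RingHom.id ℝ) a := by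
  ext <;> simp

/-- The local description of regular functions near a real point of an affine chart. -/
theorem exists_resHom_mul_eq {T : Scheme.{0}} {B : Type} [CommRing B] (j : Spec (.of B) ⟶ T)
    {U : T.Opens} (g : Γ(T, U)) {ψ : B →+* ℝ}
    (hψ : ⊤ ≤ (Spec.map (CommRingCat.ofHom ψ) ≫ j) ⁻¹ᵁ U) :
    ∃ d n : B, ψ d ≠ 0 ∧ ∀ ψ' : B →+* ℝ, ψ' d ≠ 0 →
      ∃ h : ⊤ ≤ (Spec.map (CommRingCat.ofHom ψ') ≫ j) ⁻¹ᵁ U,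
        resHom (Spec.map (CommRingCat.ofHom ψ') ≫ j) U h g * ψ' d = ψ' n := by
  let x : PrimeSpectrum ℝ := ⊥
  let y : PrimeSpectrum B := PrimeSpectrum.comap ψ x
  have hy : y ∈ (j ⁻¹ᵁ U : (Spec (.of B)).Opens) := hψ (show x ∈ (⊤ : (Spec (.of ℝ)).Opens) from trivial)
  obtain ⟨_, ⟨d, rfl⟩, hd, hdU⟩ := PrimeSpectrum.isTopologicalBasis_basic_opens.exists_subset_of_mem_open
    hy (j ⁻¹ᵁ U).isOpen
  have hψd : ψ d ≠ 0 := hd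
  let al : B →+* Localization.Away d := algebraMap _ _
  have hU : ⊤ ≤ (Spec.map (CommRingCat.ofHom al) ≫ j) ⁻¹ᵁ U := fun z _ => hdU (by
    have : PrimeSpectrum.comap al z ∈ Set.range (PrimeSpectrum.comap al) := ⟨z, rfl⟩
    rwa [PrimeSpectrum.localization_away_comap_range (Localization.Away d) d] at this)
  obtain ⟨n, ⟨_, k, rfl⟩, hn⟩ := IsLocalization.exists_mk'_eq (Submonoid.powers d)
    (resHom (Spec.map (CommRingCat.ofHom al) ≫ j) U hU g)
  -- The exponent k + 1 instead of k keeps the information ψ' d ≠ 0 when k = 0.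
  refine ⟨d ^ (k + 1), n * d, by rw [map_pow]; exact pow_ne_zero _ hψd, fun ψ' hd' => ?_⟩
  have hd'' : ψ' d ≠ 0 := fun h0 => hd' (by rw [map_pow, h0, zero_pow (Nat.succ_ne_zero k)])
  let l : Localization.Away d →+* ℝ := IsLocalization.Away.lift d (g := ψ') hd''.isUnit
  have hl : l.comp al = ψ' := IsLocalization.Away.lift_comp d hd''.isUnit
  have e : Spec.map (CommRingCat.ofHom ψ') ≫ j =
      Spec.map (CommRingCat.ofHom l) ≫ Spec.map (CommRingCat.ofHom al) ≫ j := by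
    rw [← hl, CommRingCat.ofHom_comp, Spec.map_comp, Category.assoc]
  have h' : ⊤ ≤ (Spec.map (CommRingCat.ofHom l) ≫ Spec.map (CommRingCat.ofHom al) ≫ j) ⁻¹ᵁ U :=
    fun z _ => hU (show Spec.map (CommRingCat.ofHom l) z ∈ (⊤ : (Spec (.of _)).Opens) from trivial)
  rw [e]
  refine ⟨h', ?_⟩
  rw [comp_resHom _ U hU l h', ← hn, ← hl]
  have hs := IsLocalization.mk'_spec (Localization.Away d) n
    (⟨d ^ k, k, rfl⟩ : Submonoid.powers d)
  have hs' := congrArg l hs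
  rw [map_mul] at hs'
  have h5 : ∀ b, l.comp al b = l (algebraMap _ _ b) := fun b => rfl
  rw [map_mul, map_pow, h5, h5, ← hs', pow_succ, ← mul_assoc]
  congr 2
  rw [← map_pow, ← map_pow]

end RealSphere

namespace RealSphere

open scoped QuadraticAlgebra

open Polynomial

namespace DoubleCover

variable {C : DoubleCover}

section

variable {i : Fin 2} (K : Chart C.π i)

/-- The real point of a chart given by a homomorphism to `ℝ`. -/
noncomputable def realPoint (ψ : K.B →+* ℝ) : C.RealPoints :=
  ⟨Spec.map (CommRingCat.ofHom ψ) ≫ K.j, by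
    rw [Category.assoc, ← Category.assoc K.j, K.w, Category.assoc, P1.chart_toSpec,
      ← Spec.map_comp, ← Spec.map_comp, ← CommRingCat.ofHom_comp, ← CommRingCat.ofHom_comp,
      Subsingleton.elim (ψ.comp (K.φ.comp Polynomial.C)) (RingHom.id ℝ)]
    exact Spec.map_id _⟩

theorem realPoint_comp_π (ψ : K.B →+* ℝ) : (realPoint K ψ).1 ≫ C.π =
    Spec.map (CommRingCat.ofHom (eval₂RingHom (RingHom.id ℝ) (ψ (K.φ X)))) ≫ P1.chart i := by
  rw [realPoint, Category.assoc, K.w, ← Spec.map_comp_assoc, ← CommRingCat.ofHom_comp,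
    eq_evalRingHom (ψ.comp K.φ), evalRingHom_eq]

theorem realPoint_comp_π_zero (K : Chart C.π 0) (ψ : K.B →+* ℝ) :
    (realPoint K ψ).1 ≫ C.π = P1.point (RingHom.id ℝ) (ψ (K.φ X)) := by
  rw [realPoint_comp_π, P1.point_eq]

theorem exists_realPoint_of_comp_π {s : C.RealPoints} {a : ℝ}
    (h : s.1 ≫ C.π = Spec.map (CommRingCat.ofHom (eval₂RingHom (RingHom.id ℝ) a)) ≫ P1.chart i) :
    ∃ ψ, realPoint K ψ = s ∧ ψ (K.φ X) = a := by
  obtain ⟨ψ, h1, h2⟩ := K.exists_lift s.1 h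
  refine ⟨ψ, Subtype.ext h1, ?_⟩
  have := DFunLike.congr_fun h2 X
  simpa using this

theorem sq_eq_eval {f : ℝ[X]} {u : K.B} (hq : IsQuadBasis K.φ f u) (ψ : K.B →+* ℝ) :
    ψ u ^ 2 = f.eval (ψ (K.φ X)) := by
  rw [← map_pow, hq.1]
  exact DFunLike.congr_fun (eq_evalRingHom (ψ.comp K.φ)) f

end

theorem exists_realPoint (K : ∀ i, Chart C.π i) (s : C.RealPoints) :
    ∃ i ψ, realPoint (K i) ψ = s := by
  obtain ⟨i, hi⟩ := Chart.exists_mem_opensRange K (s.1 (⊥ : PrimeSpectrum ℝ))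
  have hr : Set.range s.1 ⊆ Set.range (K i).j := by
    rintro _ ⟨x, rfl⟩
    have : x = (⊥ : PrimeSpectrum ℝ) := Subsingleton.elim (α := PrimeSpectrum ℝ) _ _
    rw [this]
    exact hi
  obtain ⟨ψ, hψ⟩ := Spec.map_surjective (IsOpenImmersion.lift (K i).j s.1 hr)
  refine ⟨i, ψ.hom, Subtype.ext ?_⟩
  exact (congrArg (· ≫ (K i).j) hψ).trans (IsOpenImmersion.lift_fac _ _ _)

/-- If `f` is nonpositive near infinity, then there is no real point at infinity. -/
theorem exists_realPoint_zero {K : Chart C.π 0} {f : ℝ[X]} {u : K.B} (hq : IsQuadBasis K.φ f u)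
    (hf : ∀ a ∈ (Set.Icc (-1 : ℝ) 1)ᶜ, f.eval a ≤ 0) (s : C.RealPoints) :
    ∃ ψ, realPoint K ψ = s := by
  let K' : ∀ i, Chart C.π i := fun i => (Chart.nonempty C.π i).some
  obtain ⟨i, ψ, rfl⟩ := exists_realPoint K' s
  have h0 := realPoint_comp_π (K' i) ψ
  obtain rfl | rfl : i = 0 ∨ i = 1 := by fin_cases i <;> simp
  · obtain ⟨ψ', h, -⟩ := exists_realPoint_of_comp_π K h0
    exact ⟨ψ', h⟩
  by_cases ha : ψ ((K' 1).φ X) = 0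
  · exfalso
    obtain ⟨ρ, ζ, hg⟩ := C.exists_isGeneric
    obtain ⟨f₁, u₁, hq₁, hf₁⟩ := C.chart_isQuadBasis (K' 1)
    have hdom := C.chart_isDomain K
    have hdom₁ := C.chart_isDomain (K' 1)
    have h1 : IsQuadExt ρ ζ f := hg.isQuadExt hq
    have h2 : IsQuadExt ρ ζ⁻¹ f₁ := hg.isQuadExt hq₁
    obtain ⟨r, r', hr, -, e⟩ := h2.exists_sq_mul_eq hq₁.notSq hq.notSq.reflect h1.reflect
      (RingHom.id _) rfl rfl
    -- At infinity the squarefree equation f₁ is, up to squares, the reflection of f, which is not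
    -- positive near 0 except perhaps at 0 itself; the extra factor X² deals with that point. Then
    -- f₁(0) < 0, and no real point lies over infinity.
    have h3 : ∀ a ∈ Set.Ioo (-1 : ℝ) 1, 0 ≤ (-f₁).eval a := by
      refine nonneg_of_sq_mul_eq (r := X * r) (r' := r')
        (f' := X ^ 2 * -f.reflect (2 * f.natDegree)) (mul_ne_zero X_ne_zero hr)
        (by linear_combination -X ^ 2 * e) isOpen_Ioo fun a ha => ?_
      by_cases ha0 : a = 0
      · simp [ha0]
      have h4 := eval_reflect (inv_ne_zero ha0) (f := f) (N := 2 * f.natDegree) (by omega)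
      rw [inv_inv, pow_mul] at h4
      have h5 : f.eval a⁻¹ ≤ 0 := hf _ fun hc => by
        have h6 : |a⁻¹| ≤ 1 := abs_le.2 hc
        have h7 : |a| < 1 := abs_lt.2 ha
        rw [abs_inv] at h6
        exact absurd (one_lt_inv_iff₀.2 ⟨abs_pos.2 ha0, h7⟩) (not_lt.2 h6)
      have h8 : 0 < (a⁻¹ ^ 2) ^ f.natDegree := by positivity
      have h9 : (f.reflect (2 * f.natDegree)).eval a ≤ 0 := by
        by_contra hc
        nlinarith [mul_pos (not_le.1 hc) h8]
      simp only [eval_mul, eval_pow, eval_X, eval_neg]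
      exact mul_nonneg (sq_nonneg a) (neg_nonneg.2 h9)
    have h5 := pos_of_nonneg_of_squarefree (Squarefree.neg hf₁) isOpen_Ioo h3
      (show (0 : ℝ) ∈ Set.Ioo (-1) 1 by simp)
    have h6 := sq_eq_eval (K' 1) hq₁ ψ
    rw [ha] at h6
    rw [eval_neg] at h5
    nlinarith [sq_nonneg (ψ u₁)]
  · obtain ⟨ψ', h, -⟩ := exists_realPoint_of_comp_π K (h0.trans
      (P1.SpecMap_eval₂_chart_eq (RingHom.id ℝ) (inv_mul_cancel₀ ha)).symm)
    exact ⟨ψ', h⟩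

theorem hasNoRealPoint_iff {K : Chart C.π 0} {f : ℝ[X]} {u : K.B} (hq : IsQuadBasis K.φ f u) :
    C.HasNoRealPoint ↔ ∀ a, f.eval a < 0 := by
  refine ⟨fun h a => ?_, fun h => ⟨fun s => ?_⟩⟩
  · by_contra hc
    obtain ⟨ψ, -, -⟩ := hq.exists_hom (Real.sq_sqrt (not_lt.1 hc))
    exact h.elim (realPoint K ψ)
  · obtain ⟨ψ, rfl⟩ := exists_realPoint_zero hq (fun a _ => (h a).le) s
    have h1 := sq_eq_eval K hq ψ
    nlinarith [sq_nonneg (ψ u), h (ψ (K.φ X))]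

theorem ImageIsInterval.exists_eq_mul (h : C.ImageIsInterval) {K : Chart C.π 0} {f : ℝ[X]} {u : K.B}
    (hq : IsQuadBasis K.φ f u) (hf : Squarefree f) :
    ∃ k : ℝ[X], f = (1 - X ^ 2) * k ∧ ∀ a, 0 < k.eval a := by
  refine exists_eq_mul_of_sign hf (fun a ha => ?_) fun a ha => ?_
  · have h1 : P1.point (RingHom.id ℝ) a ∈ Set.range fun s : C.RealPoints => s.1 ≫ C.π := by
      rw [h]
      exact ⟨a, Set.Ioo_subset_Icc_self ha, rfl⟩
    obtain ⟨s, hs⟩ := h1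
    obtain ⟨ψ, -, hψ⟩ := exists_realPoint_of_comp_π K (hs.trans (P1.point_eq _ _))
    rw [← hψ, ← sq_eq_eval K hq]
    exact sq_nonneg _
  · by_contra hc
    obtain ⟨ψ, hψ, -⟩ := hq.exists_hom (Real.sq_sqrt (not_le.1 hc).le)
    have h1 : P1.point (RingHom.id ℝ) a ∈ Set.range fun s : C.RealPoints => s.1 ≫ C.π :=
      ⟨realPoint K ψ, (realPoint_comp_π_zero K ψ).trans (by rw [hψ, eval_X])⟩
    rw [h] at h1
    obtain ⟨b, hb, hab⟩ := h1
    rw [(P1.point_injective hab).2] at hb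
    exact ha hb

theorem eval_nonneg_iff {k : ℝ[X]} (hk : ∀ a, 0 < k.eval a) (a : ℝ) :
    0 ≤ ((1 - X ^ 2) * k).eval a ↔ a ∈ Set.Icc (-1 : ℝ) 1 := by
  rw [eval_mul, mul_nonneg_iff_of_pos_right (hk a), eval_sub, eval_one, eval_pow, eval_X, sub_nonneg,
    sq_le_one_iff_abs_le_one, abs_le, Set.mem_Icc]

theorem imageIsInterval_of_eq_mul {K : Chart C.π 0} {k : ℝ[X]} {u : K.B}
    (hq : IsQuadBasis K.φ ((1 - X ^ 2) * k) u) (hk : ∀ a, 0 < k.eval a) : C.ImageIsInterval := by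
  ext t
  constructor
  · rintro ⟨s, rfl⟩
    obtain ⟨ψ, rfl⟩ := exists_realPoint_zero hq
      (fun a ha => le_of_not_ge fun hc => ha ((eval_nonneg_iff hk a).1 hc)) s
    refine ⟨ψ (K.φ X), ?_, (realPoint_comp_π_zero K ψ).symm⟩
    rw [← eval_nonneg_iff hk, ← sq_eq_eval K hq]
    exact sq_nonneg _
  · rintro ⟨a, ha, rfl⟩
    obtain ⟨ψ, hψ, -⟩ := hq.exists_hom (Real.sq_sqrt ((eval_nonneg_iff hk a).2 ha))
    exact ⟨realPoint K ψ, (realPoint_comp_π_zero K ψ).trans (by rw [hψ, eval_X])⟩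

/-- A family of real points of a chart is continuous if its coordinates are. -/
theorem continuous_realPoint {K : Chart C.π 0} {Z : Type*} [TopologicalSpace Z]
    {ψ : Z → K.B →+* ℝ} (h : ∀ b, Continuous fun z => ψ z b) :
    Continuous fun z => realPoint K (ψ z) := by
  refine continuous_generateFrom_iff.2 ?_
  rintro _ ⟨U, g, W, hW, rfl⟩
  rw [isOpen_iff_mem_nhds]
  rintro z ⟨hU, hgW⟩
  obtain ⟨d, n, hd, H⟩ := exists_resHom_mul_eq K.j g hU
  have hval : ∀ z, ψ z d ≠ 0 → ∃ hU : ⊤ ≤ (realPoint K (ψ z)).1 ⁻¹ᵁ U,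
      (Scheme.ΓSpecIso (.of ℝ)).hom ((realPoint K (ψ z)).1.appLE U ⊤ hU g) = ψ z n / ψ z d := by
    intro z hz
    obtain ⟨h', e⟩ := H (ψ z) hz
    exact ⟨h', (eq_div_iff hz).2 e⟩
  have hc : ContinuousAt (fun z => ψ z n / ψ z d) z :=
    (h n).continuousAt.div (h d).continuousAt hd
  have hz : ψ z n / ψ z d ∈ W := by
    obtain ⟨h', e⟩ := hval z hd
    rw [← e]
    exact hgW
  filter_upwards [(h d).continuousAt.eventually_ne hd, hc (hW.mem_nhds hz)] with y hy hyW
  obtain ⟨h', e⟩ := hval y hy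
  exact ⟨h', by rw [e]; exact hyW⟩

/-- All real points lie in the affine chart, so they are a continuous image of the plane curve c² =
f(a). This curve is the union of the graphs of ±√f over [-1, 1], which meet at (1, 0). -/
theorem hasOneOval_of_eq_mul {K : Chart C.π 0} {k : ℝ[X]} {u : K.B}
    (hq : IsQuadBasis K.φ ((1 - X ^ 2) * k) u) (hk : ∀ a, 0 < k.eval a) : C.HasOneOval := by
  set f := (1 - X ^ 2) * k with hf
  let Z : Set (ℝ × ℝ) := {z | z.2 ^ 2 = f.eval z.1}
  have hZ : Z = (fun a => (a, √(f.eval a))) '' Set.Icc (-1 : ℝ) 1 ∪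
      (fun a => (a, -√(f.eval a))) '' Set.Icc (-1 : ℝ) 1 := by
    ext ⟨a, c⟩
    constructor
    · intro h
      have h : c ^ 2 = f.eval a := h
      have ha := (eval_nonneg_iff hk a).1 (by rw [← hf, ← h]; exact sq_nonneg c)
      rcases le_total 0 c with hc | hc
      · exact Or.inl ⟨a, ha, by simp [← h, Real.sqrt_sq hc]⟩
      · exact Or.inr ⟨a, ha, by simp [← h, Real.sqrt_sq_eq_abs, abs_of_nonpos hc]⟩
    · rintro (⟨b, hb, h⟩ | ⟨b, hb, h⟩) <;> obtain ⟨rfl, rfl⟩ := Prod.mk.inj h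
      · exact Real.sq_sqrt ((eval_nonneg_iff hk b).2 hb)
      · exact (neg_sq _).trans (Real.sq_sqrt ((eval_nonneg_iff hk b).2 hb))
  have hcon : _root_.IsConnected Z := by
    have h1 : Continuous fun a => √(f.eval a) := f.continuous.sqrt
    have hI : _root_.IsConnected (Set.Icc (-1 : ℝ) 1) := isConnected_Icc (by norm_num)
    rw [hZ]
    refine _root_.IsConnected.union ⟨(1, 0), ⟨1, by simp, by simp [hf]⟩, ⟨1, by simp, by simp [hf]⟩⟩
      (hI.image _ (continuous_id.prodMk h1).continuousOn)
      (hI.image _ (continuous_id.prodMk h1.neg).continuousOn)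
  have : ConnectedSpace Z := _root_.isConnected_iff_connectedSpace.1 hcon
  choose ψ hψ hψu using fun z : Z => hq.exists_hom (a := z.1.1) (c := z.1.2) z.2
  have hcont : Continuous fun z => realPoint K (ψ z) := continuous_realPoint fun b => by
    obtain ⟨p, q, rfl⟩ := hq.2.1 b
    simp only [map_add, map_mul, hψ, hψu]
    fun_prop
  refine Function.Surjective.connectedSpace (f := fun z => realPoint K (ψ z)) (fun s => ?_) hcont
  obtain ⟨χ, rfl⟩ := exists_realPoint_zero hq
    (fun a ha => le_of_not_ge fun hc => ha ((eval_nonneg_iff hk a).1 hc)) s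
  refine ⟨⟨(χ (K.φ X), χ u), sq_eq_eval K hq χ⟩, congrArg (realPoint K) (hq.hom_ext ?_ (hψu _))⟩
  rw [eq_evalRingHom (χ.comp K.φ)]
  ext p <;> simp [hψ]

end DoubleCover

end RealSphere

/-! ### The square class as invariant of involutions and covers -/

namespace RealSphere

open scoped QuadraticAlgebra

open Polynomial

/-- The polynomials `f` and `f'` define the same element of `ℝ(X)ˣ / ℝ(X)ˣ²`. -/
def SqEq (f f' : ℝ[X]) : Prop := ∃ r r' : ℝ[X], r ≠ 0 ∧ r' ≠ 0 ∧ r ^ 2 * f = r' ^ 2 * f'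

theorem SqEq.of_sq_mul {m f : ℝ[X]} (hm : m ≠ 0) : SqEq (m ^ 2 * f) f :=
  ⟨1, m, one_ne_zero, hm, by ring⟩

theorem SqEq.symm {f f' : ℝ[X]} (h : SqEq f f') : SqEq f' f := by
  obtain ⟨r, r', hr, hr', e⟩ := h
  exact ⟨r', r, hr', hr, e.symm⟩

theorem SqEq.trans {f f' f'' : ℝ[X]} (h : SqEq f f') (h' : SqEq f' f'') : SqEq f f'' := by
  obtain ⟨r, r', hr, hr', e⟩ := h
  obtain ⟨s, s', hs, hs', e'⟩ := h'
  exact ⟨s * r, r' * s', mul_ne_zero hs hr, mul_ne_zero hr' hs',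
    by linear_combination s ^ 2 * e + r' ^ 2 * e'⟩

theorem NotSq.of_sqEq {f f' : ℝ[X]} (hf : NotSq f) (h : SqEq f f') : NotSq f' := by
  obtain ⟨r, r', hr, -, e⟩ := h
  exact hf.of_sq_mul_eq hr e

theorem IsQuadExt.of_sqEq {M : Type*} [Field M] {ρ : ℝ →+* M} {ζ : M} {f f' : ℝ[X]}
    (h : IsQuadExt ρ ζ f) (e : SqEq f f') : IsQuadExt ρ ζ f' := by
  obtain ⟨r, r', hr, hr', e⟩ := e
  exact h.of_sq_mul_eq hr hr' e

theorem SqEq.nonneg {f f' : ℝ[X]} (h : SqEq f f') {U : Set ℝ} (hU : IsOpen U)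
    (hf' : ∀ a ∈ U, 0 ≤ f'.eval a) : ∀ a ∈ U, 0 ≤ f.eval a := by
  obtain ⟨r, r', hr, -, e⟩ := h
  exact nonneg_of_sq_mul_eq hr e hU hf'

theorem SqEq.neg {f f' : ℝ[X]} (h : SqEq f f') : SqEq (-f) (-f') := by
  obtain ⟨r, r', hr, hr', e⟩ := h
  exact ⟨r, r', hr, hr', by linear_combination -e⟩

theorem SqEq.nonpos {f f' : ℝ[X]} (h : SqEq f f') {U : Set ℝ} (hU : IsOpen U)
    (hf' : ∀ a ∈ U, f'.eval a ≤ 0) : ∀ a ∈ U, f.eval a ≤ 0 := by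
  simpa using h.neg.nonneg hU (by simpa using hf')

/-- The residue field of the curve of fixed points of `g` is `ℝ(X)(√f)`. -/
structure HasDiscr (g : Bir) (f : ℝ[X]) : Prop where
  notSq : NotSq f
  nonempty : Nonempty (FixedCurve g)
  isQuadExt : ∀ F : FixedCurve g, IsQuadExt F.const F.z f

theorem IsRefl.hasDiscr {g : Bir} {α β γ : ℝ[X]} (h : IsRefl g α β γ) (hN : NotSq (-nrd α β γ)) :
    HasDiscr g (-nrd α β γ) :=
  ⟨hN, nonempty_fixedCurve hN h, fun F => F.isQuadExt_of_isRefl hN h⟩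

theorem HasDiscr.sqEq {g : Bir} {f f' : ℝ[X]} (h : HasDiscr g f) (h' : HasDiscr g f') : SqEq f f' := by
  obtain ⟨F⟩ := h.nonempty
  exact (h.isQuadExt F).exists_sq_mul_eq h.notSq h'.notSq (h'.isQuadExt F) (RingHom.id _) rfl rfl

/-- The conjugating map induces a local homomorphism of valuation rings. It fixes the constants and
z, because P does. -/
theorem FixedCurve.exists_ofConj_hom {g P : Bir} (hz : P (coord 2) = coord 2)
    (F : FixedCurve (P * g * P⁻¹)) : ∃ e : (F.ofConj hz).field →+* F.field,
      e.comp (F.ofConj hz).const = F.const ∧ e (F.ofConj hz).z = F.z := by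
  let ψ : (F.ofConj hz).V →+* F.V :=
    ((P : FunField →+* FunField).comp (F.ofConj hz).V.subtype).codRestrict F.V.toSubring fun x => x.2
  have hψ : IsLocalHom ψ := ⟨fun x hx => by
    obtain ⟨y, hy⟩ := hx.exists_right_inv
    have hx0 : P x.1 * y.1 = 1 := congrArg Subtype.val hy
    have hy1 : P (P⁻¹ y.1) = y.1 := P.apply_symm_apply _
    refine IsUnit.of_mul_eq_one (⟨P⁻¹ y.1, by change P (P⁻¹ y.1) ∈ F.V; rw [hy1]; exact y.2⟩ :
      (F.ofConj hz).V) (Subtype.ext (P.injective ?_))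
    change P (x.1 * P⁻¹ y.1) = P 1
    rw [map_mul, hy1, hx0, map_one]⟩
  refine ⟨IsLocalRing.ResidueField.map ψ, ?_, ?_⟩
  · ext r
    change IsLocalRing.ResidueField.map ψ (IsLocalRing.residue _ _) = _
    rw [IsLocalRing.ResidueField.map_residue]
    exact congrArg _ (Subtype.ext (P.commutes r))
  · change IsLocalRing.ResidueField.map ψ (IsLocalRing.residue _ _) = _
    rw [IsLocalRing.ResidueField.map_residue]
    exact congrArg _ (Subtype.ext hz)

theorem HasDiscr.sqEq_conj {g P : Bir} (hz : P (coord 2) = coord 2) {f f' : ℝ[X]} (h : HasDiscr g f)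
    (h' : HasDiscr (P * g * P⁻¹) f') : SqEq f f' := by
  obtain ⟨F⟩ := h'.nonempty
  obtain ⟨e, h1, h2⟩ := F.exists_ofConj_hom hz
  exact (h.isQuadExt (F.ofConj hz)).exists_sq_mul_eq h.notSq h'.notSq (h'.isQuadExt F) e h1 h2

namespace DoubleCover

/-- The function field of `C` is `ℝ(X)(√f)`. -/
def HasDiscr (C : DoubleCover) (f : ℝ[X]) : Prop :=
  NotSq f ∧ ∃ ρ ζ, C.IsGeneric ρ ζ ∧ IsQuadExt ρ ζ f

variable {C C' : DoubleCover} {f f' : ℝ[X]}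

theorem HasDiscr.of_sqEq (h : C.HasDiscr f) (e : SqEq f f') : C.HasDiscr f' := by
  obtain ⟨hf, ρ, ζ, hg, h⟩ := h
  exact ⟨hf.of_sqEq e, ρ, ζ, hg, h.of_sqEq e⟩

theorem HasDiscr.sqEq (h : C.HasDiscr f) (h' : C.HasDiscr f') : SqEq f f' := by
  obtain ⟨hf, ρ, ζ, hg, h⟩ := h
  obtain ⟨hf', ρ', ζ', hg', h'⟩ := h'
  obtain ⟨rfl, rfl⟩ := P1.point_injective (hg.symm.trans hg')
  exact h.exists_sq_mul_eq hf hf' h' (RingHom.id _) rfl rfl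

theorem hasDiscr_of_isQuadBasis {K : Chart C.π 0} {u : K.B} (hq : IsQuadBasis K.φ f u) :
    C.HasDiscr f := by
  have := C.chart_isDomain K
  obtain ⟨ρ, ζ, hg⟩ := C.exists_isGeneric
  exact ⟨hq.notSq, ρ, ζ, hg, hg.isQuadExt hq⟩

variable (C) in
theorem exists_hasDiscr : ∃ f, C.HasDiscr f := by
  obtain ⟨K⟩ := Chart.nonempty C.π 0
  obtain ⟨f, u, hq, -⟩ := C.chart_isQuadBasis K
  exact ⟨f, hasDiscr_of_isQuadBasis hq⟩

/-- An isomorphism carries a chart and its quadratic basis along, so both covers have the same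
equation. Conversely, equal square classes give isomorphic function fields over ℝ(z), and these
determine the covers. -/
theorem HasDiscr.equiv_iff (h : C.HasDiscr f) (h' : C'.HasDiscr f') : C ≈ C' ↔ SqEq f f' := by
  constructor
  · rintro ⟨e, he⟩
    obtain ⟨K⟩ := Chart.nonempty C.π 0
    obtain ⟨f₀, u, hq, -⟩ := C.chart_isQuadBasis K
    let K' : Chart C'.π 0 := ⟨K.B, K.φ, K.j ≫ e.hom,
      K.isPullback.of_iso (Iso.refl _) e (Iso.refl _) (Iso.refl _) (by simp) (by simp)
        (by simp [he]) (by simp)⟩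
    have hq' : IsQuadBasis K'.φ f₀ (show K'.B from u) := hq
    exact (h.sqEq (hasDiscr_of_isQuadBasis hq)).trans ((hasDiscr_of_isQuadBasis hq').sqEq h')
  · intro e
    obtain ⟨-, ρ, ζ, hg, h⟩ := h.of_sqEq e
    obtain ⟨hf', ρ', ζ', hg', h'⟩ := h'
    obtain ⟨e, he, he'⟩ := h.exists_ringEquiv hf' h'
    exact hg.equiv hg' e he he'

theorem HasDiscr.isFixedCurveOf_iff {g : Bir} (h : C.HasDiscr f) (h' : RealSphere.HasDiscr g f') :
    IsFixedCurveOf C g ↔ SqEq f' f := by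
  obtain ⟨hf, ρ, ζ, hg, h⟩ := h
  constructor
  · rintro ⟨F, e, he⟩
    have h1 := hg.symm.trans (he.trans (P1.SpecMap_point F.const F.z e.toRingHom))
    obtain ⟨h2, h3⟩ := P1.point_injective h1
    exact (h'.isQuadExt F).exists_sq_mul_eq h'.notSq hf h e.toRingHom h2.symm h3.symm
  · intro e
    obtain ⟨F⟩ := h'.nonempty
    obtain ⟨e, h1, h2⟩ := ((h'.isQuadExt F).of_sqEq e).exists_ringEquiv hf h
    refine ⟨F, e, hg.trans ?_⟩
    rw [FixedCurve.genericMap, P1.SpecMap_point]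
    exact congrArg₂ P1.point h1.symm h2.symm

/-- The chart has a squarefree equation in the same square class; squarefreeness turns f ≤ 0 into a
strict inequality. -/
theorem HasDiscr.hasNoRealPoint (h : C.HasDiscr f) (hf : ∀ a, f.eval a ≤ 0) : C.HasNoRealPoint := by
  obtain ⟨K⟩ := Chart.nonempty C.π 0
  obtain ⟨f₀, u, hq, hf₀⟩ := C.chart_isQuadBasis K
  refine (hasNoRealPoint_iff hq).2 fun a =>
    neg_of_nonpos_of_squarefree hf₀ isOpen_univ ?_ (Set.mem_univ a)
  exact ((hasDiscr_of_isQuadBasis hq).sqEq h).nonpos isOpen_univ fun a _ => hf a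

theorem HasNoRealPoint.exists_hasDiscr (h : C.HasNoRealPoint) :
    ∃ f, C.HasDiscr f ∧ ∀ a, f.eval a < 0 := by
  obtain ⟨K⟩ := Chart.nonempty C.π 0
  obtain ⟨f, u, hq, hf⟩ := C.chart_isQuadBasis K
  exact ⟨f, hasDiscr_of_isQuadBasis hq, (hasNoRealPoint_iff hq).1 h⟩

theorem HasDiscr.hasOneOval {k : ℝ[X]} (h : C.HasDiscr ((1 - X ^ 2) * k)) (hk : ∀ a, 0 ≤ k.eval a) :
    C.HasOneOval ∧ C.ImageIsInterval := by
  obtain ⟨K⟩ := Chart.nonempty C.π 0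
  obtain ⟨f, u, hq, hf⟩ := C.chart_isQuadBasis K
  have e := (hasDiscr_of_isQuadBasis hq).sqEq h
  have hv : ∀ a, ((1 - X ^ 2) * k).eval a = (1 - a ^ 2) * k.eval a := fun a => by simp
  obtain ⟨k', rfl, hk'⟩ := exists_eq_mul_of_sign hf
    (e.nonneg isOpen_Ioo fun a ha => by
      rw [hv]
      exact mul_nonneg (by nlinarith [ha.1, ha.2]) (hk a))
    (e.nonpos isClosed_Icc.isOpen_compl fun a ha => by
      rw [hv]
      refine mul_nonpos_of_nonpos_of_nonneg ?_ (hk a)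
      rw [Set.mem_compl_iff, Set.mem_Icc, not_and_or, not_le, not_le] at ha
      rcases ha with ha | ha <;> nlinarith)
  exact ⟨hasOneOval_of_eq_mul hq hk', imageIsInterval_of_eq_mul hq hk'⟩

theorem ImageIsInterval.exists_hasDiscr (h : C.ImageIsInterval) :
    ∃ k : ℝ[X], C.HasDiscr ((1 - X ^ 2) * k) ∧ ∀ a, 0 < k.eval a := by
  obtain ⟨K⟩ := Chart.nonempty C.π 0
  obtain ⟨f, u, hq, hf⟩ := C.chart_isQuadBasis K
  obtain ⟨k, rfl, hk⟩ := h.exists_eq_mul hq hf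
  exact ⟨k, hasDiscr_of_isQuadBasis hq, hk⟩

end DoubleCover

theorem HasDiscr.exists_doubleCover {g : Bir} {f : ℝ[X]} (h : HasDiscr g f) :
    ∃ C : DoubleCover, C.HasDiscr f := by
  obtain ⟨F⟩ := h.nonempty
  obtain ⟨m, f₀, hm, hf₀, rfl⟩ := exists_eq_sq_mul_squarefree h.notSq.ne_zero
  have e : SqEq (m ^ 2 * f₀) f₀ := SqEq.of_sq_mul hm
  obtain ⟨C, ρ, ζ, hg, hC⟩ := RealSphere.exists_doubleCover hf₀ (h.notSq.of_sqEq e)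
    ((h.isQuadExt F).of_sqEq e)
  exact ⟨C, h.notSq, ρ, ζ, hg, hC.of_sqEq e.symm⟩

/-! ### The invariants of the involutions -/

theorem IsTimelike.notSq {α β γ : ℝ[X]} (h : IsTimelike α β γ) : NotSq (-nrd α β γ) :=
  NotSq.of_eval_neg (Set.Icc_infinite (by norm_num : (-1 : ℝ) < 1)) fun a ha => by
    rw [eval_neg]
    exact neg_neg_of_pos (h.eval_nrd_pos ha)

/-- Outside [-1, 1] the factor 1 - a² is not positive, so the norm is a sum of nonnegative terms
whatever the quaternion is. -/
theorem IsTimelike.eval_neg_nrd_nonpos {α β γ : ℝ[X]} (h : IsTimelike α β γ) (a : ℝ) :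
    (-nrd α β γ).eval a ≤ 0 := by
  rw [eval_neg, neg_nonpos]
  by_cases ha : a ∈ Set.Icc (-1 : ℝ) 1
  · exact (h.eval_nrd_pos ha).le
  · rw [eval_nrd]
    have : 1 - a ^ 2 ≤ 0 := by
      rw [Set.mem_Icc, not_and_or, not_le, not_le] at ha
      rcases ha with ha | ha <;> nlinarith
    nlinarith [sq_nonneg (α.eval a), mul_nonneg (neg_nonneg.2 this)
      (add_nonneg (sq_nonneg (β.eval a)) (sq_nonneg (γ.eval a)))]

theorem IsSpacelike.eval_nonneg {α β γ : ℝ[X]} (h : IsSpacelike α β γ) (a : ℝ) :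
    0 ≤ (β ^ 2 + γ ^ 2 - (1 - X ^ 2) * α ^ 2).eval a := by
  by_cases ha : a ∈ Set.Icc (-1 : ℝ) 1
  · exact (h.eval_pos a ha).le
  · have : 1 - a ^ 2 ≤ 0 := by
      rw [Set.mem_Icc, not_and_or, not_le, not_le] at ha
      rcases ha with ha | ha <;> nlinarith
    simp only [eval_sub, eval_add, eval_mul, eval_pow, eval_X, eval_one]
    nlinarith [sq_nonneg (β.eval a), sq_nonneg (γ.eval a), mul_nonneg (neg_nonneg.2 this)
      (sq_nonneg (α.eval a))]

theorem neg_nrd_spacelike (α β γ : ℝ[X]) : -nrd ((1 - X ^ 2) * α) β γ =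
    (1 - X ^ 2) * (β ^ 2 + γ ^ 2 - (1 - X ^ 2) * α ^ 2) := by
  rw [nrd_spacelike]; ring

/-- For z > 1 the polynomial is negative apart from the finitely many zeros of the second factor. -/
theorem IsSpacelike.notSq {α β γ : ℝ[X]} (h : IsSpacelike α β γ) :
    NotSq (-nrd ((1 - X ^ 2) * α) β γ) := by
  rw [neg_nrd_spacelike]
  set k := β ^ 2 + γ ^ 2 - (1 - X ^ 2) * α ^ 2 with hk
  have hk0 : k ≠ 0 := ne_zero_of_pos h.eval_pos
  refine NotSq.of_eval_neg ((Set.Ioi_infinite (1 : ℝ)).sdiff (k.rootSet_finite ℝ)) ?_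
  rintro a ⟨ha, hka⟩
  have h1 : k.eval a ≠ 0 := by simpa [mem_rootSet, hk0] using hka
  have h2 : 0 < k.eval a := lt_of_le_of_ne (h.eval_nonneg a) h1.symm
  have h3 : (1 : ℝ) < a := ha
  rw [eval_mul]
  refine mul_neg_of_neg_of_pos ?_ h2
  simp only [eval_sub, eval_one, eval_pow, eval_X]
  nlinarith

/-- Two sets of equivalence classes with the same set of invariants are in bijection. -/
theorem exists_quotient_equiv {A B S : Type*} (s : Setoid A) (t : Setoid B) (R : A → S → Prop)
    (Q : B → S → Prop) (E : S → S → Prop) (symm : ∀ {x y}, E x y → E y x)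
    (trans : ∀ {x y z}, E x y → E y z → E x z)
    (hR : ∀ a a' x x', R a x → R a' x' → (s a a' ↔ E x x'))
    (hQ : ∀ b b' x x', Q b x → Q b' x' → (t b b' ↔ E x x'))
    (hRQ : ∀ a, ∃ b x, R a x ∧ Q b x) (hQR : ∀ b, ∃ a x, R a x ∧ Q b x) :
    ∃ Φ : Quotient s ≃ Quotient t, ∀ a b x y, R a x → Q b y →
      (Φ (Quotient.mk _ a) = Quotient.mk _ b ↔ E x y) := by
  choose c x hx hcx using hRQ
  let F : Quotient s → Quotient t := Quotient.map c fun a a' h =>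
    (hQ _ _ _ _ (hcx a) (hcx a')).2 ((hR _ _ _ _ (hx a) (hx a')).1 h)
  have hF : ∀ a b z y, R a z → Q b y → (F (Quotient.mk _ a) = Quotient.mk _ b ↔ E z y) := by
    intro a b z y hz hy
    have h1 : E z (x a) := (hR a a _ _ hz (hx a)).1 (s.refl a)
    change Quotient.mk _ (c a) = _ ↔ _
    rw [Quotient.eq, hQ _ _ _ _ (hcx a) hy]
    exact ⟨fun h => trans h1 h, fun h => trans (symm h1) h⟩
  refine ⟨Equiv.ofBijective F ⟨?_, ?_⟩, hF⟩
  · intro p q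
    induction p, q using Quotient.inductionOn₂ with
    | _ a a' =>
      intro h
      have h1 := (hQ _ _ _ _ (hcx a) (hcx a')).1 (Quotient.exact h)
      exact Quotient.sound ((hR _ _ _ _ (hx a) (hx a')).2 h1)
  · intro q
    induction q using Quotient.inductionOn with
    | _ b =>
      obtain ⟨a, y, ha, hb⟩ := hQR b
      exact ⟨Quotient.mk _ a, (hF a b y y ha hb).2 ((hQ b b y y hb hb).1 (t.refl b))⟩

end RealSphere

/-! ### The two bijections -/

namespace RealSphere

open scoped QuadraticAlgebra

open Polynomial

theorem map_coord_two {P : Bir} (hP : P ∈ autRealOverPi) : P (coord 2) = coord 2 := hP.2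

theorem sqEq_of_conj {g g' P : Bir} {f f' : ℝ[X]} (hP : P ∈ autRealOverPi) (h : P * g * P⁻¹ = g')
    (hg : HasDiscr g f) (hg' : HasDiscr g' f') : SqEq f f' := by
  subst h
  exact hg.sqEq_conj (map_coord_two hP) hg'

theorem exists_conj_of_isTimelike_of_hasDiscr {g g' : Bir} {α β γ α' β' γ' f f' : ℝ[X]}
    (hg : IsRefl g α β γ) (hg' : IsRefl g' α' β' γ') (hq : IsTimelike α β γ)
    (hq' : IsTimelike α' β' γ') (hf : HasDiscr g f) (hf' : HasDiscr g' f') (e : SqEq f f') :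
    ∃ P ∈ autRealOverPiPlus, P * g * P⁻¹ = g' := by
  obtain ⟨r, r', hr, -, h⟩ := (((hg.hasDiscr hq.notSq).sqEq hf).trans e).trans
    (hf'.sqEq (hg'.hasDiscr hq'.notSq))
  exact exists_conj_of_isTimelike hg hg' hq hq' (r' := r') hr (by linear_combination -h)

/-- Both involutions are conjugate to a third one with vanishing i-component and norm in the same
class. It exists because -N/δ is nonnegative on the whole line, hence a sum of two squares. -/
theorem exists_conj_of_isSpacelike_of_hasDiscr {g g' : Bir} {α β γ α' β' γ' f f' : ℝ[X]}
    (hg : IsRefl g ((1 - X ^ 2) * α) β γ) (hg' : IsRefl g' ((1 - X ^ 2) * α') β' γ')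
    (hq : IsSpacelike α β γ) (hq' : IsSpacelike α' β' γ') (hf : HasDiscr g f)
    (hf' : HasDiscr g' f') (e : SqEq f f') : ∃ P ∈ autRealOverPi, P * g * P⁻¹ = g' := by
  obtain ⟨r, r', hr, hr', h⟩ := (((hg.hasDiscr hq.notSq).sqEq hf).trans e).trans
    (hf'.sqEq (hg'.hasDiscr hq'.notSq))
  rw [neg_nrd_spacelike, neg_nrd_spacelike] at h
  obtain ⟨β₀, γ₀, h0⟩ := exists_eq_sq_add_sq _ hq.eval_nonneg
  have hq0 : IsSpacelike 0 β₀ γ₀ := fun a ha => by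
    have := hq.eval_pos a ha
    rw [h0] at this
    simpa using this
  obtain ⟨g₀, hg₀⟩ := exists_isRefl_of_nrd_ne_zero (by simpa using hq0.nrd_ne_zero)
  have hδ : (1 - X ^ 2 : ℝ[X]) ≠ 0 := fun h0 => by simpa using congrArg (eval 0) h0
  obtain ⟨P, hP, rfl⟩ := exists_conj_of_isSpacelike hg hg₀ hq hq0 (r := 1) (r' := 1) one_ne_zero
    (by rw [h0])
  obtain ⟨Q, hQ, hPQ⟩ := exists_conj_of_isSpacelike hg' hg₀ hq' hq0 (r := r') (r' := r) hr' (by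
    rw [← h0]
    apply mul_left_cancel₀ hδ
    linear_combination -h)
  refine ⟨Q⁻¹ * P, mul_mem (inv_mem hQ) hP, ?_⟩
  have h1 : Q⁻¹ * P * g * (Q⁻¹ * P)⁻¹ = Q⁻¹ * (P * g * P⁻¹) * Q := by group
  rw [h1, ← hPQ]
  group

theorem isConj_iff_exists {H : Subgroup Bir} (g g' : H) :
    IsConj g g' ↔ ∃ P ∈ H, P * (g : Bir) * P⁻¹ = g' := by
  rw [isConj_iff]
  constructor
  · rintro ⟨P, rfl⟩
    exact ⟨P, P.2, rfl⟩
  · rintro ⟨P, hP, h⟩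
    exact ⟨⟨P, hP⟩, Subtype.ext h⟩

theorem exists_isRefl_of_mem_plus (g : {g : autRealOverPiPlus // orderOf g = 2}) :
    ∃ α β γ, IsRefl (g.1 : Bir) α β γ ∧ IsTimelike α β γ :=
  exists_isTimelike_of_mem g.1.2 (by rw [Subgroup.orderOf_coe]; exact g.2)

theorem exists_equiv_coverPlus :
    ∃ Φ : Quotient invPlus ≃ Quotient coverPlus,
      ∀ (g : {g : autRealOverPiPlus // orderOf g = 2}) (C : {C : DoubleCover // C.HasNoRealPoint}),
        Φ (Quotient.mk _ g) = Quotient.mk _ C ↔ IsFixedCurveOf C.1 (g.1 : Bir) := by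
  refine (exists_quotient_equiv invPlus coverPlus (fun g => HasDiscr (g.1 : Bir))
    (fun C => C.1.HasDiscr) SqEq SqEq.symm SqEq.trans ?_
    (fun _ _ _ _ h h' => h.equiv_iff h') ?_ ?_).imp fun Φ hΦ g C => ?_
  · intro g g' f f' hf hf'
    refine (isConj_iff_exists g.1 g'.1).trans ⟨fun ⟨P, hP, h⟩ => sqEq_of_conj hP.1 h hf hf', ?_⟩
    obtain ⟨α, β, γ, h, hq⟩ := exists_isRefl_of_mem_plus g
    obtain ⟨α', β', γ', h', hq'⟩ := exists_isRefl_of_mem_plus g'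
    exact exists_conj_of_isTimelike_of_hasDiscr h h' hq hq' hf hf'
  · intro g
    obtain ⟨α, β, γ, h, hq⟩ := exists_isRefl_of_mem_plus g
    obtain ⟨C, hC⟩ := (h.hasDiscr hq.notSq).exists_doubleCover
    exact ⟨⟨C, hC.hasNoRealPoint hq.eval_neg_nrd_nonpos⟩, _, h.hasDiscr hq.notSq, hC⟩
  · rintro ⟨C, hC⟩
    obtain ⟨f, hCf, hf⟩ := hC.exists_hasDiscr
    -- The squarefree equation of a cover without real points is negative everywhere, so its
    -- negative is a norm up to a square.
    obtain ⟨α, β, γ, m, hm, hq, e⟩ := exists_isTimelike_nrd_eq (f := -f) fun a => by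
      rw [eval_neg]; exact neg_pos.2 (hf a)
    obtain ⟨g, hg⟩ := exists_isRefl_of_nrd_ne_zero hq.nrd_ne_zero
    refine ⟨⟨⟨g, hg.mem_autRealOverPiPlus hq⟩, ?_⟩, _, hg.hasDiscr hq.notSq, hCf.of_sqEq ?_⟩
    · rw [Subgroup.orderOf_mk]
      exact hg.orderOf_eq (ne_zero_of_nrd_ne_zero hq.nrd_ne_zero)
    · rw [e, ← mul_neg, neg_neg]
      exact (SqEq.of_sq_mul hm).symm
  · obtain ⟨α, β, γ, h, hq⟩ := exists_isRefl_of_mem_plus g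
    obtain ⟨f, hC⟩ := C.1.exists_hasDiscr
    rw [hΦ _ _ _ _ (h.hasDiscr hq.notSq) hC, hC.isFixedCurveOf_iff (h.hasDiscr hq.notSq)]

theorem exists_isRefl_of_mem_minus
    (g : {g : autRealOverPi // orderOf g = 2 ∧ (g : Bir) ∉ autRealOverPiPlus}) :
    ∃ α β γ, IsRefl (g.1 : Bir) ((1 - X ^ 2) * α) β γ ∧ IsSpacelike α β γ :=
  exists_isSpacelike_of_mem g.1.2 (by rw [Subgroup.orderOf_coe]; exact g.2.1) g.2.2

theorem exists_equiv_coverMinus :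
    ∃ Φ : Quotient invMinus ≃ Quotient coverMinus,
      ∀ (g : {g : autRealOverPi // orderOf g = 2 ∧ (g : Bir) ∉ autRealOverPiPlus})
        (C : {C : DoubleCover // C.HasOneOval ∧ C.ImageIsInterval}),
        Φ (Quotient.mk _ g) = Quotient.mk _ C ↔ IsFixedCurveOf C.1 (g.1 : Bir) := by
  refine (exists_quotient_equiv invMinus coverMinus (fun g => HasDiscr (g.1 : Bir))
    (fun C => C.1.HasDiscr) SqEq SqEq.symm SqEq.trans ?_
    (fun _ _ _ _ h h' => h.equiv_iff h') ?_ ?_).imp fun Φ hΦ g C => ?_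
  · intro g g' f f' hf hf'
    refine (isConj_iff_exists g.1 g'.1).trans ⟨fun ⟨P, hP, h⟩ => sqEq_of_conj hP h hf hf', ?_⟩
    obtain ⟨α, β, γ, h, hq⟩ := exists_isRefl_of_mem_minus g
    obtain ⟨α', β', γ', h', hq'⟩ := exists_isRefl_of_mem_minus g'
    exact exists_conj_of_isSpacelike_of_hasDiscr h h' hq hq' hf hf'
  · intro g
    obtain ⟨α, β, γ, h, hq⟩ := exists_isRefl_of_mem_minus g
    obtain ⟨C, hC⟩ := (h.hasDiscr hq.notSq).exists_doubleCover
    refine ⟨⟨C, ?_⟩, _, h.hasDiscr hq.notSq, hC⟩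
    rw [neg_nrd_spacelike] at hC
    exact hC.hasOneOval hq.eval_nonneg
  · rintro ⟨C, -, hC⟩
    obtain ⟨k, hCk, hk⟩ := hC.exists_hasDiscr
    -- A spacelike quaternion without i-component has -N = δ(β² + γ²), which is already the given
    -- equation.
    obtain ⟨β, γ, rfl⟩ := exists_eq_sq_add_sq k fun a => (hk a).le
    have hq : IsSpacelike 0 β γ := fun a _ => by simpa using hk a
    obtain ⟨g, hg⟩ := exists_isRefl_of_nrd_ne_zero hq.nrd_ne_zero
    obtain ⟨h1, h2⟩ := hg.mem_autRealOverPi_of_isSpacelike hq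
    refine ⟨⟨⟨g, h1⟩, ?_, h2⟩, _, hg.hasDiscr hq.notSq, ?_⟩
    · rw [Subgroup.orderOf_mk]
      exact hg.orderOf_eq (ne_zero_of_nrd_ne_zero hq.nrd_ne_zero)
    · rw [neg_nrd_spacelike]
      simpa using hCk
  · obtain ⟨α, β, γ, h, hq⟩ := exists_isRefl_of_mem_minus g
    obtain ⟨f, hC⟩ := C.1.exists_hasDiscr
    rw [hΦ _ _ _ _ (h.hasDiscr hq.notSq) hC, hC.isFixedCurveOf_iff (h.hasDiscr hq.notSq)]

end RealSphere

theorem mainTheorem6 :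
    (∃ Φ : Quotient RealSphere.invPlus ≃ Quotient RealSphere.coverPlus,
      ∀ (g : {g : RealSphere.autRealOverPiPlus // orderOf g = 2})
        (C : {C : RealSphere.DoubleCover // C.HasNoRealPoint}),
        Φ (Quotient.mk _ g) = Quotient.mk _ C ↔
          RealSphere.IsFixedCurveOf C.1 (g.1 : RealSphere.Bir)) ∧
    (∃ Φ : Quotient RealSphere.invMinus ≃ Quotient RealSphere.coverMinus,
      ∀ (g : {g : RealSphere.autRealOverPi //
          orderOf g = 2 ∧ (g : RealSphere.Bir) ∉ RealSphere.autRealOverPiPlus})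
        (C : {C : RealSphere.DoubleCover // C.HasOneOval ∧ C.ImageIsInterval}),
        Φ (Quotient.mk _ g) = Quotient.mk _ C ↔
          RealSphere.IsFixedCurveOf C.1 (g.1 : RealSphere.Bir)) := by
  exact ⟨RealSphere.exists_equiv_coverPlus, RealSphere.exists_equiv_coverMinus⟩
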